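/- **Setting.** Put $R_\alpha=|0\rangle\langle 0|+e^{i\alpha}|1\rangle\langle 1|$. For a finite set $B$ of unitary gates of fixed size, a *circuit with fan-out over $B$* is a sequence of layers of gates, the gates in one layer acting on disjoint sets of qubits. Each gate is a gate of $B$ or an unbounded fan-out gate $|y_1\rangle\cdots|y_k\rangle|x\rangle\mapsto|y_1\oplus x\rangle\cdots|y_k\oplus x\rangle|x\rangle$. The depth of a circuit is its number of layers; its size is the total number of qubits affected by its gates. A circuit on $m$ input/output qubits and $a$ ancilla qubits, with operator $C$, *approximates* an operator $U$ on $m$ qubits with error $\varepsilon$ if $\|C|\psi\rangle|0^a\rangle-(U|\psi\rangle)|0^a\rangle\|\le\varepsilon\|\psi\|$ for all $|\psi\rangle$. A family $(C_n)_{n\ge 0}$ of circuits is *uniform* if some Turing machine with a read-only input tape, work tapes and a write-only output tape writes, on input $1^n$, the description of $C_n$ using work space $O(\log n)$ (for $n\ge 2$; constant for $n\le 1$). $\mathrm{B\text{-}QNC}^0_{\mathrm f}$ over $B$ is the class of families $(U_n)_{n\ge0}$ of unitary operators such that for every $c\in\mathbb N$ there is a uniform family of circuits with fan-out over $B$, of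 depth $O(1)$ and of size polynomial in $n$, approximating $U_n$ with error $O((n+1)^{-c})$. The classes $\mathrm{B\text{-}QAC}^0_{\mathrm f}$ and $\mathrm{B\text{-}QTC}^0_{\mathrm f}$ over $B$ are defined in the same way, where the circuits may in addition use And and Or gates of unbounded fan-in (for QAC), respectively And, Or and threshold[$t$] gates of unbounded fan-in for all $t$ (for QTC). For a Boolean function $g$ of $n$ bits, the corresponding gate on $n+1$ qubits is $|x\rangle|y\rangle\mapsto|x\rangle|y\oplus g(x)\rangle$. With $|x|$ the Hamming weight of $x\in\{0,1\}^n$, the function $g(x)$ is $1$ iff: $|x|=t$ for exact[$t$]; $|x|\ge t$ for threshold[$t$]; $|x|\ge n/2$ for majority; $|x|=n$ for And; $|x|>0$ for Or; $|x|\bmod q=0$ for mod[$q$]. The parameters $t=t(n)\ge 0$ and $q=q(n)\ge1$ may be any functions of $n$ computable in logarithmic space (from $1^n$, with output in unary); this includes constants. A family of such gates is in $\mathrm{R\text{-}QNC}^0_{\mathrm f}$ over $B$ if it satisfies the condition for $\mathrm{B\text{-}QNC}^0_{\mathrm f}$ with circuits whose error is one-sided: for some fixed $v\in\{0,1\}$,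 independent of $n$ and $c$, the circuit maps $|x\rangle|y\rangle|0^a\rangle$ to $|x\rangle|y\oplus g(x)\rangle|0^a\rangle$ without any error whenever $g(x)=v$. **Theorem.** There is a fixed angle $\theta$, with $\theta/\pi$ irrational, such that the following holds for the basis consisting of the Hadamard gate, $R_\theta$, $R_{-\theta}$ and the controlled-not gate, and more generally for every finite basis $B$ that contains these four gates. 1. The gate exact[$t$] is in $\mathrm{R\text{-}QNC}^0_{\mathrm f}$ over $B$. More precisely, it is approximated with one-sided polynomially small error, with no error on the inputs with $|x|=t$. 2. The gates threshold[$t$], majority, And and mod[$q$] are in $\mathrm{B\text{-}QNC}^0_{\mathrm f}$ over $B$. 3. $\mathrm{B\text{-}QNC}^0_{\mathrm f}=\mathrm{B\text{-}QAC}^0_{\mathrm f}=\mathrm{B\text{-}QTC}^0_{\mathrm f}$ over $B$. -/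

import Mathlib

namespace QFan

/-! ### Log-space Turing machines with output -/

/-- Symbols on the read-only input tape, which holds `1^n` between two end markers. -/
inductive InSym
  | leftEnd
  | one
  | rightEnd

/-- A deterministic Turing machine with a read-only two-way input tape, `tapes` two-way infinite
read/write work tapes and a write-only one-way output tape over the alphabet `Out`.  In one step it
reads the input cell and the work cells under its heads, and either halts (`none`) or enters a new
state, moves the input head, writes on and moves on each work tape, and appends at most one symbol
to the output.  A move is an element of `SignType`, that is `-1`, `0` or `1`. -/
structure Machine (Out : Type) where
  State : Type
  finState : Finite State
  Sym : Type
  finSym : Finite Sym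
  tapes : ℕ
  blank : Sym
  start : State
  trans : State → InSym → (Fin tapes → Sym) →
    Option (State × SignType × (Fin tapes → Sym × SignType) × Option Out)

namespace Machine

variable {Out : Type}

/-- A configuration of a machine. -/
structure Cfg (M : Machine Out) where
  state : M.State
  inHead : ℤ
  tape : Fin M.tapes → ℤ → M.Sym
  head : Fin M.tapes → ℤ
  out : List Out

/-- The initial configuration: input head on the left end marker, work tapes blank. -/
def init (M : Machine Out) : M.Cfg where
  state := M.start
  inHead := 0
  tape := fun _ _ => M.blank
  head := fun _ => 0
  out := []

/-- The symbol in cell `p` of the input tape for `1^n`; the cells are `0, …, n + 1`. -/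
def inSym (n : ℕ) (p : ℤ) : InSym :=
  if p ≤ 0 then .leftEnd else if p ≤ n then .one else .rightEnd

/-- One step on input `1^n`; the input head cannot leave the cells `0, …, n + 1`. -/
def step (M : Machine Out) (n : ℕ) (c : M.Cfg) : Option M.Cfg :=
  (M.trans c.state (inSym n c.inHead) (fun i => c.tape i (c.head i))).map fun r =>
    { state := r.1
      inHead := max 0 (min ((n : ℤ) + 1) (c.inHead + (r.2.1 : ℤ)))
      tape := fun i => Function.update (c.tape i) (c.head i) (r.2.2.1 i).1
      head := fun i => c.head i + ((r.2.2.1 i).2 : ℤ)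
      out := c.out ++ r.2.2.2.toList }

/-- `c` occurs in the run of `M` on input `1^n`. -/
def Reaches (M : Machine Out) (n : ℕ) (c : M.Cfg) : Prop :=
  Relation.ReflTransGen (fun a b => M.step n a = some b) M.init c

end Machine

/-- Some Turing machine, on every input `1^n`, halts with `f n` on its output tape, its work heads
staying within distance `O(log n)` of their initial positions throughout the run. -/
def LogSpace {Out : Type} (f : ℕ → List Out) : Prop :=
  ∃ (M : Machine Out) (k : ℕ), ∀ n : ℕ,
    (∀ c, M.Reaches n c → ∀ i, |c.head i| ≤ (k : ℤ) * ((Nat.log 2 n : ℤ) + 1)) ∧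
    ∃ c, M.Reaches n c ∧ M.step n c = none ∧ c.out = f n

/-- A numerical function is log-space computable (`1^n ↦ 1^(t n)`). -/
def LogSpaceNat (t : ℕ → ℕ) : Prop :=
  LogSpace fun n => List.replicate (t n) ()

/-! ### Qubits and operators -/

/-- Computational basis states of `N` qubits (`true` is `|1⟩`). -/
abbrev Bits (N : ℕ) : Type := Fin N → Bool

/-- Operators on `N` qubits, as matrices in the computational basis. -/
abbrev Op (N : ℕ) : Type := Matrix (Bits N) (Bits N) ℂ

/-- The operator `|a⟩ ↦ |f a⟩`. -/
def classicalOp {N : ℕ} (f : Bits N → Bits N) : Op N :=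
  Matrix.of fun b a => if b = f a then 1 else 0

theorem classicalOp_unitary {N : ℕ} (f : Bits N → Bits N) (hf : Function.Involutive f) :
    classicalOp f ∈ Matrix.unitaryGroup (Bits N) ℂ := by
  rw [Matrix.mem_unitaryGroup_iff']
  ext a b
  simp [classicalOp, Matrix.mul_apply, Matrix.star_apply, Matrix.one_apply, apply_ite star,
    hf.injective.eq_iff, eq_comm]

/-- Flip bit `y` if and only if `g b` is true; used with `g` that does not depend on bit `y`. -/
def flipIf {N : ℕ} (y : Fin N) (g : Bits N → Bool) (b : Bits N) : Bits N :=
  Function.update b y (xor (b y) (g b))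

/-! ### Fixed bases -/

/-- A unitary gate of fixed size. -/
structure FixedGate where
  arity : ℕ
  mat : Op arity
  unitary : mat ∈ Matrix.unitaryGroup (Bits arity) ℂ

/-- A fixed basis: finitely many gates of fixed size. -/
abbrev GateBasis : Type := List FixedGate

/-- The Hadamard gate. -/
noncomputable def hadamard : FixedGate where
  arity := 1
  mat := Matrix.of fun b a => (if b 0 && a 0 then -1 else 1) / (Real.sqrt 2 : ℂ)
  unitary := by
    have h2 : ((Real.sqrt 2 : ℝ) : ℂ) * ((Real.sqrt 2 : ℝ) : ℂ) = 2 := by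
      rw [← Complex.ofReal_mul, Real.mul_self_sqrt (by norm_num)]; norm_num
    have h0 : ((Real.sqrt 2 : ℝ) : ℂ) ≠ 0 := by
      intro h; simp [h] at h2
    rw [Matrix.mem_unitaryGroup_iff']
    ext a b
    rw [Matrix.mul_apply, Fintype.sum_equiv (Equiv.funUnique (Fin 1) Bool) _
      (fun t : Bool => star ((if t && a 0 then -1 else 1) / ((Real.sqrt 2 : ℝ) : ℂ)) *
        ((if t && b 0 then -1 else 1) / ((Real.sqrt 2 : ℝ) : ℂ))) (by intro x; simp [Matrix.star_apply])]
    have hab : a = b ↔ a 0 = b 0 :=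
      ⟨fun h => by rw [h], fun h => by ext i; rw [Subsingleton.elim i 0, h]⟩
    rw [Matrix.one_apply]
    simp only [hab]
    cases ha : a 0 <;> cases hb : b 0 <;> simp <;> field_simp <;> (try linear_combination -h2) <;> ring

/-- The rotation `|0⟩⟨0| + e^{iα} |1⟩⟨1|`. -/
noncomputable def rotation (α : ℝ) : FixedGate where
  arity := 1
  mat := Matrix.diagonal fun a => if a 0 then Complex.exp (α * Complex.I) else 1
  unitary := by
    rw [Matrix.mem_unitaryGroup_iff', Matrix.star_eq_conjTranspose, Matrix.diagonal_conjTranspose,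
      Matrix.diagonal_mul_diagonal, ← Matrix.diagonal_one]
    congr 1
    ext a
    by_cases h : a 0 = true <;> simp [h, ← Complex.exp_conj, ← Complex.exp_add]

/-- The controlled-not gate, `|x⟩|y⟩ ↦ |x⟩|y ⊕ x⟩`. -/
def cnot : FixedGate where
  arity := 2
  mat := classicalOp (flipIf 1 fun b => b 0)
  unitary := classicalOp_unitary _ fun b => by
    simp [flipIf]

/-- The basis of the Hadamard gate, the rotation by `θ`, its inverse, and controlled-not. -/
noncomputable def stdBasis (θ : ℝ) : GateBasis :=
  [hadamard, rotation θ, rotation (-θ), cnot]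

/-! ### Circuits -/

/-- Gates on `N` qubits: a basis gate on the qubits `w 0, w 1, …`; the fan-out gate from control `c`
to the targets `ts`; and the gates And, Or, threshold[t] with inputs `xs` and target `y`. -/
inductive Gate (B : GateBasis) (N : ℕ)
  | basic (j : Fin B.length) (w : Fin (B.get j).arity → Fin N)
  | fanout (c : Fin N) (ts : List (Fin N))
  | and (xs : List (Fin N)) (y : Fin N)
  | or (xs : List (Fin N)) (y : Fin N)
  | threshold (t : ℕ) (xs : List (Fin N)) (y : Fin N)

/-- The three gate sets: basis gates and fan-out (`nc`); these and unbounded And, Or (`ac`);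
these and threshold[t] for all `t` (`tc`). -/
inductive GateSet
  | nc
  | ac
  | tc

namespace Gate

variable {B : GateBasis} {N : ℕ}

/-- The qubits on which a gate acts. -/
def wires : Gate B N → List (Fin N)
  | basic _ w => List.ofFn w
  | fanout c ts => c :: ts
  | and xs y => xs ++ [y]
  | or xs y => xs ++ [y]
  | threshold _ xs y => xs ++ [y]

/-- Membership in a gate set. -/
def Allowed : GateSet → Gate B N → Prop
  | _, basic _ _ => True
  | _, fanout _ _ => True
  | .nc, and _ _ => False
  | _, and _ _ => True
  | .nc, or _ _ => False
  | _, or _ _ => True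
  | .tc, threshold _ _ _ => True
  | _, threshold _ _ _ => False

/-- The operator on all `N` qubits that a gate performs. -/
noncomputable def op : Gate B N → Op N
  | basic j w => Matrix.of fun b a =>
      open scoped Classical in
      if ∀ i, (∀ k, w k ≠ i) → b i = a i then (B.get j).mat (b ∘ w) (a ∘ w) else 0
  | fanout c ts => classicalOp fun b i => if i ∈ ts then xor (b i) (b c) else b i
  | and xs y => classicalOp (flipIf y fun b => decide (xs.countP b = xs.length))
  | or xs y => classicalOp (flipIf y fun b => decide (0 < xs.countP b))
  | threshold t xs y => classicalOp (flipIf y fun b => decide (t ≤ xs.countP b))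

end Gate

/-- A circuit with `m` input/output qubits (the first `m`) and `anc` ancilla qubits: a sequence of
layers; the gates of a layer act on distinct qubits. -/
structure Circuit (B : GateBasis) (m : ℕ) where
  anc : ℕ
  layers : List (List (Gate B (m + anc)))
  disjoint : ∀ L ∈ layers, (L.flatMap Gate.wires).Nodup

/-- The alphabet in which circuits are written down. -/
inductive Tok
  | mark
  | sep
  | layer
  | basic
  | fanout
  | and
  | or
  | threshold

/-- A number in unary, with a terminator. -/
def encodeNat (i : ℕ) : List Tok := List.replicate i .mark ++ [.sep]

/-- The description of a gate: its type, its index in the basis or its threshold if applicable, and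
the qubits on which it acts, in order. -/
def Gate.encode {B : GateBasis} {N : ℕ} (g : Gate B N) : List Tok :=
  (match g with
    | basic j _ => .basic :: encodeNat j
    | fanout _ _ => [.fanout]
    | and _ _ => [.and]
    | or _ _ => [.or]
    | threshold t _ _ => .threshold :: encodeNat t) ++
  g.wires.flatMap fun i => encodeNat i

namespace Circuit

variable {B : GateBasis} {m : ℕ}

/-- The description of a circuit: numbers of qubits, then the layers, gate by gate. -/
def encode (C : Circuit B m) : List Tok :=
  encodeNat m ++ encodeNat C.anc ++ C.layers.flatMap fun L => .layer :: L.flatMap Gate.encode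

/-- The number of layers. -/
def depth (C : Circuit B m) : ℕ := C.layers.length

/-- The total number of qubits affected by the gates. -/
def size (C : Circuit B m) : ℕ :=
  (C.layers.map fun L => (L.map fun g => g.wires.length).sum).sum

/-- The operator of a circuit; the first gate in the list is applied first. -/
noncomputable def op (C : Circuit B m) : Op (m + C.anc) :=
  (C.layers.flatten.map Gate.op).reverse.prod

end Circuit

/-- `|ψ⟩ ↦ |ψ⟩|0^a⟩`. -/
def withZeros {m : ℕ} (a : ℕ) (ψ : Bits m → ℂ) : Bits (m + a) → ℂ := fun b =>
  if ∀ j : Fin a, b (Fin.natAdd m j) = false then ψ fun i => b (Fin.castAdd a i) else 0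

/-- `C` approximates `U` with error `ε`: for every state `|ψ⟩` of the input/output qubits,
`‖C |ψ⟩|0^a⟩ - (U |ψ⟩)|0^a⟩‖ ≤ ε ‖ψ‖` in the Hilbert space norm. -/
def Circuit.Approximates {B : GateBasis} {m : ℕ} (C : Circuit B m) (U : Op m) (ε : ℝ) : Prop :=
  ∀ ψ : Bits m → ℂ,
    ‖WithLp.toLp 2 (C.op.mulVec (withZeros C.anc ψ) - withZeros C.anc (U.mulVec ψ))‖
      ≤ ε * ‖WithLp.toLp 2 ψ‖

/-- A log-space uniform circuit family of constant depth and polynomial size over the basis `B`,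
with gates from the set `G`; circuit number `n` has `m n` input/output qubits. -/
structure UniformShallow {B : GateBasis} {m : ℕ → ℕ} (G : GateSet)
    (C : ∀ n, Circuit B (m n)) : Prop where
  allowed : ∀ n, ∀ L ∈ (C n).layers, ∀ g ∈ L, g.Allowed G
  uniform : LogSpace fun n => (C n).encode
  depth : ∃ d : ℕ, ∀ n, (C n).depth ≤ d
  size : ∃ p : Polynomial ℕ, ∀ n, (C n).size ≤ p.eval n

/-! ### Classes of operators -/

/-- A family of unitary operators, the `n`-th one on `qubits n` qubits. -/
structure OpFamily where
  qubits : ℕ → ℕ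
  op : ∀ n, Op (qubits n)
  unitary : ∀ n, op n ∈ Matrix.unitaryGroup (Bits (qubits n)) ℂ

/-- The class of operator families approximated with (two-sided) polynomially small error, that is,
with error `O(1 / (n + 1)^c)` for every `c`, by uniform constant-depth polynomial-size circuits with fan-out
over the basis `B` and gates from `G`. -/
def BClass (B : GateBasis) (G : GateSet) : Set OpFamily :=
  {F | ∀ c : ℕ, ∃ C : ∀ n, Circuit B (F.qubits n), UniformShallow G C ∧
    ∃ K : ℝ, ∀ n, (C n).Approximates (F.op n) (K / ((n : ℝ) + 1) ^ c)}

/-- B-QNC_f^0 -/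
abbrev BQNCf0 (B : GateBasis) : Set OpFamily := BClass B .nc

/-- B-QAC_f^0 -/
abbrev BQACf0 (B : GateBasis) : Set OpFamily := BClass B .ac

/-- B-QTC_f^0 -/
abbrev BQTCf0 (B : GateBasis) : Set OpFamily := BClass B .tc

/-- A family of Boolean functions, one for every number of input bits. -/
abbrev BoolFamily : Type := ∀ n : ℕ, Bits n → Bool

/-- The gates `|x⟩|y⟩ ↦ |x⟩|y ⊕ g(x)⟩` on `n + 1` qubits. -/
def BoolFamily.gate (g : BoolFamily) : OpFamily where
  qubits n := n + 1
  op n := classicalOp (flipIf (Fin.last n) fun b => g n fun i => b i.castSucc)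
  unitary n := classicalOp_unitary _ fun b => by
    simp [flipIf]

/-- R-QNC_f^0 for gates `|x⟩|y⟩ ↦ |x⟩|y ⊕ g(x)⟩`: the approximation is as in B-QNC_f^0, and moreover
the error is one-sided: the circuits act without any error on `|x⟩|y⟩` whenever `g(x) = v`. -/
def RQNCf0 (B : GateBasis) (v : Bool) : Set BoolFamily :=
  {g | ∀ c : ℕ, ∃ C : ∀ n, Circuit B (n + 1), UniformShallow .nc C ∧
    (∃ K : ℝ, ∀ n, (C n).Approximates (g.gate.op n) (K / ((n : ℝ) + 1) ^ c)) ∧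
    ∀ n (b : Bits (n + 1)), (g n fun i => b i.castSucc) = v →
      (C n).op.mulVec (withZeros (C n).anc (Pi.single b 1)) =
        withZeros (C n).anc ((g.gate.op n).mulVec (Pi.single b 1))}

/-- The Hamming weight. -/
def weight {n : ℕ} (x : Bits n) : ℕ := (Finset.univ.filter fun i => x i = true).card

/-- exact[t] -/
def exactFn (t : ℕ → ℕ) : BoolFamily := fun n x => decide (weight x = t n)

/-- threshold[t] -/
def thresholdFn (t : ℕ → ℕ) : BoolFamily := fun n x => decide (t n ≤ weight x)

/-- majority: `|x| ≥ n / 2` -/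
def majorityFn : BoolFamily := fun n x => decide (n ≤ 2 * weight x)

/-- And -/
def andFn : BoolFamily := fun n x => decide (weight x = n)

/-- mod[q] -/
def modFn (q : ℕ → ℕ) : BoolFamily := fun n x => decide (weight x % q n = 0)

end QFan

namespace QFan

/-! ### Register programs -/

/-- Programs over registers holding natural numbers, with output alphabet `Out`.  `loop r c` repeats
`c` while register `r` is nonzero, `ite r c d` runs `c` if register `r` is zero and `d` otherwise,
`read r` adds the length of the rest of the input to register `r`. -/
inductive Cmd (Out : Type)
  | inc (r : ℕ)
  | dec (r : ℕ)
  | seq (c d : Cmd Out)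
  | loop (r : ℕ) (c : Cmd Out)
  | ite (r : ℕ) (c d : Cmd Out)
  | emit (o : Out)
  | read (r : ℕ)

namespace Cmd

variable {Out : Type}

/-- A configuration: the programs still to be run, the registers, the input head, the output. -/
structure Conf (Out : Type) where
  todo : List (Cmd Out)
  regs : ℕ → ℕ
  pos : ℤ
  out : List Out

/-- One step of a register program on input `1^n`. -/
def step (n : ℕ) : Conf Out → Option (Conf Out)
  | ⟨[], _, _, _⟩ => none
  | ⟨inc r :: k, s, p, o⟩ => some ⟨k, Function.update s r (s r + 1), p, o⟩
  | ⟨dec r :: k, s, p, o⟩ => some ⟨k, Function.update s r (s r - 1), p, o⟩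
  | ⟨seq c d :: k, s, p, o⟩ => some ⟨c :: d :: k, s, p, o⟩
  | ⟨loop r c :: k, s, p, o⟩ => some ⟨if s r = 0 then k else c :: loop r c :: k, s, p, o⟩
  | ⟨ite r c d :: k, s, p, o⟩ => some ⟨if s r = 0 then c :: k else d :: k, s, p, o⟩
  | ⟨emit a :: k, s, p, o⟩ => some ⟨k, s, p, o ++ [a]⟩
  | ⟨read r :: k, s, p, o⟩ =>
      some (match Machine.inSym n p with
        | .leftEnd => ⟨read r :: k, s, max 0 (min ((n : ℤ) + 1) (p + 1)), o⟩
        | .one => ⟨read r :: k, Function.update s r (s r + 1), max 0 (min ((n : ℤ) + 1) (p + 1)), o⟩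
        | .rightEnd => ⟨k, s, p, o⟩)

/-- The lists of programs that can remain to be run when `c` is run before `k`. -/
def conts : Cmd Out → List (Cmd Out) → Set (List (Cmd Out))
  | seq c d, k => {seq c d :: k} ∪ conts c (d :: k) ∪ conts d k
  | loop r c, k => {loop r c :: k} ∪ conts c (loop r c :: k)
  | ite r c d, k => {ite r c d :: k} ∪ conts c k ∪ conts d k
  | c, k => {c :: k}

theorem conts_finite (c : Cmd Out) : ∀ k, (conts c k).Finite := by
  induction c with
  | seq c d hc hd => intro k; simp [conts, hc, hd]
  | loop r c hc => intro k; simp [conts, hc]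
  | ite r c d hc hd => intro k; simp [conts, hc, hd]
  | _ => intro k; simp [conts]

theorem self_mem_conts (c : Cmd Out) (k : List (Cmd Out)) : c :: k ∈ conts c k := by
  cases c <;> simp [conts]

theorem step_mem_conts {n : ℕ} (c : Cmd Out) : ∀ {k : List (Cmd Out)} {x y : Conf Out},
    x.todo ∈ conts c k → step n x = some y → y.todo ∈ conts c k ∪ {k} := by
  induction c with
  | seq c d hc hd =>
    rintro k ⟨l, s, p, o⟩ y hx hy
    simp only [conts, Set.mem_union, Set.mem_singleton_iff] at hx ⊢
    rcases hx with (rfl | hx) | hx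
    · simp only [step, Option.some.injEq] at hy
      subst hy
      exact .inl (.inl (.inr (self_mem_conts _ _)))
    · rcases hc hx hy with h | h
      · exact .inl (.inl (.inr h))
      · exact .inl (.inr (h ▸ self_mem_conts _ _))
    · rcases hd hx hy with h | h
      · exact .inl (.inr h)
      · exact .inr h
  | loop r c hc =>
    rintro k ⟨l, s, p, o⟩ y hx hy
    simp only [conts, Set.mem_union, Set.mem_singleton_iff] at hx ⊢
    rcases hx with rfl | hx
    · simp only [step, Option.some.injEq] at hy
      subst hy
      by_cases h : s r = 0
      · simp [h]
      · simp only [h, if_false]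
        exact .inl (.inr (self_mem_conts _ _))
    · rcases hc hx hy with h | h
      · exact .inl (.inr h)
      · exact .inl (.inl h)
  | ite r c d hc hd =>
    rintro k ⟨l, s, p, o⟩ y hx hy
    simp only [conts, Set.mem_union, Set.mem_singleton_iff] at hx ⊢
    rcases hx with (rfl | hx) | hx
    · simp only [step, Option.some.injEq] at hy
      subst hy
      by_cases h : s r = 0
      · simp only [h, if_true]
        exact .inl (.inl (.inr (self_mem_conts _ _)))
      · simp only [h, if_false]
        exact .inl (.inr (self_mem_conts _ _))
    · rcases hc hx hy with h | h
      · exact .inl (.inl (.inr h))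
      · exact .inr h
    · rcases hd hx hy with h | h
      · exact .inl (.inr h)
      · exact .inr h
  | read r =>
    rintro k ⟨l, s, p, o⟩ y hx hy
    simp only [conts, Set.mem_singleton_iff] at hx
    subst hx
    simp only [step, Option.some.injEq] at hy
    subst hy
    simp only [conts]
    split <;> simp
  | _ =>
    rintro k ⟨l, s, p, o⟩ y hx hy
    simp only [conts, Set.mem_singleton_iff] at hx
    subst hx
    simp only [step, Option.some.injEq] at hy
    subst hy
    simp

/-- A bound on the registers that occur in a program. -/
def width : Cmd Out → ℕ
  | inc r => r + 1
  | dec r => r + 1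
  | seq c d => max c.width d.width
  | loop r c => max (r + 1) c.width
  | ite r c d => max (r + 1) (max c.width d.width)
  | emit _ => 0
  | read r => r + 1

theorem width_le_of_mem_conts {R : ℕ} (c : Cmd Out) : ∀ {k l : List (Cmd Out)}, c.width ≤ R →
    (∀ d ∈ k, d.width ≤ R) → l ∈ conts c k → ∀ d ∈ l, d.width ≤ R := by
  induction c with
  | seq c d hc hd =>
    intro k l h hk hl
    simp only [conts, Set.mem_union, Set.mem_singleton_iff] at hl
    have h' := h
    simp only [width, max_le_iff] at h'
    rcases hl with (rfl | hl) | hl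
    · simpa [h] using hk
    · exact hc h'.1 (by simpa [h'.2] using hk) hl
    · exact hd h'.2 hk hl
  | loop r c hc =>
    intro k l h hk hl
    simp only [conts, Set.mem_union, Set.mem_singleton_iff] at hl
    have h' := h
    simp only [width, max_le_iff] at h'
    rcases hl with rfl | hl
    · simpa [h] using hk
    · exact hc h'.2 (by simpa [h] using hk) hl
  | ite r c d hc hd =>
    intro k l h hk hl
    simp only [conts, Set.mem_union, Set.mem_singleton_iff] at hl
    have h' := h
    simp only [width, max_le_iff] at h'
    rcases hl with (rfl | hl) | hl
    · simpa [h] using hk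
    · exact hc h'.2.1 hk hl
    · exact hd h'.2.2 hk hl
  | _ =>
    intro k l h hk hl
    simp only [conts, Set.mem_singleton_iff] at hl
    subst hl
    simpa [h] using hk

/-! ### Simulation by a Turing machine -/

/-- Work tape symbols: binary digits, where the leading digit is written `top`. -/
inductive Digit
  | blank
  | zero
  | one
  | top

/-- Phases of the simulation of one step. -/
inductive Phase
  | fetch
  | work
  | fix
  | back

instance : Finite Digit := Finite.of_surjective
  (fun i : Fin 4 => (![Digit.blank, .zero, .one, .top] : Fin 4 → Digit) i) (by
    intro d; cases d
    exacts [⟨0, rfl⟩, ⟨1, rfl⟩, ⟨2, rfl⟩, ⟨3, rfl⟩])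

instance : Finite Phase := Finite.of_surjective
  (fun i : Fin 4 => (![Phase.fetch, .work, .fix, .back] : Fin 4 → Phase) i) (by
    intro d; cases d
    exacts [⟨0, rfl⟩, ⟨1, rfl⟩, ⟨2, rfl⟩, ⟨3, rfl⟩])

/-- The lowest digit of a number. -/
def digit0 (v : ℕ) : Digit :=
  if v = 0 then .blank else if v = 1 then .top else if v % 2 = 0 then .zero else .one

/-- The binary digits of a number, lowest first. -/
def digit : ℕ → ℕ → Digit
  | v, 0 => digit0 v
  | v, p + 1 => digit (v / 2) p

/-- The tape that holds the number `v`. -/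
def tapeOf (v : ℕ) : ℤ → Digit
  | .ofNat p => digit v p
  | .negSucc _ => .blank

@[simp] theorem digit_zero (p : ℕ) : digit 0 p = .blank := by
  induction p with
  | zero => rfl
  | succ p ih => simpa [digit] using ih

variable {R : ℕ}

/-- The symbol on tape `r`. -/
def look (r : ℕ) (x : Fin R → Digit) : Digit := if h : r < R then x ⟨r, h⟩ else .blank

/-- Write `d` on tape `r` and move its head by `m`, leaving the other tapes alone. -/
def act (r : ℕ) (d : Digit) (m : SignType) (x : Fin R → Digit) : Fin R → Digit × SignType :=
  fun i => if i.val = r then (d, m) else (x i, 0)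

/-- Leave all tapes alone. -/
def keep (x : Fin R → Digit) : Fin R → Digit × SignType := fun i => (x i, 0)

/-- The register on which the next program operates. -/
def reg : List (Cmd Out) → ℕ
  | inc r :: _ => r
  | dec r :: _ => r
  | read r :: _ => r
  | _ => 0

/-- What remains to be run after the next increment or decrement. -/
def rest : List (Cmd Out) → List (Cmd Out)
  | inc _ :: k => k
  | dec _ :: k => k
  | l => l

/-- The transition function of the simulating machine. -/
def trans (R : ℕ) (l : List (Cmd Out)) (a : InSym) (x : Fin R → Digit) :
    Phase → Option ((List (Cmd Out) × Phase) × SignType × (Fin R → Digit × SignType) × Option Out)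
  | .fetch => match l with
    | [] => none
    | inc r :: k => some ((inc r :: k, .work), 0, keep x, none)
    | dec r :: k => match look r x with
      | .blank => some ((k, .fetch), 0, keep x, none)
      | _ => some ((dec r :: k, .work), 0, keep x, none)
    | seq c d :: k => some ((c :: d :: k, .fetch), 0, keep x, none)
    | loop r c :: k => match look r x with
      | .blank => some ((k, .fetch), 0, keep x, none)
      | _ => some ((c :: loop r c :: k, .fetch), 0, keep x, none)
    | ite r c d :: k => match look r x with
      | .blank => some ((c :: k, .fetch), 0, keep x, none)
      | _ => some ((d :: k, .fetch), 0, keep x, none)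
    | emit o :: k => some ((k, .fetch), 0, keep x, some o)
    | read r :: k => match a with
      | .leftEnd => some ((read r :: k, .fetch), 1, keep x, none)
      | .one => some ((read r :: k, .work), 1, keep x, none)
      | .rightEnd => some ((k, .fetch), 0, keep x, none)
  | .work => match l with
    | dec r :: k => match look r x with
      | .zero => some ((dec r :: k, .work), 0, act r .one 1 x, none)
      | .one => some ((dec r :: k, .back), 0, act r .zero (-1) x, none)
      | .top => some ((dec r :: k, .fix), 0, act r .blank (-1) x, none)
      | .blank => none
    | l => match look (reg l) x with
      | .zero => some ((l, .back), 0, act (reg l) .one (-1) x, none)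
      | .blank => some ((l, .back), 0, act (reg l) .top (-1) x, none)
      | _ => some ((l, .work), 0, act (reg l) .zero 1 x, none)
  | .fix => match look (reg l) x with
    | .blank => some ((rest l, .fetch), 0, act (reg l) .blank 1 x, none)
    | _ => some ((l, .back), 0, act (reg l) .top (-1) x, none)
  | .back => match look (reg l) x with
    | .blank => some ((rest l, .fetch), 0, act (reg l) .blank 1 x, none)
    | d => some ((l, .back), 0, act (reg l) d (-1) x, none)

/-- The lists of programs that occur when `c` is run. -/
def States (c : Cmd Out) : Set (List (Cmd Out)) := conts c [] ∪ {[]}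

open scoped Classical in
/-- The Turing machine that runs `c`. -/
noncomputable def machine (c : Cmd Out) : Machine Out where
  State := States c × Phase
  finState := by
    have : Finite (States c) := ((conts_finite c []).union (Set.finite_singleton _)).to_subtype
    infer_instance
  Sym := Digit
  finSym := inferInstance
  tapes := c.width
  blank := .blank
  start := (⟨[c], .inl (self_mem_conts _ _)⟩, .fetch)
  trans st a x := (trans c.width st.1.1 a x st.2).map fun r =>
    ((if h : r.1.1 ∈ States c then ⟨r.1.1, h⟩ else st.1, r.1.2), r.2)

/-- The configuration of the machine in which register `r` is being worked on: its tape holds `f`,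
with the head on cell `h`. -/
def mcfg (c : Cmd Out) (l : States c) (ph : Phase) (s : ℕ → ℕ) (p : ℤ) (o : List Out)
    (r : ℕ) (f : ℤ → Digit) (h : ℤ) : (machine c).Cfg where
  state := (l, ph)
  inHead := p
  tape i := if i.val = r then f else tapeOf (s i)
  head i := if i.val = r then h else 0
  out := o

/-- The configuration of the machine between two steps of the program. -/
def ncfg (c : Cmd Out) (l : States c) (s : ℕ → ℕ) (p : ℤ) (o : List Out) : (machine c).Cfg where
  state := (l, .fetch)
  inHead := p
  tape i := tapeOf (s i)
  head _ := 0
  out := o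

theorem mcfg_fetch (c : Cmd Out) (l : States c) (s : ℕ → ℕ) (p : ℤ) (o : List Out) (r v : ℕ) :
    mcfg c l .fetch s p o r (tapeOf v) 0 = ncfg c l (Function.update s r v) p o := by
  simp only [mcfg, ncfg, ite_self]
  congr 1
  funext i
  by_cases h : i.val = r
  · subst h; simp only [Function.update_self]; exact if_pos trivial
  · simp only [Function.update_of_ne h]; exact if_neg h

theorem mcfg_self (c : Cmd Out) (l : States c) (s : ℕ → ℕ) (p : ℤ) (o : List Out) (r : ℕ) :
    mcfg c l .fetch s p o r (tapeOf (s r)) 0 = ncfg c l s p o := by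
  rw [mcfg_fetch, Function.update_eq_self]

/-- A run of the machine whose heads stay within distance `W` of the origin. -/
def Path (c : Cmd Out) (n : ℕ) (W : ℤ) : (machine c).Cfg → (machine c).Cfg → Prop :=
  Relation.ReflTransGen fun a b => (machine c).step n a = some b ∧ ∀ i, |b.head i| ≤ W

theorem Path.trans {c : Cmd Out} {n : ℕ} {W : ℤ} {x y z : (machine c).Cfg}
    (h : Path c n W x y) (h' : Path c n W y z) : Path c n W x z :=
  Relation.ReflTransGen.trans h h'

theorem path_single {c : Cmd Out} {n : ℕ} {W : ℤ} {a b : (machine c).Cfg}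
    (h : (machine c).step n a = some b) (hW : ∀ i, |b.head i| ≤ W) : Path c n W a b :=
  .single ⟨h, hW⟩

theorem step_act {c : Cmd Out} {n : ℕ} {l l' : States c} {ph ph' : Phase} {s : ℕ → ℕ} {p : ℤ}
    {o : List Out} {r : ℕ} {f : ℤ → Digit} {h : ℤ} {d : Digit} {m : SignType}
    (hp : 0 ≤ p ∧ p ≤ n + 1) (hr : r < c.width)
    (ht : ∀ x : Fin c.width → Digit, look r x = f h →
      trans c.width l.1 (Machine.inSym n p) x ph = some ((l'.1, ph'), 0, act r d m x, none)) :
    (machine c).step n (mcfg c l ph s p o r f h) =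
      some (mcfg c l' ph' s p o r (Function.update f h d) (h + (m : ℤ))) := by
  simp only [Machine.step, machine, mcfg, Option.map_map]
  rw [ht]
  · simp only [Option.map_some, Function.comp_apply, Subtype.coe_prop, dite_true, Subtype.coe_eta,
      Option.toList_none, List.append_nil, Option.some.injEq, Machine.Cfg.mk.injEq, true_and, and_true, act]
    refine ⟨?_, funext fun i => ?_, funext fun i => ?_⟩
    · simp only [SignType.coe_zero, add_zero]; omega
    · by_cases hi : i.val = r <;> simp [hi]
    · by_cases hi : i.val = r <;> simp [hi]
  · simp [look, hr]

theorem step_keep {c : Cmd Out} {n : ℕ} {l l' : States c} {ph' : Phase} {s : ℕ → ℕ} {p : ℤ}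
    {o : List Out} {m : SignType} {e : Option Out}
    (ht : trans c.width l.1 (Machine.inSym n p) (fun i => tapeOf (s i) 0) .fetch =
      some ((l'.1, ph'), m, keep fun i => tapeOf (s i) 0, e)) :
    (machine c).step n (ncfg c l s p o) =
      some { ncfg c l' s (max 0 (min ((n : ℤ) + 1) (p + (m : ℤ)))) (o ++ e.toList) with
        state := (l', ph') } := by
  simp only [Machine.step, machine, ncfg, Option.map_map]
  rw [ht]
  simp [keep]

theorem path_act {c : Cmd Out} {n : ℕ} {l l' : States c} {ph ph' : Phase} {s : ℕ → ℕ} {p : ℤ}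
    {o : List Out} {r : ℕ} {f : ℤ → Digit} {h : ℤ} {d : Digit} {m : SignType} {W : ℤ}
    (hp : 0 ≤ p ∧ p ≤ n + 1) (hr : r < c.width)
    (ht : ∀ x : Fin c.width → Digit, look r x = f h →
      trans c.width l.1 (Machine.inSym n p) x ph = some ((l'.1, ph'), 0, act r d m x, none))
    (hW : |h + (m : ℤ)| ≤ W) :
    Path c n W (mcfg c l ph s p o r f h)
      (mcfg c l' ph' s p o r (Function.update f h d) (h + (m : ℤ))) := by
  refine path_single (step_act hp hr ht) fun i => ?_
  by_cases hi : i.val = r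
  · simpa [mcfg, hi] using hW
  · simpa [mcfg, hi] using (abs_nonneg _).trans hW

theorem digit_succ (u p : ℕ) : digit u (p + 1) = digit (u / 2) p := rfl

section Run

variable {c : Cmd Out} {n : ℕ} {l l' : States c} {s : ℕ → ℕ} {p : ℤ} {o : List Out} {r W : ℕ}

theorem path_back (hp : 0 ≤ p ∧ p ≤ n + 1) (hr : r < c.width) (hl : reg l.1 = r)
    (hl' : rest l.1 = l'.1) {f : ℤ → Digit} (hb : f (-1) = .blank) :
    ∀ m : ℕ, (∀ q : ℕ, q < m → f q ≠ .blank) → m ≤ W + 1 →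
      Path c n (W + 1) (mcfg c l .back s p o r f ((m : ℤ) - 1)) (mcfg c l' .fetch s p o r f 0) := by
  intro m
  induction m with
  | zero =>
    intro _ _
    have := path_act (W := W + 1) (l := l) (l' := l') (ph := .back) (ph' := .fetch) (s := s) (o := o)
      (f := f) (h := -1) (d := .blank) (m := 1) hp hr (by
        intro x hx
        simp [trans, hl, hx, hb, hl']) (by simp; omega)
    rw [← hb, Function.update_eq_self] at this
    simpa using this
  | succ m ih =>
    intro hf hm
    have h1 : f m ≠ .blank := hf m (by omega)
    have := path_act (W := W + 1) (l := l) (l' := l) (ph := .back) (ph' := .back) (s := s) (o := o)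
      (f := f) (h := m) (d := f m) (m := -1) hp hr (by
        intro x hx
        simp only [trans, hl, hx]) (by
          have h2 : ((-1 : SignType) : ℤ) = -1 := rfl
          exact abs_le.2 ⟨by omega, by omega⟩)
    rw [Function.update_eq_self] at this
    have h2 : ((m + 1 : ℕ) : ℤ) - 1 = m := by push_cast; ring
    rw [h2]
    refine this.trans ?_
    exact ih (fun q hq => hf q (by omega)) (by omega)

theorem path_carry (hp : 0 ≤ p ∧ p ≤ n + 1) (hr : r < c.width)
    (hl : ∀ x : Fin c.width → Digit, trans c.width l.1 (Machine.inSym n p) x .work =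
      match look r x with
      | .zero => some ((l.1, .back), 0, act r .one (-1) x, none)
      | .blank => some ((l.1, .back), 0, act r .top (-1) x, none)
      | _ => some ((l.1, .work), 0, act r .zero 1 x, none)) :
    ∀ (w u h : ℕ) (f : ℤ → Digit), (∀ q : ℕ, f (h + q) = digit u q) → u < 2 ^ w → h + w ≤ W →
      ∃ (f' : ℤ → Digit) (m : ℕ),
        Path c n (W + 1) (mcfg c l .work s p o r f h) (mcfg c l .back s p o r f' ((m : ℤ) - 1)) ∧
        (∀ q : ℕ, f' (h + q) = digit (u + 1) q) ∧ (∀ q : ℤ, q < h → f' q = f q) ∧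
        h ≤ m ∧ m ≤ W + 1 ∧ ∀ q : ℕ, h ≤ q → q < m → f' q ≠ .blank := by
  intro w
  induction w with
  | zero =>
    intro u h f hf hu hW
    obtain rfl : u = 0 := by simpa using hu
    have hb1 : |(h : ℤ) + ((-1 : SignType) : ℤ)| ≤ W + 1 := by
      simp only [SignType.coe_neg_one]; exact abs_le.2 ⟨by omega, by omega⟩
    refine ⟨Function.update f h .top, h, ?_, ?_, ?_, le_rfl, by omega, by omega⟩
    · refine path_act (m := -1) hp hr (fun x hx => ?_) hb1
      rw [hl, hx, show f h = .blank by simpa using hf 0]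
    · rintro (_ | q)
      · simp [digit, digit0]
      · have := hf (q + 1)
        rw [Function.update_of_ne (by omega), this, digit_succ, digit_succ]
    · intro q hq
      rw [Function.update_of_ne (by omega)]
  | succ w ih =>
    intro u h f hf hu hW
    have h0 : f h = digit0 u := by simpa [digit] using hf 0
    have hb1 : |(h : ℤ) + ((-1 : SignType) : ℤ)| ≤ W + 1 := by
      simp only [SignType.coe_neg_one]; exact abs_le.2 ⟨by omega, by omega⟩
    have hb2 : |(h : ℤ) + ((1 : SignType) : ℤ)| ≤ W + 1 := by
      simp only [SignType.coe_one]; exact abs_le.2 ⟨by omega, by omega⟩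
    by_cases hodd : u % 2 = 1
    · have h1 : f h = .one ∨ f h = .top := by
        rw [h0, digit0]; split_ifs <;> simp_all
      obtain ⟨f', m, hP, h2, h3, h4, h5, h6⟩ := ih (u / 2) (h + 1) (Function.update f h .zero) (by
          intro q
          rw [Function.update_of_ne (by omega)]
          have := hf (q + 1)
          rw [digit_succ] at this
          rw [← this]; congr 1; push_cast; ring) (by rw [pow_succ] at hu; omega) (by omega)
      have h7 : f' h = .zero := by rw [h3 _ (by push_cast; omega)]; simp
      refine ⟨f', m, ?_, ?_, ?_, by omega, h5, ?_⟩
      · refine Path.trans (path_act (m := 1) (d := .zero) hp hr (fun x hx => ?_)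
          hb2) (by simpa using hP)
        rw [hl, hx]
        rcases h1 with h1 | h1 <;> rw [h1]
      · rintro (_ | q)
        · simp [h7, digit, digit0]
          rw [if_neg (by omega), if_pos (by omega)]
        · have := h2 q
          rw [digit_succ, show (u + 1) / 2 = u / 2 + 1 by omega, ← this]
          congr 1; push_cast; ring
      · intro q hq
        rw [h3 q (by push_cast; omega), Function.update_of_ne (by omega)]
      · intro q hq hq'
        rcases hq.eq_or_lt with rfl | hq
        · simp [h7]
        · exact h6 q hq hq'
    · by_cases hu0 : u = 0
      · subst hu0
        refine ⟨Function.update f h .top, h, ?_, ?_, ?_, le_rfl, by omega, by omega⟩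
        · refine path_act (m := -1) hp hr (fun x hx => ?_) hb1
          rw [hl, hx, show f h = .blank by simpa using hf 0]
        · rintro (_ | q)
          · simp [digit, digit0]
          · have := hf (q + 1)
            rw [Function.update_of_ne (by omega), this, digit_succ, digit_succ]
        · intro q hq
          rw [Function.update_of_ne (by omega)]
      · have h1 : f h = .zero := by
          rw [h0, digit0, if_neg hu0, if_neg (by omega), if_pos (by omega)]
        refine ⟨Function.update f h .one, h, ?_, ?_, ?_, le_rfl, by omega, by omega⟩
        · refine path_act (m := -1) hp hr (fun x hx => ?_) hb1
          rw [hl, hx, h1]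
        · rintro (_ | q)
          · simp only [Nat.cast_zero, add_zero, Function.update_self, digit, digit0]
            rw [if_neg (by omega), if_neg (by omega), if_neg (by omega)]
          · have := hf (q + 1)
            rw [Function.update_of_ne (by omega), this, digit_succ, digit_succ]
            congr 1; omega
        · intro q hq
          rw [Function.update_of_ne (by omega)]

theorem path_inc (hp : 0 ≤ p ∧ p ≤ n + 1) (hr : r < c.width) (hreg : reg l.1 = r)
    (hl' : rest l.1 = l'.1)
    (hl : ∀ x : Fin c.width → Digit, trans c.width l.1 (Machine.inSym n p) x .work =
      match look r x with
      | .zero => some ((l.1, .back), 0, act r .one (-1) x, none)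
      | .blank => some ((l.1, .back), 0, act r .top (-1) x, none)
      | _ => some ((l.1, .work), 0, act r .zero 1 x, none)) (hs : s r < 2 ^ W) :
    Path c n (W + 1) (mcfg c l .work s p o r (tapeOf (s r)) 0)
      (ncfg c l' (Function.update s r (s r + 1)) p o) := by
  obtain ⟨f', m, hP, h2, h3, -, h5, h6⟩ := path_carry (W := W) (s := s) (o := o) hp hr hl W (s r) 0
    (tapeOf (s r)) (fun q => by simp; rfl) hs (by omega)
  have hf : f' = tapeOf (s r + 1) := by
    funext q
    cases q with
    | ofNat q => exact (by simpa using h2 q : f' (q : ℤ) = digit (s r + 1) q)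
    | negSucc q => rw [h3 _ (by simp)]; rfl
  rw [← mcfg_fetch]
  refine hP.trans ?_
  rw [hf] at h6 ⊢
  exact path_back hp hr hreg hl' rfl m (fun q hq => h6 q (by omega) hq) h5

theorem path_borrow (hp : 0 ≤ p ∧ p ≤ n + 1) (hr : r < c.width)
    (hl : ∃ k, l.1 = dec r :: k) :
    ∀ (w u h : ℕ) (f : ℤ → Digit), (∀ q : ℕ, f (h + q) = digit u q) → 0 < u → u < 2 ^ w →
      h + w ≤ W →
      ∃ (f' : ℤ → Digit) (m : ℕ) (ph : Phase),
        Path c n (W + 1) (mcfg c l .work s p o r f h) (mcfg c l ph s p o r f' ((m : ℤ) - 1)) ∧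
        (∀ q : ℤ, q < h → f' q = f q) ∧
        m ≤ W + 1 ∧ (∀ q : ℕ, h ≤ q → q < m → f' q ≠ .blank) ∧
        ((ph = .back ∧ 2 ≤ u ∧ h ≤ m ∧ ∀ q : ℕ, f' (h + q) = digit (u - 1) q) ∨
         (ph = .fix ∧ 2 ≤ u ∧ h < m ∧
           ∀ q : ℕ, Function.update f' ((m : ℤ) - 1) .top (h + q) = digit (u - 1) q) ∨
         (ph = .fix ∧ u = 1 ∧ h = m ∧ ∀ q : ℕ, f' (h + q) = .blank)) := by
  obtain ⟨k, hl⟩ := hl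
  intro w
  induction w with
  | zero => intro u h f hf h0 hu; simp at hu; omega
  | succ w ih =>
    intro u h f hf hu0 hu hW
    have h0 : f h = digit0 u := by simpa [digit] using hf 0
    have hb1 : |(h : ℤ) + ((-1 : SignType) : ℤ)| ≤ W + 1 := by
      simp only [SignType.coe_neg_one]; exact abs_le.2 ⟨by omega, by omega⟩
    have hb2 : |(h : ℤ) + ((1 : SignType) : ℤ)| ≤ W + 1 := by
      simp only [SignType.coe_one]; exact abs_le.2 ⟨by omega, by omega⟩
    by_cases hu1 : u = 1
    · subst hu1
      refine ⟨Function.update f h .blank, h, .fix, ?_, ?_, by omega, by omega, .inr (.inr ⟨rfl, rfl, rfl, ?_⟩)⟩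
      · refine path_act (m := -1) hp hr (fun x hx => ?_) hb1
        simp only [trans, hl, hx, show f h = .top by simpa [digit0] using h0]
      · intro q hq
        rw [Function.update_of_ne (by omega)]
      · rintro (_ | q)
        · simp
        · have := hf (q + 1)
          rw [Function.update_of_ne (by omega), this, digit_succ]
          simp
    by_cases hodd : u % 2 = 1
    · have h1 : f h = .one := by
        rw [h0, digit0, if_neg (by omega), if_neg hu1, if_neg (by omega)]
      refine ⟨Function.update f h .zero, h, .back, ?_, ?_, by omega, by omega,
        .inl ⟨rfl, by omega, le_rfl, ?_⟩⟩
      · refine path_act (m := -1) hp hr (fun x hx => ?_) hb1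
        simp only [trans, hl, hx, h1]
      · intro q hq
        rw [Function.update_of_ne (by omega)]
      · rintro (_ | q)
        · simp only [Nat.cast_zero, add_zero, Function.update_self, digit, digit0]
          rw [if_neg (by omega), if_neg (by omega), if_pos (by omega)]
        · have := hf (q + 1)
          rw [Function.update_of_ne (by omega), this, digit_succ, digit_succ]
          congr 1; omega
    · have h1 : f h = .zero := by
        rw [h0, digit0, if_neg (by omega), if_neg hu1, if_pos (by omega)]
      obtain ⟨f', m, ph, hP, h3, h5, h6, hc⟩ := ih (u / 2) (h + 1) (Function.update f h .one) (by
          intro q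
          rw [Function.update_of_ne (by omega)]
          have := hf (q + 1)
          rw [digit_succ] at this
          rw [← this]; congr 1; push_cast; ring) (by omega) (by rw [pow_succ] at hu; omega) (by omega)
      have h7 : f' h = .one := by rw [h3 _ (by push_cast; omega)]; simp
      have hd : digit0 (u - 1) = if u = 2 then .top else .one := by
        rw [digit0, if_neg (by omega)]
        by_cases h2 : u = 2
        · simp [h2]
        · rw [if_neg (by omega), if_neg (by omega), if_neg h2]
      refine ⟨f', m, ph, ?_, ?_, by omega, ?_, ?_⟩
      · refine Path.trans (path_act (m := 1) (d := .one) hp hr (fun x hx => ?_)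
          hb2) (by simpa using hP)
        simp only [trans, hl, hx, h1]
      · intro q hq
        rw [h3 q (by push_cast; omega), Function.update_of_ne (by omega)]
      · intro q hq hq'
        rcases hq.eq_or_lt with rfl | hq
        · simp [h7]
        · exact h6 q hq hq'
      · have key : ∀ g : ℤ → Digit, ∀ v, (∀ q : ℕ, g (((h + 1 : ℕ) : ℤ) + q) = digit v q) →
            ∀ q : ℕ, g (h + ((q + 1 : ℕ) : ℤ)) = digit v q := by
          intro g v hg q
          rw [← hg q]; congr 1; push_cast; ring
        rcases hc with ⟨rfl, h8, h9, h10⟩ | ⟨rfl, h8, h9, h10⟩ | ⟨rfl, h8, h9, h10⟩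
        · refine .inl ⟨rfl, by omega, by omega, ?_⟩
          rintro (_ | q)
          · simp only [Nat.cast_zero, add_zero, h7, digit]
            rw [hd, if_neg (by omega)]
          · rw [key _ _ h10, digit_succ]
            congr 1; omega
        · refine .inr (.inl ⟨rfl, by omega, by omega, ?_⟩)
          rintro (_ | q)
          · rw [Function.update_of_ne (by omega)]
            simp only [Nat.cast_zero, add_zero, h7, digit]
            rw [hd, if_neg (by omega)]
          · rw [key _ _ h10, digit_succ]
            congr 1; omega
        · refine .inr (.inl ⟨rfl, by omega, by omega, ?_⟩)
          have hu2 : u = 2 := by omega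
          rintro (_ | q)
          · rw [← h9]
            simp [digit, digit0, hu2]
          · rw [Function.update_of_ne (by rw [← h9]; push_cast; omega),
              key f' 0 (by simpa using h10), digit_succ, hu2]

theorem path_dec (hp : 0 ≤ p ∧ p ≤ n + 1) (hr : r < c.width) (hl : l.1 = dec r :: l'.1)
    (h0 : 0 < s r) (hs : s r < 2 ^ W) :
    Path c n (W + 1) (mcfg c l .work s p o r (tapeOf (s r)) 0)
      (ncfg c l' (Function.update s r (s r - 1)) p o) := by
  obtain ⟨f', m, ph, hP, h3, h5, h6, hc⟩ := path_borrow (W := W) (s := s) (o := o) hp hr ⟨_, hl⟩ W (s r) 0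
    (tapeOf (s r)) (fun q => by simp; rfl) h0 hs (by omega)
  have hneg : ∀ q : ℕ, f' (Int.negSucc q) = .blank := fun q => by rw [h3 _ (by simp)]; rfl
  have hreg : reg l.1 = r := by rw [hl, reg]
  have hrest : rest l.1 = l'.1 := by rw [hl, rest]
  rw [← mcfg_fetch]
  refine hP.trans ?_
  rcases hc with ⟨rfl, h8, h9, h10⟩ | ⟨rfl, h8, h9, h10⟩ | ⟨rfl, h8, h9, h10⟩
  · have hf : f' = tapeOf (s r - 1) := by
      funext q
      cases q with
      | ofNat q => exact (by simpa using h10 q : f' (q : ℤ) = digit (s r - 1) q)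
      | negSucc q => rw [hneg]; rfl
    rw [hf] at h6 ⊢
    exact path_back hp hr hreg hrest rfl m (fun q hq => h6 q (by omega) hq) h5
  · have hf : Function.update f' ((m : ℤ) - 1) .top = tapeOf (s r - 1) := by
      funext q
      cases q with
      | ofNat q => exact (by simpa using h10 q :
          Function.update f' ((m : ℤ) - 1) .top (q : ℤ) = digit (s r - 1) q)
      | negSucc q => rw [Function.update_of_ne (by omega), hneg]; rfl
    have h1 : f' ((m : ℤ) - 1) ≠ .blank := by
      have := h6 (m - 1) (by omega) (by omega)
      rwa [Nat.cast_pred h9] at this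
    have := path_act (W := W + 1) (l := l) (l' := l) (ph := .fix) (ph' := .back) (s := s) (o := o)
      (f := f') (h := (m : ℤ) - 1) (d := .top) (m := -1) hp hr (by
        intro x hx
        simp only [trans, hreg, hx]) (by
          have h2 : ((-1 : SignType) : ℤ) = -1 := rfl
          exact abs_le.2 ⟨by omega, by omega⟩)
    refine this.trans ?_
    have h2 : (m : ℤ) - 1 + ((-1 : SignType) : ℤ) = ((m - 1 : ℕ) : ℤ) - 1 := by
      simp; omega
    rw [h2, ← hf]
    refine path_back hp hr hreg hrest ?_ (m - 1) (fun q hq => ?_) (by omega)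
    · rw [Function.update_of_ne (by omega)]; exact hneg 0
    · rw [Function.update_of_ne (by omega)]
      exact h6 q (by omega) (by omega)
  · have hf : f' = tapeOf (s r - 1) := by
      funext q
      cases q with
      | ofNat q => rw [h8]; simpa [tapeOf] using h10 q
      | negSucc q => rw [hneg]; rfl
    have := path_act (W := W + 1) (l := l) (l' := l') (ph := .fix) (ph' := .fetch) (s := s) (o := o)
      (f := f') (h := (m : ℤ) - 1) (d := .blank) (m := 1) hp hr (by
        intro x hx
        simp only [trans, hreg, hx, ← h9, hrest]
        rw [show f' (((0 : ℕ) : ℤ) - 1) = .blank from hneg 0]) (by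
          rw [← h9]; simp; omega)
    rw [← hf]
    have h11 : Function.update f' ((m : ℤ) - 1) .blank = f' := by
      rw [Function.update_eq_self_iff, ← h9]; exact (hneg 0).symm
    rw [h11] at this
    simpa [← h9] using this

end Run

end Cmd
end QFan

namespace QFan
namespace Cmd

variable {Out : Type}

theorem tapeOf_zero_cell (v : ℕ) : tapeOf v 0 = digit0 v := rfl

theorem digit0_eq_blank {v : ℕ} : digit0 v = .blank ↔ v = 0 := by
  rw [digit0]; split_ifs <;> simp_all

theorem look_tape {R : ℕ} {s : ℕ → ℕ} {r : ℕ} (hr : r < R) :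
    look (R := R) r (fun i => tapeOf (s i) 0) = digit0 (s r) := by
  simp [look, hr, tapeOf_zero_cell]

theorem path_step {c : Cmd Out} {n W : ℕ} {x y : Conf Out} (hx : x.todo ∈ States c)
    (hy : y.todo ∈ States c) (h : step n x = some y) (hs : ∀ r, x.regs r < 2 ^ W)
    (hp : 0 ≤ x.pos ∧ x.pos ≤ n + 1) :
    Path c n (W + 1) (ncfg c ⟨x.todo, hx⟩ x.regs x.pos x.out) (ncfg c ⟨y.todo, hy⟩ y.regs y.pos y.out) := by
  obtain ⟨l, s, p, o⟩ := x
  have hp0 : max 0 (min ((n : ℤ) + 1) (p + ((0 : SignType) : ℤ))) = p := by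
    simp only [SignType.coe_zero, add_zero]; simp only at hp; omega
  have hw : ∀ i : Fin (machine c).tapes, |(0 : ℤ)| ≤ (W : ℤ) + 1 := fun _ => by simp; omega
  have hR : ∀ d ∈ l, d.width ≤ c.width := by
    rcases hx with hx | hx
    · exact width_le_of_mem_conts c le_rfl (by simp) hx
    · rw [Set.mem_singleton_iff] at hx
      simp only at hx
      subst hx; simp
  have fetch : ∀ {l' : States c} {q : ℤ} {o' : List Out} {ph : Phase} {m : SignType} {e : Option Out},
      trans c.width l (Machine.inSym n p) (fun i => tapeOf (s i) 0) .fetch =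
        some ((l'.1, ph), m, keep fun i => tapeOf (s i) 0, e) →
      max 0 (min ((n : ℤ) + 1) (p + (m : ℤ))) = q → o ++ e.toList = o' →
      Path c n (W + 1) (ncfg c ⟨l, hx⟩ s p o) { ncfg c l' s q o' with state := (l', ph) } := by
    intro l' q o' ph m e ht hq ho
    subst hq; subst ho
    exact path_single (step_keep (l := ⟨l, hx⟩) ht) hw
  have hwork : ∀ (l' : States c) (q : ℤ) (r : ℕ), ({ ncfg c l' s q o with state := (l', .work) } :
      (machine c).Cfg) = mcfg c l' .work s q o r (tapeOf (s r)) 0 := by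
    intro l' q r
    have h1 := congrArg Machine.Cfg.tape (mcfg_self c l' s q o r)
    have h2 := congrArg Machine.Cfg.head (mcfg_self c l' s q o r)
    simp only [ncfg, mcfg] at h1 h2 ⊢
    rw [h1, h2]
  cases l with
  | nil => simp [step] at h
  | cons a k =>
    have ha : a.width ≤ c.width := hR a (by simp)
    cases a with
    | inc r =>
      simp only [step, Option.some.injEq] at h
      subst h
      have hr : r < c.width := ha
      refine Path.trans (fetch (l' := ⟨inc r :: k, hx⟩) (o' := o) (ph := .work) (m := 0) (e := none) rfl hp0
        (by simp)) ?_
      rw [hwork _ _ r]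
      exact path_inc hp hr rfl rfl (fun x => rfl) (hs r)
    | dec r =>
      simp only [step, Option.some.injEq] at h
      subst h
      have hr : r < c.width := ha
      rcases Nat.eq_zero_or_pos (s r) with h0 | h0
      · have : Function.update s r (s r - 1) = s := by
          rw [Function.update_eq_self_iff]; omega
        simp only [this]
        refine fetch (l' := ⟨k, hy⟩) (m := 0) (e := none) ?_ hp0 (by simp)
        simp only [trans, look_tape hr, h0]
        rfl
      · refine Path.trans (fetch (l' := ⟨dec r :: k, hx⟩) (o' := o) (ph := .work) (m := 0) (e := none) ?_ hp0
          (by simp)) ?_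
        · have : digit0 (s r) ≠ .blank := fun h => by rw [digit0_eq_blank] at h; omega
          simp only [trans, look_tape hr]
        · rw [hwork _ _ r]
          exact path_dec (l' := ⟨k, hy⟩) hp hr rfl h0 (hs r)
    | seq c' d' =>
      simp only [step, Option.some.injEq] at h
      subst h
      exact fetch (l' := ⟨_, hy⟩) (m := 0) (e := none) rfl hp0 (by simp)
    | loop r c' =>
      simp only [step, Option.some.injEq] at h
      subst h
      have hr : r < c.width := lt_of_lt_of_le (by simp [width]) ha
      refine fetch (l' := ⟨_, hy⟩) (m := 0) (e := none) ?_ hp0 (by simp)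
      simp only [trans, look_tape hr]
      by_cases h0 : s r = 0
      · simp [h0, digit0]
      · have : digit0 (s r) ≠ .blank := fun h => h0 (digit0_eq_blank.1 h)
        simp only [h0, if_false]
    | ite r c' d' =>
      simp only [step, Option.some.injEq] at h
      subst h
      have hr : r < c.width := lt_of_lt_of_le (by simp [width]) ha
      refine fetch (l' := ⟨_, hy⟩) (m := 0) (e := none) ?_ hp0 (by simp)
      simp only [trans, look_tape hr]
      by_cases h0 : s r = 0
      · simp [h0, digit0]
      · have : digit0 (s r) ≠ .blank := fun h => h0 (digit0_eq_blank.1 h)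
        simp only [h0, if_false]
    | emit a =>
      simp only [step, Option.some.injEq] at h
      subst h
      exact fetch (l' := ⟨_, hy⟩) (m := 0) (e := some a) rfl hp0 rfl
    | read r =>
      have hr : r < c.width := ha
      rcases hi : Machine.inSym n p with _ | _ | _
      · simp only [step, hi, Option.some.injEq] at h
        subst h
        exact fetch (l' := ⟨_, hy⟩) (m := 1) (e := none) (by simp [trans, hi]) rfl (by simp)
      · simp only [step, hi, Option.some.injEq] at h
        subst h
        refine Path.trans (fetch (l' := ⟨_, hy⟩) (o' := o) (ph := .work) (m := 1) (e := none)
          (by simp [trans, hi]) rfl (by simp)) ?_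
        rw [hwork _ _ r]
        exact path_inc ⟨by omega, by omega⟩ hr rfl rfl (fun x => rfl) (hs r)
      · simp only [step, hi, Option.some.injEq] at h
        subst h
        exact fetch (l' := ⟨_, hy⟩) (m := 0) (e := none) (by simp [trans, hi]) hp0 (by simp)

/-- A run of a register program in which the registers stay below `B + 1`. -/
def Steps (n B : ℕ) : Conf Out → Conf Out → Prop :=
  Relation.ReflTransGen fun x y => step n x = some y ∧ ∀ r, y.regs r ≤ B

theorem step_pos {n : ℕ} {x y : Conf Out} (h : step n x = some y)
    (hp : 0 ≤ x.pos ∧ x.pos ≤ n + 1) : 0 ≤ y.pos ∧ y.pos ≤ n + 1 := by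
  obtain ⟨l, s, p, o⟩ := x
  rcases l with _ | ⟨a, k⟩
  · simp [step] at h
  · cases a with
    | read r =>
      simp only [step, Option.some.injEq] at h
      subst h
      simp only at hp
      split <;> simp only <;> omega
    | _ =>
      simp only [step, Option.some.injEq] at h
      subst h
      exact hp

theorem path_of_steps {c : Cmd Out} {n B W : ℕ} (hB : B < 2 ^ W) {x y : Conf Out}
    (h : Steps n B x y) (hx : x.todo ∈ States c) (hs : ∀ r, x.regs r ≤ B)
    (hp : 0 ≤ x.pos ∧ x.pos ≤ n + 1) :
    ∃ hy : y.todo ∈ States c, Path c n (W + 1) (ncfg c ⟨x.todo, hx⟩ x.regs x.pos x.out)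
      (ncfg c ⟨y.todo, hy⟩ y.regs y.pos y.out) := by
  have key : ∃ hy : y.todo ∈ States c, (∀ r, y.regs r ≤ B) ∧ (0 ≤ y.pos ∧ y.pos ≤ n + 1) ∧
      Path c n (W + 1) (ncfg c ⟨x.todo, hx⟩ x.regs x.pos x.out)
        (ncfg c ⟨y.todo, hy⟩ y.regs y.pos y.out) := by
    induction h with
    | refl => exact ⟨hx, hs, hp, .refl⟩
    | @tail y z _ h ih =>
      obtain ⟨hy, hs', hp', hP⟩ := ih
      have hy0 : y.todo ∈ conts c [] := by
        rcases hy with hy | hy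
        · exact hy
        · obtain ⟨l, s, p, o⟩ := y
          rw [Set.mem_singleton_iff] at hy
          simp only at hy
          subst hy
          simp [step] at h
      have hz : z.todo ∈ States c := step_mem_conts c hy0 h.1
      exact ⟨hz, h.2, step_pos h.1 hp', hP.trans (path_step hy hz h.1
        (fun r => (hs' r).trans_lt hB) hp')⟩
  obtain ⟨hy, -, -, hP⟩ := key
  exact ⟨hy, hP⟩

theorem steps_read {n B : ℕ} (hB : n ≤ B) (k : List (Cmd Out)) (o : List Out) :
    Steps n B ⟨read 0 :: k, fun _ => 0, 0, o⟩ ⟨k, Function.update (fun _ => 0) 0 n, n + 1, o⟩ := by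
  have key : ∀ m : ℕ, m ≤ n → Steps n B ⟨read 0 :: k, fun _ => 0, 0, o⟩
      ⟨read 0 :: k, Function.update (fun _ => 0) 0 m, m + 1, o⟩ := by
    intro m
    induction m with
    | zero =>
      intro _
      refine .single ⟨?_, ?_⟩
      · simp [step, Machine.inSym]
      · simp
    | succ m ih =>
      intro hm
      refine .tail (ih (by omega)) ⟨?_, ?_⟩
      · simp only [step, Machine.inSym]
        rw [if_neg (by omega), if_pos (by omega)]
        simp
        omega
      · intro r
        by_cases hr : r = 0
        · subst hr; simp; omega
        · simp [hr]
  refine .tail (key n le_rfl) ⟨?_, ?_⟩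
  · simp only [step, Machine.inSym]
    rw [if_neg (by omega), if_neg (by omega)]
  · intro r
    by_cases hr : r = 0
    · subst hr; simpa using hB
    · simp [hr]

/-- Running `c` from the registers `s` ends with the registers `s'`, outputs `w`, and keeps the
registers below `B + 1`. -/
def Runs (n B : ℕ) (c : Cmd Out) (s s' : ℕ → ℕ) (w : List Out) : Prop :=
  ∀ k p o, Steps n B ⟨c :: k, s, p, o⟩ ⟨k, s', p, o ++ w⟩

theorem Path.reaches {c : Cmd Out} {n : ℕ} {W : ℤ} {x z : (machine c).Cfg} (h : Path c n W x z) :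
    Relation.ReflTransGen (fun a b => (machine c).step n a = some b) x z := by
  induction h with
  | refl => exact .refl
  | tail _ h ih => exact .tail ih h.1

theorem head_le_of_path {c : Cmd Out} {n : ℕ} {W : ℤ} {x z : (machine c).Cfg}
    (h : Path c n W x z) (hz : (machine c).step n z = none) (hx : ∀ i, |x.head i| ≤ W)
    {y : (machine c).Cfg}
    (hy : Relation.ReflTransGen (fun a b => (machine c).step n a = some b) x y) :
    ∀ i, |y.head i| ≤ W := by
  revert y
  induction h using Relation.ReflTransGen.head_induction_on with
  | refl =>
    intro y hy
    rcases hy.cases_head with rfl | ⟨b, hb, -⟩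
    · exact hx
    · rw [hz] at hb; simp at hb
  | head h1 _ ih =>
    intro y hy
    rcases hy.cases_head with rfl | ⟨b, hb, hby⟩
    · exact hx
    · rw [h1.1, Option.some.injEq] at hb
      subst hb
      exact ih h1.2 hby

end Cmd

open Cmd in
/-- A function computed by a register program with polynomially bounded registers is log-space
computable. -/
theorem logSpace_of_runs {Out : Type} {f : ℕ → List Out} (c : Cmd Out) (d : ℕ) (hd : 0 < d)
    (h : ∀ n, ∃ s', Runs n ((n + 2) ^ d) c (Function.update (fun _ => 0) 0 n) s' (f n)) :
    LogSpace f := by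
  refine ⟨machine (seq (read 0) c), 2 * d + 2, fun n => ?_⟩
  obtain ⟨s', hrun⟩ := h n
  set W := d * (Nat.log 2 n + 2) + 1 with hW
  have h2 : n + 2 ≤ 2 ^ (Nat.log 2 n + 2) := by
    rcases Nat.eq_zero_or_pos n with rfl | hn
    · simp
    · have := Nat.lt_pow_succ_log_self (b := 2) (by norm_num) n
      rw [pow_succ]
      have h3 : 2 ≤ 2 ^ (Nat.log 2 n).succ := by
        calc 2 = 2 ^ 1 := rfl
          _ ≤ _ := Nat.pow_le_pow_right (by norm_num) (by simp)
      simp only [Nat.succ_eq_add_one] at *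
      omega
  have hB : (n + 2) ^ d < 2 ^ W := by
    calc (n + 2) ^ d ≤ (2 ^ (Nat.log 2 n + 2)) ^ d := Nat.pow_le_pow_left h2 d
      _ = 2 ^ (d * (Nat.log 2 n + 2)) := by rw [← pow_mul, mul_comm]
      _ < 2 ^ W := Nat.pow_lt_pow_right (by norm_num) (by omega)
  have hn : n ≤ (n + 2) ^ d := (by omega : n ≤ n + 2).trans (Nat.le_self_pow hd.ne' _)
  have hst : Steps n ((n + 2) ^ d) ⟨[seq (read 0) c], fun _ => 0, 0, []⟩
      ⟨[], s', n + 1, f n⟩ := by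
    refine .head (b := ⟨[read 0, c], fun _ => 0, 0, []⟩) ⟨rfl, by simp⟩ ?_
    exact (steps_read hn _ _).trans (show Steps _ _ _ _ by simpa using hrun [] (n + 1) [])
  obtain ⟨hy, hP⟩ := path_of_steps (c := seq (read 0) c) hB hst (.inl (self_mem_conts _ _))
    (by simp) ⟨le_rfl, by simp; omega⟩
  have hinit : (machine (seq (read 0) c)).init =
      ncfg (seq (read 0) c) ⟨[seq (read 0) c], .inl (self_mem_conts _ _)⟩ (fun _ => 0) 0 [] := by
    simp only [Machine.init, ncfg, machine, Machine.Cfg.mk.injEq, true_and, and_true]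
    funext i p
    cases p <;> simp [tapeOf]
  have hhalt : (machine (seq (read 0) c)).step n (ncfg (seq (read 0) c) ⟨[], hy⟩ s' (n + 1) (f n)) =
      none := by
    simp [Machine.step, machine, ncfg, Cmd.trans]
  refine ⟨fun x hx i => ?_, _, ?_, hhalt, rfl⟩
  · rw [Machine.Reaches, hinit] at hx
    refine (head_le_of_path hP hhalt (fun _ => by simp [ncfg]; omega) hx i).trans ?_
    rw [hW]
    push_cast
    nlinarith [Nat.zero_le (Nat.log 2 n)]
  · rw [Machine.Reaches, hinit]
    exact hP.reaches

end QFan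

namespace QFan
namespace Cmd

variable {Out : Type} {n B : ℕ} {s s' s'' : ℕ → ℕ} {w w' : List Out} {c d : Cmd Out} {r t : ℕ}

theorem Steps.mono {B' : ℕ} {x y : Conf Out} (h : Steps n B x y) (hB : B ≤ B') :
    Steps n B' x y := by
  induction h with
  | refl => exact .refl
  | tail _ h ih => exact .tail ih ⟨h.1, fun r => (h.2 r).trans hB⟩

theorem Runs.mono {B' : ℕ} (h : Runs n B c s s' w) (hB : B ≤ B') : Runs n B' c s s' w := by
  intro k p o
  exact (h k p o).mono hB

theorem Runs.le (h : Runs n B c s s' w) (r : ℕ) : s' r ≤ B := by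
  rcases (h [] 0 []).cases_tail with h | ⟨x, -, h⟩
  · simp at h
  · exact h.2 r

theorem runs_inc (hs : ∀ r, s r ≤ B) (hr : s r + 1 ≤ B) :
    Runs (Out := Out) n B (inc r) s (Function.update s r (s r + 1)) [] := by
  intro k p o
  refine .single ⟨by simp [step], fun q => ?_⟩
  by_cases hq : q = r
  · subst hq; simpa using hr
  · simpa [hq] using hs q

theorem runs_dec (hs : ∀ r, s r ≤ B) :
    Runs (Out := Out) n B (dec r) s (Function.update s r (s r - 1)) [] := by
  intro k p o
  refine .single ⟨by simp [step], fun q => ?_⟩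
  by_cases hq : q = r
  · subst hq; simpa using (hs q).trans (Nat.le_succ _)
  · simpa [hq] using hs q

theorem runs_emit (hs : ∀ r, s r ≤ B) (o : Out) : Runs n B (emit o) s s [o] := by
  intro k p o'
  exact .single ⟨by simp [step], hs⟩

theorem Runs.seq (hs : ∀ r, s r ≤ B) (h : Runs n B c s s' w) (h' : Runs n B d s' s'' w') :
    Runs n B (seq c d) s s'' (w ++ w') := by
  intro k p o
  refine .head ⟨rfl, hs⟩ ((h _ _ _).trans ?_)
  rw [← List.append_assoc]
  exact h' _ _ _

theorem Runs.seq_nil (hs : ∀ r, s r ≤ B) (h : Runs n B c s s' []) (h' : Runs n B d s' s'' []) :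
    Runs n B (Cmd.seq c d) s s'' [] := by
  simpa using h.seq hs h'

theorem runs_ite_zero (hs : ∀ r, s r ≤ B) (hr : s r = 0) (h : Runs n B c s s' w) :
    Runs n B (ite r c d) s s' w := by
  intro k p o
  refine .head ⟨rfl, hs⟩ ?_
  rw [if_pos hr]
  exact h k p o

theorem runs_ite_pos (hs : ∀ r, s r ≤ B) (hr : s r ≠ 0) (h : Runs n B d s s' w) :
    Runs n B (ite r c d) s s' w := by
  intro k p o
  refine .head ⟨rfl, hs⟩ ?_
  rw [if_neg hr]
  exact h k p o

theorem runs_loop (S : ℕ → ℕ → ℕ) (w : ℕ → List Out) (m : ℕ) (hS : ∀ t r, t ≤ m → S t r ≤ B)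
    (h : ∀ t < m, S t r ≠ 0 ∧ Runs n B c (S t) (S (t + 1)) (w t)) (hm : S m r = 0) :
    Runs n B (loop r c) (S 0) (S m) ((List.range m).flatMap w) := by
  intro k p o
  have key : ∀ t ≤ m, Steps n B ⟨loop r c :: k, S 0, p, o⟩
      ⟨loop r c :: k, S t, p, o ++ (List.range t).flatMap w⟩ := by
    intro t
    induction t with
    | zero => intro _; rw [List.range_zero, List.flatMap_nil, List.append_nil]; exact .refl
    | succ t ih =>
      intro ht
      refine (ih (by omega)).trans (.head (b := ⟨c :: loop r c :: k, S t, p,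
          o ++ (List.range t).flatMap w⟩) ⟨?_, ?_⟩ ?_)
      · simp only [step, if_neg (h t (by omega)).1]
      · exact fun r => hS t r (by omega)
      · have := (h t (by omega)).2 (loop r c :: k) p (o ++ (List.range t).flatMap w)
        rw [List.range_succ, List.flatMap_append, List.flatMap_singleton, ← List.append_assoc]
        exact this
  exact (key m le_rfl).tail ⟨by simp [step, hm], fun r => hS m r le_rfl⟩

theorem flatMap_nil (m : ℕ) : ((List.range m).flatMap fun _ => ([] : List Out)) = [] := by
  simp

/-- Set a register to zero. -/
def clear (r : ℕ) : Cmd Out := loop r (dec r)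

theorem runs_clear (hs : ∀ r, s r ≤ B) : Runs (Out := Out) n B (clear r) s (Function.update s r 0) [] := by
  have hle : ∀ t q, Function.update s r (s r - t) q ≤ B := by
    intro t q
    by_cases hq : q = r
    · subst hq; simpa using (hs q).trans (Nat.le_add_right _ _)
    · simpa [hq] using hs q
  have := runs_loop (Out := Out) (n := n) (B := B) (c := dec r) (r := r)
    (fun t => Function.update s r (s r - t)) (fun _ => []) (s r) (fun t q _ => hle t q) (by
      intro t ht
      refine ⟨by simp; omega, ?_⟩
      have := runs_dec (Out := Out) (n := n) (r := r) (hle t)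
      simpa [Nat.sub_sub] using this) (by simp)
  rw [flatMap_nil] at this
  rw [clear]
  simpa using this

/-- Add register `r` to register `t` and set register `r` to zero. -/
def move (r t : ℕ) : Cmd Out := loop r (seq (dec r) (inc t))

theorem runs_move (hrt : r ≠ t) (hs : ∀ r, s r ≤ B) (hB : s t + s r ≤ B) :
    Runs (Out := Out) n B (move r t) s (Function.update (Function.update s t (s t + s r)) r 0) [] := by
  set S : ℕ → ℕ → ℕ := fun m => Function.update (Function.update s t (s t + m)) r (s r - m) with hS
  have hle : ∀ m q, m ≤ s r → S m q ≤ B := by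
    intro m q hm
    simp only [hS, Function.update_apply]
    split_ifs with h1 h2
    · have := hs r; omega
    · omega
    · exact hs q
  have := runs_loop (Out := Out) (n := n) (B := B) (c := seq (dec r) (inc t)) (r := r)
    S (fun _ => []) (s r) (fun t q h => hle t q h) (by
      intro m hm
      refine ⟨by simp [hS]; omega, ?_⟩
      have h1 := runs_dec (Out := Out) (n := n) (r := r) (fun q => hle m q hm.le)
      have h2 := runs_inc (Out := Out) (n := n) (r := t) (fun q => h1.le q) (by
        simp only [hS, Function.update_apply, if_neg hrt.symm, if_true]; omega)
      convert h1.seq_nil (fun q => hle m q hm.le) h2 using 1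
      funext q
      simp only [hS, Function.update_apply]
      split_ifs <;> simp_all <;> omega) (by simp [hS])
  have h0 : S 0 = s := by
    funext q
    simp only [hS, Function.update_apply]
    split_ifs <;> simp_all
  have h1 : S (s r) = Function.update (Function.update s t (s t + s r)) r 0 := by simp [hS]
  rwa [h0, h1, flatMap_nil] at this

/-- Run a list of programs; register `z` should stay zero. -/
def all (z : ℕ) : List (Cmd Out) → Cmd Out
  | [] => dec z
  | c :: l => seq c (all z l)

theorem runs_all {κ : Type} {z : ℕ} (c : κ → Cmd Out) (I : List κ → (ℕ → ℕ) → Prop)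
    (hle : ∀ l s, I l s → ∀ r, s r ≤ B) (hz : ∀ s, I [] s → s z = 0)
    (hstep : ∀ k l s, I (k :: l) s → ∃ s', Runs n B (c k) s s' [] ∧ I l s') :
    ∀ l s, I l s → ∃ s', Runs n B (all z (l.map c)) s s' [] ∧ I [] s' := by
  intro l
  induction l with
  | nil =>
    intro s hs
    refine ⟨s, ?_, hs⟩
    have := runs_dec (Out := Out) (n := n) (r := z) (hle _ _ hs)
    rwa [show s z - 1 = s z by rw [hz s hs], Function.update_eq_self] at this
  | cons k l ih =>
    intro s hs
    obtain ⟨s', h1, h2⟩ := hstep k l s hs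
    obtain ⟨s'', h3, h4⟩ := ih s' h2
    exact ⟨s'', h1.seq_nil (hle _ _ hs) h3, h4⟩

/-- The elements of a finite type, in some order. -/
noncomputable def elems (κ : Type) [Finite κ] : List κ :=
  (@Finset.univ κ (Fintype.ofFinite κ)).toList

theorem mem_elems {κ : Type} [Finite κ] (k : κ) : k ∈ elems κ := by simp [elems]

theorem nodup_elems {κ : Type} [Finite κ] : (elems κ).Nodup := Finset.nodup_toList _

theorem runs_clear_all {κ : Type} [Finite κ] {z : ℕ} (e : κ → ℕ) (hs : ∀ r, s r ≤ B) (hz : s z = 0) :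
    ∃ s', Runs n B (all z ((elems κ).map fun k => clear (e k)) : Cmd Out) s s' [] ∧
      (∀ k, s' (e k) = 0) ∧ ∀ r, (∀ k, e k ≠ r) → s' r = s r := by
  obtain ⟨s', h, h1, h2, -, h3⟩ := runs_all (n := n) (B := B) (Out := Out) (z := z)
    (fun k => clear (e k))
    (fun l s' => (∀ k, k ∉ l → s' (e k) = 0) ∧ (∀ r, (∀ k, e k ≠ r) → s' r = s r) ∧ s' z = 0 ∧
      ∀ r, s' r ≤ B) (fun _ _ h => h.2.2.2) (fun _ h => h.2.2.1) (by
      rintro k l s' ⟨h1, h2, h3, h4⟩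
      refine ⟨_, runs_clear h4, ?_, ?_, ?_, fun q => (runs_clear (Out := Out) (n := n) h4).le q⟩
      · intro k' hk'
        by_cases hk : e k' = e k
        · simp [hk]
        · rw [Function.update_of_ne hk]
          exact h1 k' (by
            simp only [List.mem_cons, not_or]
            exact ⟨fun h => hk (by rw [h]), hk'⟩)
      · intro r hr
        rw [Function.update_of_ne (hr k).symm, h2 r hr]
      · by_cases hk : z = e k
        · rw [hk]; simp
        · rw [Function.update_of_ne hk, h3]) (elems κ) s
    ⟨fun k hk => absurd (mem_elems k) hk, fun _ _ => rfl, hz, hs⟩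
  exact ⟨s', h, fun k => h1 k (by simp), h2⟩

theorem runs_move_all {κ : Type} [Finite κ] {z : ℕ} (e f : κ → ℕ) (he : Function.Injective e)
    (hf : Function.Injective f) (hef : ∀ k k', e k ≠ f k') (hs : ∀ r, s r ≤ B)
    (hz : s z = 0) (hze : ∀ k, e k ≠ z) (hzf : ∀ k, f k ≠ z) (h0 : ∀ k, s (f k) = 0) :
    ∃ s', Runs n B (all z ((elems κ).map fun k => move (e k) (f k)) : Cmd Out) s s' [] ∧
      (∀ k, s' (f k) = s (e k)) ∧ (∀ k, s' (e k) = 0) ∧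
      ∀ r, (∀ k, e k ≠ r) → (∀ k, f k ≠ r) → s' r = s r := by
  obtain ⟨s', h, h1, h2, h3, -⟩ := runs_all (n := n) (B := B) (Out := Out) (z := z)
    (fun k => move (e k) (f k))
    (fun l s' => (∀ k, k ∉ l → s' (f k) = s (e k) ∧ s' (e k) = 0) ∧
      (∀ k, k ∈ l → s' (f k) = 0 ∧ s' (e k) = s (e k)) ∧
      (∀ r, (∀ k, e k ≠ r) → (∀ k, f k ≠ r) → s' r = s r) ∧ l.Nodup ∧
      ∀ r, s' r ≤ B) (fun _ _ h => h.2.2.2.2) (fun _ h => by rw [h.2.2.1 z hze hzf, hz]) (by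
      rintro k l s' ⟨h1, h2, h3, h4, h5⟩
      have hm := runs_move (Out := Out) (n := n) (hef k k) h5 (by
        rw [(h2 k (by simp)).1, (h2 k (by simp)).2, zero_add]; exact hs _)
      refine ⟨_, hm, ?_, ?_, ?_, h4.of_cons, fun q => hm.le q⟩
      · intro k' hk'
        by_cases hk : k' = k
        · subst hk
          rw [Function.update_of_ne (hef _ _).symm, Function.update_self, Function.update_self,
            (h2 k' (by simp)).1, (h2 k' (by simp)).2]
          simp
        · rw [Function.update_of_ne (hef _ _).symm, Function.update_of_ne (hf.ne hk),
            Function.update_of_ne (he.ne hk), Function.update_of_ne (hef _ _)]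
          exact h1 k' (by simp [hk, hk'])
      · intro k' hk'
        have hk : k' ≠ k := fun h => (List.nodup_cons.1 h4).1 (h ▸ hk')
        rw [Function.update_of_ne (hef _ _).symm, Function.update_of_ne (hf.ne hk),
            Function.update_of_ne (he.ne hk), Function.update_of_ne (hef _ _)]
        exact h2 k' (by simp [hk'])
      · intro r hr hr'
        rw [Function.update_of_ne (hr k).symm, Function.update_of_ne (hr' k).symm, h3 r hr hr'])
    (elems κ) s
    ⟨fun k hk => absurd (mem_elems k) hk, fun k _ => ⟨h0 k, rfl⟩, fun _ _ _ => rfl, nodup_elems, hs⟩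
  exact ⟨s', h, fun k => (h1 k (by simp)).1, fun k => (h1 k (by simp)).2, h3⟩

end Cmd

/-- Numerical functions of finitely many variables that are computable by register programs with
polynomially bounded registers: the functions obtained from zero, successor and projections by
composition and by simultaneous iteration with polynomially bounded values. -/
inductive LFV : ∀ {ι : Type}, ((ι → ℕ) → ℕ) → Prop
  | zero {ι : Type} : LFV fun _ : ι → ℕ => 0
  | succ {ι : Type} (i : ι) : LFV fun v => v i + 1
  | proj {ι : Type} (i : ι) : LFV fun v => v i
  | comp {ι κ : Type} [Finite κ] {f : (κ → ℕ) → ℕ} {g : κ → (ι → ℕ) → ℕ} :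
      LFV f → (∀ k, LFV (g k)) → LFV fun v => f fun k => g k v
  | iter {ι κ : Type} [Finite κ] {a : κ → (ι → ℕ) → ℕ} {h : κ → (κ → ℕ) → ℕ} {m : (ι → ℕ) → ℕ} :
      (∀ k, LFV (a k)) → (∀ k, LFV (h k)) → LFV m →
      (∃ d, ∀ v N, (∀ i, v i ≤ N) → ∀ t ≤ m v, ∀ k,
        ((fun u j => h j u)^[t] fun j => a j v) k ≤ (N + 2) ^ d) →
      ∀ k, LFV fun v => ((fun u j => h j u)^[m v] fun j => a j v) k

namespace Cmd

/-- The function `f` is computable by programs that may use any registers. -/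
def Computes (Out : Type) {ι : Type} (f : (ι → ℕ) → ℕ) : Prop :=
  ∀ (ins : ι → ℕ) (o b : ℕ), (∀ i, ins i < b) → o < b → (∀ i, ins i ≠ o) →
    ∃ (c : Cmd Out) (d : ℕ), ∀ n N s, (∀ r, s r ≤ N) → s o = 0 → (∀ r ≥ b, s r = 0) →
      Runs n ((N + 2) ^ d) c s (Function.update s o (f (s ∘ ins))) []

theorem pow_bound (N d e : ℕ) : ((N + 2) ^ d + 2) ^ e ≤ (N + 2) ^ ((d + 2) * e) := by
  rw [pow_mul]
  refine Nat.pow_le_pow_left ?_ e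
  have h1 : 1 ≤ (N + 2) ^ d := Nat.one_le_pow _ _ (by omega)
  have h2 : 4 ≤ (N + 2) ^ 2 := by ring_nf; nlinarith
  rw [pow_add]
  nlinarith

theorem le_pow_bound (N d : ℕ) : N ≤ (N + 2) ^ (d + 1) := by
  calc N ≤ N + 2 := by omega
    _ ≤ _ := Nat.le_self_pow (by omega) _

theorem pow_le_pow_bound (N : ℕ) {d e : ℕ} (h : d ≤ e) : (N + 2) ^ d ≤ (N + 2) ^ e :=
  Nat.pow_le_pow_right (by omega) h

variable {Out : Type}

/-- Several functions can be computed one after the other. -/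
theorem computes_all {ι κ : Type} [Finite κ] {g : κ → (ι → ℕ) → ℕ} (hg : ∀ k, Computes Out (g k))
    (ins : ι → ℕ) (e : κ → ℕ) (b : ℕ) (hins : ∀ i, ins i < b) (heb : ∀ k, e k < b)
    (he : Function.Injective e) (hie : ∀ i k, ins i ≠ e k) :
    ∃ (c : Cmd Out) (d : ℕ), ∀ n N s, (∀ r, s r ≤ N) → (∀ k, s (e k) = 0) → (∀ r ≥ b, s r = 0) →
      ∃ s', Runs n ((N + 2) ^ d) c s s' [] ∧ (∀ k, s' (e k) = g k (s ∘ ins)) ∧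
        ∀ r, (∀ k, e k ≠ r) → s' r = s r := by
  choose c d hc using fun k => hg k ins (e k) b hins (heb k) (fun i => hie i k)
  obtain ⟨D, hD⟩ : ∃ D, ∀ k, d k ≤ D := by
    obtain ⟨D, hD⟩ := (Set.finite_range d).bddAbove
    exact ⟨D, fun k => hD ⟨k, rfl⟩⟩
  have hval : ∀ N s, (∀ r, s r ≤ N) → (∀ k, s (e k) = 0) → (∀ r ≥ b, s r = 0) → ∀ k,
      g k (s ∘ ins) ≤ (N + 2) ^ (D + 1) := by
    intro N s h1 h2 h3 k
    have := (hc k 0 N s h1 (h2 k) h3).le (e k)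
    rw [Function.update_self] at this
    exact this.trans (pow_le_pow_bound _ ((hD k).trans (by omega)))
  refine ⟨all b ((elems κ).map c), (D + 1 + 2) * (D + 1), fun n N s hs h0 hb => ?_⟩
  have hN : (N + 2) ^ (D + 1) ≤ (N + 2) ^ ((D + 1 + 2) * (D + 1)) := pow_le_pow_bound _ (by nlinarith)
  obtain ⟨s', h, h1, -, h3, -⟩ := runs_all (n := n) (B := (N + 2) ^ ((D + 1 + 2) * (D + 1))) (z := b) c
    (fun l s' => (∀ k, k ∉ l → s' (e k) = g k (s ∘ ins)) ∧ (∀ k, k ∈ l → s' (e k) = 0) ∧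
      (∀ r, (∀ k, e k ≠ r) → s' r = s r) ∧ l.Nodup ∧
      ∀ r, s' r ≤ (N + 2) ^ (D + 1)) (fun _ _ h r => (h.2.2.2.2 r).trans hN)
      (fun _ h => by rw [h.2.2.1 b fun k => (heb k).ne, hb b le_rfl]) (by
      rintro k l s' ⟨h1, h2, h3, h4, h5⟩
      have hsi : s' ∘ ins = s ∘ ins := by
        funext i
        exact h3 _ fun k => (hie i k).symm
      have hr := hc k n _ s' h5 (h2 k (by simp)) fun r hr => by
        rw [h3 r fun k => ((heb k).trans_le hr).ne, hb r hr]
      rw [hsi] at hr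
      refine ⟨_, hr.mono ?_, ?_, ?_, ?_, h4.of_cons, fun r => ?_⟩
      · refine (pow_bound N (D + 1) (d k)).trans (pow_le_pow_bound _ ?_)
        exact Nat.mul_le_mul_left _ ((hD k).trans (by omega))
      · intro k' hk'
        by_cases hk : k' = k
        · subst hk; simp
        · rw [Function.update_of_ne (he.ne hk)]
          exact h1 k' (by simp [hk, hk'])
      · intro k' hk'
        have hk : k' ≠ k := fun h => (List.nodup_cons.1 h4).1 (h ▸ hk')
        rw [Function.update_of_ne (he.ne hk)]
        exact h2 k' (by simp [hk'])
      · intro r hr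
        rw [Function.update_of_ne (hr k).symm, h3 r hr]
      · by_cases hk : r = e k
        · subst hk
          rw [Function.update_self]
          exact hval N s hs h0 hb k
        · rw [Function.update_of_ne hk]
          exact h5 r) (elems κ) s
    ⟨fun k hk => absurd (mem_elems k) hk, fun k _ => h0 k, fun _ _ => rfl, nodup_elems,
      fun r => (hs r).trans (le_pow_bound _ _)⟩
  exact ⟨s', h, fun k => h1 k (by simp), h3⟩

end Cmd
end QFan

namespace QFan
namespace Cmd

variable {Out : Type} {n B : ℕ} {s : ℕ → ℕ} {r t u : ℕ}

/-- Add register `r` to register `t`, by means of register `u`. -/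
def copy (r t u : ℕ) : Cmd Out := seq (loop r (seq (dec r) (seq (inc t) (inc u)))) (move u r)

theorem runs_copy (hrt : r ≠ t) (hru : r ≠ u) (htu : t ≠ u) (hs : ∀ r, s r ≤ B) (ht : s t = 0)
    (hu : s u = 0) : Runs (Out := Out) n B (copy r t u) s (Function.update s t (s r)) [] := by
  set S : ℕ → ℕ → ℕ := fun m => Function.update (Function.update (Function.update s t m) u m) r (s r - m)
    with hS
  have hle : ∀ m q, m ≤ s r → S m q ≤ B := by
    intro m q hm
    have := hs r
    simp only [hS, Function.update_apply]
    split_ifs with h1 h2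
    · omega
    · omega
    · omega
    · exact hs q
  have h1 := runs_loop (Out := Out) (n := n) (B := B) (c := seq (dec r) (seq (inc t) (inc u))) (r := r)
    S (fun _ => []) (s r) (fun t q h => hle t q h) (by
      intro m hm
      have := hs r
      refine ⟨by simp [hS]; omega, ?_⟩
      have h1 := runs_dec (Out := Out) (n := n) (r := r) (fun q => hle m q hm.le)
      have h2 := runs_inc (Out := Out) (n := n) (r := t) (fun q => h1.le q) (by
        simp only [hS, Function.update_apply, if_neg hrt.symm, if_neg htu, if_true]; omega)
      have h3 := runs_inc (Out := Out) (n := n) (r := u) (fun q => h2.le q) (by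
        simp only [hS, Function.update_apply, if_neg hru.symm, if_neg htu.symm, if_true]; omega)
      convert h1.seq_nil (fun q => hle m q hm.le) (h2.seq_nil (fun q => h1.le q) h3) using 1
      funext q
      simp only [hS, Function.update_apply]
      split_ifs <;> simp_all <;> omega) (by simp [hS])
  have h0 : S 0 = s := by
    funext q
    simp only [hS, Function.update_apply]
    split_ifs <;> simp_all
  have h2 := runs_move (Out := Out) (n := n) (r := u) (t := r) hru.symm (fun q => hle (s r) q le_rfl) (by
    simp only [hS, Function.update_apply, if_neg hru.symm, if_true, if_neg hru]
    have := hs r; omega)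
  rw [h0, flatMap_nil] at h1
  rw [copy]
  convert h1.seq_nil hs h2 using 1
  funext q
  simp only [hS, Function.update_apply]
  split_ifs <;> simp_all

theorem exists_index (κ : Type) [Finite κ] (b : ℕ) :
    ∃ (e : κ → ℕ) (m : ℕ), Function.Injective e ∧ ∀ k, b ≤ e k ∧ e k < b + m :=
  ⟨fun k => b + (Finite.equivFin κ k).val, Nat.card κ,
    fun k k' h => (Finite.equivFin κ).injective (Fin.ext (by simpa using h)), fun k => ⟨by simp, by simp⟩⟩

theorem computes_proj {ι : Type} (i : ι) : Computes Out fun v : ι → ℕ => v i := by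
  intro ins o b hi ho hio
  refine ⟨copy (ins i) o b, 1, fun n N s hs h0 hb => ?_⟩
  refine runs_copy (hio i) (hi i).ne ho.ne (fun r => (hs r).trans (le_pow_bound N 0)) h0
    (hb b le_rfl)

theorem computes_comp {ι κ : Type} [Finite κ] {f : (κ → ℕ) → ℕ} {g : κ → (ι → ℕ) → ℕ}
    (hf : Computes Out f) (hg : ∀ k, Computes Out (g k)) :
    Computes Out fun v => f fun k => g k v := by
  intro ins o b hi ho hio
  obtain ⟨e, m, he, heb⟩ := exists_index κ b
  obtain ⟨cg, dg, hcg⟩ := computes_all hg ins e (b + m) (fun i => by have := hi i; omega)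
    (fun k => (heb k).2) he (fun i k => ((hi i).trans_le (heb k).1).ne)
  obtain ⟨cf, df, hcf⟩ := hf e o (b + m) (fun k => (heb k).2) (by omega)
    (fun k => (ho.trans_le (heb k).1).ne')
  refine ⟨seq cg (seq cf (all (b + m) ((elems κ).map fun k => clear (e k)))), dg + 1 + (dg + 2) * df,
    fun n N s hs h0 hb => ?_⟩
  obtain ⟨s1, hr1, h1, h1'⟩ := hcg n N s hs (fun k => hb _ (heb k).1) fun r hr => hb r (by omega)
  have hr2 := hcf n _ s1 hr1.le (by rw [h1' o fun k => (ho.trans_le (heb k).1).ne', h0])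
    fun r hr => by rw [h1' r fun k => ((heb k).2.trans_le hr).ne, hb r (by omega)]
  have hr1' := hr1.mono (pow_le_pow_bound N (show dg ≤ dg + 1 + (dg + 2) * df by omega))
  have hr2' := hr2.mono ((pow_bound N dg df).trans
    (pow_le_pow_bound N (show (dg + 2) * df ≤ dg + 1 + (dg + 2) * df by omega)))
  obtain ⟨s3, hr3, h3, h3'⟩ := runs_clear_all (n := n) (Out := Out) (z := b + m) e hr2'.le (by
    rw [Function.update_of_ne (by omega), h1' _ fun k => (heb k).2.ne, hb _ (by omega)])
  have hs' : ∀ r, s r ≤ (N + 2) ^ (dg + 1 + (dg + 2) * df) := fun r =>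
    (hs r).trans ((le_pow_bound N 0).trans (pow_le_pow_bound N (by omega)))
  convert hr1'.seq_nil hs' (hr2'.seq_nil hr1'.le hr3) using 1
  funext r
  by_cases hro : r = o
  · subst hro
    rw [h3' _ fun k => (ho.trans_le (heb k).1).ne', Function.update_self, Function.update_self]
    exact congrArg f (funext fun k => (h1 k).symm)
  · rw [Function.update_of_ne hro]
    by_cases hrk : ∃ k, e k = r
    · obtain ⟨k, rfl⟩ := hrk
      rw [h3, hb _ (heb k).1]
    · push Not at hrk
      rw [h3' r hrk, Function.update_of_ne hro, h1' r hrk]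

theorem computes_iter {ι κ : Type} [Finite κ] {a : κ → (ι → ℕ) → ℕ} {h : κ → (κ → ℕ) → ℕ}
    {m : (ι → ℕ) → ℕ} (ha : ∀ k, Computes Out (a k)) (hh : ∀ k, Computes Out (h k))
    (hm : Computes Out m)
    (hbd : ∃ d, ∀ v N, (∀ i, v i ≤ N) → ∀ t ≤ m v, ∀ k,
        ((fun u j => h j u)^[t] fun j => a j v) k ≤ (N + 2) ^ d) (k0 : κ) :
    Computes Out fun v => ((fun u j => h j u)^[m v] fun j => a j v) k0 := by
  intro ins o b hi ho hio
  obtain ⟨e, M, he, heb⟩ := exists_index κ b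
  obtain ⟨e', M', he', heb'⟩ := exists_index κ (b + M)
  set z := b + M + M' + 1 with hz
  set q := b + M + M' with hq
  obtain ⟨d0, hbd⟩ := hbd
  obtain ⟨ca, da, hca⟩ := computes_all ha ins e z (fun i => by have := hi i; omega)
    (fun k => by have := heb k; omega) he (fun i k => ((hi i).trans_le (heb k).1).ne)
  obtain ⟨ch, dh, hch⟩ := computes_all hh e e' z (fun k => by have := heb k; omega)
    (fun k => by have := heb' k; omega) he' (fun i k => by have := heb i; have := heb' k; omega)
  obtain ⟨cm, dm, hcm⟩ := hm ins q z (fun i => by have := hi i; omega) (by omega)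
    (fun i => by have := hi i; omega)
  set D1 := d0 + dm + 1 with hD1
  set D := da + D1 + (D1 + 2) * (dh + 1) with hD
  refine ⟨seq cm (seq ca (seq (loop q (seq (dec q) (seq ch
    (seq (all z ((elems κ).map fun k => clear (e k)))
      (all z ((elems κ).map fun k => move (e' k) (e k)))))))
      (seq (move (e k0) o) (all z ((elems κ).map fun k => clear (e k)))))), D + (D1 + 2) * (da + 1),
    fun n N s hs h0 hb => ?_⟩
  set B := (N + 2) ^ (D + (D1 + 2) * (da + 1)) with hB
  set v := s ∘ ins with hv
  set V : ℕ → κ → ℕ := fun t => (fun u j => h j u)^[t] fun j => a j v with hV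
  have hVs : ∀ t j, V (t + 1) j = h j (V t) := fun t j => by
    simp only [hV, Function.iterate_succ_apply']
  have hN1 : N ≤ (N + 2) ^ D1 := le_pow_bound N _
  have hB1 : (N + 2) ^ D1 ≤ B := pow_le_pow_bound N (by omega)
  have hVle : ∀ t ≤ m v, ∀ j, V t j ≤ (N + 2) ^ D1 := fun t ht j =>
    (hbd v N (fun i => hs _) t ht j).trans (pow_le_pow_bound N (by omega))
  -- the counter
  have hr1 := (hcm n N s hs (hb _ (by omega)) (fun r hr => hb r (by omega))).mono
    (pow_le_pow_bound N (show dm ≤ D1 by omega))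
  have hmv : m v ≤ (N + 2) ^ D1 := by
    have := hr1.le q
    rwa [Function.update_self] at this
  set s1 := Function.update s q (m v) with hs1
  have hs1i : s1 ∘ ins = v := by
    funext i
    have := hi i
    simp only [hs1, hv, Function.comp]
    rw [Function.update_of_ne (by omega)]
  -- the initial values
  obtain ⟨s2, hr2, h2, h2'⟩ := hca n _ s1 hr1.le
    (fun k => by
      have := heb k
      rw [hs1, Function.update_of_ne (by omega), hb _ (by omega)])
    (fun r hr => by rw [hs1, Function.update_of_ne (by omega), hb _ (by omega)])
  have hr2' : Runs n B ca s1 s2 [] := hr2.mono ((pow_bound N D1 da).trans (pow_le_pow_bound N (by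
    have : (D1 + 2) * da ≤ (D1 + 2) * (da + 1) := Nat.mul_le_mul_left _ (by omega)
    omega)))
  -- the loop
  set S : ℕ → ℕ → ℕ := fun t => Function.update (Function.extend e (V t) s) q (m v - t) with hS
  have hSe : ∀ t k, S t (e k) = V t k := by
    intro t k
    have := heb k
    simp only [hS]
    rw [Function.update_of_ne (by omega), he.extend_apply]
  have hSo : ∀ t r, (∀ k, e k ≠ r) → r ≠ q → S t r = s r := by
    intro t r hr hr'
    simp only [hS]
    rw [Function.update_of_ne hr', Function.extend_apply' _ _ _ (by push Not; exact hr)]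
  have hSq : ∀ t, S t q = m v - t := fun t => by simp [hS]
  have hSle : ∀ t ≤ m v, ∀ r, S t r ≤ (N + 2) ^ D1 := by
    intro t ht r
    by_cases hrq : r = q
    · rw [hrq, hSq]; omega
    · by_cases hrk : ∃ k, e k = r
      · obtain ⟨k, rfl⟩ := hrk
        rw [hSe]
        exact hVle t ht k
      · push Not at hrk
        rw [hSo t r hrk hrq]
        exact (hs r).trans hN1
  have hSz : ∀ t, ∀ r ≥ z, S t r = 0 := fun t r hr => by
    rw [hSo t r (fun k => by have := heb k; omega) (by omega), hb r (by omega)]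
  have hs2 : s2 = S 0 := by
    funext r
    by_cases hrk : ∃ k, e k = r
    · obtain ⟨k, rfl⟩ := hrk
      rw [hSe, h2, hs1i]
      rfl
    · push Not at hrk
      rw [h2' r hrk]
      by_cases hrq : r = q
      · rw [hrq, hSq, hs1]; simp
      · rw [hSo 0 r hrk hrq, hs1, Function.update_of_ne hrq]
  have hbody : ∀ t < m v, S t q ≠ 0 ∧ Runs n B (seq (dec q) (seq ch
      (seq (all z ((elems κ).map fun k => clear (e k)))
        (all z ((elems κ).map fun k => move (e' k) (e k)))))) (S t) (S (t + 1)) [] := by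
    intro t ht
    refine ⟨by rw [hSq]; omega, ?_⟩
    have g1 := runs_dec (Out := Out) (n := n) (r := q) (hSle t ht.le)
    set u1 := Function.update (S t) q (S t q - 1) with hu1
    have hu1e : ∀ k, u1 (e k) = V t k := fun k => by
      have := heb k
      rw [hu1, Function.update_of_ne (by omega), hSe]
    have hu1o : ∀ r, (∀ k, e k ≠ r) → r ≠ q → u1 r = s r := fun r hr hr' => by
      rw [hu1, Function.update_of_ne hr', hSo t r hr hr']
    obtain ⟨u2, g2, k2, k2'⟩ := hch n _ u1 g1.le (fun k => by
      have := heb' k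
      rw [hu1o _ (fun k => by have := heb k; omega) (by omega), hb _ (by omega)])
      (fun r hr => by rw [hu1o _ (fun k => by have := heb k; omega) (by omega), hb _ (by omega)])
    have g2' : Runs n B ch u1 u2 [] := g2.mono ((pow_bound N D1 dh).trans (pow_le_pow_bound N (by
      have : (D1 + 2) * dh ≤ (D1 + 2) * (dh + 1) := Nat.mul_le_mul_left _ (by omega)
      omega)))
    have hez : ∀ k, e k ≠ z := fun k => by have := heb k; omega
    have hez' : ∀ k, e' k ≠ z := fun k => by have := heb' k; omega
    have hee : ∀ k k', e' k ≠ e k' := fun k k' => by have := heb k'; have := heb' k; omega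
    have hu2z : u2 z = 0 := by
      rw [k2' _ hez', hu1o _ hez (by omega), hb _ (by omega)]
    obtain ⟨u3, g3, k3, k3'⟩ := runs_clear_all (n := n) (Out := Out) (z := z) e g2'.le hu2z
    obtain ⟨u4, g4, k4, k4', k4''⟩ := runs_move_all (n := n) (Out := Out) (z := z) e' e he' he
      hee g3.le (by rw [k3' _ hez, hu2z]) hez' hez k3
    have hu4 : u4 = S (t + 1) := by
      funext r
      by_cases hrk : ∃ k, e k = r
      · obtain ⟨k, rfl⟩ := hrk
        rw [hSe, k4, k3' _ (fun k' => (hee k k').symm), k2, hVs]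
        exact congrArg (h k) (funext hu1e)
      · push Not at hrk
        by_cases hrk' : ∃ k, e' k = r
        · obtain ⟨k, rfl⟩ := hrk'
          have := heb' k
          rw [k4', hSo _ _ hrk (by omega), hb _ (by omega)]
        · push Not at hrk'
          rw [k4'' r hrk' hrk, k3' r hrk, k2' r hrk']
          by_cases hrq : r = q
          · rw [hrq, hSq, hu1, Function.update_self, hSq]; omega
          · rw [hu1o r hrk hrq, hSo _ r hrk hrq]
    rw [← hu4]
    exact (g1.mono hB1).seq_nil (fun r => (hSle t ht.le r).trans hB1)
      (g2'.seq_nil (fun r => (g1.le r).trans hB1) (g3.seq_nil g2'.le g4))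
  have hr3 := runs_loop S (fun _ => []) (m v) (fun t r ht => (hSle t ht r).trans hB1)
    hbody (by rw [hSq]; omega)
  rw [flatMap_nil, ← hs2] at hr3
  have hSo0 : S (m v) o = 0 := by
    rw [hSo _ o (fun k => by have := heb k; omega) (by omega), h0]
  have hr4 := runs_move (Out := Out) (n := n) (r := e k0) (t := o)
    (by have := heb k0; omega) hr3.le (by rw [hSo0, zero_add]; exact hr3.le _)
  obtain ⟨s5, hr5, h5, h5'⟩ := runs_clear_all (n := n) (Out := Out) (z := z) e hr4.le (by
    have := heb k0
    rw [Function.update_of_ne (by omega), Function.update_of_ne (by omega), hSz _ _ le_rfl])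
  convert (hr1.mono hB1).seq_nil (fun r => (hs r).trans (hN1.trans hB1))
    (hr2'.seq_nil (fun r => (hr1.le r).trans hB1)
      (hr3.seq_nil hr2'.le (hr4.seq_nil hr3.le hr5))) using 1
  funext r
  by_cases hrk : ∃ k, e k = r
  · obtain ⟨k, rfl⟩ := hrk
    have := heb k
    rw [h5, Function.update_of_ne (by omega), hb _ (by omega)]
  · push Not at hrk
    rw [h5' r hrk, Function.update_of_ne (hrk k0).symm]
    by_cases hro : r = o
    · rw [hro, Function.update_self, Function.update_self, hSo0, zero_add, hSe]
    · rw [Function.update_of_ne hro, Function.update_of_ne hro]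
      by_cases hrq : r = q
      · rw [hrq, hSq, hb _ (by omega)]; omega
      · rw [hSo _ r hrk hrq]

end Cmd

open Cmd in
theorem LFV.computes {Out ι : Type} {f : (ι → ℕ) → ℕ} (h : LFV f) : Computes Out f := by
  induction h with
  | zero =>
    intro ins o b hi ho hio
    refine ⟨dec o, 1, fun n N s hs h0 hb => ?_⟩
    have := runs_dec (Out := Out) (n := n) (r := o) (B := (N + 2) ^ 1)
      fun r => (hs r).trans (le_pow_bound N 0)
    rwa [h0] at this
  | succ i =>
    intro ins o b hi ho hio
    refine ⟨seq (copy (ins i) o b) (inc o), 1, fun n N s hs h0 hb => ?_⟩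
    have hs' : ∀ r, s r ≤ (N + 2) ^ 1 := fun r => (hs r).trans (le_pow_bound N 0)
    have h1 := runs_copy (Out := Out) (n := n) (hio i) (hi i).ne ho.ne hs' h0 (hb b le_rfl)
    have h2 := runs_inc (Out := Out) (n := n) (r := o) h1.le (by
      have := hs (ins i)
      rw [Function.update_self, pow_one]; omega)
    simpa using h1.seq_nil hs' h2
  | proj i => exact computes_proj i
  | comp _ _ hf hg => exact computes_comp hf hg
  | iter _ _ _ hbd k ha hh hm => exact computes_iter ha hh hm hbd k

/-- Values of functions in the class are polynomially bounded. -/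
theorem LFV.bounded {ι : Type} [Finite ι] {f : (ι → ℕ) → ℕ} (h : LFV f) :
    ∃ d, ∀ v N, (∀ i, v i ≤ N) → f v ≤ (N + 2) ^ d := by
  obtain ⟨e, m, he, heb⟩ := Cmd.exists_index ι 1
  obtain ⟨c, d, hc⟩ := h.computes (Out := Unit) e 0 (1 + m) (fun i => (heb i).2) (by omega)
    (fun i => by have := heb i; omega)
  refine ⟨d, fun v N hv => ?_⟩
  have := (hc 0 N (Function.extend e v fun _ => 0) (fun r => ?_) ?_ ?_).le 0
  · rw [Function.update_self] at this
    convert this using 2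
    funext i
    exact (he.extend_apply v _ i).symm
  · by_cases hr : ∃ i, e i = r
    · obtain ⟨i, rfl⟩ := hr
      rw [he.extend_apply]; exact hv i
    · rw [Function.extend_apply' _ _ _ hr]; omega
  · rw [Function.extend_apply' _ _ _ (by rintro ⟨i, hi⟩; have := heb i; omega)]
  · intro r hr
    rw [Function.extend_apply' _ _ _ (by rintro ⟨i, hi⟩; have := heb i; omega)]

end QFan

namespace QFan

theorem LFV.const {ι : Type} (k : ℕ) : LFV fun _ : ι → ℕ => k := by
  induction k with
  | zero => exact .zero
  | succ k ih => exact .comp (f := fun v : Unit → ℕ => v () + 1) (g := fun _ _ => k) (.succ ()) fun _ => ih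

theorem LFV.sign : LFV fun v : Unit → ℕ => if v () = 0 then 0 else 1 := by
  have h := LFV.iter (ι := Unit) (κ := Unit) (a := fun _ _ => 0) (h := fun _ _ => 1) (m := fun v => v ())
    (fun _ => .zero) (fun _ => .const 1) (.proj ()) ⟨1, by
      intro v N _ t _ k
      rcases t with _ | t
      · simp
      · rw [Function.iterate_succ_apply']; exact Nat.one_le_pow _ _ (by omega)⟩ ()
  convert h using 2 with v
  rcases v () with _ | t
  · simp
  · rw [Function.iterate_succ_apply']; simp

/-- Types whose elements are tuples of numbers. -/
class Ctx (Γ : Type) where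
  idx : Type
  fin : Finite idx
  get : Γ → idx → ℕ
  put : (idx → ℕ) → Γ
  put_get : ∀ x, put (get x) = x
  get_put : ∀ i, LFV fun v => get (put v) i
  get_put_le : ∀ v N, (∀ i, v i ≤ N) → ∀ i, get (put v) i ≤ N + 1

attribute [instance] Ctx.fin
attribute [simp] Ctx.put_get

open Ctx

instance : Ctx ℕ where
  idx := Unit
  fin := inferInstance
  get x _ := x
  put v := v ()
  put_get _ := rfl
  get_put i := .proj i
  get_put_le _ N h _ := (h ()).trans (Nat.le_succ N)

instance (m : ℕ) : Ctx (Fin m → ℕ) where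
  idx := Fin m
  fin := inferInstance
  get x := x
  put v := v
  put_get _ := rfl
  get_put i := .proj i
  get_put_le _ N h i := (h i).trans (Nat.le_succ N)

instance : Ctx Bool where
  idx := Unit
  fin := inferInstance
  get x _ := if x then 1 else 0
  put v := decide (v () ≠ 0)
  put_get x := by cases x <;> rfl
  get_put i := by
    convert LFV.sign using 2 with v
    by_cases h : v () = 0 <;> simp [h]
  get_put_le v N h i := by
    by_cases h : v () = 0 <;> simp [h]

instance {Γ Δ : Type} [Ctx Γ] [Ctx Δ] : Ctx (Γ × Δ) where
  idx := idx Γ ⊕ idx Δ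
  fin := inferInstance
  get x := Sum.elim (get x.1) (get x.2)
  put v := (put fun i => v (.inl i), put fun i => v (.inr i))
  put_get x := by simp
  get_put i := by
    rcases i with i | i
    · exact .comp (get_put i) fun j => .proj (Sum.inl j)
    · exact .comp (get_put i) fun j => .proj (Sum.inr j)
  get_put_le v N h i := by
    rcases i with i | i
    · exact get_put_le _ N (fun j => h _) i
    · exact get_put_le _ N (fun j => h _) i

variable {Γ Δ Θ : Type} [Ctx Γ] [Ctx Δ] [Ctx Θ]

/-- Functions between tuples of numbers that are computable with polynomially bounded registers. -/
@[fun_prop]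
def LF (f : Γ → Δ) : Prop := ∀ i, LFV fun v => get (f (put v)) i

namespace LF

@[fun_prop]
theorem id : LF fun x : Γ => x := fun i => get_put i

@[fun_prop]
theorem comp {g : Δ → Θ} {f : Γ → Δ} (hg : LF g) (hf : LF f) : LF fun x => g (f x) := by
  intro i
  have := LFV.comp (hg i) hf
  simpa using this

@[fun_prop]
theorem const (y : Δ) : LF fun _ : Γ => y := fun _ => .const _

@[fun_prop]
theorem fst : LF (Prod.fst : Γ × Δ → Γ) := by
  intro i
  exact LFV.comp (get_put i) fun j => .proj (Sum.inl j)

@[fun_prop]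
theorem snd : LF (Prod.snd : Γ × Δ → Δ) := by
  intro i
  exact LFV.comp (get_put i) fun j => .proj (Sum.inr j)

@[fun_prop]
theorem prodMk {f : Γ → Δ} {g : Γ → Θ} (hf : LF f) (hg : LF g) : LF fun x => (f x, g x) := by
  rintro (i | i)
  · exact hf i
  · exact hg i

theorem succ : LF Nat.succ := fun i => .succ i

theorem pi {m : ℕ} {f : Γ → Fin m → ℕ} (hf : ∀ i, LF fun x => f x i) : LF f := fun i => hf i ()

theorem proj {m : ℕ} (i : Fin m) : LF fun v : Fin m → ℕ => v i := fun _ => .proj i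

/-- Polynomially bounded functions. -/
def _root_.QFan.Bdd (f : Γ → ℕ) : Prop := ∃ d, ∀ x N, (∀ i, get x i ≤ N) → f x ≤ (N + 2) ^ d

theorem bdd {f : Γ → ℕ} (hf : LF f) : Bdd f := by
  obtain ⟨d, hd⟩ := (hf ()).bounded
  exact ⟨d, fun x N h => by have := hd (Ctx.get x) N h; rwa [put_get] at this⟩

theorem iterate {a : Γ → Δ} {h : Γ → Δ → Δ} {m B : Γ → ℕ} (ha : LF a)
    (hh : LF fun p : Γ × Δ => h p.1 p.2) (hm : LF m) (hB : Bdd B)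
    (hle : ∀ x, ∀ t ≤ m x, ∀ i, get ((h x)^[t] (a x)) i ≤ B x) :
    LF fun x => (h x)^[m x] (a x) := by
  obtain ⟨d, hd⟩ := hB
  have key : ∀ x t, (fun p : Γ × Δ => (p.1, h p.1 p.2))^[t] (x, a x) = (x, (h x)^[t] (a x)) := by
    intro x t
    induction t with
    | zero => rfl
    | succ t ih => rw [Function.iterate_succ_apply', ih, Function.iterate_succ_apply']
  have hst : ∀ (v : idx Γ → ℕ) t, (fun u j => get (((put u : Γ × Δ).1, h (put u : Γ × Δ).1 (put u : Γ × Δ).2)) j)^[t]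
      (fun j => get ((put v : Γ), a (put v)) j) = get ((put v : Γ), (h (put v))^[t] (a (put v))) := by
    intro v t
    induction t with
    | zero => rfl
    | succ t ih =>
      rw [Function.iterate_succ_apply', ih, Function.iterate_succ_apply']
      simp
  have hstep : LF fun p : Γ × Δ => (p.1, h p.1 p.2) := by fun_prop
  have hinit : LF fun x : Γ => (x, a x) := by fun_prop
  intro i
  have := LFV.iter hinit hstep (hm ()) ⟨2 * (d + 1), by
    intro v N hv t ht k
    rw [hst]
    have hN : (N + 1 + 2) ^ (d + 1) ≤ (N + 2) ^ (2 * (d + 1)) := by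
      rw [pow_mul]; exact Nat.pow_le_pow_left (by ring_nf; omega) _
    refine le_trans ?_ hN
    rcases k with k | k
    · exact (get_put_le v N hv k).trans (Cmd.le_pow_bound (N + 1) d)
    · refine (hle _ t ht k).trans ((hd _ (N + 1) (get_put_le v N hv)).trans ?_)
      exact Nat.pow_le_pow_right (by omega) (by omega)⟩ (Sum.inr i)
  simp only [hst] at this
  exact this

end LF

end QFan

namespace QFan

open Ctx

variable {Γ Δ Θ : Type} [Ctx Γ] [Ctx Δ] [Ctx Θ]

theorem Bdd.add {f g : Γ → ℕ} (hf : Bdd f) (hg : Bdd g) : Bdd fun x => f x + g x := by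
  obtain ⟨d, hd⟩ := hf
  obtain ⟨e, he⟩ := hg
  refine ⟨d + e + 1, fun x N h => ?_⟩
  have h1 := (hd x N h).trans (Cmd.pow_le_pow_bound N (show d ≤ d + e by omega))
  have h2 := (he x N h).trans (Cmd.pow_le_pow_bound N (show e ≤ d + e by omega))
  rw [pow_succ]
  nlinarith

theorem Bdd.mul {f g : Γ → ℕ} (hf : Bdd f) (hg : Bdd g) : Bdd fun x => f x * g x := by
  obtain ⟨d, hd⟩ := hf
  obtain ⟨e, he⟩ := hg
  refine ⟨d + e, fun x N h => ?_⟩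
  rw [pow_add]
  exact Nat.mul_le_mul (hd x N h) (he x N h)

/-- A uniform bound for the values `f x i` with `i ≤ m x`. -/
theorem Bdd.sup {f : Γ → ℕ → ℕ} {m : Γ → ℕ} (hf : Bdd fun p : Γ × ℕ => f p.1 p.2) (hm : Bdd m) :
    ∃ B : Γ → ℕ, Bdd B ∧ ∀ x, ∀ i ≤ m x, f x i ≤ B x := by
  obtain ⟨d, hd⟩ := hf
  obtain ⟨e, he⟩ := hm
  refine ⟨fun x => (Finset.range (m x + 1)).sup (f x), ⟨(e + 1 + 2) * d, fun x N hx => ?_⟩,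
    fun x i hi => Finset.le_sup (f := f x) (Finset.mem_range.2 (by omega))⟩
  refine Finset.sup_le fun i hi => ?_
  refine (hd (x, i) ((N + 2) ^ (e + 1)) ?_).trans (Cmd.pow_bound N (e + 1) d)
  rintro (j | j)
  · exact (hx j).trans (Cmd.le_pow_bound N e)
  · rw [Finset.mem_range] at hi
    exact (show i ≤ m x by omega).trans ((he x N hx).trans (Cmd.pow_le_pow_bound N (by omega)))

namespace LF

@[fun_prop]
theorem add {f g : Γ → ℕ} (hf : LF f) (hg : LF g) : LF fun x => f x + g x := by
  have key : ∀ a t : ℕ, (fun y => y + 1)^[t] a = a + t := by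
    intro a t
    induction t with
    | zero => rfl
    | succ t ih => rw [Function.iterate_succ_apply', ih]; rfl
  have := iterate (h := fun _ y => y + 1) (B := fun x => f x + g x) hf
    (comp succ snd) hg (hf.bdd.add hg.bdd)
    (fun x t ht i => by
      rw [key]; exact Nat.add_le_add_left ht _)
  simpa only [key] using this

@[fun_prop]
theorem mul {f g : Γ → ℕ} (hf : LF f) (hg : LF g) : LF fun x => f x * g x := by
  have key : ∀ a t : ℕ, (fun y => y + a)^[t] 0 = a * t := by
    intro a t
    induction t with
    | zero => rfl
    | succ t ih => rw [Function.iterate_succ_apply', ih]; rfl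
  have := iterate (a := fun _ => 0) (h := fun x y => y + f x) (B := fun x => f x * g x) (const 0)
    (by fun_prop) hg (hf.bdd.mul hg.bdd)
    (fun x t ht i => by
      rw [key]; exact Nat.mul_le_mul_left _ ht)
  simpa only [key] using this

theorem pred {f : Γ → ℕ} (hf : LF f) : LF fun x => f x - 1 := by
  have key : ∀ t : ℕ, (fun y : ℕ × ℕ => (y.1 + 1, y.1))^[t] (0, 0) = (t, t - 1) := by
    intro t
    induction t with
    | zero => rfl
    | succ t ih => rw [Function.iterate_succ_apply', ih]; rfl
  have := iterate (a := fun _ => ((0, 0) : ℕ × ℕ)) (h := fun _ y => (y.1 + 1, y.1)) (B := f) (const _)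
    (by fun_prop) hf hf.bdd
    (fun x t ht i => by
      rw [key]
      rcases i with i | i
      · exact ht
      · exact (Nat.sub_le t 1).trans ht)
  simpa only [key] using comp snd this

@[fun_prop]
theorem sub {f g : Γ → ℕ} (hf : LF f) (hg : LF g) : LF fun x => f x - g x := by
  have key : ∀ a t : ℕ, (fun y => y - 1)^[t] a = a - t := by
    intro a t
    induction t with
    | zero => rfl
    | succ t ih => rw [Function.iterate_succ_apply', ih]; rfl
  have := iterate (h := fun _ y => y - 1) (B := f) hf (pred snd) hg hf.bdd
    (fun x t ht i => by
      rw [key]; exact Nat.sub_le _ _)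
  simpa only [key] using this

@[fun_prop]
theorem toNat {b : Γ → Bool} (hb : LF b) : LF fun x => (b x).toNat := by
  intro i
  have h : (fun v => Ctx.get ((b (put v)).toNat) i) = fun v => Ctx.get (b (put v)) () := by
    funext v
    cases b (put v) <;> rfl
  rw [h]
  exact hb ()

theorem cond_nat {b : Γ → Bool} {f g : Γ → ℕ} (hb : LF b) (hf : LF f) (hg : LF g) :
    LF fun x => bif b x then f x else g x := by
  have : LF fun x => (b x).toNat * f x + (1 - (b x).toNat) * g x := by fun_prop
  convert this using 2 with x
  cases b x <;> simp

@[fun_prop]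
theorem cond {b : Γ → Bool} {f g : Γ → Δ} (hb : LF b) (hf : LF f) (hg : LF g) :
    LF fun x => bif b x then f x else g x := by
  intro i
  have := cond_nat (f := fun x => Ctx.get (f x) i) (g := fun x => Ctx.get (g x) i) hb (fun _ => hf i)
    (fun _ => hg i) ()
  have h : (fun v => Ctx.get (bif b (put v) then f (put v) else g (put v)) i) = fun v =>
      Ctx.get (bif b (put v) then Ctx.get (f (put v)) i else Ctx.get (g (put v)) i) () := by
    funext v
    cases b (put v) <;> rfl
  rw [h]
  exact this

@[fun_prop]
theorem ite {p : Γ → Prop} [DecidablePred p] {f g : Γ → Δ} (hp : LF fun x => decide (p x))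
    (hf : LF f) (hg : LF g) : LF fun x => if p x then f x else g x := by
  convert cond hp hf hg using 2 with x
  by_cases h : p x <;> simp [h]

theorem ne_zero {f : Γ → ℕ} (hf : LF f) : LF fun x => decide (f x ≠ 0) := by
  refine comp (g := fun n : ℕ => decide (n ≠ 0)) (fun i => ?_) hf
  have h : (fun v : Unit → ℕ => Ctx.get (decide (v () ≠ 0)) ()) = fun v => if v () = 0 then 0 else 1 := by
    funext v
    by_cases h : v () = 0 <;> simp [Ctx.get, h]
  exact h ▸ LFV.sign

@[fun_prop]
theorem decide_lt {f g : Γ → ℕ} (hf : LF f) (hg : LF g) : LF fun x => decide (f x < g x) := by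
  convert ne_zero (hg.sub hf) using 3 with x
  simp only [ne_eq]
  omega

@[fun_prop]
theorem decide_and {p q : Γ → Prop} [DecidablePred p] [DecidablePred q] (hp : LF fun x => decide (p x))
    (hq : LF fun x => decide (q x)) : LF fun x => decide (p x ∧ q x) := by
  convert cond hp hq (const false) using 2 with x
  by_cases h : p x <;> simp [h]

@[fun_prop]
theorem decide_or {p q : Γ → Prop} [DecidablePred p] [DecidablePred q] (hp : LF fun x => decide (p x))
    (hq : LF fun x => decide (q x)) : LF fun x => decide (p x ∨ q x) := by
  convert cond hp (const true) hq using 2 with x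
  by_cases h : p x <;> simp [h]

@[fun_prop]
theorem decide_not {p : Γ → Prop} [DecidablePred p] (hp : LF fun x => decide (p x)) :
    LF fun x => decide (¬ p x) := by
  convert cond hp (const false) (const true) using 2 with x
  by_cases h : p x <;> simp [h]

@[fun_prop]
theorem decide_le {f g : Γ → ℕ} (hf : LF f) (hg : LF g) : LF fun x => decide (f x ≤ g x) := by
  convert decide_not (hg.decide_lt hf) using 3 with x
  simp

@[fun_prop]
theorem decide_eq {f g : Γ → ℕ} (hf : LF f) (hg : LF g) : LF fun x => decide (f x = g x) := by
  convert decide_and (hf.decide_le hg) (hg.decide_le hf) using 3 with x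
  omega

@[fun_prop]
theorem decide_bool {b : Γ → Bool} (hb : LF b) : LF fun x => decide (b x = true) := by
  simpa using hb

@[fun_prop]
theorem sum {f : Γ → ℕ → ℕ} {m : Γ → ℕ} (hf : LF fun p : Γ × ℕ => f p.1 p.2) (hm : LF m) :
    LF fun x => ∑ i ∈ Finset.range (m x), f x i := by
  have key : ∀ x t, (fun y : ℕ × ℕ => (y.1 + 1, y.2 + f x y.1))^[t] (0, 0) =
      (t, ∑ i ∈ Finset.range t, f x i) := by
    intro x t
    induction t with
    | zero => rfl
    | succ t ih => rw [Function.iterate_succ_apply', ih, Finset.sum_range_succ]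
  obtain ⟨B, hB, hle⟩ := hf.bdd.sup hm.bdd
  have hstep : LF fun p : Γ × (ℕ × ℕ) => f p.1 p.2.1 :=
    comp hf (f := fun p : Γ × (ℕ × ℕ) => (p.1, p.2.1)) (by fun_prop)
  have := iterate (a := fun _ => ((0, 0) : ℕ × ℕ)) (h := fun x y => (y.1 + 1, y.2 + f x y.1))
    (B := fun x => m x + m x * B x) (const _) (by fun_prop) hm (hm.bdd.add (hm.bdd.mul hB))
    (fun x t ht i => by
      rw [key]
      rcases i with i | i
      · exact ht.trans (Nat.le_add_right _ _)
      · refine le_trans ?_ (Nat.le_add_left _ _)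
        calc (∑ i ∈ Finset.range t, f x i) ≤ ∑ i ∈ Finset.range t, B x :=
              Finset.sum_le_sum fun i hi => hle x i ((Finset.mem_range.1 hi).le.trans ht)
          _ ≤ m x * B x := by simpa using Nat.mul_le_mul_right _ ht)
  simpa only [key] using comp snd this

@[fun_prop]
theorem div {f g : Γ → ℕ} (hf : LF f) (hg : LF g) : LF fun x => f x / g x := by
  have h : LF fun x => if g x = 0 then 0 else
      ∑ i ∈ Finset.range (f x), if (i + 1) * g x ≤ f x then 1 else 0 := by fun_prop
  convert h using 2 with x
  split_ifs with h0
  · simp [h0]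
  · rw [← Finset.card_filter]
    have : (Finset.range (f x)).filter (fun i => (i + 1) * g x ≤ f x) = Finset.range (f x / g x) := by
      ext i
      simp only [Finset.mem_filter, Finset.mem_range]
      rw [← Nat.le_div_iff_mul_le (Nat.pos_of_ne_zero h0)]
      have := Nat.div_le_self (f x) (g x)
      omega
    rw [this, Finset.card_range]

@[fun_prop]
theorem mod {f g : Γ → ℕ} (hf : LF f) (hg : LF g) : LF fun x => f x % g x := by
  have h : LF fun x => f x - g x * (f x / g x) := by fun_prop
  convert h using 2 with x
  have := Nat.mod_add_div (f x) (g x)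
  omega

@[fun_prop]
theorem min {f g : Γ → ℕ} (hf : LF f) (hg : LF g) : LF fun x => min (f x) (g x) := by
  have h : LF fun x => if f x ≤ g x then f x else g x := by fun_prop
  convert h using 2 with x
  split_ifs <;> omega

end LF

end QFan

namespace QFan

open Ctx

variable {Γ Δ : Type} [Ctx Γ] [Ctx Δ]

/-! ### Lists of tokens -/

/-- The tokens in the order of their codes. -/
def toks : List Tok := [.mark, .sep, .layer, .basic, .fanout, .and, .or, .threshold]

/-- The code of a token. -/
def Tok.code : Tok → ℕ
  | .mark => 0
  | .sep => 1
  | .layer => 2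
  | .basic => 3
  | .fanout => 4
  | .and => 5
  | .or => 6
  | .threshold => 7

theorem toks_code (t : Tok) : toks[t.code]? = some t := by cases t <;> rfl

/-- Functions to lists of tokens whose length and entries are computable with polynomially bounded
registers. -/
def LFL (f : Γ → List Tok) : Prop :=
  ∃ (len : Γ → ℕ) (sym : Γ → ℕ → ℕ), LF len ∧ LF (fun p : Γ × ℕ => sym p.1 p.2) ∧
    ∀ x, (f x).map Tok.code = (List.range (len x)).map (sym x)

namespace LFL

theorem nil : LFL fun _ : Γ => [] :=
  ⟨fun _ => 0, fun _ _ => 0, by fun_prop, by fun_prop, fun _ => rfl⟩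

theorem comp {f : Δ → List Tok} {g : Γ → Δ} (hf : LFL f) (hg : LF g) : LFL fun x => f (g x) := by
  obtain ⟨len, sym, h1, h2, h3⟩ := hf
  exact ⟨fun x => len (g x), fun x i => sym (g x) i, by fun_prop,
    LF.comp h2 (f := fun p : Γ × ℕ => (g p.1, p.2)) (by fun_prop), fun x => h3 _⟩

theorem singleton (t : Tok) : LFL fun _ : Γ => [t] :=
  ⟨fun _ => 1, fun _ _ => t.code, by fun_prop, by fun_prop, fun _ => rfl⟩

theorem append {f g : Γ → List Tok} (hf : LFL f) (hg : LFL g) : LFL fun x => f x ++ g x := by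
  obtain ⟨lf, sf, h1, h2, h3⟩ := hf
  obtain ⟨lg, sg, k1, k2, k3⟩ := hg
  refine ⟨fun x => lf x + lg x, fun x i => if i < lf x then sf x i else sg x (i - lf x), by fun_prop,
    ?_, fun x => ?_⟩
  · have := LF.comp k2 (f := fun p : Γ × ℕ => (p.1, p.2 - lf p.1)) (by fun_prop)
    fun_prop
  · rw [List.map_append, h3, k3, List.range_add, List.map_append, List.map_map]
    congr 1
    · exact List.map_congr_left fun i hi => by simp [List.mem_range.1 hi]
    · exact List.map_congr_left fun i hi => by simp

theorem cons (t : Tok) {f : Γ → List Tok} (hf : LFL f) : LFL fun x => t :: f x :=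
  append (singleton t) hf

theorem ite {p : Γ → Prop} [DecidablePred p] {f g : Γ → List Tok} (hp : LF fun x => decide (p x))
    (hf : LFL f) (hg : LFL g) : LFL fun x => if p x then f x else g x := by
  obtain ⟨lf, sf, h1, h2, h3⟩ := hf
  obtain ⟨lg, sg, k1, k2, k3⟩ := hg
  refine ⟨fun x => if p x then lf x else lg x, fun x i => if p x then sf x i else sg x i,
    by fun_prop, ?_, fun x => ?_⟩
  · exact LF.ite (LF.comp hp LF.fst) h2 k2
  · by_cases h : p x
    · simpa [h] using h3 x
    · simpa [h] using k3 x

/-- The block that contains position `p`, for blocks of lengths `l 0, …, l (b - 1)`. -/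
def block (l : ℕ → ℕ) (b p : ℕ) : ℕ :=
  ∑ i ∈ Finset.range b, if ∑ j ∈ Finset.range (i + 1), l j ≤ p then 1 else 0

theorem flatMap_range_eq (l : ℕ → ℕ) (s : ℕ → ℕ → ℕ) (b : ℕ) :
    ((List.range b).flatMap fun i => (List.range (l i)).map (s i)) =
      (List.range (∑ i ∈ Finset.range b, l i)).map fun p =>
        s (block l b p) (p - ∑ j ∈ Finset.range (block l b p), l j) := by
  induction b with
  | zero => rfl
  | succ b ih =>
    have hmono : ∀ i ≤ b, ∑ j ∈ Finset.range i, l j ≤ ∑ j ∈ Finset.range b, l j := fun i hi =>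
      Finset.sum_le_sum_of_subset (Finset.range_mono hi)
    rw [List.range_succ, List.flatMap_append, ih, Finset.sum_range_succ, List.range_add,
      List.map_append, List.map_map, List.flatMap_singleton]
    congr 1
    · refine List.map_congr_left fun p hp => ?_
      have h : block l (b + 1) p = block l b p := by
        rw [block, Finset.sum_range_succ, if_neg, add_zero, block]
        rw [Finset.sum_range_succ]
        have := List.mem_range.1 hp
        omega
      rw [h]
    · refine List.map_congr_left fun p hp => ?_
      have hp := List.mem_range.1 hp
      have h : block l (b + 1) ((∑ j ∈ Finset.range b, l j) + p) = b := by
        rw [block, Finset.sum_range_succ, if_neg (by rw [Finset.sum_range_succ]; omega), add_zero,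
          Finset.sum_congr rfl fun i hi => if_pos ((hmono (i + 1) (Finset.mem_range.1 hi)).trans
            (Nat.le_add_right _ _))]
        simp
      simp only [Function.comp_apply, h, Nat.add_sub_cancel_left]

theorem flatMap {f : Γ → ℕ → List Tok} {b : Γ → ℕ} (hf : LFL fun p : Γ × ℕ => f p.1 p.2)
    (hb : LF b) : LFL fun x => (List.range (b x)).flatMap (f x) := by
  obtain ⟨l, s, h1, h2, h3⟩ := hf
  have hbl : LF fun p : Γ × ℕ => block (fun i => l (p.1, i)) (b p.1) p.2 := by
    unfold block
    have h4 : LF fun q : ((Γ × ℕ) × ℕ) × ℕ => l (q.1.1.1, q.2) := by fun_prop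
    fun_prop
  refine ⟨fun x => ∑ i ∈ Finset.range (b x), l (x, i),
    fun x p => s (x, block (fun i => l (x, i)) (b x) p)
      (p - ∑ j ∈ Finset.range (block (fun i => l (x, i)) (b x) p), l (x, j)), ?_, ?_, fun x => ?_⟩
  · fun_prop
  · refine LF.comp h2 (f := fun p : Γ × ℕ => ((p.1, block (fun i => l (p.1, i)) (b p.1) p.2),
      p.2 - ∑ j ∈ Finset.range (block (fun i => l (p.1, i)) (b p.1) p.2), l (p.1, j))) ?_
    fun_prop
  · rw [List.map_flatMap, ← flatMap_range_eq (fun i => l (x, i)) (fun i => s (x, i))]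
    simp only [← h3 (x, _)]

theorem replicate {m : Γ → ℕ} (hm : LF m) (t : Tok) : LFL fun x => List.replicate (m x) t := by
  have h : ∀ k, List.replicate k t = (List.range k).flatMap fun _ => [t] := by
    intro k
    induction k with
    | zero => rfl
    | succ k ih => rw [List.replicate_succ', List.range_succ, List.flatMap_append, ← ih]; rfl
  simp only [h]
  exact flatMap (singleton t) hm

theorem encodeNat {v : Γ → ℕ} (hv : LF v) : LFL fun x => encodeNat (v x) :=
  append (replicate hv _) (singleton _)

theorem length {f : Γ → List Tok} (hf : LFL f) : LF fun x => (f x).length := by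
  obtain ⟨l, s, h1, h2, h3⟩ := hf
  convert h1 using 2 with x
  simpa using congrArg List.length (h3 x)

end LFL

namespace Cmd

variable {Out : Type} {n B : ℕ}

/-- Output the entry of the list `l` whose number is in register `r`. -/
def select (r : ℕ) : List Out → Cmd Out
  | [] => dec r
  | a :: l => ite r (emit a) (seq (dec r) (select r l))

theorem runs_select (r : ℕ) (a : Out) : ∀ (l : List Out) (s : ℕ → ℕ), (∀ q, s q ≤ B) →
    l[s r]? = some a → Runs n B (select r l) s (Function.update s r 0) [a] := by
  intro l
  induction l with
  | nil => intro s _ h; simp at h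
  | cons b l ih =>
    intro s hs h
    by_cases h0 : s r = 0
    · rw [h0] at h
      obtain rfl : b = a := by simpa using h
      have := runs_ite_zero (d := seq (dec r) (select r l)) hs h0 (runs_emit (n := n) hs b)
      rwa [← h0, Function.update_eq_self]
    · obtain ⟨v, hv⟩ := Nat.exists_eq_succ_of_ne_zero h0
      have h1 := runs_dec (Out := Out) (n := n) (r := r) hs
      have h2 := ih _ h1.le (by rw [hv] at h; simpa [hv] using h)
      have := runs_ite_pos (c := emit b) hs h0 (h1.seq hs h2)
      simpa [select] using this

end Cmd

open Cmd in
/-- Lists of tokens whose length and entries are computable are log-space computable. -/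
theorem LFL.logSpace {f : ℕ → List Tok} (hf : LFL f) : LogSpace f := by
  obtain ⟨len, sym, h1, h2, h3⟩ := hf
  obtain ⟨cl, dl, hcl⟩ := (h1 ()).computes (Out := Tok) (fun _ => 0) 1 4 (by simp) (by omega) (by simp)
  obtain ⟨cs, ds, hcs⟩ := (h2 ()).computes (Out := Tok) (Sum.elim (fun _ => 0) fun _ => 2) 3 4
    (by rintro (i | i) <;> simp) (by omega) (by rintro (i | i) <;> simp)
  set D := dl + 1 with hD
  refine logSpace_of_runs (seq cl (loop 1 (seq (dec 1) (seq cs (seq (select 3 toks) (inc 2))))))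
    (D + 1 + (D + 2) * (ds + 1)) (by omega) fun n => ?_
  set B := (n + 2) ^ (D + 1 + (D + 2) * (ds + 1)) with hB
  set s : ℕ → ℕ := Function.update (fun _ => 0) 0 n with hs
  have hsn : ∀ r, s r ≤ n := by
    intro r
    by_cases hr : r = 0 <;> simp [hs, hr]
  have hs0 : ∀ r, r ≠ 0 → s r = 0 := fun r hr => by simp [hs, hr]
  have hnB : n ≤ B := (le_pow_bound n D).trans (pow_le_pow_bound n (by omega))
  have hv1 : ∀ i : idx ℕ, Ctx.get (len (put (s ∘ fun _ : idx ℕ => 0))) i = len n := by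
    intro i; simp [hs, put, Ctx.get]
  have hr1 : Runs n ((n + 2) ^ dl) cl s (Function.update s 1 (len n)) [] := by
    have := hcl n n s hsn (hs0 _ (by omega)) fun r hr => hs0 r (by omega)
    convert this using 2
    exact (hv1 ()).symm
  have hlen : len n ≤ (n + 2) ^ dl := by simpa using hr1.le 1
  set S : ℕ → ℕ → ℕ := fun t => Function.update (Function.update s 2 t) 1 (len n - t) with hS
  have hSle : ∀ t ≤ len n, ∀ r, S t r ≤ (n + 2) ^ D := by
    intro t ht r
    have h4 : (n + 2) ^ dl ≤ (n + 2) ^ D := pow_le_pow_bound n (by omega)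
    simp only [hS, Function.update_apply]
    split_ifs
    · omega
    · omega
    · exact (hsn r).trans (le_pow_bound n dl)
  have hDB : (n + 2) ^ D ≤ B := pow_le_pow_bound n (by omega)
  have hloop := runs_loop (n := n) (B := B) (r := 1)
    (c := seq (dec 1) (seq cs (seq (select 3 toks) (inc 2)))) S
    (fun t => (toks[sym n t]?).toList) (len n) (fun t r ht => (hSle t ht r).trans hDB) (by
      intro t ht
      refine ⟨by simp [hS]; omega, ?_⟩
      have g1 := runs_dec (Out := Tok) (n := n) (r := 1) (hSle t ht.le)
      set u1 := Function.update (S t) 1 (S t 1 - 1) with hu1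
      have hu : ∀ r, u1 r = if r = 1 then len n - (t + 1) else if r = 2 then t else s r := by
        intro r
        simp only [hu1, hS, Function.update_apply]
        split_ifs <;> omega
      have g2 := hcs n ((n + 2) ^ D) u1 g1.le (by rw [hu]; simp [hs0]) (fun r hr => by
        rw [hu, if_neg (by omega), if_neg (by omega), hs0 _ (by omega)])
      have hv2 : ∀ i : idx ℕ, Ctx.get ((fun p : ℕ × ℕ => sym p.1 p.2)
          (put (u1 ∘ Sum.elim (fun _ : idx ℕ => 0) fun _ : idx ℕ => 2))) i = sym n t := by
        intro i
        have h5 : u1 0 = n := by rw [hu]; simp [hs]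
        have h6 : u1 2 = t := by rw [hu]; simp
        simp [put, Ctx.get, h5, h6]
      have g2' : Runs n B cs u1 (Function.update u1 3 (sym n t)) [] := by
        rw [← hv2 ()]
        exact g2.mono ((pow_bound n D ds).trans (pow_le_pow_bound n (by
        have : (D + 2) * ds ≤ (D + 2) * (ds + 1) := Nat.mul_le_mul_left _ (by omega)
        omega)))
      obtain ⟨a, ha⟩ : ∃ a : Tok, a.code = sym n t := by
        have := congrArg (fun l => l[t]?) (h3 n)
        simp only [List.getElem?_map, List.getElem?_range ht, Option.map_some, Option.map_eq_some_iff] at this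
        obtain ⟨a, -, ha⟩ := this
        exact ⟨a, ha⟩
      have g3 := runs_select (n := n) 3 a toks _ g2'.le (by
        rw [Function.update_self, ← ha, toks_code])
      have g4 := runs_inc (Out := Tok) (n := n) (r := 2) g3.le (by
        have : u1 2 = t := by rw [hu]; simp
        simp only [Function.update_apply]
        simp only [show (2 : ℕ) ≠ 3 by omega, if_false, this]
        have := hSle (t + 1) ht 2
        simp [hS] at this
        omega)
      have ht' : (toks[sym n t]?).toList = [a] := by rw [← ha, toks_code]; rfl
      rw [ht']
      have := (g1.mono hDB).seq (fun r => (hSle t ht.le r).trans hDB)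
        (g2'.seq (fun r => (g1.le r).trans hDB) (g3.seq g2'.le g4))
      simp only [List.nil_append, List.append_nil] at this
      convert this using 1
      funext r
      have h7 := hu r
      have h8 := hu 2
      simp only [hS, Function.update_apply, h7, h8]
      split_ifs <;> first | omega | simp_all) (by simp [hS])
  refine ⟨S (len n), ?_⟩
  have hS0 : S 0 = Function.update s 1 (len n) := by
    simp only [hS]
    rw [show Function.update s 2 0 = s from by
      rw [Function.update_eq_self_iff, hs0 _ (by omega)]]
    simp
  rw [hS0] at hloop
  have := (hr1.mono (pow_le_pow_bound n (show dl ≤ D + 1 + (D + 2) * (ds + 1) by omega))).seq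
    (fun r => (hsn r).trans hnB) hloop
  convert this using 1
  have h9 : (f n).map some = (List.range (len n)).map fun t => toks[sym n t]? := by
    have := congrArg (List.map fun k => toks[k]?) (h3 n)
    simpa [List.map_map, Function.comp_def, toks_code] using this
  have h10 : ∀ l : List Tok, l = (l.map some).flatMap Option.toList := by
    intro l
    induction l with
    | nil => rfl
    | cons a l ih => simpa using ih
  rw [List.nil_append, h10 (f n), h9, List.flatMap_map]

end QFan

namespace QFan

open Ctx

variable {Γ Δ : Type}

section
variable [Ctx Γ] [Ctx Δ]

theorem LF.pow {f : Γ → ℕ} (hf : LF f) (d : ℕ) : LF fun x => f x ^ d := by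
  induction d with
  | zero => simp only [pow_zero]; fun_prop
  | succ d ih => simp only [pow_succ]; fun_prop

theorem LF.decide_forall_mem {ι : Type} {p : ι → Γ → Prop} [∀ j x, Decidable (p j x)]
    (hp : ∀ j, LF fun x => decide (p j x)) (l : List ι) : LF fun x => decide (∀ j ∈ l, p j x) := by
  induction l with
  | nil => simpa using LF.const true
  | cons a l ih =>
    have := LF.decide_and (hp a) ih
    simpa using this

theorem LF.decide_forall {ι : Type} [Finite ι] {p : ι → Γ → Prop} [∀ j x, Decidable (p j x)]
    [∀ x, Decidable (∀ j, p j x)] (hp : ∀ j, LF fun x => decide (p j x)) :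
    LF fun x => decide (∀ j, p j x) := by
  convert LF.decide_forall_mem hp (Cmd.elems ι) using 3 with x
  simp [Cmd.mem_elems]

end

/-- The value `G a x` for the first `a` in the list with `p a x`, otherwise `z x`. -/
def pick {α : Type} (p : α → Γ → Prop) [∀ a x, Decidable (p a x)] (G : α → Γ → Δ) (z : Γ → Δ) :
    List α → Γ → Δ
  | [], x => z x
  | a :: l, x => if p a x then G a x else pick p G z l x

theorem LF.pick [Ctx Γ] [Ctx Δ] {α : Type} {p : α → Γ → Prop} [∀ a x, Decidable (p a x)] {G : α → Γ → Δ} {z : Γ → Δ}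
    (hp : ∀ a, LF fun x => decide (p a x)) (hG : ∀ a, LF (G a)) (hz : LF z) (l : List α) :
    LF (pick p G z l) := by
  induction l with
  | nil => exact hz
  | cons a l ih => exact LF.ite (hp a) (hG a) ih

theorem pick_eq {α : Type} {p : α → Γ → Prop} [∀ a x, Decidable (p a x)] {G : α → Γ → Δ} {z : Γ → Δ}
    {l : List α} {x : Γ} {a : α} (ha : a ∈ l) (hpa : p a x) (huniq : ∀ b, p b x → b = a) :
    pick p G z l x = G a x := by
  induction l with
  | nil => simp at ha
  | cons b l ih =>
    by_cases hb : p b x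
    · rw [pick, if_pos hb, huniq b hb]
    · rw [pick, if_neg hb]
      exact ih (by
        rcases List.mem_cons.1 ha with rfl | h
        · exact absurd hpa hb
        · exact h)

/-- `v` has the base `b` digits `g 0, g 1, …`. -/
def HasDigits (b v : ℕ) (g : ℕ → ℕ) : Prop := ∀ j, v / b ^ j % b = g j

theorem HasDigits.push {b v s : ℕ} {g : ℕ → ℕ} (h : HasDigits b v g) (hs : s < b) :
    HasDigits b (v * b + s) fun j => if j = 0 then s else g (j - 1) := by
  rintro (_ | j)
  · simp [Nat.mod_eq_of_lt hs]
  · rw [pow_succ', ← Nat.div_div_eq_div_mul, mul_comm v, Nat.mul_add_div (by omega),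
      Nat.div_eq_of_lt hs, add_zero, h j]
    simp

theorem HasDigits.pop {b v : ℕ} {g : ℕ → ℕ} (h : HasDigits b v g) :
    HasDigits b (v / b) fun j => g (j + 1) := by
  intro j
  rw [Nat.div_div_eq_div_mul, ← pow_succ', h]

theorem HasDigits.head {b v : ℕ} {g : ℕ → ℕ} (h : HasDigits b v g) : v % b = g 0 := by
  simpa using h 0

theorem eq_zero_of_digits {b : ℕ} (hb : 2 ≤ b) : ∀ v : ℕ, (∀ j, v / b ^ j % b = 0) → v = 0 := by
  intro v
  induction v using Nat.strong_induction_on with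
  | _ v ih =>
    intro h
    by_contra hv
    have h1 : v / b = 0 := ih _ (Nat.div_lt_self (by omega) (by omega)) fun j => by
      rw [Nat.div_div_eq_div_mul, ← pow_succ', h]
    have h2 := h 0
    have := Nat.mod_add_div v b
    rw [h1] at this
    simp at h2
    omega

theorem HasDigits.lt {b v J : ℕ} {g : ℕ → ℕ} (hb : 2 ≤ b) (h : HasDigits b v g)
    (hg : ∀ j ≥ J, g j = 0) : v < b ^ J := by
  have := eq_zero_of_digits hb (v / b ^ J) fun j => by
    rw [Nat.div_div_eq_div_mul, ← pow_add, h, hg _ (by omega)]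
  rcases Nat.div_eq_zero_iff.1 this with h | h
  · exact absurd h (pow_ne_zero _ (by omega))
  · exact h

/-- A deterministic run that visits only configurations from a finite set and does not visit a
halting configuration before time `τ` is shorter than the size of the set. -/
theorem time_lt_card {Y : Type} {f : Y → Y} {y : ℕ → Y} {halt : Y → Prop} {S : Finset Y} {τ : ℕ}
    (hy : ∀ t < τ, y (t + 1) = f (y t)) (hS : ∀ t ≤ τ, y t ∈ S) (hτ : halt (y τ))
    (hn : ∀ t < τ, ¬ halt (y t)) : τ < S.card := by
  have key : ∀ t t' : ℕ, t < t' → t' ≤ τ → y t ≠ y t' := by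
    intro t t' htt ht' he
    have : ∀ s, t' + s ≤ τ → y (t + s) = y (t' + s) := by
      intro s
      induction s with
      | zero => intro _; exact he
      | succ s ih =>
        intro hs
        rw [← add_assoc, ← add_assoc, hy _ (by omega), hy _ (by omega), ih (by omega)]
    have h1 := this (τ - t') (by omega)
    rw [show t' + (τ - t') = τ by omega] at h1
    exact hn _ (by omega) (h1 ▸ hτ)
  have : (Finset.range (τ + 1)).card ≤ S.card := by
    refine Finset.card_le_card_of_injOn y (fun t ht => ?_) fun t ht t' ht' h => ?_
    · exact hS t (by simpa [Nat.lt_succ_iff] using ht)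
    · simp only [Finset.coe_range, Set.mem_Iio] at ht ht'
      rcases lt_trichotomy t t' with h1 | h1 | h1
      · exact absurd h (key t t' h1 (by omega))
      · exact h1
      · exact absurd h.symm (key t' t h1 (by omega))
  rw [Finset.card_range] at this
  omega

theorem bdd_pow_log (b k : ℕ) : Bdd fun n : ℕ => b ^ (2 * (k * (Nat.log 2 n + 1)) + 1) := by
  refine ⟨4 * k * b + b, fun n N hN => ?_⟩
  have hN : n ≤ N := hN ()
  have h1 : 2 ^ (Nat.log 2 n + 1) ≤ (N + 2) ^ 2 := by
    rcases Nat.eq_zero_or_pos n with rfl | hn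
    · simp; nlinarith
    · have := Nat.pow_log_le_self 2 hn.ne'
      rw [pow_succ]; nlinarith
  calc b ^ (2 * (k * (Nat.log 2 n + 1)) + 1)
      ≤ (2 ^ b) ^ (2 * (k * (Nat.log 2 n + 1)) + 1) := Nat.pow_le_pow_left Nat.lt_two_pow_self.le _
    _ = (2 ^ (Nat.log 2 n + 1)) ^ (2 * k * b) * 2 ^ b := by
        rw [← pow_mul, ← pow_mul, ← pow_add]; congr 1; ring
    _ ≤ ((N + 2) ^ 2) ^ (2 * k * b) * (N + 2) ^ b :=
        Nat.mul_le_mul (Nat.pow_le_pow_left h1 _) (Nat.pow_le_pow_left (by omega) _)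
    _ = (N + 2) ^ (4 * k * b + b) := by
        rw [← pow_mul, ← pow_add]; congr 1; ring

/-! ### Numerical simulation of a Turing machine -/

namespace Machine

variable {Out : Type} (M : Machine Out)

/-- What a machine sees: its state and the symbols under its heads. -/
abbrev View : Type := M.State × Fin 3 × (Fin M.tapes → M.Sym)

instance : Finite M.State := M.finState
instance : Finite M.Sym := M.finSym

/-- The numerical code of a configuration without the output: state, input head, and for each tape
the parts to the left and to the right of the head. -/
abbrev Core : Type := (ℕ × ℕ) × (Fin M.tapes → ℕ) × (Fin M.tapes → ℕ)

def symOf : Fin 3 → InSym := ![.leftEnd, .one, .rightEnd]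

def inCode (n p : ℕ) : ℕ := if p = 0 then 0 else if p ≤ n then 1 else 2

/-- Codes for the states and symbols of a machine; the blank has code zero. -/
structure Coding where
  st : M.State → ℕ
  st_inj : Function.Injective st
  stBound : ℕ
  st_lt : ∀ a, st a < stBound
  sy : M.Sym → ℕ
  sy_inj : Function.Injective sy
  base : ℕ
  two_le_base : 2 ≤ base
  sy_lt : ∀ a, sy a < base
  sy_blank : sy M.blank = 0

theorem exists_coding : Nonempty M.Coding := by
  classical
  let e := Finite.equivFin M.Sym
  have hpos : 0 < Nat.card M.Sym := Nat.card_pos_iff.2 ⟨⟨M.blank⟩, inferInstance⟩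
  let z : Fin (Nat.card M.Sym) := ⟨0, hpos⟩
  refine ⟨⟨fun a => (Finite.equivFin M.State a).val, fun a b h => ?_, Nat.card M.State,
    fun a => (Finite.equivFin M.State a).isLt, fun a => (Equiv.swap (e M.blank) z (e a)).val,
    fun a b h => ?_, Nat.card M.Sym + 1, by omega, fun a => by omega, by simp [z]⟩⟩
  · exact (Finite.equivFin M.State).injective (Fin.ext h)
  · exact e.injective ((Equiv.swap _ _).injective (Fin.ext h))

variable {M} (κ : M.Coding)

namespace Coding

/-- The configuration with code `y` presents the view `a`. -/
def Sees (n : ℕ) (a : M.View) (y : M.Core) : Prop :=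
  y.1.1 = κ.st a.1 ∧ inCode n y.1.2 = a.2.1.val ∧ ∀ j, y.2.2 j % κ.base = κ.sy (a.2.2 j)

instance (n : ℕ) (a : M.View) (y : M.Core) : Decidable (κ.Sees n a y) := by
  unfold Sees; infer_instance

/-- The code of the next configuration, when the view is `a`. -/
def next (n : ℕ) (a : M.View) (y : M.Core) : M.Core :=
  match M.trans a.1 (symOf a.2.1) a.2.2 with
  | none => y
  | some r => ((κ.st r.1, match r.2.1 with
      | .zero => y.1.2
      | .neg => y.1.2 - 1
      | .pos => Min.min (n + 1) (y.1.2 + 1)),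
    (fun j => match (r.2.2.1 j).2 with
      | .zero => y.2.1 j
      | .neg => y.2.1 j / κ.base
      | .pos => y.2.1 j * κ.base + κ.sy (r.2.2.1 j).1),
    (fun j => match (r.2.2.1 j).2 with
      | .zero => y.2.2 j / κ.base * κ.base + κ.sy (r.2.2.1 j).1
      | .neg => (y.2.2 j / κ.base * κ.base + κ.sy (r.2.2.1 j).1) * κ.base + y.2.1 j % κ.base
      | .pos => y.2.2 j / κ.base))

/-- The output when the view is `a`. -/
def emits (a : M.View) : Option Out :=
  (M.trans a.1 (symOf a.2.1) a.2.2).bind fun r => r.2.2.2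

theorem lf_sees (a : M.View) : LF fun x : ℕ × M.Core => decide (κ.Sees x.1 a x.2) := by
  unfold Sees inCode
  refine LF.decide_and (by fun_prop) (LF.decide_and (by fun_prop) (LF.decide_forall fun j => ?_))
  have := LF.comp (LF.proj j) (f := fun x : ℕ × M.Core => x.2.2.2) (by fun_prop)
  fun_prop

theorem lf_next (a : M.View) : LF fun x : ℕ × M.Core => κ.next x.1 a x.2 := by
  unfold next
  cases M.trans a.1 (symOf a.2.1) a.2.2 with
  | none => simp only; fun_prop
  | some r =>
    simp only
    have hL := fun j => LF.comp (LF.proj j) (f := fun x : ℕ × M.Core => x.2.2.1) (by fun_prop)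
    have hR := fun j => LF.comp (LF.proj j) (f := fun x : ℕ × M.Core => x.2.2.2) (by fun_prop)
    refine LF.prodMk (LF.prodMk (LF.const _) ?_) (LF.prodMk (LF.pi fun j => ?_) (LF.pi fun j => ?_))
    · cases r.2.1 <;> simp only <;> fun_prop
    · have := hL j
      cases (r.2.2.1 j).2 <;> simp only <;> fun_prop
    · have := hL j
      have := hR j
      cases (r.2.2.1 j).2 <;> simp only <;> fun_prop

/-- The next core. -/
noncomputable def stepCore (n : ℕ) (y : M.Core) : M.Core :=
  pick (fun a (x : ℕ × M.Core) => κ.Sees x.1 a x.2) (fun a x => κ.next x.1 a x.2) (fun x => x.2)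
    (Cmd.elems M.View) (n, y)

/-- Update the number of output symbols and the code of the output symbol number `i`. -/
noncomputable def stepOut (code : Out → ℕ) (n i : ℕ) (y : M.Core) (w : ℕ × ℕ) : ℕ × ℕ :=
  pick (fun a (x : (ℕ × M.Core) × ℕ × ℕ × ℕ) => κ.Sees x.1.1 a x.1.2)
    (fun a x => match emits a with
      | none => x.2.2
      | some o => (x.2.2.1 + 1, if x.2.2.1 = x.2.1 then code o else x.2.2.2))
    (fun x => x.2.2) (Cmd.elems M.View) ((n, y), i, w)

theorem lf_stepCore : LF fun x : ℕ × M.Core => κ.stepCore x.1 x.2 :=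
  LF.pick κ.lf_sees κ.lf_next LF.snd _

theorem lf_stepOut (code : Out → ℕ) :
    LF fun x : (ℕ × M.Core) × ℕ × ℕ × ℕ => κ.stepOut code x.1.1 x.2.1 x.1.2 x.2.2 := by
  refine LF.pick (fun a => LF.comp (g := fun x : ℕ × M.Core => decide (κ.Sees x.1 a x.2))
    (κ.lf_sees a) (f := Prod.fst) LF.fst) (fun a => ?_) (by fun_prop) _
  cases emits a <;> simp only <;> fun_prop

/-- `y` is the code of the configuration `c`. -/
def Rep (c : M.Cfg) (y : M.Core) : Prop :=
  y.1.1 = κ.st c.state ∧ (y.1.2 : ℤ) = c.inHead ∧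
    (∀ j, HasDigits κ.base (y.2.1 j) fun p => κ.sy (c.tape j (c.head j - 1 - p))) ∧
    ∀ j, HasDigits κ.base (y.2.2 j) fun p => κ.sy (c.tape j (c.head j + p))

theorem symOf_inCode {n p : ℕ} {q : Fin 3} (h : inCode n p = q.val) : symOf q = inSym n p := by
  unfold inCode at h
  unfold inSym
  split_ifs at h with h1 h2
  · obtain rfl : q = 0 := Fin.ext h.symm
    rw [if_pos (by omega)]; rfl
  · obtain rfl : q = 1 := Fin.ext h.symm
    rw [if_neg (by omega), if_pos (by omega)]; rfl
  · obtain rfl : q = 2 := Fin.ext h.symm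
    rw [if_neg (by omega), if_neg (by omega)]; rfl

theorem exists_view {n : ℕ} {c : M.Cfg} {y : M.Core} (h : κ.Rep c y) :
    ∃ a : M.View, κ.Sees n a y ∧ (∀ b, κ.Sees n b y → b = a) ∧
      M.trans a.1 (symOf a.2.1) a.2.2 =
        M.trans c.state (inSym n c.inHead) fun i => c.tape i (c.head i) := by
  obtain ⟨h1, h2, h3, h4⟩ := h
  have hlt : inCode n y.1.2 < 3 := by unfold inCode; split_ifs <;> omega
  have hd : ∀ j, y.2.2 j % κ.base = κ.sy (c.tape j (c.head j)) := fun j => by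
    simpa using (h4 j).head
  refine ⟨(c.state, ⟨_, hlt⟩, fun j => c.tape j (c.head j)), ⟨h1, rfl, hd⟩, ?_, ?_⟩
  · rintro ⟨b1, b2, b3⟩ ⟨k1, k2, k3⟩
    refine Prod.ext (κ.st_inj (k1.symm.trans h1)) (Prod.ext (Fin.ext k2.symm) (funext fun j => ?_))
    exact κ.sy_inj ((k3 j).symm.trans (hd j))
  · rw [← h2, symOf_inCode rfl]

theorem rep_step {n : ℕ} {c c' : M.Cfg} {y : M.Core} (h : κ.Rep c y) (hs : M.step n c = some c')
    (hp : c.inHead ≤ n + 1) : κ.Rep c' (κ.stepCore n y) := by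
  obtain ⟨a, ha, huniq, ht⟩ := κ.exists_view (n := n) h
  obtain ⟨h1, h2, h3, h4⟩ := h
  have hy : κ.stepCore n y = κ.next n a y :=
    pick_eq (x := (n, y)) (Cmd.mem_elems a) ha huniq
  rw [hy]
  simp only [step, ← ht, Option.map_eq_some_iff] at hs
  obtain ⟨r, hr, rfl⟩ := hs
  simp only [next, hr]
  refine ⟨rfl, ?_, fun j => ?_, fun j => ?_⟩
  · simp only
    cases r.2.1 <;> simp only [SignType.zero_eq_zero, SignType.neg_eq_neg_one, SignType.pos_eq_one,
      SignType.coe_zero, SignType.coe_neg_one, SignType.coe_one, Nat.cast_min, Nat.cast_add,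
      Nat.cast_one] <;> omega
  · have hL := h3 j
    have hw := κ.sy_lt (r.2.2.1 j).1
    simp only
    cases hm : (r.2.2.1 j).2 with
    | zero =>
      intro p
      rw [hL p]
      simp only [SignType.zero_eq_zero, SignType.coe_zero, add_zero]
      rw [Function.update_of_ne (by omega)]
    | neg =>
      intro p
      rw [hL.pop p]
      simp only [SignType.neg_eq_neg_one, SignType.coe_neg_one]
      rw [Function.update_of_ne (by omega)]
      congr 2; push_cast; ring
    | pos =>
      intro p
      rw [hL.push hw p]
      simp only [SignType.pos_eq_one, SignType.coe_one]
      rcases p with _ | p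
      · simp
      · rw [if_neg (by omega), Function.update_of_ne (by omega)]
        congr 2; push_cast; ring_nf
  · have hL := h3 j
    have hR := h4 j
    have hw := κ.sy_lt (r.2.2.1 j).1
    have hR' := hR.pop.push hw
    simp only
    cases hm : (r.2.2.1 j).2 with
    | zero =>
      intro p
      rw [hR' p]
      simp only [SignType.zero_eq_zero, SignType.coe_zero, add_zero]
      rcases p with _ | p
      · simp
      · rw [if_neg (by omega), Function.update_of_ne (by push_cast; omega)]
        rfl
    | neg =>
      intro p
      rw [hR'.push (Nat.mod_lt _ (by have := κ.two_le_base; omega)) p]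
      simp only [SignType.neg_eq_neg_one, SignType.coe_neg_one]
      rcases p with _ | _ | p
      · rw [if_pos rfl, hL.head, Function.update_of_ne (by push_cast; omega)]
        congr 2
      · rw [if_neg (by omega), if_pos rfl]
        simp
      · rw [if_neg (by omega), if_neg (by omega), Function.update_of_ne (by push_cast; omega)]
        congr 2; push_cast; ring
    | pos =>
      intro p
      rw [hR.pop p]
      simp only [SignType.pos_eq_one, SignType.coe_one]
      rw [Function.update_of_ne (by omega)]
      congr 2; push_cast; ring

theorem out_step (code : Out → ℕ) {n i : ℕ} {c c' : M.Cfg} {y : M.Core} (h : κ.Rep c y)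
    (hs : M.step n c = some c') :
    κ.stepOut code n i y (c.out.length, (c.out[i]?).elim 0 code) =
      (c'.out.length, (c'.out[i]?).elim 0 code) := by
  obtain ⟨a, ha, huniq, ht⟩ := κ.exists_view (n := n) h
  rw [stepOut, pick_eq (p := fun a (x : (ℕ × M.Core) × ℕ × ℕ × ℕ) => κ.Sees x.1.1 a x.1.2) (a := a)
    (Cmd.mem_elems a) ha huniq]
  simp only [step, ← ht, Option.map_eq_some_iff] at hs
  obtain ⟨r, hr, rfl⟩ := hs
  simp only [emits, hr, Option.bind_some]
  cases r.2.2.2 with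
  | none => simp
  | some o =>
    simp only [Option.toList_some, List.length_append, List.length_singleton, Prod.mk.injEq, true_and]
    rcases lt_trichotomy i c.out.length with hi | hi | hi
    · rw [List.getElem?_append_left hi, if_neg hi.ne']
    · subst hi; simp
    · rw [if_neg hi.ne, List.getElem?_eq_none hi.le,
        List.getElem?_eq_none (by rw [List.length_append]; exact hi)]

theorem stepCore_none {n : ℕ} {c : M.Cfg} {y : M.Core} (h : κ.Rep c y) (hs : M.step n c = none) :
    κ.stepCore n y = y := by
  obtain ⟨a, ha, huniq, ht⟩ := κ.exists_view (n := n) h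
  have hy : κ.stepCore n y = κ.next n a y := pick_eq (x := (n, y)) (Cmd.mem_elems a) ha huniq
  simp only [step, ← ht, Option.map_eq_none_iff] at hs
  rw [hy, next, hs]

theorem stepOut_none (code : Out → ℕ) {n i : ℕ} {c : M.Cfg} {y : M.Core} (h : κ.Rep c y)
    (hs : M.step n c = none) (w : ℕ × ℕ) : κ.stepOut code n i y w = w := by
  obtain ⟨a, ha, huniq, ht⟩ := κ.exists_view (n := n) h
  rw [stepOut, pick_eq (p := fun a (x : (ℕ × M.Core) × ℕ × ℕ × ℕ) => κ.Sees x.1.1 a x.1.2) (a := a)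
    (Cmd.mem_elems a) ha huniq]
  simp only [step, ← ht, Option.map_eq_none_iff] at hs
  simp only [emits, hs, Option.bind_none]

theorem rep_init : κ.Rep M.init ((κ.st M.start, 0), fun _ => 0, fun _ => 0) := by
  refine ⟨rfl, rfl, fun j p => ?_, fun j p => ?_⟩ <;> simp [init, κ.sy_blank]

end Coding

variable (M)

/-- The configuration at time `t`; halting configurations do not change. -/
def cfgAt (n t : ℕ) : M.Cfg := (fun c => (M.step n c).getD c)^[t] M.init

theorem cfgAt_succ (n t : ℕ) : M.cfgAt n (t + 1) = (M.step n (M.cfgAt n t)).getD (M.cfgAt n t) :=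
  Function.iterate_succ_apply' _ _ _

theorem reaches_cfgAt (n t : ℕ) : M.Reaches n (M.cfgAt n t) := by
  induction t with
  | zero => exact .refl
  | succ t ih =>
    rw [cfgAt_succ]
    cases h : M.step n (M.cfgAt n t) with
    | none => exact ih
    | some c => exact ih.tail h

theorem exists_cfgAt {n : ℕ} {c : M.Cfg} (h : M.Reaches n c) : ∃ t, M.cfgAt n t = c := by
  induction h with
  | refl => exact ⟨0, rfl⟩
  | tail _ hs ih =>
    obtain ⟨t, rfl⟩ := ih
    exact ⟨t + 1, by rw [cfgAt_succ, hs]; rfl⟩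

theorem cfgAt_of_halt {n t : ℕ} (h : M.step n (M.cfgAt n t) = none) : ∀ s ≥ t,
    M.cfgAt n s = M.cfgAt n t := by
  intro s hs
  induction s, hs using Nat.le_induction with
  | base => rfl
  | succ s _ ih => rw [cfgAt_succ, ih, h]; rfl

variable {M}

theorem cfgAt_inHead (n t : ℕ) : 0 ≤ (M.cfgAt n t).inHead ∧ (M.cfgAt n t).inHead ≤ n + 1 := by
  induction t with
  | zero => simp only [cfgAt, Function.iterate_zero, id, init]; omega
  | succ t ih =>
    rw [cfgAt_succ, step]
    cases M.trans (M.cfgAt n t).state (inSym n (M.cfgAt n t).inHead)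
      fun i => (M.cfgAt n t).tape i ((M.cfgAt n t).head i) with
    | none => exact ih
    | some r => simp only [Option.map_some, Option.getD_some]; omega

theorem cfgAt_length (n t : ℕ) : (M.cfgAt n t).out.length ≤ t := by
  induction t with
  | zero => simp [cfgAt, init]
  | succ t ih =>
    rw [cfgAt_succ, step]
    cases M.trans (M.cfgAt n t).state (inSym n (M.cfgAt n t).inHead)
      fun i => (M.cfgAt n t).tape i ((M.cfgAt n t).head i) with
    | none => exact ih.trans (Nat.le_succ t)
    | some r =>
      simp only [Option.map_some, Option.getD_some, List.length_append]
      have : r.2.2.2.toList.length ≤ 1 := by cases r.2.2.2 <;> simp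
      omega

theorem cfgAt_tape {n : ℕ} {H : ℤ} (hH : ∀ t i, |(M.cfgAt n t).head i| ≤ H) (t : ℕ) :
    ∀ i p, H < |p| → (M.cfgAt n t).tape i p = M.blank := by
  induction t with
  | zero => intro i p _; rfl
  | succ t ih =>
    rw [cfgAt_succ, step]
    cases M.trans (M.cfgAt n t).state (inSym n (M.cfgAt n t).inHead)
      fun i => (M.cfgAt n t).tape i ((M.cfgAt n t).head i) with
    | none => exact ih
    | some r =>
      intro i p hp
      simp only [Option.map_some, Option.getD_some]
      rw [Function.update_of_ne, ih i p hp]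
      rintro rfl
      exact absurd (hH t i) (by omega)

/-- The codes of the configurations in a run. -/
noncomputable def coreAt (κ : M.Coding) (n t : ℕ) : M.Core :=
  (κ.stepCore n)^[t] ((κ.st M.start, 0), fun _ => 0, fun _ => 0)

theorem coreAt_succ (κ : M.Coding) (n t : ℕ) :
    coreAt κ n (t + 1) = κ.stepCore n (coreAt κ n t) :=
  Function.iterate_succ_apply' _ _ _

theorem rep_coreAt (κ : M.Coding) (n t : ℕ) : κ.Rep (M.cfgAt n t) (coreAt κ n t) := by
  induction t with
  | zero => exact κ.rep_init
  | succ t ih =>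
    rw [cfgAt_succ, coreAt_succ]
    cases h : M.step n (M.cfgAt n t) with
    | none => rw [κ.stepCore_none ih h]; exact ih
    | some c => exact κ.rep_step ih h (cfgAt_inHead n t).2

theorem step_pair (κ : M.Coding) (code : Out → ℕ) (n i t : ℕ) :
    (fun z : M.Core × ℕ × ℕ => (κ.stepCore n z.1, κ.stepOut code n i z.1 z.2))^[t]
      (((κ.st M.start, 0), fun _ => 0, fun _ => 0), 0, 0) =
      (coreAt κ n t, (M.cfgAt n t).out.length, ((M.cfgAt n t).out[i]?).elim 0 code) := by
  induction t with
  | zero => simp [coreAt, cfgAt, init]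
  | succ t ih =>
    rw [Function.iterate_succ_apply', ih, coreAt_succ, cfgAt_succ]
    refine Prod.ext rfl ?_
    simp only
    cases h : M.step n (M.cfgAt n t) with
    | none => exact κ.stepOut_none code (rep_coreAt κ n t) h _
    | some c => exact κ.out_step code (rep_coreAt κ n t) h

theorem coreAt_lt (κ : M.Coding) {n H : ℕ} (hH : ∀ t i, |(M.cfgAt n t).head i| ≤ H) (t : ℕ) :
    (coreAt κ n t).1.1 < κ.stBound ∧ (coreAt κ n t).1.2 < n + 2 ∧
      (∀ j, (coreAt κ n t).2.1 j < κ.base ^ (2 * H + 1)) ∧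
      ∀ j, (coreAt κ n t).2.2 j < κ.base ^ (2 * H + 1) := by
  obtain ⟨h1, h2, h3, h4⟩ := rep_coreAt κ n t
  have hin := cfgAt_inHead (M := M) n t
  refine ⟨h1 ▸ κ.st_lt _, by omega, fun j => (h3 j).lt κ.two_le_base fun p hp => ?_,
    fun j => (h4 j).lt κ.two_le_base fun p hp => ?_⟩
  all_goals
    have := abs_le.1 (hH t j)
    rw [cfgAt_tape hH t, κ.sy_blank]
    rw [lt_abs]
    omega

theorem exists_halt (κ : M.Coding) {n H : ℕ} (hH : ∀ t i, |(M.cfgAt n t).head i| ≤ H) {c : M.Cfg}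
    (hc : M.Reaches n c) (hs : M.step n c = none) {s : ℕ}
    (hle : κ.stBound * (n + 2) * ((κ.base ^ (2 * H + 1)) ^ M.tapes * (κ.base ^ (2 * H + 1)) ^ M.tapes) ≤ s) :
    M.cfgAt n s = c := by
  classical
  have hex : ∃ t, M.step n (M.cfgAt n t) = none := by
    obtain ⟨t, rfl⟩ := M.exists_cfgAt hc
    exact ⟨t, hs⟩
  have hτ := Nat.find_spec hex
  have hmin := fun t (ht : t < Nat.find hex) => Nat.find_min hex ht
  set τ := Nat.find hex
  obtain ⟨t, rfl⟩ := M.exists_cfgAt hc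
  have htτ : τ ≤ t := Nat.find_min' hex hs
  rw [M.cfgAt_of_halt hτ t htτ]
  apply M.cfgAt_of_halt hτ
  let S : Finset M.Core := (Finset.range κ.stBound ×ˢ Finset.range (n + 2)) ×ˢ
    (Fintype.piFinset fun _ => Finset.range (κ.base ^ (2 * H + 1))) ×ˢ
    Fintype.piFinset fun _ => Finset.range (κ.base ^ (2 * H + 1))
  have hcard : S.card = κ.stBound * (n + 2) *
      ((κ.base ^ (2 * H + 1)) ^ M.tapes * (κ.base ^ (2 * H + 1)) ^ M.tapes) := by
    simp [S, Finset.card_product]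
  have := time_lt_card (f := κ.stepCore n) (y := coreAt κ n) (S := S) (τ := τ)
    (halt := fun y => ∃ a : M.View, κ.Sees n a y ∧ M.trans a.1 (symOf a.2.1) a.2.2 = none)
    (fun t _ => coreAt_succ κ n t)
    (fun t _ => by
      obtain ⟨h1, h2, h3, h4⟩ := coreAt_lt κ hH t
      simpa [S] using ⟨⟨h1, h2⟩, h3, h4⟩)
    (by
      obtain ⟨a, ha, -, ht⟩ := κ.exists_view (n := n) (rep_coreAt κ n τ)
      refine ⟨a, ha, ?_⟩
      rw [ht]
      simpa [step] using hτ)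
    (fun t ht => by
      rintro ⟨b, hb, hb'⟩
      obtain ⟨a, ha, hu, hta⟩ := κ.exists_view (n := n) (rep_coreAt κ n t)
      obtain rfl := hu b hb
      rw [hb'] at hta
      exact hmin t ht (by simp [step, ← hta]))
  omega

end Machine

/-- The length and the entries of a log-space computable list. -/
theorem LogSpace.lf {Out : Type} {f : ℕ → List Out} (hf : LogSpace f) (code : Out → ℕ) {W : ℕ}
    (hW : ∀ o, code o ≤ W) :
    LF fun p : ℕ × ℕ => ((f p.1).length, ((f p.1)[p.2]?).elim 0 code) := by
  obtain ⟨M, k, hM⟩ := hf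
  obtain ⟨κ⟩ := M.exists_coding
  set H : ℕ → ℕ := fun n => k * (Nat.log 2 n + 1) with hHdef
  have hH : ∀ n t i, |(M.cfgAt n t).head i| ≤ (H n : ℤ) := fun n t i => by
    have := (hM n).1 _ (M.reaches_cfgAt n t) i
    simpa [hHdef] using this
  have hb := bdd_pow_log κ.base k
  have hpow : ∀ d, Bdd fun n => (κ.base ^ (2 * H n + 1)) ^ d := by
    intro d
    induction d with
    | zero => exact ⟨0, fun x N _ => by simp⟩
    | succ d ih => simp only [pow_succ _ d]; exact ih.mul hb
  have hT : Bdd fun n : ℕ => κ.stBound * (n + 2) *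
      ((κ.base ^ (2 * H n + 1)) ^ M.tapes * (κ.base ^ (2 * H n + 1)) ^ M.tapes) :=
    (LF.bdd (by fun_prop : LF fun n : ℕ => κ.stBound * (n + 2))).mul ((hpow _).mul (hpow _))
  obtain ⟨D, hD⟩ := hT
  have hD := fun n => hD n n fun _ => le_rfl
  have hTlf : LF fun p : ℕ × ℕ => (p.1 + 2) ^ D := LF.pow (by fun_prop) D
  have key := LF.iterate (Γ := ℕ × ℕ) (Δ := M.Core × ℕ × ℕ)
    (a := fun _ => (((κ.st M.start, 0), fun _ => 0, fun _ => 0), 0, 0))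
    (h := fun p z => (κ.stepCore p.1 z.1, κ.stepOut code p.1 p.2 z.1 z.2))
    (m := fun p => (p.1 + 2) ^ D)
    (B := fun p => κ.stBound + (p.1 + 2) + κ.base ^ (2 * H p.1 + 1) + (p.1 + 2) ^ D + W)
    (LF.const _) (LF.prodMk
      (LF.comp κ.lf_stepCore (f := fun q : (ℕ × ℕ) × M.Core × ℕ × ℕ => (q.1.1, q.2.1)) (by fun_prop))
      (LF.comp (κ.lf_stepOut code)
        (f := fun q : (ℕ × ℕ) × M.Core × ℕ × ℕ => ((q.1.1, q.2.1), q.1.2, q.2.2)) (by fun_prop)))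
    hTlf ?_ ?_
  · convert LF.comp LF.snd key using 2 with p
    rw [Machine.step_pair]
    obtain ⟨c, hc, hs, hout⟩ := (hM p.1).2
    have := Machine.exists_halt κ (hH p.1) hc hs (hD p.1)
    simp only [this, hout]
  · refine Bdd.add (Bdd.add (Bdd.add ?_ ?_) hTlf.bdd) (LF.const W).bdd
    · exact (by fun_prop : LF fun p : ℕ × ℕ => κ.stBound + (p.1 + 2)).bdd
    · obtain ⟨e, he⟩ := hb
      exact ⟨e, fun x N hx => he x.1 N fun i => hx (Sum.inl i)⟩
  · intro p t ht i
    obtain ⟨h1, h2, h3, h4⟩ := Machine.coreAt_lt κ (hH p.1) t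
    have h5 := Machine.cfgAt_length (M := M) p.1 t
    have h6 : ((M.cfgAt p.1 t).out[p.2]?).elim 0 code ≤ W := by
      cases (M.cfgAt p.1 t).out[p.2]? with
      | none => exact Nat.zero_le _
      | some o => exact hW o
    rw [Machine.step_pair]
    rcases i with ((i | i) | (i | i)) | (i | i)
    · exact (show (Machine.coreAt κ p.1 t).1.1 ≤ _ by omega)
    · exact (show (Machine.coreAt κ p.1 t).1.2 ≤ _ by omega)
    · have := h3 i
      exact (show (Machine.coreAt κ p.1 t).2.1 i ≤ _ by omega)
    · have := h4 i
      exact (show (Machine.coreAt κ p.1 t).2.2 i ≤ _ by omega)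
    · exact (show (M.cfgAt p.1 t).out.length ≤ _ by omega)
    · exact (show ((M.cfgAt p.1 t).out[p.2]?).elim 0 code ≤ _ by omega)

theorem LogSpaceNat.lf {t : ℕ → ℕ} (ht : LogSpaceNat t) : LF t := by
  have := LF.comp LF.fst (LF.comp (LogSpace.lf ht (fun _ => 0) (W := 0) (by simp))
    (f := fun n : ℕ => (n, 0)) (by fun_prop))
  simpa using this

theorem Bdd.polynomial {f : ℕ → ℕ} (hf : Bdd f) : ∃ p : Polynomial ℕ, ∀ n, f n ≤ p.eval n := by
  obtain ⟨d, hd⟩ := hf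
  exact ⟨(Polynomial.X + 2) ^ d, fun n => by simpa using hd n n fun _ => le_rfl⟩

end QFan

namespace QFan

/-! ### Operators on qubits -/

variable {N : ℕ}

/-- The Hilbert space norm of a state. -/
noncomputable def nrm {N : ℕ} (ψ : Bits N → ℂ) : ℝ := ‖WithLp.toLp 2 ψ‖

theorem nrm_nonneg (ψ : Bits N → ℂ) : 0 ≤ nrm ψ := norm_nonneg _

theorem nrm_sq (ψ : Bits N → ℂ) : nrm ψ ^ 2 = ∑ b, ‖ψ b‖ ^ 2 := by
  rw [nrm, EuclideanSpace.norm_sq_eq]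

theorem nrm_add_le (ψ φ : Bits N → ℂ) : nrm (ψ + φ) ≤ nrm ψ + nrm φ := by
  rw [nrm, WithLp.toLp_add]; exact norm_add_le _ _

theorem nrm_sub_le (ψ χ φ : Bits N → ℂ) : nrm (ψ - φ) ≤ nrm (ψ - χ) + nrm (χ - φ) := by
  have := nrm_add_le (ψ - χ) (χ - φ)
  rwa [sub_add_sub_cancel] at this

theorem nrm_le_of_sq {ψ φ : Bits N → ℂ} {ε : ℝ} (hε : 0 ≤ ε) (h : ∀ b, ‖ψ b‖ ≤ ε * ‖φ b‖) :
    nrm ψ ≤ ε * nrm φ := by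
  refine le_of_sq_le_sq ?_ (mul_nonneg hε (nrm_nonneg _))
  rw [mul_pow, nrm_sq, nrm_sq, Finset.mul_sum]
  refine Finset.sum_le_sum fun b _ => ?_
  rw [← mul_pow]
  exact pow_le_pow_left₀ (norm_nonneg _) (h b) 2

theorem nrm_mulVec {X : Op N} (hX : X ∈ Matrix.unitaryGroup (Bits N) ℂ) (ψ : Bits N → ℂ) :
    nrm (X.mulVec ψ) = nrm ψ := by
  have key : ∀ φ : Bits N → ℂ, ((nrm φ ^ 2 : ℝ) : ℂ) = star φ ⬝ᵥ φ := by
    intro φ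
    rw [nrm_sq, dotProduct]
    push_cast
    refine Finset.sum_congr rfl fun b _ => ?_
    rw [Pi.star_apply, Complex.star_def, ← Complex.normSq_eq_conj_mul_self, Complex.normSq_eq_norm_sq]
    push_cast; rfl
  have h : ((nrm (X.mulVec ψ) ^ 2 : ℝ) : ℂ) = ((nrm ψ ^ 2 : ℝ) : ℂ) := by
    rw [key, key, Matrix.star_mulVec, Matrix.dotProduct_mulVec, Matrix.vecMul_vecMul,
      ← Matrix.star_eq_conjTranspose, Matrix.mem_unitaryGroup_iff'.1 hX, Matrix.vecMul_one]
  have h' : nrm (X.mulVec ψ) ^ 2 = nrm ψ ^ 2 := by exact_mod_cast h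
  exact (pow_left_inj₀ (nrm_nonneg _) (nrm_nonneg _) two_ne_zero).1 h'

/-- The state is a superposition of basis states that satisfy `R`. -/
def Supp (R : Bits N → Prop) (ψ : Bits N → ℂ) : Prop := ∀ b, ψ b ≠ 0 → R b

theorem Supp.mono {R R' : Bits N → Prop} {ψ : Bits N → ℂ} (h : Supp R ψ) (hR : ∀ b, R b → R' b) :
    Supp R' ψ := fun b hb => hR b (h b hb)

theorem classicalOp_mulVec {f : Bits N → Bits N} (hf : Function.Involutive f) (ψ : Bits N → ℂ) :
    (classicalOp f).mulVec ψ = fun b => ψ (f b) := by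
  funext b
  simp only [Matrix.mulVec, dotProduct, classicalOp, Matrix.of_apply, ite_mul, one_mul, zero_mul]
  rw [Finset.sum_eq_single (f b)]
  · rw [if_pos (hf b).symm]
  · intro a _ ha
    rw [if_neg]
    rintro rfl
    exact ha (hf a).symm
  · simp

theorem classicalOp_mul (f g : Bits N → Bits N) :
    classicalOp f * classicalOp g = classicalOp (f ∘ g) := by
  ext b a
  rw [Matrix.mul_apply, Finset.sum_eq_single (g a)]
  · simp [classicalOp]
  · intro c _ hc
    simp [classicalOp, hc]
  · simp

theorem op_ext {X Y : Op N} (h : ∀ ψ, X.mulVec ψ = Y.mulVec ψ) : X = Y :=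
  Matrix.mulVec_injective (funext h)

/-- `X` acts on the qubits in `S` only. -/
structure Local (S : Set (Fin N)) (X : Op N) : Prop where
  eq_off : ∀ b a, X b a ≠ 0 → ∀ i ∉ S, b i = a i
  congr : ∀ b a b' a', (∀ i ∈ S, b i = b' i ∧ a i = a' i) → (∀ i ∉ S, b i = a i) →
    (∀ i ∉ S, b' i = a' i) → X b a = X b' a'

open Classical in
theorem Local.mul_apply {S T : Set (Fin N)} {X Y : Op N} (hX : Local S X) (hY : Local T Y)
    (hST : Disjoint S T) (b a : Bits N) :
    (X * Y) b a = X b (S.piecewise a b) * Y (S.piecewise a b) a := by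
  rw [Matrix.mul_apply, Finset.sum_eq_single (S.piecewise a b)]
  · intro m _ hm
    by_contra h
    apply hm
    funext i
    by_cases hi : i ∈ S
    · rw [Set.piecewise_eq_of_mem _ _ _ hi]
      exact hY.eq_off _ _ (right_ne_zero_of_mul h) i (Set.disjoint_left.1 hST hi)
    · rw [Set.piecewise_eq_of_notMem _ _ _ hi]
      exact (hX.eq_off _ _ (left_ne_zero_of_mul h) i hi).symm
  · simp

open Classical in
theorem Local.commute {S T : Set (Fin N)} {X Y : Op N} (hX : Local S X) (hY : Local T Y)
    (hST : Disjoint S T) : Commute X Y := by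
  ext b a
  rw [hX.mul_apply hY hST, hY.mul_apply hX hST.symm]
  by_cases h : ∀ i, i ∉ S → i ∉ T → b i = a i
  · rw [mul_comm]
    congr 1
    · refine hY.congr _ _ _ _ (fun i hi => ?_) (fun i hi => ?_) fun i hi => ?_
      · have := Set.disjoint_right.1 hST hi
        rw [Set.piecewise_eq_of_notMem _ _ _ this, Set.piecewise_eq_of_mem _ _ _ hi]
        simp
      · by_cases hS : i ∈ S
        · rw [Set.piecewise_eq_of_mem _ _ _ hS]
        · rw [Set.piecewise_eq_of_notMem _ _ _ hS]; exact h i hS hi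
      · rw [Set.piecewise_eq_of_notMem _ _ _ hi]
    · refine hX.congr _ _ _ _ (fun i hi => ?_) (fun i hi => ?_) fun i hi => ?_
      · have := Set.disjoint_left.1 hST hi
        rw [Set.piecewise_eq_of_mem _ _ _ hi, Set.piecewise_eq_of_notMem _ _ _ this]
        simp
      · rw [Set.piecewise_eq_of_notMem _ _ _ hi]
      · by_cases hS : i ∈ T
        · rw [Set.piecewise_eq_of_mem _ _ _ hS]
        · rw [Set.piecewise_eq_of_notMem _ _ _ hS]; exact h i hi hS
  · push Not at h
    obtain ⟨i, h1, h2, h3⟩ := h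
    have e1 : Y (S.piecewise a b) a = 0 := by
      by_contra h
      apply h3
      have := hY.eq_off _ _ h i h2
      rwa [Set.piecewise_eq_of_notMem _ _ _ h1] at this
    have e2 : X (T.piecewise a b) a = 0 := by
      by_contra h
      apply h3
      have := hX.eq_off _ _ h i h1
      rwa [Set.piecewise_eq_of_notMem _ _ _ h2] at this
    rw [e1, e2, mul_zero, mul_zero]

theorem local_classicalOp {S : Set (Fin N)} {f : Bits N → Bits N} (h1 : ∀ b, ∀ i ∉ S, f b i = b i)
    (h2 : ∀ b b', (∀ i ∈ S, b i = b' i) → ∀ i ∈ S, f b i = f b' i) : Local S (classicalOp f) := by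
  refine ⟨fun b a h i hi => ?_, fun b a b' a' h hb hb' => ?_⟩
  · simp only [classicalOp, Matrix.of_apply, ne_eq, ite_eq_right_iff, one_ne_zero, imp_false,
      not_not] at h
    rw [h, h1 _ _ hi]
  · simp only [classicalOp, Matrix.of_apply]
    congr 1
    rw [eq_iff_iff]
    constructor
    · intro e
      funext i
      by_cases hi : i ∈ S
      · rw [← (h i hi).1, e, h2 a a' (fun j hj => (h j hj).2) i hi]
      · rw [hb' i hi, h1 _ _ hi]
    · intro e
      funext i
      by_cases hi : i ∈ S
      · rw [(h i hi).1, e, h2 a a' (fun j hj => (h j hj).2) i hi]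
      · rw [hb i hi, h1 _ _ hi]

theorem local_diagonal {S : Set (Fin N)} {d : Bits N → ℂ}
    (h : ∀ b b', (∀ i ∈ S, b i = b' i) → d b = d b') : Local S (Matrix.diagonal d) := by
  refine ⟨fun b a hb i _ => ?_, fun b a b' a' hS hb hb' => ?_⟩
  · by_contra hi
    exact hb (Matrix.diagonal_apply_ne _ fun e => hi (congrFun e i))
  · simp only [Matrix.diagonal_apply]
    have : b = a ↔ b' = a' := by
      constructor <;> intro e <;> funext i <;> by_cases hi : i ∈ S
      · rw [← (hS i hi).1, ← (hS i hi).2, e]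
      · exact hb' i hi
      · rw [(hS i hi).1, (hS i hi).2, e]
      · exact hb i hi
    simp only [this]
    split_ifs
    · exact h _ _ fun i hi => (hS i hi).1
    · rfl

theorem local_flipIf {S : Set (Fin N)} {y : Fin N} {g : Bits N → Bool} (hy : y ∈ S)
    (hg : ∀ b b', (∀ i ∈ S, b i = b' i) → g b = g b') : Local S (classicalOp (flipIf y g)) := by
  refine local_classicalOp (fun b i hi => ?_) fun b b' h i hi => ?_
  · rw [flipIf, Function.update_of_ne]
    rintro rfl; exact hi hy
  · by_cases h' : i = y
    · subst h'; simp [flipIf, h i hi, hg b b' h]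
    · simp [flipIf, h', h i hi]

theorem flipIf_involutive {y : Fin N} {g : Bits N → Bool}
    (hg : ∀ b v, g (Function.update b y v) = g b) : Function.Involutive (flipIf y g) := by
  intro b
  simp [flipIf, hg]

/-- The operator on `N` qubits that acts as `A` on the qubits `w 0, w 1, …`. -/
noncomputable def embed {k : ℕ} (w : Fin k → Fin N) (A : Op k) : Op N := Matrix.of fun b a =>
  open scoped Classical in if ∀ i, (∀ k, w k ≠ i) → b i = a i then A (b ∘ w) (a ∘ w) else 0

theorem embed_mul {k : ℕ} {w : Fin k → Fin N} (hw : Function.Injective w) (A A' : Op k) :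
    embed w A * embed w A' = embed w (A * A') := by
  classical
  ext b a
  rw [Matrix.mul_apply]
  simp only [embed, Matrix.of_apply]
  have hext : ∀ (u : Bits k) i, (∀ k, w k ≠ i) → Function.extend w u b i = b i := fun u i hi =>
    Function.extend_apply' _ _ _ fun ⟨j, hj⟩ => hi j hj
  have hcomp : ∀ u : Bits k, Function.extend w u b ∘ w = u := fun u => Function.extend_comp hw _ _
  split_ifs with h
  · rw [Matrix.mul_apply]
    symm
    refine Finset.sum_of_injOn (fun u => Function.extend w u b) (fun u _ u' _ e => ?_) (by simp)
      (fun m _ hm => ?_) fun u _ => ?_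
    · have := congrArg (· ∘ w) e
      simpa [hcomp] using this
    · rw [if_neg, zero_mul]
      intro hb
      apply hm
      refine ⟨m ∘ w, by simp, funext fun i => ?_⟩
      by_cases hi : ∃ j, w j = i
      · obtain ⟨j, rfl⟩ := hi
        exact hw.extend_apply _ _ _
      · push Not at hi
        exact (hext _ i hi).trans (hb i hi)
    · rw [if_pos fun i hi => (hext u i hi).symm, if_pos fun i hi => (hext u i hi).trans (h i hi), hcomp]
  · refine Finset.sum_eq_zero fun m _ => ?_
    by_cases h1 : ∀ i, (∀ k, w k ≠ i) → b i = m i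
    · rw [if_neg (c := ∀ i, (∀ k, w k ≠ i) → m i = a i), mul_zero]
      exact fun h2 => h fun i hi => (h1 i hi).trans (h2 i hi)
    · rw [if_neg h1, zero_mul]

theorem embed_one {k : ℕ} (w : Fin k → Fin N) : embed w (1 : Op k) = 1 := by
  classical
  ext b a
  simp only [embed, Matrix.of_apply, Matrix.one_apply]
  by_cases h : b = a
  · subst h; simp
  · rw [if_neg h]
    split_ifs with h1 h2
    · exact absurd (funext fun i => by
        by_cases hi : ∃ j, w j = i
        · obtain ⟨j, rfl⟩ := hi; exact congrFun h2 j
        · push Not at hi; exact h1 i hi) h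
    · rfl
    · rfl

theorem embed_star {k : ℕ} (w : Fin k → Fin N) (A : Op k) : star (embed w A) = embed w (star A) := by
  classical
  ext b a
  simp only [embed, Matrix.star_apply, Matrix.of_apply, apply_ite star, star_zero, eq_comm]

theorem embed_unitary {k : ℕ} {w : Fin k → Fin N} (hw : Function.Injective w) {A : Op k}
    (hA : A ∈ Matrix.unitaryGroup (Bits k) ℂ) : embed w A ∈ Matrix.unitaryGroup (Bits N) ℂ := by
  rw [Matrix.mem_unitaryGroup_iff', embed_star, embed_mul hw, Matrix.mem_unitaryGroup_iff'.1 hA,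
    embed_one]

theorem local_embed {k : ℕ} (w : Fin k → Fin N) (A : Op k) : Local (Set.range w) (embed w A) := by
  classical
  have hS : ∀ i, i ∉ Set.range w ↔ ∀ k, w k ≠ i := by simp
  refine ⟨fun b a h i hi => ?_, fun b a b' a' h hb hb' => ?_⟩
  · by_contra hne
    apply h
    simp only [embed, Matrix.of_apply]
    rw [if_neg fun h' => hne (h' i ((hS i).1 hi))]
  · simp only [embed, Matrix.of_apply]
    rw [if_pos fun i hi => hb i ((hS i).2 hi), if_pos fun i hi => hb' i ((hS i).2 hi)]
    congr 1
    · exact funext fun j => (h _ ⟨j, rfl⟩).1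
    · exact funext fun j => (h _ ⟨j, rfl⟩).2

namespace Gate

variable {B : GateBasis}

theorem op_basic (j : Fin B.length) (w : Fin (B.get j).arity → Fin N) :
    (basic j w).op = embed w (B.get j).mat := rfl

theorem op_unitary {g : Gate B N} (hg : g.wires.Nodup) : g.op ∈ Matrix.unitaryGroup (Bits N) ℂ := by
  have key : ∀ (xs : List (Fin N)) (y : Fin N) (f : ℕ → Bool), (xs ++ [y]).Nodup →
      classicalOp (flipIf y fun b => f (xs.countP b)) ∈ Matrix.unitaryGroup (Bits N) ℂ := by
    intro xs y f h
    refine classicalOp_unitary _ (flipIf_involutive fun b v => ?_)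
    congr 1
    refine List.countP_congr fun i hi => ?_
    rw [Function.update_of_ne]
    rintro rfl
    rw [List.nodup_append] at h
    exact h.2.2 _ hi _ (by simp) rfl
  cases g with
  | basic j w => exact embed_unitary (List.nodup_ofFn.1 hg) (B.get j).unitary
  | fanout c ts =>
    refine classicalOp_unitary _ fun b => funext fun i => ?_
    have hc : c ∉ ts := (List.nodup_cons.1 hg).1
    by_cases hi : i ∈ ts <;> simp [hi, hc]
  | and xs y => exact key xs y (fun v => decide (v = xs.length)) hg
  | or xs y => exact key xs y (fun v => decide (0 < v)) hg
  | threshold t xs y => exact key xs y (fun v => decide (t ≤ v)) hg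

theorem op_local (g : Gate B N) : Local {i | i ∈ g.wires} g.op := by
  have key : ∀ (xs : List (Fin N)) (y : Fin N) (f : ℕ → Bool),
      Local {i | i ∈ xs ++ [y]} (classicalOp (flipIf y fun b => f (xs.countP b))) := by
    intro xs y f
    refine local_flipIf (by simp) fun b b' h => ?_
    congr 1
    refine List.countP_congr fun i hi => ?_
    rw [h i (by simp [hi])]
  cases g with
  | basic j w =>
    have := local_embed w (B.get j).mat
    simpa [wires, List.mem_ofFn', op_basic, Set.range, Set.ext_iff] using this
  | fanout c ts =>
    refine local_classicalOp (fun b i hi => ?_) fun b b' h i hi => ?_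
    · have : i ∉ ts := fun h => hi (by simp [wires, h])
      simp [this]
    · rw [h i hi, h c (by simp [wires])]
  | and xs y => exact key xs y fun v => decide (v = xs.length)
  | or xs y => exact key xs y fun v => decide (0 < v)
  | threshold t xs y => exact key xs y fun v => decide (t ≤ v)

end Gate

/-! ### Hadamard gates -/

/-- The Hadamard matrix. -/
noncomputable def hMat : Op 1 := hadamard.mat

/-- The Hadamard gate on qubit `i`. -/
noncomputable def Hop (i : Fin N) : Op N := embed (fun _ : Fin 1 => i) hMat

theorem sum_agree (i : Fin N) (b : Bits N) (f : Bits N → ℂ) :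
    (∑ a, open scoped Classical in if ∀ k, (Fin 1 → i ≠ k) → b k = a k then f a else 0) =
      f (Function.update b i false) + f (Function.update b i true) := by
  classical
  rw [← Finset.sum_filter, ← Finset.sum_pair (f := f)]
  · refine Finset.sum_congr ?_ fun _ _ => rfl
    ext a
    simp only [Finset.mem_filter, Finset.mem_univ, true_and, Finset.mem_insert, Finset.mem_singleton]
    constructor
    · intro h
      have : a = Function.update b i (a i) := funext fun k => by
        by_cases hk : k = i
        · subst hk; simp
        · rw [Function.update_of_ne hk, h k fun _ => Ne.symm hk]
      cases hai : a i <;> rw [hai] at this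
      · exact .inl this
      · exact .inr this
    · rintro (rfl | rfl) k hk <;> rw [Function.update_of_ne (hk 0).symm]
  · intro h
    have := congrFun h i
    simp at this

/-- `(-1)^v` -/
def sgn (v : Bool) : ℂ := if v then -1 else 1

theorem Hop_mulVec (i : Fin N) (ψ : Bits N → ℂ) (b : Bits N) :
    ((Hop i).mulVec ψ) b = (ψ (Function.update b i false) + sgn (b i) * ψ (Function.update b i true)) /
      (Real.sqrt 2 : ℂ) := by
  simp only [Matrix.mulVec, dotProduct, Hop, embed, Matrix.of_apply, ite_mul, zero_mul]
  rw [sum_agree i b fun a => hMat (b ∘ fun _ => i) (a ∘ fun _ => i) * ψ a]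
  simp only [hMat, hadamard, Matrix.of_apply, Function.comp_apply, Function.update_self, Bool.and_false,
    Bool.and_true, sgn]
  cases b i <;> simp <;> ring

theorem Hop_unitary (i : Fin N) : Hop i ∈ Matrix.unitaryGroup (Bits N) ℂ :=
  embed_unitary (fun _ _ _ => Subsingleton.elim _ _) hadamard.unitary

theorem local_Hop (i : Fin N) : Local {i} (Hop i) := by
  simpa [Hop] using local_embed (fun _ : Fin 1 => i) hMat

theorem Hop_commute {i j : Fin N} (h : i ≠ j) : Commute (Hop i) (Hop j) :=
  (local_Hop i).commute (local_Hop j) (by simpa using h)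

theorem sqrt_two_mul : (Real.sqrt 2 : ℂ) * (Real.sqrt 2 : ℂ) = 2 := by
  rw [← Complex.ofReal_mul, Real.mul_self_sqrt (by norm_num)]; norm_num

theorem sqrt_two_ne : (Real.sqrt 2 : ℂ) ≠ 0 := by
  intro h
  have := sqrt_two_mul
  simp [h] at this

/-- Conjugation with a Hadamard gate turns a controlled sign into a controlled flip. -/
theorem Hop_sign (i : Fin N) {g : Bits N → Bool} (hg : ∀ b v, g (Function.update b i v) = g b) :
    Hop i * Matrix.diagonal (fun b => sgn (b i && g b)) * Hop i = classicalOp (flipIf i g) := by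
  refine op_ext fun ψ => ?_
  rw [classicalOp_mulVec (flipIf_involutive hg), ← Matrix.mulVec_mulVec, ← Matrix.mulVec_mulVec]
  funext b
  rw [Hop_mulVec]
  simp only [Matrix.mulVec_diagonal, Hop_mulVec, Function.update_self, Function.update_idem, hg,
    Bool.false_and, Bool.true_and, flipIf]
  have h2 := sqrt_two_mul
  have h0 := sqrt_two_ne
  cases b i <;> cases g b <;> simp [sgn] <;> field_simp <;> rw [pow_two, h2] <;> ring

theorem Hop_mul_self (i : Fin N) : Hop i * Hop i = 1 := by
  have := Hop_sign i (g := fun _ => false) fun _ _ => rfl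
  have h1 : (fun b : Bits N => sgn (b i && false)) = fun _ => 1 := by simp [sgn]
  have h2 : flipIf i (fun _ : Bits N => false) = id := by funext b; simp [flipIf]
  rw [h1, h2, Matrix.diagonal_one, mul_one] at this
  rw [this]
  ext b a
  simp [classicalOp, Matrix.one_apply]

/-- Controlled-not with control `c` and target `t`. -/
def CX (c t : Fin N) : Op N := classicalOp (flipIf t fun b => b c)

theorem local_CX (c t : Fin N) : Local {c, t} (CX c t) :=
  local_flipIf (by simp) fun b b' h => h c (by simp)

theorem Hop_CX {c t : Fin N} (h : c ≠ t) :
    (Hop c * Hop t) * CX c t * (Hop c * Hop t) = CX t c := by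
  have h1 := Hop_sign t (g := fun b => b c) fun b v => Function.update_of_ne h _ _
  have h2 := Hop_sign c (g := fun b => b t) fun b v => Function.update_of_ne h.symm _ _
  have h3 : (fun b : Bits N => sgn (b c && b t)) = fun b => sgn (b t && b c) := by
    funext b; rw [Bool.and_comm]
  rw [h3] at h2
  rw [CX, CX, ← h2, ← h1]
  set D := Matrix.diagonal fun b : Bits N => sgn (b t && b c)
  calc Hop c * Hop t * (Hop t * D * Hop t) * (Hop c * Hop t)
      = Hop c * (Hop t * Hop t) * D * Hop t * (Hop c * Hop t) := by simp only [mul_assoc]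
    _ = Hop c * (Hop t * Hop t) * D * Hop t * (Hop t * Hop c) := by rw [Hop_commute h]
    _ = Hop c * (Hop t * Hop t) * D * (Hop t * Hop t) * Hop c := by simp only [mul_assoc]
    _ = Hop c * D * Hop c := by simp only [Hop_mul_self, mul_one]

/-- Hadamard gates on all qubits in `W`. -/
noncomputable def Hs (W : Finset (Fin N)) : Op N :=
  W.noncommProd Hop fun _ _ _ _ h => Hop_commute h

theorem Hs_empty : Hs (∅ : Finset (Fin N)) = 1 := Finset.noncommProd_empty _ _

theorem Hs_insert {W : Finset (Fin N)} {i : Fin N} (h : i ∉ W) : Hs (insert i W) = Hop i * Hs W :=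
  Finset.noncommProd_insert_of_notMem _ _ _ _ h

theorem Hs_erase {W : Finset (Fin N)} {i : Fin N} (h : i ∈ W) : Hs W = Hop i * Hs (W.erase i) := by
  rw [← Hs_insert (Finset.notMem_erase i W), Finset.insert_erase h]

theorem Hs_commute {W : Finset (Fin N)} {X : Op N} (h : ∀ i ∈ W, Commute (Hop i) X) :
    Commute (Hs W) X :=
  (Finset.noncommProd_commute _ _ _ _ fun i hi => (h i hi).symm).symm

theorem Hs_commute_local {W : Finset (Fin N)} {X : Op N} {S : Set (Fin N)} (hX : Local S X)
    (h : ∀ i ∈ W, i ∉ S) : Commute (Hs W) X :=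
  Hs_commute fun i hi => (local_Hop i).commute hX (by simpa using h i hi)

theorem Hs_mul_self (W : Finset (Fin N)) : Hs W * Hs W = 1 := by
  induction W using Finset.induction_on with
  | empty => rw [Hs_empty, mul_one]
  | insert i W h ih =>
    have hc : Commute (Hs W) (Hop i) := Hs_commute fun j hj => Hop_commute fun e => h (e ▸ hj)
    rw [Hs_insert h, mul_assoc, ← mul_assoc (Hs W), hc.eq, mul_assoc, ih, mul_one, Hop_mul_self]

theorem Hs_unitary (W : Finset (Fin N)) : Hs W ∈ Matrix.unitaryGroup (Bits N) ℂ := by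
  induction W using Finset.induction_on with
  | empty => rw [Hs_empty]; exact one_mem _
  | insert i W h ih => rw [Hs_insert h]; exact mul_mem (Hop_unitary i) ih

theorem Hs_CX {W : Finset (Fin N)} {c t : Fin N} (hc : c ∈ W) (ht : t ∈ W) (h : c ≠ t) :
    Hs W * CX c t * Hs W = CX t c := by
  have e : Hs W = (Hop c * Hop t) * Hs ((W.erase c).erase t) := by
    rw [Hs_erase hc, Hs_erase (Finset.mem_erase.2 ⟨h.symm, ht⟩), mul_assoc]
  have h1 : Commute (Hs ((W.erase c).erase t)) (CX c t) :=
    Hs_commute_local (local_CX c t) fun i hi => by simp at hi ⊢; tauto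
  have h2 : Commute (Hs ((W.erase c).erase t)) (Hop c * Hop t) := by
    refine Commute.mul_right (Hs_commute fun i hi => Hop_commute ?_)
      (Hs_commute fun i hi => Hop_commute ?_) <;> simp at hi <;> tauto
  calc Hs W * CX c t * Hs W
      = (Hop c * Hop t) * (Hs ((W.erase c).erase t) * CX c t) *
          ((Hop c * Hop t) * Hs ((W.erase c).erase t)) := by rw [e]; simp only [mul_assoc]
    _ = (Hop c * Hop t) * (CX c t * Hs ((W.erase c).erase t)) *
          (Hs ((W.erase c).erase t) * (Hop c * Hop t)) := by rw [h1.eq, h2.eq]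
    _ = (Hop c * Hop t) * CX c t * (Hs ((W.erase c).erase t) * Hs ((W.erase c).erase t)) *
          (Hop c * Hop t) := by simp only [mul_assoc]
    _ = CX t c := by rw [Hs_mul_self, mul_one, Hop_CX h]

/-- A product of Hadamard gates preserves a property that does not depend on their qubits. -/
theorem Supp.Hs {R : Bits N → Prop} {ψ : Bits N → ℂ} (h : Supp R ψ) {W : Finset (Fin N)}
    (hR : ∀ i ∈ W, ∀ b v, R (Function.update b i v) → R b) : Supp R ((Hs W).mulVec ψ) := by
  induction W using Finset.induction_on with
  | empty => rwa [Hs_empty, Matrix.one_mulVec]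
  | insert i W hi ih =>
    rw [Hs_insert hi, ← Matrix.mulVec_mulVec]
    have h1 := ih fun j hj => hR j (Finset.mem_insert_of_mem hj)
    intro b hb
    rw [Hop_mulVec] at hb
    by_contra hRb
    apply hb
    have h0 : ∀ v, (QFan.Hs W).mulVec ψ (Function.update b i v) = 0 := fun v => by
      by_contra hv
      exact hRb (hR i (Finset.mem_insert_self i W) b v (h1 _ hv))
    simp [h0]

theorem Supp.diagonal {R : Bits N → Prop} {ψ : Bits N → ℂ} (h : Supp R ψ) (d : Bits N → ℂ) :
    Supp R ((Matrix.diagonal d).mulVec ψ) := by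
  intro b hb
  rw [Matrix.mulVec_diagonal] at hb
  exact h b (right_ne_zero_of_mul hb)

theorem diagonal_mul (d d' : Bits N → ℂ) :
    Matrix.diagonal d * Matrix.diagonal d' = Matrix.diagonal fun b => d b * d' b :=
  Matrix.diagonal_mul_diagonal _ _

theorem diagonal_unitary {d : Bits N → ℂ} (hd : ∀ b, ‖d b‖ = 1) :
    Matrix.diagonal d ∈ Matrix.unitaryGroup (Bits N) ℂ := by
  rw [Matrix.mem_unitaryGroup_iff', Matrix.star_eq_conjTranspose, Matrix.diagonal_conjTranspose,
    Matrix.diagonal_mul_diagonal, ← Matrix.diagonal_one]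
  congr 1
  funext b
  rw [Pi.star_apply, Complex.star_def, ← Complex.normSq_eq_conj_mul_self, Complex.normSq_eq_norm_sq,
    hd b]
  simp

end QFan

namespace QFan

variable {N : ℕ}

/-- On states supported on `S`, the operators differ by at most `ε`. -/
def Near (S : Bits N → Prop) (ε : ℝ) (X Y : Op N) : Prop :=
  ∀ ψ, Supp S ψ → nrm (X.mulVec ψ - Y.mulVec ψ) ≤ ε * nrm ψ

theorem Near.refl (S : Bits N → Prop) (X : Op N) : Near S 0 X X := fun ψ _ => by
  simp [nrm]

theorem Near.mono {S : Bits N → Prop} {ε ε' : ℝ} {X Y : Op N} (h : Near S ε X Y) (hε : ε ≤ ε') :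
    Near S ε' X Y := fun ψ hψ =>
  (h ψ hψ).trans (mul_le_mul_of_nonneg_right hε (nrm_nonneg _))

theorem Near.comp {S S' : Bits N → Prop} {ε ε' : ℝ} {X Y X' Y' : Op N} (h' : Near S' ε' X' Y')
    (h : Near S ε X Y) (hX' : X' ∈ Matrix.unitaryGroup (Bits N) ℂ)
    (hY : Y ∈ Matrix.unitaryGroup (Bits N) ℂ) (hS : ∀ ψ, Supp S ψ → Supp S' (Y.mulVec ψ)) :
    Near S (ε' + ε) (X' * X) (Y' * Y) := by
  intro ψ hψ
  rw [← Matrix.mulVec_mulVec, ← Matrix.mulVec_mulVec]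
  refine (nrm_sub_le _ (X'.mulVec (Y.mulVec ψ)) _).trans ?_
  rw [← Matrix.mulVec_sub, nrm_mulVec hX']
  have h1 := h ψ hψ
  have h2 := h' _ (hS ψ hψ)
  rw [nrm_mulVec hY] at h2
  linarith

theorem Near.diagonal {S : Bits N → Prop} {ε : ℝ} {d d' : Bits N → ℂ} (hε : 0 ≤ ε)
    (h : ∀ b, S b → ‖d b - d' b‖ ≤ ε) : Near S ε (Matrix.diagonal d) (Matrix.diagonal d') := by
  intro ψ hψ
  refine nrm_le_of_sq hε fun b => ?_
  simp only [Pi.sub_apply, Matrix.mulVec_diagonal, ← sub_mul, norm_mul]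
  by_cases hb : ψ b = 0
  · simp [hb]
  · exact mul_le_mul_of_nonneg_right (h b (hψ b hb)) (norm_nonneg _)

/-- `f` does not depend on the qubits in `W`. -/
def Free {α : Type} (W : Finset (Fin N)) (f : Bits N → α) : Prop :=
  ∀ i ∈ W, ∀ b v, f (Function.update b i v) = f b

theorem Free.commute {W : Finset (Fin N)} {d : Bits N → ℂ} (hd : Free W d) :
    Commute (Hs W) (Matrix.diagonal d) := by
  refine Hs_commute fun i hi => ?_
  refine (local_Hop i).commute (local_diagonal (S := {i}ᶜ) fun b b' h => ?_) (by simp)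
  rw [← hd i hi b false, ← hd i hi b' false]
  congr 1
  funext j
  by_cases hj : j = i
  · subst hj; simp
  · rw [Function.update_of_ne hj, Function.update_of_ne hj, h j (by simpa using hj)]

theorem Supp.Hs_free {R : Bits N → Prop} {ψ : Bits N → ℂ} (h : Supp R ψ) {W : Finset (Fin N)}
    (hR : Free W R) : Supp R ((QFan.Hs W).mulVec ψ) :=
  h.Hs fun i hi b v hb => (hR i hi b v) ▸ hb

theorem conj_split {M : Type} [Monoid M] {h H D D' : M} (h1 : Commute H D) (h2 : Commute h H)
    (h3 : Commute h D') : h * H * (D * D') * (h * H) = h * D * h * (H * D' * H) := by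
  calc h * H * (D * D') * (h * H)
      = h * (H * D) * D' * (h * H) := by simp only [mul_assoc]
    _ = h * D * H * (D' * h) * H := by rw [h1.eq]; simp only [mul_assoc]
    _ = h * D * (H * h) * D' * H := by rw [← h3.eq]; simp only [mul_assoc]
    _ = h * D * h * (H * D' * H) := by rw [← h2.eq]; simp only [mul_assoc]

theorem Hs_singleton (i : Fin N) : Hs {i} = Hop i := Finset.noncommProd_singleton _ _

/-- Conjugation with Hadamard gates turns controlled signs into controlled flips. -/
theorem Hs_sign {ι : Type} {y : ι → Fin N} {f : ι → Bits N → Bool} (l : List ι)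
    (hy : (l.map y).Nodup) (hf : ∀ g ∈ l, ∀ g' ∈ l, ∀ b v, f g (Function.update b (y g') v) = f g b) :
    Hs (l.map y).toFinset *
      Matrix.diagonal (fun b => (l.map fun g => sgn (b (y g) && f g b)).prod) *
      Hs (l.map y).toFinset = (l.map fun g => classicalOp (flipIf (y g) (f g))).prod := by
  induction l with
  | nil => simp [Hs_empty]
  | cons g l ih =>
    have hg : y g ∉ (l.map y).toFinset := by
      rw [List.mem_toFinset]; exact (List.nodup_cons.1 hy).1
    have ih := ih (List.nodup_cons.1 hy).2 fun a ha a' ha' =>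
      hf a (List.mem_cons_of_mem _ ha) a' (List.mem_cons_of_mem _ ha')
    simp only [List.map_cons, List.toFinset_cons, List.prod_cons]
    rw [Hs_insert hg, ← ih, ← Hop_sign (y g) fun b v => hf g (by simp) g (by simp) b v]
    rw [← diagonal_mul (fun b => sgn (b (y g) && f g b))
      fun b => (l.map fun g => sgn (b (y g) && f g b)).prod]
    set D := Matrix.diagonal fun b => sgn (b (y g) && f g b)
    set D' := Matrix.diagonal fun b => (l.map fun g => sgn (b (y g) && f g b)).prod
    set H := Hs (l.map y).toFinset
    have h1 : Commute H D := Free.commute fun i hi b v => by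
      obtain ⟨a, ha, rfl⟩ := List.mem_map.1 (List.mem_toFinset.1 hi)
      rw [hf g (by simp) a (by simp [ha]),
        Function.update_of_ne fun e : y g = y a => hg (by rw [e]; exact hi)]
    have h2 : Commute (Hop (y g)) H :=
      (Hs_commute fun i hi => Hop_commute fun e : i = y g => hg (by rw [← e]; exact hi)).symm
    have h3 : Commute (Hop (y g)) D' := by
      have := Free.commute (W := {y g})
        (d := fun b => (l.map fun g => sgn (b (y g) && f g b)).prod) fun i hi b v => by
          obtain rfl := Finset.mem_singleton.1 hi
          refine congrArg List.prod (List.map_congr_left fun a ha => ?_)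
          rw [hf a (by simp [ha]) g (by simp), Function.update_of_ne fun e : y a = y g => hg ?_]
          rw [← e, List.mem_toFinset]
          exact List.mem_map_of_mem ha
      rwa [Hs_singleton] at this
    exact conj_split h1 h2 h3

/-- Phases controlled by the qubits in `C`. -/
noncomputable def ctrl (C : Finset (Fin N)) (φ : Fin N → Bits N → ℂ) (b : Bits N) : ℂ :=
  ∏ i ∈ C, if b i then φ i b else 1

theorem ctrl_erase {C : Finset (Fin N)} {φ : Fin N → Bits N → ℂ} {i : Fin N} (hi : i ∈ C) (b : Bits N) :
    ctrl C φ b = (if b i then φ i b else 1) * ctrl (C.erase i) φ b :=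
  (Finset.mul_prod_erase C (fun i => if b i then φ i b else 1) hi).symm

/-- The controls hold the results of the phase estimation. -/
def Estimated (C : Finset (Fin N)) (φ : Fin N → Bits N → ℂ) (b : Bits N) : Prop :=
  ∀ i ∈ C, (φ i b = 1 → b i = false) ∧ (φ i b = -1 → b i = true)

theorem Hop_phase {i : Fin N} {φ : Bits N → ℂ} (hφ : ∀ b v, φ (Function.update b i v) = φ b)
    {ψ : Bits N → ℂ} (hψ : Supp (fun b => b i = false) ψ) :
    Supp (fun b => (φ b = 1 → b i = false) ∧ (φ b = -1 → b i = true))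
      ((Hop i * Matrix.diagonal (fun b : Bits N => if b i then φ b else 1) * Hop i).mulVec ψ) := by
  intro b hb
  rw [← Matrix.mulVec_mulVec, ← Matrix.mulVec_mulVec, Hop_mulVec] at hb
  have h1 : ψ (Function.update b i true) = 0 := by
    by_contra h
    have := hψ _ h
    simp at this
  simp only [Matrix.mulVec_diagonal, Hop_mulVec, Function.update_self, Function.update_idem, hφ,
    h1, mul_zero, add_zero] at hb
  constructor <;> intro h <;> by_contra hbi <;> apply hb <;> simp at hbi <;> simp [hbi, h, sgn]

theorem supp_estimated {C : Finset (Fin N)} {φ : Fin N → Bits N → ℂ} (hφ : ∀ i ∈ C, Free C (φ i))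
    {ψ : Bits N → ℂ} (hψ : Supp (fun b => ∀ i ∈ C, b i = false) ψ) :
    Supp (Estimated C φ) ((Hs C * Matrix.diagonal (ctrl C φ) * Hs C).mulVec ψ) := by
  intro b hb i hi
  revert b
  show Supp (fun b => (φ i b = 1 → b i = false) ∧ (φ i b = -1 → b i = true)) _
  have e1 : Matrix.diagonal (ctrl C φ) = Matrix.diagonal (fun b : Bits N => if b i then φ i b else 1) *
      Matrix.diagonal (ctrl (C.erase i) φ) := by
    rw [diagonal_mul]
    congr 1
    exact funext (ctrl_erase hi)
  set D := Matrix.diagonal fun b : Bits N => if b i then φ i b else 1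
  set D' := Matrix.diagonal (ctrl (C.erase i) φ)
  set H := Hs (C.erase i)
  have h1 : Commute H D := Free.commute fun j hj b v => by
    have hj := Finset.mem_erase.1 hj
    rw [Function.update_of_ne hj.1.symm, hφ i hi j hj.2]
  have h2 : Commute (Hop i) H :=
    (Hs_commute fun j hj => Hop_commute (Finset.mem_erase.1 hj).1).symm
  have h3 : Commute (Hop i) D' := by
    have := Free.commute (W := {i}) (d := ctrl (C.erase i) φ) fun k hk b v => by
      obtain rfl := Finset.mem_singleton.1 hk
      refine Finset.prod_congr rfl fun j hj => ?_
      have hj := Finset.mem_erase.1 hj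
      rw [Function.update_of_ne hj.1, hφ j hj.2 k hi]
    rwa [Hs_singleton] at this
  have e2 : Hs C * Matrix.diagonal (ctrl C φ) * Hs C = (Hop i * D * Hop i) * (H * D' * H) := by
    rw [Hs_erase hi, e1]
    exact conj_split h1 h2 h3
  rw [e2, ← Matrix.mulVec_mulVec]
  refine Hop_phase (fun b v => hφ i hi i hi b v) ?_
  rw [← Matrix.mulVec_mulVec, ← Matrix.mulVec_mulVec]
  have hfree : Free (C.erase i) fun b : Bits N => b i = false := fun j hj b v => by
    beta_reduce
    rw [Function.update_of_ne (Finset.mem_erase.1 hj).1.symm]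
  exact (((hψ.mono fun b h => h i hi).Hs_free hfree).diagonal _).Hs_free hfree

/-- The circuit for symmetric functions, in terms of its phases. -/
noncomputable def gadget (Y C : Finset (Fin N)) (p q : Bits N → ℂ) : Op N :=
  Hs Y * (Hs C * (Matrix.diagonal (star p) * (Hs C * (Matrix.diagonal q *
    (Hs C * (Matrix.diagonal p * (Hs C * Hs Y)))))))

/-- Compute, apply signs, and uncompute. -/
theorem compute_sign {C : Finset (Fin N)} {φ : Fin N → Bits N → ℂ} (hφ : ∀ i ∈ C, Free C (φ i))
    (hφ1 : ∀ i b, ‖φ i b‖ = 1) {Bz : Bits N → Prop} (hBz : Free C Bz) {q s : Bits N → ℂ}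
    (hq : ∀ b, Bz b → Estimated C φ b → q b = s b) (hs : Free C s)
    {ψ : Bits N → ℂ} (hψ : Supp (fun b => Bz b ∧ ∀ i ∈ C, b i = false) ψ) :
    (Hs C * (Matrix.diagonal (star (ctrl C φ)) * (Hs C * (Matrix.diagonal q *
      (Hs C * (Matrix.diagonal (ctrl C φ) * Hs C)))))).mulVec ψ = (Matrix.diagonal s).mulVec ψ := by
  set P := Matrix.diagonal (ctrl C φ)
  have hP : Matrix.diagonal (star (ctrl C φ)) * P = 1 := by
    rw [diagonal_mul, ← Matrix.diagonal_one]
    congr 1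
    funext b
    have : ‖ctrl C φ b‖ = 1 := by
      rw [ctrl, norm_prod]
      exact Finset.prod_eq_one fun i _ => by split_ifs <;> simp [hφ1]
    rw [Pi.star_apply, Complex.star_def, ← Complex.normSq_eq_conj_mul_self, Complex.normSq_eq_norm_sq,
      this]
    simp
  set v := (Hs C * (P * Hs C)).mulVec ψ with hv
  have hest : Supp (Estimated C φ) v := by
    have := supp_estimated hφ (hψ.mono fun b h => h.2)
    rwa [mul_assoc] at this
  have hbz : Supp Bz v := by
    rw [hv, ← Matrix.mulVec_mulVec, ← Matrix.mulVec_mulVec]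
    exact (((hψ.mono fun b h => h.1).Hs_free hBz).diagonal _).Hs_free hBz
  have hqv : (Matrix.diagonal q).mulVec v = (Matrix.diagonal s).mulVec v := by
    funext b
    rw [Matrix.mulVec_diagonal, Matrix.mulVec_diagonal]
    by_cases hb : v b = 0
    · simp [hb]
    · rw [hq b (hbz b hb) (hest b hb)]
  set S := Matrix.diagonal s
  have hS : Commute (Hs C) S := hs.commute
  have hSP : Commute S P := by
    rw [commute_iff_eq, diagonal_mul, diagonal_mul]
    simp only [mul_comm]
  set P' := Matrix.diagonal (star (ctrl C φ))
  have e1 : Hs C * (P' * (Hs C * (Matrix.diagonal q * (Hs C * (P * Hs C))))) =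
      (Hs C * (P' * Hs C)) * Matrix.diagonal q * (Hs C * (P * Hs C)) := by simp only [mul_assoc]
  rw [e1, ← Matrix.mulVec_mulVec ψ, ← hv, ← Matrix.mulVec_mulVec v, hqv, hv, Matrix.mulVec_mulVec,
    Matrix.mulVec_mulVec, ← mul_assoc (Hs C) P' (Hs C)]
  refine congrArg (fun X : Op N => X.mulVec ψ) ?_
  calc Hs C * P' * Hs C * S * (Hs C * (P * Hs C))
      = Hs C * P' * Hs C * (S * Hs C) * P * Hs C := by simp only [mul_assoc]
    _ = Hs C * P' * (Hs C * Hs C) * (S * P) * Hs C := by rw [← hS.eq]; simp only [mul_assoc]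
    _ = Hs C * (P' * P) * (S * Hs C) := by rw [Hs_mul_self, hSP.eq]; simp only [mul_assoc, one_mul]
    _ = (Hs C * Hs C) * S := by rw [hP, ← hS.eq, mul_one, mul_assoc]
    _ = S := by rw [Hs_mul_self, one_mul]

theorem gadget_near {ι : Type} {y : ι → Fin N} {f : ι → Bits N → Bool} (l : List ι)
    (hy : (l.map y).Nodup) (hf : ∀ g ∈ l, ∀ g' ∈ l, ∀ b v, f g (Function.update b (y g') v) = f g b)
    {C : Finset (Fin N)} (hyC : ∀ g ∈ l, y g ∉ C) (hfC : ∀ g ∈ l, Free C (f g))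
    {φ : Fin N → Bits N → ℂ} (hφ : ∀ i ∈ C, Free C (φ i))
    (hφ1 : ∀ i b, ‖φ i b‖ = 1) {Bz : Bits N → Prop} (hBz : Free C Bz) (hBzY : Free (l.map y).toFinset Bz)
    {p q q' : Bits N → ℂ} (hp1 : ∀ b, ‖p b‖ = 1) (hq1 : ∀ b, ‖q b‖ = 1) {ε ε' : ℝ} (hε : 0 ≤ ε)
    (hε' : 0 ≤ ε') (hp : ∀ b, Bz b → ‖p b - ctrl C φ b‖ ≤ ε) (hq : ∀ b, Bz b → ‖q b - q' b‖ ≤ ε')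
    (hq'1 : ∀ b, ‖q' b‖ = 1)
    (hq' : ∀ b, Bz b → Estimated C φ b → q' b = (l.map fun g => sgn (b (y g) && f g b)).prod) :
    Near (fun b => Bz b ∧ ∀ i ∈ C, b i = false) (2 * ε + ε') (gadget (l.map y).toFinset C p q)
      (l.map fun g => classicalOp (flipIf (y g) (f g))).prod := by
  set Y := (l.map y).toFinset
  set s : Bits N → ℂ := fun b => (l.map fun g => sgn (b (y g) && f g b)).prod
  have hYC : ∀ i ∈ Y, i ∉ C := fun i hi => by
    obtain ⟨g, hg, rfl⟩ := List.mem_map.1 (List.mem_toFinset.1 hi)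
    exact hyC g hg
  have hs : Free C s := fun i hi b v => by
    refine congrArg List.prod (List.map_congr_left fun g hg => ?_)
    rw [hfC g hg i hi, Function.update_of_ne fun e => hyC g hg (by rwa [e])]
  set Z : Bits N → Prop := fun b => Bz b ∧ ∀ i ∈ C, b i = false
  have hZY : Free Y Z := fun i hi b v => by
    simp only [Z, hBzY i hi b v]
    congr 1
    refine forall_congr fun j => ?_
    by_cases hj : j ∈ C
    · rw [Function.update_of_ne fun e => hYC i hi (by rwa [← e])]
    · simp [hj]
  have hctrl1 : ∀ b, ‖ctrl C φ b‖ = 1 := fun b => by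
    rw [ctrl, norm_prod]
    exact Finset.prod_eq_one fun i _ => by split_ifs <;> simp [hφ1]
  have uH := fun W : Finset (Fin N) => Hs_unitary W
  have ud := fun {d : Bits N → ℂ} (hd : ∀ b, ‖d b‖ = 1) => diagonal_unitary hd
  have hstar : ∀ {d : Bits N → ℂ}, (∀ b, ‖d b‖ = 1) → ∀ b, ‖star d b‖ = 1 := fun hd b => by
    rw [Pi.star_apply, norm_star, hd]
  have n0 : Near Z 0 (Hs C * Hs Y) (Hs C * Hs Y) := .refl _ _
  have hsupp0 : ∀ ψ, Supp Z ψ → Supp Bz ((Hs C * Hs Y).mulVec ψ) := fun ψ hψ => by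
    rw [← Matrix.mulVec_mulVec]
    exact ((hψ.Hs_free hZY).mono fun b h => h.1).Hs_free hBz
  have n1 := (Near.diagonal hε hp).comp n0 (ud hp1) (mul_mem (uH C) (uH Y)) hsupp0
  have u1 := mul_mem (ud hctrl1) (mul_mem (uH C) (uH Y))
  have hsupp1 : ∀ ψ, Supp Z ψ →
      Supp Bz ((Matrix.diagonal (ctrl C φ) * (Hs C * Hs Y)).mulVec ψ) := fun ψ hψ => by
    rw [← Matrix.mulVec_mulVec]
    exact (hsupp0 ψ hψ).diagonal _
  have n2 := (Near.refl Bz (Hs C)).comp n1 (uH C) u1 hsupp1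
  have u2 := mul_mem (uH C) u1
  have hsupp2 : ∀ ψ, Supp Z ψ →
      Supp Bz ((Hs C * (Matrix.diagonal (ctrl C φ) * (Hs C * Hs Y))).mulVec ψ) := fun ψ hψ => by
    rw [← Matrix.mulVec_mulVec]
    exact (hsupp1 ψ hψ).Hs_free hBz
  have n3 := (Near.diagonal hε' hq).comp n2 (ud hq1) u2 hsupp2
  have u3 := mul_mem (ud hq'1) u2
  have hsupp3 : ∀ ψ, Supp Z ψ → Supp Bz ((Matrix.diagonal q' *
      (Hs C * (Matrix.diagonal (ctrl C φ) * (Hs C * Hs Y)))).mulVec ψ) := fun ψ hψ => by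
    rw [← Matrix.mulVec_mulVec]
    exact (hsupp2 ψ hψ).diagonal _
  have n4 := (Near.refl Bz (Hs C)).comp n3 (uH C) u3 hsupp3
  have u4 := mul_mem (uH C) u3
  have hsupp4 : ∀ ψ, Supp Z ψ → Supp Bz ((Hs C * (Matrix.diagonal q' *
      (Hs C * (Matrix.diagonal (ctrl C φ) * (Hs C * Hs Y))))).mulVec ψ) := fun ψ hψ => by
    rw [← Matrix.mulVec_mulVec]
    exact (hsupp3 ψ hψ).Hs_free hBz
  have n5 := (Near.diagonal (d := star p) (d' := star (ctrl C φ)) hε fun b hb => by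
    rw [Pi.star_apply, Pi.star_apply, ← star_sub, norm_star]; exact hp b hb).comp n4
      (ud (hstar hp1)) u4 hsupp4
  have u5 := mul_mem (ud (hstar hctrl1)) u4
  have n6 := (Near.refl (fun _ => True) (Hs Y * Hs C)).comp n5 (mul_mem (uH Y) (uH C)) u5
    fun _ _ _ _ => trivial
  intro ψ hψ
  have h7 := n6 ψ hψ
  have e : (Hs Y * Hs C * (Matrix.diagonal (star (ctrl C φ)) * (Hs C * (Matrix.diagonal q' *
      (Hs C * (Matrix.diagonal (ctrl C φ) * (Hs C * Hs Y))))))).mulVec ψ =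
      (l.map fun g => classicalOp (flipIf (y g) (f g))).prod.mulVec ψ := by
    rw [← Hs_sign l hy hf]
    have := compute_sign hφ hφ1 hBz (q := q') (s := s) hq' hs (hψ.Hs_free hZY)
    rw [← Matrix.mulVec_mulVec ψ (Hs Y * Matrix.diagonal s), ← Matrix.mulVec_mulVec _ (Hs Y), ← this,
      Matrix.mulVec_mulVec, Matrix.mulVec_mulVec]
    simp only [mul_assoc]
  rw [e] at h7
  have e' : gadget Y C p q = Hs Y * Hs C * (Matrix.diagonal (star p) * (Hs C * (Matrix.diagonal q *
      (Hs C * (Matrix.diagonal p * (Hs C * Hs Y)))))) := by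
    simp only [gadget, mul_assoc]
  rw [e']
  refine h7.trans_eq ?_
  ring

theorem diagonal_mulVec_eq {R : Bits N → Prop} {ψ : Bits N → ℂ} (h : Supp R ψ) {d : Bits N → ℂ}
    (hd : ∀ b, R b → d b = 1) : (Matrix.diagonal d).mulVec ψ = ψ := by
  funext b
  rw [Matrix.mulVec_diagonal]
  by_cases hb : ψ b = 0
  · simp [hb]
  · rw [hd b (h b hb), one_mul]

/-- The gadget acts trivially if all phases vanish. -/
theorem gadget_exact {Y C : Finset (Fin N)} (hYC : ∀ i ∈ Y, i ∉ C) {T : Bits N → Prop} (hTC : Free C T)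
    (hTY : Free Y T) {p q : Bits N → ℂ} (hp : ∀ b, T b → p b = 1)
    (hq : ∀ b, T b → (∀ i ∈ C, b i = false) → q b = 1) {ψ : Bits N → ℂ}
    (hψ : Supp (fun b => T b ∧ ∀ i ∈ C, b i = false) ψ) : (gadget Y C p q).mulVec ψ = ψ := by
  have hZY : Free Y fun b : Bits N => T b ∧ ∀ i ∈ C, b i = false := fun i hi b v => by
    simp only [hTY i hi b v]
    congr 1
    refine forall_congr fun j => ?_
    by_cases hj : j ∈ C
    · rw [Function.update_of_ne fun e => hYC i hi (by rwa [← e])]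
    · simp [hj]
  have h1 := hψ.Hs_free hZY
  set φ := (Hs Y).mulVec ψ with hφ
  have h2 : Supp T ((Hs C).mulVec φ) := (h1.mono fun b h => h.1).Hs_free hTC
  have cancel : ∀ W χ, (Hs W).mulVec ((Hs W).mulVec χ) = (χ : Bits N → ℂ) := fun W χ => by
    rw [Matrix.mulVec_mulVec, Hs_mul_self, Matrix.one_mulVec]
  simp only [gadget, ← Matrix.mulVec_mulVec]
  rw [← hφ, diagonal_mulVec_eq h2 hp, cancel, diagonal_mulVec_eq h1 fun b h => hq b h.1 h.2,
    diagonal_mulVec_eq (d := star p) h2 fun b h => by rw [Pi.star_apply, hp b h, star_one], cancel,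
    hφ, cancel]

end QFan

namespace QFan

/-! ### The angle -/

/-- `∑_j 2^{-2^j}` -/
noncomputable def tau : ℝ := ∑' j : ℕ, (1 / 2 : ℝ) ^ 2 ^ j

theorem summable_tau : Summable fun j : ℕ => (1 / 2 : ℝ) ^ 2 ^ j := by
  refine Summable.of_nonneg_of_le (fun j => by positivity) (fun j => ?_)
    (summable_geometric_of_lt_one (r := (1 / 2 : ℝ)) (by norm_num) (by norm_num))
  exact pow_le_pow_of_le_one (by norm_num) (by norm_num) Nat.lt_two_pow_self.le

theorem tau_tail (j : ℕ) : 0 < ∑' i : ℕ, (1 / 2 : ℝ) ^ 2 ^ (i + (j + 2)) ∧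
    ∑' i : ℕ, (1 / 2 : ℝ) ^ 2 ^ (i + (j + 2)) ≤ 2 * (1 / 2) ^ (4 * 2 ^ j) := by
  have htail : Summable fun i : ℕ => (1 / 2 : ℝ) ^ 2 ^ (i + (j + 2)) :=
    (summable_nat_add_iff (f := fun j : ℕ => (1 / 2 : ℝ) ^ 2 ^ j) (j + 2)).2 summable_tau
  have hle : ∀ i : ℕ, (1 / 2 : ℝ) ^ 2 ^ (i + (j + 2)) ≤ (1 / 2) ^ (4 * 2 ^ j) * (1 / 2) ^ i := by
    intro i
    have h1 : 4 * 2 ^ j + i ≤ 2 ^ (i + (j + 2)) := by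
      have h2 : i + 1 ≤ 2 ^ i := Nat.lt_two_pow_self
      have h3 : 1 ≤ 2 ^ j := Nat.one_le_two_pow
      have h4 : 2 ^ (i + (j + 2)) = 2 ^ i * (4 * 2 ^ j) := by rw [pow_add, pow_add]; ring
      rw [h4]; nlinarith
    rw [← pow_add]
    exact pow_le_pow_of_le_one (by norm_num) (by norm_num) h1
  have hgeo := (summable_geometric_of_lt_one (r := (1 / 2 : ℝ)) (by norm_num) (by norm_num)).mul_left
    ((1 / 2) ^ (4 * 2 ^ j))
  refine ⟨htail.tsum_pos (fun i => by positivity) 0 (by positivity),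
    (htail.tsum_le_tsum hle hgeo).trans_eq ?_⟩
  rw [tsum_mul_left, tsum_geometric_of_lt_one (by norm_num) (by norm_num), mul_comm]
  norm_num

theorem tau_approx (j : ℕ) : ∃ (I : ℤ) (δ : ℝ), 0 < δ ∧ δ ≤ 2 / (2 ^ 2 ^ j) ^ 3 ∧
    2 ^ 2 ^ j * tau = I + 1 / 2 ^ 2 ^ j + δ := by
  obtain ⟨E, hE⟩ : ∃ E : ℝ, E = 2 ^ 2 ^ j := ⟨_, rfl⟩
  rw [← hE]
  have hE0 : 0 < E := by rw [hE]; positivity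
  obtain ⟨ht0, ht1⟩ := tau_tail j
  have hsplit : tau = _ := (summable_tau.sum_add_tsum_nat_add (j + 2)).symm
  rw [Finset.sum_range_succ] at hsplit
  generalize ∑' i : ℕ, (1 / 2 : ℝ) ^ 2 ^ (i + (j + 2)) = t at *
  refine ⟨∑ i ∈ Finset.range (j + 1), 2 ^ (2 ^ j - 2 ^ i), E * t, mul_pos hE0 ht0, ?_, ?_⟩
  · calc E * t ≤ E * (2 * (1 / 2) ^ (4 * 2 ^ j)) := mul_le_mul_of_nonneg_left ht1 hE0.le
      _ = 2 / E ^ 3 := by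
        rw [mul_comm 4, pow_mul, one_div_pow, ← hE]
        field_simp
  · rw [hsplit, mul_add, mul_add, Finset.mul_sum]
    have e1 : E * (1 / 2) ^ 2 ^ (j + 1) = 1 / E := by
      rw [pow_succ 2 j, pow_mul, one_div_pow, ← hE]
      field_simp
    have e2 : ∑ i ∈ Finset.range (j + 1), E * (1 / 2 : ℝ) ^ 2 ^ i =
        ((∑ i ∈ Finset.range (j + 1), 2 ^ (2 ^ j - 2 ^ i) : ℤ) : ℝ) := by
      rw [Int.cast_sum]
      refine Finset.sum_congr rfl fun i hi => ?_
      have h1 : 2 ^ i ≤ 2 ^ j := Nat.pow_le_pow_right (by omega)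
        (by have := Finset.mem_range.1 hi; omega)
      rw [Int.cast_pow, Int.cast_ofNat, hE, one_div_pow, pow_sub₀ _ (by norm_num) h1, one_div]
    rw [e1, e2]

theorem irrational_two_mul_tau : Irrational (2 * tau) := by
  rintro ⟨q, hq⟩
  obtain ⟨j, hj⟩ : ∃ j : ℕ, 6 * q.den < 2 ^ j := ⟨6 * q.den, Nat.lt_two_pow_self⟩
  obtain ⟨I, δ, h0, h1, h2⟩ := tau_approx j
  set E : ℝ := 2 ^ 2 ^ j with hE
  have hd : (0 : ℝ) < q.den := by exact_mod_cast q.den_pos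
  have hE1 : 6 * (q.den : ℝ) < E := by
    have h3 : 2 ^ j < 2 ^ 2 ^ j := Nat.pow_lt_pow_right (by omega) Nat.lt_two_pow_self
    have h4 : 6 * q.den < 2 ^ 2 ^ j := hj.trans h3
    rw [hE]; exact_mod_cast h4
  have hE2 : 1 ≤ E := by
    have : (1 : ℝ) ≤ q.den := by exact_mod_cast q.den_pos
    linarith
  have hE0 : 0 < E := by linarith
  have hqd : (q.den : ℝ) * (2 * tau) = q.num := by
    rw [← hq]
    have := Rat.mul_den_eq_num q
    have h : ((q * q.den : ℚ) : ℝ) = ((q.num : ℚ) : ℝ) := by rw [this]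
    push_cast at h
    linarith
  have hEi : E = ((2 ^ 2 ^ j : ℤ) : ℝ) := by rw [hE]; push_cast; rfl
  have key : ((2 ^ 2 ^ j * q.num - 2 * q.den * I : ℤ) : ℝ) = 2 * q.den * (1 / E + δ) := by
    push_cast
    rw [← hqd, ← hE]
    linear_combination (2 * (q.den : ℝ)) * h2
  have hpos : 0 < 2 * q.den * (1 / E + δ) := by positivity
  have hlt : 2 * q.den * (1 / E + δ) < 1 := by
    have h3 : 1 / E + δ ≤ 3 / E := by
      have : 2 / E ^ 3 ≤ 2 / E := by
        apply div_le_div_of_nonneg_left (by norm_num) hE0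
        exact le_self_pow₀ hE2 (by norm_num)
      rw [show (3 : ℝ) / E = 1 / E + 2 / E by ring]
      linarith
    calc 2 * q.den * (1 / E + δ) ≤ 2 * q.den * (3 / E) := by gcongr
      _ = 6 * q.den / E := by ring
      _ < 1 := (div_lt_one hE0).2 hE1
  rw [← key] at hpos hlt
  have h4 : 0 < (2 ^ 2 ^ j * q.num - 2 * q.den * I : ℤ) := by exact_mod_cast hpos
  have h5 : (2 ^ 2 ^ j * q.num - 2 * q.den * I : ℤ) < 1 := by exact_mod_cast hlt
  omega

/-- The phase `e^{2πix}`. -/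
noncomputable def cis (x : ℝ) : ℂ := Complex.exp ((2 * Real.pi * x : ℝ) * Complex.I)

theorem cis_add (x y : ℝ) : cis (x + y) = cis x * cis y := by
  rw [cis, cis, cis, ← Complex.exp_add]; push_cast; ring_nf

theorem cis_zero : cis 0 = 1 := by simp [cis]

theorem cis_sum {ι : Type} (s : Finset ι) (f : ι → ℝ) : cis (∑ i ∈ s, f i) = ∏ i ∈ s, cis (f i) := by
  classical
  induction s using Finset.induction_on with
  | empty => simp [cis_zero]
  | insert i s h ih => rw [Finset.sum_insert h, Finset.prod_insert h, cis_add, ih]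

theorem cis_int (n : ℤ) : cis n = 1 := by
  rw [cis, show ((2 * Real.pi * (n : ℝ) : ℝ) : ℂ) * Complex.I = n * (2 * Real.pi * Complex.I) by
    push_cast; ring]
  exact Complex.exp_int_mul_two_pi_mul_I n

theorem cis_half : cis (1 / 2) = -1 := by
  rw [cis, show ((2 * Real.pi * (1 / 2) : ℝ) : ℂ) = Real.pi by push_cast; ring]
  exact Complex.exp_pi_mul_I

theorem norm_cis (x : ℝ) : ‖cis x‖ = 1 := Complex.norm_exp_ofReal_mul_I _

theorem star_cis (x : ℝ) : star (cis x) = cis (-x) := by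
  rw [cis, cis, Complex.star_def, ← Complex.exp_conj, map_mul, Complex.conj_ofReal, Complex.conj_I]
  push_cast
  ring_nf

theorem norm_cis_sub_le {x y η : ℝ} {n : ℤ} (h : x - y = n + η) : ‖cis x - cis y‖ ≤ 2 * Real.pi * |η| := by
  have h1 : x = y + η + n := by linarith
  rw [h1, cis_add, cis_int, mul_one, cis_add, show cis y * cis η - cis y = cis y * (cis η - 1) by ring,
    norm_mul, norm_cis, one_mul, cis, mul_comm _ Complex.I]
  refine (Real.norm_exp_I_mul_ofReal_sub_one_le).trans_eq ?_
  rw [Real.norm_eq_abs, abs_mul, abs_of_pos (by positivity)]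

/-! ### Sums over multi-indices -/

theorem sum_range_mul {α : Type} [AddCommMonoid α] (f : ℕ → ℕ → α) (a b : ℕ) :
    ∑ s ∈ Finset.range (a * b), f (s / b) (s % b) =
      ∑ i ∈ Finset.range a, ∑ j ∈ Finset.range b, f i j := by
  induction a with
  | zero => simp
  | succ a ih =>
    rw [Nat.succ_mul, Finset.sum_range_add, ih, Finset.sum_range_succ]
    congr 1
    refine Finset.sum_congr rfl fun j hj => ?_
    have hj := Finset.mem_range.1 hj
    rw [show (a * b + j) / b = a by
      rw [mul_comm, Nat.mul_add_div (by omega), Nat.div_eq_of_lt hj, add_zero],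
      mul_comm, Nat.mul_add_mod, Nat.mod_eq_of_lt hj]

/-- The parity of the bits of `z` selected by `σ`. -/
def select (k σ : ℕ) (z : ℕ → Bool) : ℕ :=
  (∑ r ∈ Finset.range k, if σ / 2 ^ r % 2 = 1 then (z r).toNat else 0) % 2

theorem sum_select (k : ℕ) (z : ℕ → Bool) :
    2 * ∑ σ ∈ Finset.range (2 ^ k), select k σ z = if ∃ r < k, z r = true then 2 ^ k else 0 := by
  induction k with
  | zero => simp [select]
  | succ k ih =>
    have h1 : ∀ σ < 2 ^ k, ∀ v : ℕ, select (k + 1) (2 ^ k * v + σ) z =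
        (select k σ z + if v % 2 = 1 then (z k).toNat else 0) % 2 := by
      intro σ hσ v
      rw [select, Finset.sum_range_succ, select, Nat.mul_add_div (by positivity), Nat.div_eq_of_lt hσ,
        add_zero, Nat.mod_add_mod]
      congr 2
      refine Finset.sum_congr rfl fun r hr => ?_
      have hr := Finset.mem_range.1 hr
      rw [show 2 ^ k * v = 2 ^ r * (2 * (2 ^ (k - r - 1) * v)) by
        rw [← mul_assoc 2, ← pow_succ', ← mul_assoc, ← pow_add]; congr 2; omega,
        Nat.mul_add_div (by positivity), Nat.mul_add_mod]
    have h2 : ∀ σ, select k σ z < 2 := fun σ => Nat.mod_lt _ (by omega)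
    rw [pow_succ, mul_two, Finset.sum_range_add]
    have e1 : ∑ σ ∈ Finset.range (2 ^ k), select (k + 1) σ z = ∑ σ ∈ Finset.range (2 ^ k), select k σ z :=
      Finset.sum_congr rfl fun σ hσ => by
        have := h1 σ (Finset.mem_range.1 hσ) 0
        simp only [mul_zero, zero_add, Nat.zero_mod, zero_ne_one, if_false, add_zero] at this
        rw [this, Nat.mod_eq_of_lt (h2 σ)]
    have e2 : ∀ σ ∈ Finset.range (2 ^ k), select (k + 1) (2 ^ k + σ) z =
        (select k σ z + (z k).toNat) % 2 := fun σ hσ => by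
      have := h1 σ (Finset.mem_range.1 hσ) 1
      simpa using this
    rw [e1, Finset.sum_congr rfl e2]
    cases hz : z k with
    | false =>
      have : (∃ r < k + 1, z r = true) ↔ ∃ r < k, z r = true := by
        constructor
        · rintro ⟨r, hr, h⟩
          refine ⟨r, lt_of_le_of_ne (by omega) ?_, h⟩
          rintro rfl
          simp [hz] at h
        · rintro ⟨r, hr, h⟩
          exact ⟨r, by omega, h⟩
      simp only [this, Bool.toNat_false, add_zero]
      rw [Finset.sum_congr rfl fun σ _ => Nat.mod_eq_of_lt (h2 σ), mul_add, ih]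
      split_ifs <;> ring
    | true =>
      rw [if_pos ⟨k, by omega, hz⟩, ← Finset.sum_add_distrib, Finset.sum_congr rfl fun σ _ =>
        show select k σ z + (select k σ z + true.toNat) % 2 = 1 by
          have := h2 σ; rw [Bool.toNat_true]; omega]
      simp; ring

end QFan

namespace QFan

/-- The sign encoded by `0`, `1` or `2`. -/
def signVal (s : ℕ) : ℤ := if s = 1 then 1 else if s = 2 then -1 else 0

/-- The bit in a slot; an empty slot is `0` and wire `i` is `i + 1`. -/
def slotVal (v : ℕ → Bool) (i : ℕ) : ℕ := if i = 0 then 0 else (v (i - 1)).toNat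

/-- The parity of the bits in the slots of a term. -/
def par (A : ℕ) (slot : ℕ → ℕ) (v : ℕ → Bool) : ℕ := (∑ p ∈ Finset.range A, slotVal v (slot p)) % 2

/-- The signed sum of the parities of `T` terms. -/
def phaseSum (T A : ℕ) (sign : ℕ → ℕ) (slot : ℕ → ℕ → ℕ) (v : ℕ → Bool) : ℤ :=
  ∑ s ∈ Finset.range T, signVal (sign s) * par A (slot s) v

/-- Gates for symmetric functions: gate number `g < Λ` acts, if `act g`, on the inputs
`inp g 0, …, inp g (cnt g - 1)`, and flips `y g` for every `j < Λ + 2` with `J g j` that is not the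
number of ones. -/
structure Sym where
  M : ℕ
  Λ : ℕ
  k : ℕ
  act : ℕ → Bool
  cnt : ℕ → ℕ
  inp : ℕ → ℕ → ℕ
  y : ℕ → ℕ
  J : ℕ → ℕ → Bool

namespace Sym

variable (S : Sym)

def E : ℕ := 2 ^ (S.k + 1)
def pairs : ℕ := S.Λ * (S.Λ + 2)
def gOf (c : ℕ) : ℕ := c / (S.Λ + 2)
def jOf (c : ℕ) : ℕ := c % (S.Λ + 2)
def on (c : ℕ) : Bool := S.act (S.gOf c) && S.J (S.gOf c) (S.jOf c)

/-- The number of control qubits. -/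
def ctls : ℕ := S.pairs * S.k

/-- The number of ones among the inputs of gate `g`. -/
def ones (v : ℕ → Bool) (g : ℕ) : ℕ := ∑ i ∈ Finset.range (S.cnt g), (v (S.inp g i)).toNat

/-- The number of terms of the first phase. -/
def pT : ℕ := S.ctls * (S.Λ + 2) * 5 * (S.E * S.E)

def pSign' (c i t μ : ℕ) : ℕ :=
  if S.on (c / S.k) = true ∧ μ < 2 ^ (c % S.k) * S.E ∧
      (if t < 3 then i < S.cnt (S.gOf (c / S.k)) else i < S.jOf (c / S.k)) then
    (if t = 0 ∨ t = 2 then 1 else 2) else 0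

def pSlot' (c i t p : ℕ) : ℕ :=
  if p = 0 then (if t < 2 then S.inp (S.gOf (c / S.k)) i + 1 else S.M + c + 1)
  else if p = 1 ∧ t = 1 then S.M + c + 1 else 0

def pSign (s : ℕ) : ℕ :=
  S.pSign' (s / (S.E * S.E) / 5 / (S.Λ + 2)) (s / (S.E * S.E) / 5 % (S.Λ + 2)) (s / (S.E * S.E) % 5)
    (s % (S.E * S.E))

def pSlot (s : ℕ) : ℕ → ℕ :=
  S.pSlot' (s / (S.E * S.E) / 5 / (S.Λ + 2)) (s / (S.E * S.E) / 5 % (S.Λ + 2)) (s / (S.E * S.E) % 5)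

/-- The number of terms of the second phase. -/
def qT : ℕ := S.pairs * 2 ^ S.k * 3 * S.E

def qSign' (c t : ℕ) : ℕ := if S.on c = true then (if t < 2 then 1 else 2) else 0

def qSlot' (c σ t p : ℕ) : ℕ :=
  if p < S.k then (if t ≠ 0 ∧ σ / 2 ^ p % 2 = 1 then S.M + (c * S.k + p) + 1 else 0)
  else if p = S.k ∧ t ≠ 1 then S.y (S.gOf c) + 1 else 0

def qSign (s : ℕ) : ℕ := S.qSign' (s / S.E / 3 / 2 ^ S.k) (s / S.E % 3)

def qSlot (s : ℕ) : ℕ → ℕ := S.qSlot' (s / S.E / 3 / 2 ^ S.k) (s / S.E / 3 % 2 ^ S.k) (s / S.E % 3)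

theorem sum_ite_lt {α : Type} [AddCommMonoid α] {a b : ℕ} (h : a ≤ b) (f : ℕ → α) :
    (∑ i ∈ Finset.range b, if i < a then f i else 0) = ∑ i ∈ Finset.range a, f i := by
  rw [← Finset.sum_filter]
  refine Finset.sum_congr ?_ fun _ _ => rfl
  ext i
  simp only [Finset.mem_filter, Finset.mem_range]
  omega

theorem pPar (v : ℕ → Bool) (c i t : ℕ) : par (S.k + 2) (S.pSlot' c i t) v =
    if t < 2 then ((v (S.inp (S.gOf (c / S.k)) i)).toNat + if t = 1 then (v (S.M + c)).toNat else 0) % 2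
    else (v (S.M + c)).toNat := by
  rw [par, Finset.sum_range_succ', Finset.sum_range_succ', Finset.sum_eq_zero fun p _ => by
    rw [pSlot', if_neg (by omega), if_neg (by omega)]; rfl]
  have hb : ∀ b : Bool, b.toNat % 2 = b.toNat := by decide
  by_cases h2 : t < 2
  · by_cases h1 : t = 1
    · subst h1; simp [pSlot', slotVal, add_comm]
    · obtain rfl : t = 0 := by omega
      simp [pSlot', slotVal]
  · have h1 : t ≠ 1 := by omega
    simp [pSlot', slotVal, h2, h1, hb]

theorem sum_p (v : ℕ → Bool) (hcnt : ∀ g, S.act g = true → S.cnt g ≤ S.Λ) :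
    phaseSum S.pT (S.k + 2) S.pSign S.pSlot v =
      ∑ c ∈ Finset.range S.ctls, if S.on (c / S.k) = true ∧ v (S.M + c) = true then
        2 ^ (c % S.k) * (S.E : ℤ) * (2 * ((S.ones v (S.gOf (c / S.k)) : ℤ) - S.jOf (c / S.k))) else 0 := by
  rw [phaseSum, pT]
  have h1 := sum_range_mul (fun s μ => signVal (S.pSign' (s / 5 / (S.Λ + 2)) (s / 5 % (S.Λ + 2)) (s % 5) μ) *
    (par (S.k + 2) (S.pSlot' (s / 5 / (S.Λ + 2)) (s / 5 % (S.Λ + 2)) (s % 5)) v : ℤ))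
    (S.ctls * (S.Λ + 2) * 5) (S.E * S.E)
  have h2 := sum_range_mul (fun s t => ∑ μ ∈ Finset.range (S.E * S.E),
    signVal (S.pSign' (s / (S.Λ + 2)) (s % (S.Λ + 2)) t μ) *
    (par (S.k + 2) (S.pSlot' (s / (S.Λ + 2)) (s % (S.Λ + 2)) t) v : ℤ)) (S.ctls * (S.Λ + 2)) 5
  have h3 := sum_range_mul (fun c i => ∑ t ∈ Finset.range 5, ∑ μ ∈ Finset.range (S.E * S.E),
    signVal (S.pSign' c i t μ) * (par (S.k + 2) (S.pSlot' c i t) v : ℤ)) S.ctls (S.Λ + 2)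
  refine (h1.trans (h2.trans h3)).trans (Finset.sum_congr rfl fun c hc => ?_)
  have hc := Finset.mem_range.1 hc
  have hk : 0 < S.k := by
    rcases Nat.eq_zero_or_pos S.k with h | h
    · simp [ctls, h] at hc
    · exact h
  set g := S.gOf (c / S.k) with hg
  set j := S.jOf (c / S.k) with hj
  set r := c % S.k with hr
  have hrk : r < S.k := Nat.mod_lt _ hk
  by_cases hon : S.on (c / S.k) = true
  swap
  · rw [if_neg fun h => hon h.1]
    refine Finset.sum_eq_zero fun i _ => Finset.sum_eq_zero fun t _ => Finset.sum_eq_zero fun μ _ => ?_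
    rw [pSign', if_neg fun h => hon h.1]
    simp [signVal]
  have hact : S.act g = true := by
    rw [on, Bool.and_eq_true] at hon
    exact hon.1
  have hjl : j < S.Λ + 2 := Nat.mod_lt _ (by omega)
  have hμ : 2 ^ r * S.E ≤ S.E * S.E :=
    Nat.mul_le_mul_right _ (Nat.pow_le_pow_right (by omega) (by omega))
  have hinner : ∀ i t, ∑ μ ∈ Finset.range (S.E * S.E),
      signVal (S.pSign' c i t μ) * (par (S.k + 2) (S.pSlot' c i t) v : ℤ) =
      2 ^ r * S.E * (if (if t < 3 then i < S.cnt g else i < j) then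
        (if t = 0 ∨ t = 2 then 1 else -1) * (par (S.k + 2) (S.pSlot' c i t) v : ℤ) else 0) := by
    intro i t
    have : ∀ μ ∈ Finset.range (S.E * S.E), signVal (S.pSign' c i t μ) * (par (S.k + 2) (S.pSlot' c i t) v : ℤ) =
        if μ < 2 ^ r * S.E then (if (if t < 3 then i < S.cnt g else i < j) then
        (if t = 0 ∨ t = 2 then 1 else -1) * (par (S.k + 2) (S.pSlot' c i t) v : ℤ) else 0) else 0 := by
      intro μ _
      simp only [pSign', hon, true_and, ← hg, ← hj, ← hr]
      by_cases h1 : μ < 2 ^ r * S.E <;> by_cases h2 : (if t < 3 then i < S.cnt g else i < j) <;>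
        by_cases h3 : t = 0 ∨ t = 2 <;> simp [h1, h2, h3, signVal]
    rw [Finset.sum_congr rfl this, sum_ite_lt hμ]
    simp
  simp only [hinner]
  set z := (v (S.M + c)).toNat with hz
  have hz2 : z = 0 ∨ z = 1 := by rw [hz]; cases v (S.M + c) <;> simp
  have h5 : ∀ i ∈ Finset.range (S.Λ + 2), ∑ t ∈ Finset.range 5, 2 ^ r * (S.E : ℤ) *
      (if (if t < 3 then i < S.cnt g else i < j) then
        (if t = 0 ∨ t = 2 then 1 else -1) * (par (S.k + 2) (S.pSlot' c i t) v : ℤ) else 0) =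
      2 ^ r * S.E * ((if i < S.cnt g then 2 * z * ((v (S.inp g i)).toNat : ℤ) else 0) -
        if i < j then 2 * (z : ℤ) else 0) := by
    intro i _
    rw [← Finset.mul_sum]
    congr 1
    simp only [Finset.sum_range_succ, Finset.sum_range_zero, pPar, ← hg, ← hz]
    norm_num
    set x := (v (S.inp g i)).toNat with hx
    have hx2 : x = 0 ∨ x = 1 := by rw [hx]; cases v (S.inp g i) <;> simp
    rcases hz2 with h | h <;> rcases hx2 with h' | h' <;> rw [h, h'] <;> split_ifs <;> norm_num
  rw [Finset.sum_congr rfl h5, ← Finset.mul_sum, Finset.sum_sub_distrib,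
    sum_ite_lt (show S.cnt g ≤ S.Λ + 2 by have := hcnt g hact; omega), sum_ite_lt hjl.le,
    ← Finset.mul_sum, Finset.sum_const, Finset.card_range, nsmul_eq_mul]
  have hw : (S.ones v g : ℤ) = ∑ i ∈ Finset.range (S.cnt g), ((v (S.inp g i)).toNat : ℤ) := by
    rw [ones]; push_cast; rfl
  rw [← hw]
  by_cases hv : v (S.M + c) = true
  · rw [if_pos ⟨hon, hv⟩, hz, hv]; push_cast [Bool.toNat_true]; ring
  · rw [if_neg fun h => hv h.2, hz, Bool.eq_false_of_not_eq_true hv]; simp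

theorem qPar (v : ℕ → Bool) (c σ t : ℕ) : par (S.k + 2) (S.qSlot' c σ t) v =
    ((if t ≠ 0 then select S.k σ (fun r => v (S.M + (c * S.k + r))) else 0) +
      if t ≠ 1 then (v (S.y (S.gOf c))).toNat else 0) % 2 := by
  rw [par, Finset.sum_range_succ, Finset.sum_range_succ]
  have h1 : slotVal v (S.qSlot' c σ t (S.k + 1)) = 0 := by simp [qSlot', slotVal]
  have h2 : slotVal v (S.qSlot' c σ t S.k) = if t ≠ 1 then (v (S.y (S.gOf c))).toNat else 0 := by
    by_cases h : t = 1 <;> simp [qSlot', slotVal, h]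
  have h3 : ∑ p ∈ Finset.range S.k, slotVal v (S.qSlot' c σ t p) = if t ≠ 0 then
      ∑ r ∈ Finset.range S.k, if σ / 2 ^ r % 2 = 1 then (v (S.M + (c * S.k + r))).toNat else 0 else 0 := by
    by_cases h : t = 0
    · rw [if_neg (by simpa using h)]
      refine Finset.sum_eq_zero fun p hp => ?_
      rw [qSlot', if_pos (Finset.mem_range.1 hp), if_neg fun h' => h'.1 h]; rfl
    · rw [if_pos h]
      refine Finset.sum_congr rfl fun p hp => ?_
      rw [qSlot', if_pos (Finset.mem_range.1 hp)]
      by_cases h' : σ / 2 ^ p % 2 = 1 <;> simp [h, h', slotVal]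
  rw [h1, h2, h3, add_zero, select]
  split_ifs <;> simp

theorem sum_q (v : ℕ → Bool) :
    phaseSum S.qT (S.k + 2) S.qSign S.qSlot v =
      ∑ c ∈ Finset.range S.pairs, if S.on c = true ∧ v (S.y (S.gOf c)) = true ∧
        (∃ r < S.k, v (S.M + (c * S.k + r)) = true) then (S.E : ℤ) * 2 ^ S.k else 0 := by
  rw [phaseSum, qT]
  have h1 := sum_range_mul (fun s _ => signVal (S.qSign' (s / 3 / 2 ^ S.k) (s % 3)) *
    (par (S.k + 2) (S.qSlot' (s / 3 / 2 ^ S.k) (s / 3 % 2 ^ S.k) (s % 3)) v : ℤ))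
    (S.pairs * 2 ^ S.k * 3) S.E
  have h2 := sum_range_mul (fun s t => ∑ μ ∈ Finset.range S.E, signVal (S.qSign' (s / 2 ^ S.k) t) *
    (par (S.k + 2) (S.qSlot' (s / 2 ^ S.k) (s % 2 ^ S.k) t) v : ℤ)) (S.pairs * 2 ^ S.k) 3
  have h3 := sum_range_mul (fun c σ => ∑ t ∈ Finset.range 3, ∑ μ ∈ Finset.range S.E,
    signVal (S.qSign' c t) * (par (S.k + 2) (S.qSlot' c σ t) v : ℤ)) S.pairs (2 ^ S.k)
  refine (h1.trans (h2.trans h3)).trans (Finset.sum_congr rfl fun c _ => ?_)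
  by_cases hon : S.on c = true
  swap
  · rw [if_neg fun h => hon h.1]
    refine Finset.sum_eq_zero fun i _ => Finset.sum_eq_zero fun t _ => Finset.sum_eq_zero fun μ _ => ?_
    rw [qSign', if_neg hon]
    simp [signVal]
  set z : ℕ → Bool := fun r => v (S.M + (c * S.k + r))
  set u := (v (S.y (S.gOf c))).toNat with hu
  have hu2 : u = 0 ∨ u = 1 := by rw [hu]; cases v (S.y (S.gOf c)) <;> simp
  have h4 : ∀ σ ∈ Finset.range (2 ^ S.k), ∑ t ∈ Finset.range 3, ∑ μ ∈ Finset.range S.E,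
      signVal (S.qSign' c t) * (par (S.k + 2) (S.qSlot' c σ t) v : ℤ) =
      S.E * u * (2 * select S.k σ z : ℕ) := by
    intro σ _
    have hp : ∀ t, par (S.k + 2) (S.qSlot' c σ t) v =
        ((if t ≠ 0 then select S.k σ z else 0) + if t ≠ 1 then u else 0) % 2 := S.qPar v c σ
    simp only [Finset.sum_const, Finset.card_range, nsmul_eq_mul, Finset.sum_range_succ,
      Finset.sum_range_zero, hp, qSign', hon]
    have hs : select S.k σ z = 0 ∨ select S.k σ z = 1 := by
      have : select S.k σ z < 2 := Nat.mod_lt _ (by omega)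
      omega
    rcases hu2 with h | h <;> rcases hs with h' | h' <;> simp only [h, h'] <;> norm_num [signVal]; ring
  rw [Finset.sum_congr rfl h4, ← Finset.mul_sum, ← Nat.cast_sum, ← Finset.mul_sum, sum_select]
  by_cases hy : v (S.y (S.gOf c)) = true
  · by_cases he : ∃ r < S.k, z r = true
    · rw [if_pos he, if_pos ⟨hon, hy, he⟩, hu, hy]; simp
    · rw [if_neg he, if_neg fun h => he h.2.2]; simp
  · rw [if_neg (c := _ ∧ _ ∧ _) fun h => hy h.2.1, hu, Bool.eq_false_of_not_eq_true hy]
    simp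

end Sym
end QFan

namespace QFan

/-- Qubit number `i`. -/
def wire (N : ℕ) [NeZero N] (i : ℕ) : Fin N := Fin.ofNat N i

/-- Bit number `i`. -/
def bit {N : ℕ} [NeZero N] (b : Bits N) (i : ℕ) : Bool := b (wire N i)

variable {N : ℕ} [NeZero N]

theorem wire_val {i : ℕ} (h : i < N) : (wire N i : ℕ) = i := Nat.mod_eq_of_lt h

theorem wire_inj {i j : ℕ} (hi : i < N) (hj : j < N) : wire N i = wire N j ↔ i = j := by
  rw [Fin.ext_iff, wire_val hi, wire_val hj]

theorem bit_update {b : Bits N} {i : Fin N} {v : Bool} {m : ℕ} (hm : m < N) (h : m ≠ i) :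
    bit (Function.update b i v) m = bit b m := by
  rw [bit, Function.update_of_ne, bit]
  intro e
  exact h (by rw [← e, wire_val hm])

theorem exists_odd_part : ∀ (k : ℕ) (d : ℤ), d ≠ 0 → |d| < 2 ^ k →
    ∃ r < k, ∃ m : ℤ, d * 2 ^ r * 2 = (2 * m + 1) * 2 ^ k
  | 0, d, h0, h => by
    rw [pow_zero, Int.abs_lt_one_iff] at h
    exact absurd h h0
  | k + 1, d, h0, h => by
    rcases Int.even_or_odd' d with ⟨m, rfl | rfl⟩
    · obtain ⟨r, hr, m', h'⟩ := exists_odd_part k m (by rintro rfl; simp at h0) (by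
        rw [abs_mul, pow_succ] at h
        have : |(2 : ℤ)| = 2 := rfl
        rw [this] at h
        linarith)
      exact ⟨r, by omega, m', by rw [pow_succ]; linear_combination 2 * h'⟩
    · exact ⟨k, by omega, m, by rw [pow_succ]; ring⟩

theorem prod_range_filter (act : ℕ → Bool) (h : ℕ → ℂ) (n : ℕ) :
    ∏ g ∈ Finset.range n, (if act g = true then h g else 1) =
      (((List.range n).filter act).map h).prod := by
  induction n with
  | zero => simp
  | succ n ih =>
    rw [Finset.prod_range_succ, ih, List.range_succ, List.filter_append, List.map_append,
      List.prod_append]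
    congr 1
    by_cases hn : act n = true <;> simp [hn]

theorem cis_nat_half (n : ℕ) : cis (n / 2) = sgn (decide (n % 2 = 1)) := by
  rcases Nat.even_or_odd' n with ⟨m, rfl | rfl⟩
  · rw [show ((2 * m : ℕ) : ℝ) / 2 = ((m : ℤ) : ℝ) by push_cast; ring, cis_int]
    simp [sgn]
  · rw [show ((2 * m + 1 : ℕ) : ℝ) / 2 = ((m : ℤ) : ℝ) + 1 / 2 by push_cast; ring, cis_add, cis_int,
      cis_half]
    simp [sgn, Nat.add_mod]

namespace Sym

variable (S : Sym)

/-- The gates are well-formed and act on disjoint sets of qubits. -/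
structure Valid : Prop where
  lt : ∀ g, S.act g = true → g < S.Λ
  cnt_le : ∀ g, S.act g = true → S.cnt g ≤ S.Λ
  inp_lt : ∀ g, S.act g = true → ∀ i < S.cnt g, S.inp g i < S.M
  y_lt : ∀ g, S.act g = true → S.y g < S.M
  inp_ne : ∀ g, S.act g = true → ∀ g', S.act g' = true → ∀ i < S.cnt g, S.inp g i ≠ S.y g'
  y_inj : ∀ g, S.act g = true → ∀ g', S.act g' = true → S.y g = S.y g' → g = g'

def gates : List ℕ := (List.range S.Λ).filter S.act

theorem mem_gates {S : Sym} (hS : S.Valid) {g : ℕ} : g ∈ S.gates ↔ S.act g = true := by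
  simp only [gates, List.mem_filter, List.mem_range, and_iff_right_iff_imp]
  exact hS.lt g

/-- Whether gate `g` flips its target, for `w` ones among its inputs. -/
def flips (g w : ℕ) : Bool :=
  decide ((∑ j ∈ Finset.range (S.Λ + 2), if S.J g j = true ∧ w ≠ j then 1 else 0) % 2 = 1)

/-- The flip of the target of gate `g`. -/
noncomputable def flipOp (N : ℕ) [NeZero N] (g : ℕ) : Op N :=
  classicalOp (flipIf (wire N (S.y g)) fun b => S.flips g (S.ones (bit b) g))

/-- The operator that the gates perform. -/
noncomputable def op (N : ℕ) [NeZero N] : Op N := (S.gates.map (S.flipOp N)).prod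

/-- The control qubits. -/
def C (N : ℕ) : Finset (Fin N) := {i | S.M ≤ i ∧ (i : ℕ) < S.M + S.ctls}

/-- The target qubits. -/
def Y (N : ℕ) [NeZero N] : Finset (Fin N) := (S.gates.map fun g => wire N (S.y g)).toFinset

noncomputable def fraction (c w : ℕ) : ℝ := ((w : ℝ) - S.jOf (c / S.k)) * 2 ^ (c % S.k) / 2 ^ S.k

noncomputable def φ (N : ℕ) [NeZero N] (i : Fin N) (b : Bits N) : ℂ :=
  if S.on ((i - S.M) / S.k) = true then
    cis (S.fraction (i - S.M) (S.ones (bit b) (S.gOf ((i - S.M) / S.k)))) else 1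

theorem jOf_lt (c : ℕ) : S.jOf c < S.Λ + 2 := Nat.mod_lt _ (by omega)

variable {S}

theorem on_act {c : ℕ} (h : S.on c = true) : S.act (S.gOf c) = true := by
  rw [on, Bool.and_eq_true] at h
  exact h.1

theorem ones_congr {v v' : ℕ → Bool} {g : ℕ}
    (h : ∀ i < S.cnt g, v (S.inp g i) = v' (S.inp g i)) : S.ones v g = S.ones v' g :=
  Finset.sum_congr rfl fun i hi => by rw [h i (Finset.mem_range.1 hi)]

theorem ones_le (hS : S.Valid) {v : ℕ → Bool} {g : ℕ} (hg : S.act g = true) : S.ones v g ≤ S.Λ := by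
  refine (Finset.sum_le_card_nsmul _ _ 1 fun i _ => ?_).trans (by simpa using hS.cnt_le g hg)
  cases v (S.inp g i) <;> simp

theorem ones_update (hS : S.Valid) (hN : S.M ≤ N) {g : ℕ} (hg : S.act g = true) {i : Fin N}
    (hi : ∀ m < S.cnt g, S.inp g m ≠ i) (b : Bits N) (v : Bool) :
    S.ones (bit (Function.update b i v)) g = S.ones (bit b) g :=
  ones_congr fun m hm => bit_update ((hS.inp_lt g hg m hm).trans_le hN) (hi m hm)

theorem ones_free (hS : S.Valid) (hN : S.M ≤ N) {g : ℕ} (hg : S.act g = true) :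
    Free (S.C N) fun b : Bits N => S.ones (bit b) g := fun i hi b v =>
  ones_update hS hN hg (fun m hm => by
    have := hS.inp_lt g hg m hm
    simp only [C, Finset.mem_filter] at hi
    omega) b v

theorem mem_C {c : ℕ} (hN : S.M + S.ctls ≤ N) (hc : c < S.ctls) :
    wire N (S.M + c) ∈ S.C N ∧ (wire N (S.M + c) : ℕ) - S.M = c := by
  have := wire_val (N := N) (i := S.M + c) (by omega)
  simp only [C, Finset.mem_filter, Finset.mem_univ, true_and, this]
  omega

theorem ctrl_eq (hN : S.M + S.ctls ≤ N) (b : Bits N) : ctrl (S.C N) (S.φ N) b =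
    cis (∑ c ∈ Finset.range S.ctls, if S.on (c / S.k) = true ∧ bit b (S.M + c) = true then
      S.fraction c (S.ones (bit b) (S.gOf (c / S.k))) else 0) := by
  rw [cis_sum, ctrl]
  refine Finset.prod_nbij' (fun i => (i : ℕ) - S.M) (fun c => wire N (S.M + c)) (fun i hi => ?_)
    (fun c hc => (mem_C hN (Finset.mem_range.1 hc)).1) (fun i hi => ?_)
    (fun c hc => (mem_C hN (Finset.mem_range.1 hc)).2) fun i hi => ?_
  all_goals
    simp only [C, Finset.mem_filter, Finset.mem_univ, true_and] at hi
  · rw [Finset.mem_range]; omega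
  · refine Fin.ext ?_
    rw [wire_val] <;> omega
  · have : bit b (S.M + (i - S.M)) = b i := by
      rw [bit]
      congr 1
      refine Fin.ext ?_
      rw [wire_val] <;> omega
    rw [this, φ]
    by_cases h1 : S.on ((i - S.M) / S.k) = true <;> by_cases h2 : b i = true <;>
      simp [h1, h2, cis_zero]

theorem estimated_iff (hS : S.Valid) (hN : S.M + S.ctls ≤ N) (hΛ : S.Λ + 2 ≤ 2 ^ S.k) {b : Bits N}
    (hb : Estimated (S.C N) (S.φ N) b) {c : ℕ} (hc : c < S.pairs) (hon : S.on c = true) :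
    (∃ r < S.k, bit b (S.M + (c * S.k + r)) = true) ↔ S.ones (bit b) (S.gOf c) ≠ S.jOf c := by
  have hlt : ∀ r < S.k, c * S.k + r < S.ctls := fun r hr => by
    rw [ctls]
    calc c * S.k + r < c * S.k + S.k := by omega
      _ = (c + 1) * S.k := by ring
      _ ≤ S.pairs * S.k := Nat.mul_le_mul_right _ hc
  have hφ : ∀ r < S.k, S.φ N (wire N (S.M + (c * S.k + r))) b =
      cis (((S.ones (bit b) (S.gOf c) : ℝ) - S.jOf c) * 2 ^ r / 2 ^ S.k) := fun r hr => by
    have h1 : (c * S.k + r) / S.k = c := by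
      rw [mul_comm, Nat.mul_add_div (by omega), Nat.div_eq_of_lt hr, add_zero]
    have h2 : (c * S.k + r) % S.k = r := by
      rw [mul_comm, Nat.mul_add_mod, Nat.mod_eq_of_lt hr]
    rw [φ, (mem_C hN (hlt r hr)).2, fraction, h1, h2, if_pos hon]
  constructor
  · rintro ⟨r, hr, h⟩ he
    have := (hb _ (mem_C hN (hlt r hr)).1).1 (by rw [hφ r hr, he]; simp [cis_zero])
    rw [bit, this] at h
    exact Bool.false_ne_true h
  · intro hne
    obtain ⟨r, hr, m, hm⟩ := exists_odd_part S.k ((S.ones (bit b) (S.gOf c) : ℤ) - S.jOf c) (by omega) (by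
      have h1 := ones_le hS (v := bit b) (on_act hon)
      have h2 := S.jOf_lt c
      have h3 : ((S.Λ + 2 : ℕ) : ℤ) ≤ 2 ^ S.k := by exact_mod_cast hΛ
      rw [abs_lt]
      push_cast at h3
      omega)
    refine ⟨r, hr, (hb _ (mem_C hN (hlt r hr)).1).2 ?_⟩
    have hm' : ((S.ones (bit b) (S.gOf c) : ℝ) - S.jOf c) * 2 ^ r * 2 = (2 * m + 1) * 2 ^ S.k := by
      exact_mod_cast hm
    have h4 : ((S.ones (bit b) (S.gOf c) : ℝ) - S.jOf c) * 2 ^ r / 2 ^ S.k = (m : ℤ) + 1 / 2 := by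
      have : (2 : ℝ) ^ S.k ≠ 0 := by positivity
      field_simp
      linear_combination hm'
    rw [hφ r hr, h4, cis_add, cis_int, cis_half, one_mul]

/-- The ideal second phase. -/
noncomputable def ideal (S : Sym) (N : ℕ) [NeZero N] (b : Bits N) : ℂ :=
  cis (∑ c ∈ Finset.range S.pairs, if S.on c = true ∧ bit b (S.y (S.gOf c)) = true ∧
    (∃ r < S.k, bit b (S.M + (c * S.k + r)) = true) then 1 / 2 else 0)

theorem ideal_eq (hS : S.Valid) (hN : S.M + S.ctls ≤ N) (hΛ : S.Λ + 2 ≤ 2 ^ S.k) {b : Bits N}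
    (hb : Estimated (S.C N) (S.φ N) b) : S.ideal N b =
      (S.gates.map fun g => sgn (b (wire N (S.y g)) && S.flips g (S.ones (bit b) g))).prod := by
  obtain ⟨F, hF⟩ : ∃ F : ℕ → ℕ → ℝ, ∀ g j, F g j = if S.act g = true ∧ bit b (S.y g) = true ∧
    S.J g j = true ∧ S.ones (bit b) g ≠ j then (1 / 2 : ℝ) else 0 := ⟨_, fun _ _ => rfl⟩
  have h1 : ∀ c ∈ Finset.range S.pairs, (if S.on c = true ∧ bit b (S.y (S.gOf c)) = true ∧
      (∃ r < S.k, bit b (S.M + (c * S.k + r)) = true) then (1 / 2 : ℝ) else 0) =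
      F (c / (S.Λ + 2)) (c % (S.Λ + 2)) := by
    intro c hc
    rw [hF]
    refine if_congr ?_ rfl rfl
    by_cases hon : S.on c = true
    · rw [estimated_iff hS hN hΛ hb (Finset.mem_range.1 hc) hon]
      simp only [hon, true_and]
      simp only [on, Bool.and_eq_true, gOf, jOf] at hon ⊢
      tauto
    · simp only [hon, Bool.false_eq_true, false_and, false_iff]
      simp only [on, Bool.and_eq_true, gOf, jOf] at hon
      tauto
  rw [ideal, Finset.sum_congr rfl h1, pairs, sum_range_mul F, cis_sum, gates, ← prod_range_filter]
  refine Finset.prod_congr rfl fun g _ => ?_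
  simp only [hF]
  by_cases ha : S.act g = true
  · by_cases hy : b (wire N (S.y g)) = true
    · have hy' : bit b (S.y g) = true := hy
      simp only [ha, hy, hy', true_and, if_true, Bool.true_and, flips]
      rw [← cis_nat_half]
      push_cast
      rw [Finset.sum_div]
      congr 1
      refine Finset.sum_congr rfl fun j _ => ?_
      split_ifs <;> simp
    · have hy' : ¬ bit b (S.y g) = true := hy
      simp [hy', Bool.eq_false_of_not_eq_true hy, sgn, cis_zero]
  · simp [ha, cis_zero]

end Sym
end QFan

namespace QFan

variable {N : ℕ}

/-- Only the first `M` qubits may be in a state other than `|0⟩`. -/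
def Clean (M : ℕ) (b : Bits N) : Prop := ∀ i : Fin N, M ≤ i → b i = false

theorem Clean.free {M : ℕ} {W : Finset (Fin N)} (h : ∀ i ∈ W, (i : ℕ) < M) :
    Free W (Clean M : Bits N → Prop) := fun i hi b v => by
  refine propext (forall_congr' fun j => ?_)
  by_cases hj : M ≤ j
  · rw [Function.update_of_ne]
    rintro rfl
    have := h _ hi
    omega
  · simp [hj]

theorem clean_iff {M c : ℕ} {b : Bits N} {C : Finset (Fin N)}
    (hC : ∀ i : Fin N, i ∈ C ↔ M ≤ i ∧ (i : ℕ) < M + c) :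
    Clean M b ↔ Clean (M + c) b ∧ ∀ i ∈ C, b i = false := by
  simp only [hC]
  constructor
  · exact fun h => ⟨fun i hi => h i (by omega), fun i hi => h i hi.1⟩
  · rintro ⟨h1, h2⟩ i hi
    by_cases h : M + c ≤ i
    · exact h1 i h
    · exact h2 i ⟨hi, by omega⟩

theorem Sym.mem_C_iff {S : Sym} (i : Fin N) : i ∈ S.C N ↔ S.M ≤ i ∧ (i : ℕ) < S.M + S.ctls := by
  simp [Sym.C]

variable [NeZero N]

namespace Sym

variable {S : Sym}

theorem phase_p {j : ℕ} (hj : S.k + 1 = 2 ^ j) (hS : S.Valid) (v : ℕ → Bool) :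
    ∃ (n : ℤ) (η : ℝ), tau * phaseSum S.pT (S.k + 2) S.pSign S.pSlot v -
      (∑ c ∈ Finset.range S.ctls, if S.on (c / S.k) = true ∧ v (S.M + c) = true then
        S.fraction c (S.ones v (S.gOf (c / S.k))) else 0) = n + η ∧
      |η| ≤ S.pairs * (S.Λ + 2) * (2 / (S.E : ℝ) ^ 2) := by
  obtain ⟨I, δ, h0, h1, h2⟩ := tau_approx j
  have hE : (S.E : ℝ) = 2 ^ 2 ^ j := by rw [E, hj]; push_cast; rfl
  have hE' : (S.E : ℝ) = 2 * 2 ^ S.k := by rw [E, pow_succ']; push_cast; rfl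
  rw [← hE] at h1 h2
  have hE0 : 0 < (S.E : ℝ) := by rw [hE]; positivity
  rw [S.sum_p v hS.cnt_le]
  set t : ℕ → Prop := fun c => S.on (c / S.k) = true ∧ v (S.M + c) = true
  set d : ℕ → ℤ := fun c => (S.ones v (S.gOf (c / S.k)) : ℤ) - S.jOf (c / S.k) with hd
  refine ⟨∑ c ∈ Finset.range S.ctls, if t c then 2 ^ (c % S.k) * 2 * d c * I else 0,
    ∑ c ∈ Finset.range S.ctls, if t c then 2 ^ (c % S.k) * 2 * d c * δ else 0, ?_, ?_⟩
  · push_cast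
    rw [Finset.mul_sum, ← Finset.sum_sub_distrib, ← Finset.sum_add_distrib]
    refine Finset.sum_congr rfl fun c _ => ?_
    by_cases ht : t c
    · rw [if_pos ht, if_pos ht, if_pos ht, if_pos ht, fraction]
      have e1 : ((d c : ℤ) : ℝ) = (S.ones v (S.gOf (c / S.k)) : ℝ) - S.jOf (c / S.k) := by
        rw [hd]; push_cast; rfl
      rw [← e1]
      have e2 : (2 : ℝ) / S.E = 1 / 2 ^ S.k := by
        rw [hE']
        have : (2 : ℝ) ^ S.k ≠ 0 := by positivity
        field_simp
      linear_combination (2 ^ (c % S.k) * 2 * (d c : ℝ)) * h2 + (2 ^ (c % S.k) * (d c : ℝ)) * e2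
    · rw [if_neg ht, if_neg ht, if_neg ht, if_neg ht]; simp
  · have hb : ∀ c ∈ Finset.range S.ctls, |if t c then 2 ^ (c % S.k) * 2 * (d c : ℝ) * δ else 0| ≤
        (fun _ r => 2 ^ r * (2 * (S.Λ + 2) * δ)) (c / S.k) (c % S.k) := by
      intro c _
      by_cases ht : t c
      · have hw := ones_le hS (v := v) (on_act ht.1)
        have hjl := S.jOf_lt (c / S.k)
        have hdc : |(d c : ℝ)| ≤ S.Λ + 2 := by
          have : |d c| ≤ S.Λ + 2 := by
            simp only [hd, abs_le]; omega
          exact_mod_cast this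
        simp only [if_pos ht]
        rw [abs_mul, abs_mul, abs_of_pos h0, abs_of_pos (by positivity : (0 : ℝ) < 2 ^ (c % S.k) * 2)]
        calc 2 ^ (c % S.k) * 2 * |(d c : ℝ)| * δ ≤ 2 ^ (c % S.k) * 2 * (S.Λ + 2) * δ := by gcongr
          _ = _ := by ring
      · rw [if_neg ht, abs_zero]; positivity
    refine (Finset.abs_sum_le_sum_abs _ _).trans ((Finset.sum_le_sum hb).trans ?_)
    rw [ctls, sum_range_mul fun _ r => (2 : ℝ) ^ r * (2 * (S.Λ + 2) * δ), Finset.sum_const,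
      Finset.card_range, nsmul_eq_mul, ← Finset.sum_mul, geom_sum_eq (by norm_num)]
    have e3 : ((2 : ℝ) ^ S.k - 1) / (2 - 1) ≤ S.E / 2 := by rw [hE']; norm_num
    calc (S.pairs : ℝ) * (((2 : ℝ) ^ S.k - 1) / (2 - 1) * (2 * (S.Λ + 2) * δ))
        ≤ S.pairs * (S.E / 2 * (2 * (S.Λ + 2) * (2 / (S.E : ℝ) ^ 3))) := by gcongr
      _ = _ := by field_simp

theorem phase_q {j : ℕ} (hj : S.k + 1 = 2 ^ j) (b : Bits N) :
    ‖cis (tau * phaseSum S.qT (S.k + 2) S.qSign S.qSlot (bit b)) - S.ideal N b‖ ≤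
      2 * Real.pi * (S.pairs / (S.E : ℝ) ^ 2) := by
  obtain ⟨I, δ, h0, h1, h2⟩ := tau_approx j
  have hE : (S.E : ℝ) = 2 ^ 2 ^ j := by rw [E, hj]; push_cast; rfl
  have hE' : (S.E : ℝ) = 2 * 2 ^ S.k := by rw [E, pow_succ']; push_cast; rfl
  rw [← hE] at h1 h2
  have hE0 : 0 < (S.E : ℝ) := by rw [hE]; positivity
  rw [S.sum_q, ideal]
  set t : ℕ → Prop := fun c => S.on c = true ∧ bit b (S.y (S.gOf c)) = true ∧
    ∃ r < S.k, bit b (S.M + (c * S.k + r)) = true with ht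
  have key := norm_cis_sub_le
    (x := tau * ((∑ c ∈ Finset.range S.pairs, if t c then (S.E : ℤ) * 2 ^ S.k else 0 : ℤ) : ℝ))
    (y := ∑ c ∈ Finset.range S.pairs, if t c then (1 / 2 : ℝ) else 0)
    (n := ∑ c ∈ Finset.range S.pairs, if t c then 2 ^ S.k * I else 0)
    (η := ∑ c ∈ Finset.range S.pairs, if t c then 2 ^ S.k * δ else 0) (by
      push_cast
      rw [Finset.mul_sum, ← Finset.sum_sub_distrib, ← Finset.sum_add_distrib]
      refine Finset.sum_congr rfl fun c _ => ?_
      by_cases htc : t c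
      · rw [if_pos htc, if_pos htc, if_pos htc, if_pos htc]
        have e2 : (2 : ℝ) ^ S.k * (1 / S.E) = 1 / 2 := by
          rw [hE']
          have : (2 : ℝ) ^ S.k ≠ 0 := by positivity
          field_simp
        linear_combination (2 : ℝ) ^ S.k * h2 + e2
      · simp [if_neg htc])
  refine key.trans (mul_le_mul_of_nonneg_left ?_ (by positivity))
  refine (Finset.abs_sum_le_sum_abs _ _).trans ?_
  refine (Finset.sum_le_card_nsmul _ _ (1 / (S.E : ℝ) ^ 2) fun c _ => ?_).trans_eq ?_
  · by_cases htc : t c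
    · rw [if_pos htc, abs_of_pos (by positivity)]
      calc 2 ^ S.k * δ ≤ 2 ^ S.k * (2 / (S.E : ℝ) ^ 3) := by gcongr
        _ = 1 / (S.E : ℝ) ^ 2 := by rw [show (2 : ℝ) ^ S.k = S.E / 2 by rw [hE']; ring]; field_simp
    · rw [if_neg htc, abs_zero]; positivity
  · rw [Finset.card_range, nsmul_eq_mul]; ring

theorem mem_Y (hS : S.Valid) (hN : S.M ≤ N) {i : Fin N} (hi : i ∈ S.Y N) :
    ∃ g, S.act g = true ∧ (i : ℕ) = S.y g := by
  rw [Y, List.mem_toFinset, List.mem_map] at hi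
  obtain ⟨g, hg, rfl⟩ := hi
  have hg := (mem_gates hS).1 hg
  exact ⟨g, hg, wire_val ((hS.y_lt g hg).trans_le hN)⟩

theorem notMem_C (hS : S.Valid) (hN : S.M ≤ N) {i : Fin N} (hi : i ∈ S.Y N) : i ∉ S.C N := by
  obtain ⟨g, hg, h⟩ := mem_Y hS hN hi
  have := hS.y_lt g hg
  simp only [C, Finset.mem_filter]
  omega

theorem ones_free_Y (hS : S.Valid) (hN : S.M ≤ N) {g : ℕ} (hg : S.act g = true) :
    Free (S.Y N) fun b : Bits N => S.ones (bit b) g := fun i hi b v => by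
  obtain ⟨g', hg', h⟩ := mem_Y hS hN hi
  exact ones_update hS hN hg (fun m hm => by rw [h]; exact hS.inp_ne g hg g' hg' m hm) b v

theorem near (hS : S.Valid) (hN : S.M + S.ctls ≤ N) {j : ℕ} (hj : S.k + 1 = 2 ^ j)
    (hΛ : S.Λ + 2 ≤ 2 ^ S.k) {p q : Bits N → ℂ} (hp1 : ∀ b, ‖p b‖ = 1) (hq1 : ∀ b, ‖q b‖ = 1)
    (hp : ∀ b, Clean (S.M + S.ctls) b →
      p b = cis (tau * phaseSum S.pT (S.k + 2) S.pSign S.pSlot (bit b)))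
    (hq : ∀ b, Clean (S.M + S.ctls) b →
      q b = cis (tau * phaseSum S.qT (S.k + 2) S.qSign S.qSlot (bit b))) :
    Near (Clean S.M) (32 * (S.pairs * (S.Λ + 2)) / (S.E : ℝ) ^ 2) (gadget (S.Y N) (S.C N) p q) (S.op N) := by
  have hE0 : 0 < (S.E : ℝ) := by rw [E]; positivity
  have hMN : S.M ≤ N := by omega
  have hgate : ∀ g ∈ S.gates, S.act g = true := fun g hg => (mem_gates hS).1 hg
  have hyY : ∀ g ∈ S.gates, wire N (S.y g) ∈ S.Y N := fun g hg =>
    List.mem_toFinset.2 (List.mem_map_of_mem hg)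
  have hφ1 : ∀ (i : Fin N) b, ‖S.φ N i b‖ = 1 := fun i b => by
    rw [φ]; split_ifs <;> simp [norm_cis]
  have key := gadget_near (N := N) (y := fun g => wire N (S.y g))
    (f := fun g b => S.flips g (S.ones (bit b) g)) S.gates
    (((List.nodup_range (n := S.Λ)).filter _).map_on fun g hg g' hg' h =>
      hS.y_inj g (hgate g hg) g' (hgate g' hg')
        ((wire_inj ((hS.y_lt g (hgate g hg)).trans_le hMN) ((hS.y_lt g' (hgate g' hg')).trans_le hMN)).1 h))
    (fun g hg g' hg' b v => by
      have := ones_free_Y hS hMN (hgate g hg) _ (hyY g' hg') b v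
      simp only at this
      rw [this])
    (C := S.C N) (fun g hg => notMem_C hS hMN (hyY g hg))
    (fun g hg i hi b v => by
      have := ones_free hS hMN (hgate g hg) i hi b v
      simp only at this
      simp only [this])
    (φ := S.φ N) (fun i hi i' hi' b v => by
      simp only [φ]
      by_cases hon : S.on ((i - S.M) / S.k) = true
      · have := ones_free hS hMN (on_act hon) i' hi' b v
        simp only at this
        rw [if_pos hon, if_pos hon, this]
      · rw [if_neg hon, if_neg hon])
    hφ1 (Bz := Clean (S.M + S.ctls))
    (Clean.free fun i hi => by simp only [C, Finset.mem_filter] at hi; omega)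
    (Clean.free fun i hi => by
      obtain ⟨g, hg, h⟩ := mem_Y hS hMN hi
      have := hS.y_lt g hg
      omega)
    (p := p) (q := q) (q' := S.ideal N) hp1 hq1
    (ε := 2 * Real.pi * (S.pairs * (S.Λ + 2) * (2 / (S.E : ℝ) ^ 2)))
    (ε' := 2 * Real.pi * (S.pairs / (S.E : ℝ) ^ 2)) (by positivity) (by positivity)
    (fun b hb => by
      obtain ⟨n, η, h1, h2⟩ := phase_p hj hS (bit b)
      rw [hp b hb, ctrl_eq hN]
      exact (norm_cis_sub_le h1).trans (mul_le_mul_of_nonneg_left h2 (by positivity)))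
    (fun b hb => by rw [hq b hb]; exact phase_q hj b)
    (fun b => norm_cis _) fun b _ he => ideal_eq hS hN hΛ he
  intro ψ hψ
  refine (key ψ (hψ.mono fun b hb => (clean_iff mem_C_iff).1 hb)).trans
    (mul_le_mul_of_nonneg_right ?_ (nrm_nonneg _))
  have hpi := Real.pi_lt_d2
  have h1 : (S.pairs : ℝ) / (S.E : ℝ) ^ 2 ≤ S.pairs * (S.Λ + 2) / (S.E : ℝ) ^ 2 := by
    gcongr
    have : (0 : ℝ) ≤ S.Λ := by positivity
    have : (0 : ℝ) ≤ S.pairs := by positivity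
    nlinarith
  have h0 : 0 ≤ (S.pairs : ℝ) * (S.Λ + 2) / (S.E : ℝ) ^ 2 := by positivity
  calc 2 * (2 * Real.pi * (S.pairs * (S.Λ + 2) * (2 / (S.E : ℝ) ^ 2))) +
        2 * Real.pi * (S.pairs / (S.E : ℝ) ^ 2)
      ≤ 8 * Real.pi * (S.pairs * (S.Λ + 2) / (S.E : ℝ) ^ 2) +
        2 * Real.pi * (S.pairs * (S.Λ + 2) / (S.E : ℝ) ^ 2) := by
        refine add_le_add (le_of_eq (by ring)) (mul_le_mul_of_nonneg_left h1 (by positivity))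
    _ = 10 * Real.pi * (S.pairs * (S.Λ + 2) / (S.E : ℝ) ^ 2) := by ring
    _ ≤ 32 * (S.pairs * (S.Λ + 2) / (S.E : ℝ) ^ 2) :=
        mul_le_mul_of_nonneg_right (by linarith) h0
    _ = _ := by ring

/-- No gate flips anything and all phases vanish. -/
def Trivial (S : Sym) (b : Bits N) : Prop :=
  ∀ c, S.on c = true → S.ones (bit b) (S.gOf c) = S.jOf c

theorem exact (hS : S.Valid) (hN : S.M + S.ctls ≤ N) {p q : Bits N → ℂ}
    (hp : ∀ b, Clean (S.M + S.ctls) b →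
      p b = cis (tau * phaseSum S.pT (S.k + 2) S.pSign S.pSlot (bit b)))
    (hq : ∀ b, Clean (S.M + S.ctls) b →
      q b = cis (tau * phaseSum S.qT (S.k + 2) S.qSign S.qSlot (bit b)))
    {ψ : Bits N → ℂ} (hψ : Supp (fun b => Clean S.M b ∧ S.Trivial b) ψ) :
    (gadget (S.Y N) (S.C N) p q).mulVec ψ = ψ := by
  have hMN : S.M ≤ N := by omega
  have hfree : ∀ {W : Finset (Fin N)}, (∀ g, S.act g = true → Free W fun b : Bits N => S.ones (bit b) g) →
      (∀ i ∈ W, (i : ℕ) < S.M + S.ctls) →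
      Free W fun b : Bits N => Clean (S.M + S.ctls) b ∧ S.Trivial b := by
    intro W h1 h2 i hi b v
    have e1 := Clean.free h2 i hi b v
    have e2 : S.Trivial (Function.update b i v) = S.Trivial b := by
      refine propext (forall_congr' fun c => imp_congr_right fun hc => ?_)
      have := h1 _ (on_act hc) i hi b v
      simp only at this
      rw [this]
    simp only [e1, e2]
  refine gadget_exact (fun i hi => notMem_C hS hMN hi)
    (hfree (fun g hg => ones_free hS hMN hg) fun i hi => by simp only [C, Finset.mem_filter] at hi; omega)
    (hfree (fun g hg => ones_free_Y hS hMN hg) fun i hi => by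
      obtain ⟨g, hg, h⟩ := mem_Y hS hMN hi
      have := hS.y_lt g hg
      omega) (fun b hb => ?_) (fun b hb hC => ?_)
    (hψ.mono fun b hb => ⟨⟨((clean_iff mem_C_iff).1 hb.1).1, hb.2⟩, ((clean_iff mem_C_iff).1 hb.1).2⟩)
  · rw [hp b hb.1, S.sum_p _ hS.cnt_le, Finset.sum_eq_zero, Int.cast_zero, mul_zero, cis_zero]
    intro c _
    split_ifs with h
    · rw [hb.2 _ h.1]; ring
    · rfl
  · rw [hq b hb.1, S.sum_q, Finset.sum_eq_zero, Int.cast_zero, mul_zero, cis_zero]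
    intro c hc
    rw [if_neg]
    rintro ⟨h1, h2, r, hr, h3⟩
    have hlt : c * S.k + r < S.ctls := by
      rw [ctls]
      calc c * S.k + r < c * S.k + S.k := by omega
        _ = (c + 1) * S.k := by ring
        _ ≤ S.pairs * S.k := Nat.mul_le_mul_right _ (Finset.mem_range.1 hc)
    rw [bit, hC _ (mem_C hN hlt).1] at h3
    exact Bool.false_ne_true h3

end Sym
end QFan

namespace QFan

/-- Positions of the Hadamard gate and the rotations in a basis. -/
structure Std (B : GateBasis) where
  h : Fin B.length
  get_h : B.get h = hadamard
  pos : Fin B.length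
  get_pos : B.get pos = rotation (2 * Real.pi * tau)
  neg : Fin B.length
  get_neg : B.get neg = rotation (-(2 * Real.pi * tau))

theorem exists_std {B : GateBasis} (h : stdBasis (2 * Real.pi * tau) ⊆ B) : Nonempty (Std B) := by
  obtain ⟨i, hi⟩ := List.mem_iff_get.1 (h (show hadamard ∈ _ by simp [stdBasis]))
  obtain ⟨j, hj⟩ := List.mem_iff_get.1 (h (show rotation (2 * Real.pi * tau) ∈ _ by simp [stdBasis]))
  obtain ⟨k, hk⟩ := List.mem_iff_get.1 (h (show rotation (-(2 * Real.pi * tau)) ∈ _ by simp [stdBasis]))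
  exact ⟨⟨i, hi, j, hj, k, hk⟩⟩

variable {B : GateBasis} {N : ℕ}

/-- A basis gate with all inputs on qubit `i`; used for gates on a single qubit. -/
def single (j : Fin B.length) (i : Fin N) : Gate B N := .basic j fun _ => i

theorem single_op {j : Fin B.length} {g : FixedGate} (h : B.get j = g) (i : Fin N) :
    (single j i).op = embed (fun _ => i) g.mat := by subst h; rfl

theorem single_wires {j : Fin B.length} (h : (B.get j).arity = 1) (i : Fin N) :
    (single j i).wires = [i] := by
  rw [single, Gate.wires, List.ofFn_const, h]; rfl

theorem single_encode {j : Fin B.length} (h : (B.get j).arity = 1) (i : Fin N) :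
    (single j i).encode = (Tok.basic :: encodeNat j) ++ encodeNat i := by
  have : (single j i).encode = (Tok.basic :: encodeNat j) ++
      (single j i).wires.flatMap fun i => encodeNat i := rfl
  rw [this, single_wires h]
  simp

/-- The operator of a layer. -/
noncomputable def layerOp (L : List (Gate B N)) : Op N := (L.map Gate.op).reverse.prod

theorem layerOp_nil : layerOp ([] : List (Gate B N)) = 1 := rfl

theorem layerOp_append (L L' : List (Gate B N)) : layerOp (L ++ L') = layerOp L' * layerOp L := by
  simp [layerOp]

theorem layerOp_cons (g : Gate B N) (L : List (Gate B N)) : layerOp (g :: L) = layerOp L * g.op := by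
  simp [layerOp]

theorem layerOp_unitary {L : List (Gate B N)} (hL : (L.flatMap Gate.wires).Nodup) :
    layerOp L ∈ Matrix.unitaryGroup (Bits N) ℂ := by
  induction L with
  | nil => exact one_mem _
  | cons g L ih =>
    rw [List.flatMap_cons] at hL
    rw [layerOp_cons]
    exact mul_mem (ih hL.of_append_right) (Gate.op_unitary hL.of_append_left)

theorem nodup_flatMap_of {α : Type} {l : List α} {f : α → List (Fin N)} (own : Fin N → α)
    (hl : l.Nodup) (hf : ∀ x ∈ l, (f x).Nodup) (ho : ∀ x ∈ l, ∀ i ∈ f x, own i = x) :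
    (l.flatMap f).Nodup := by
  refine List.nodup_flatMap.2 ⟨hf, hl.imp_of_mem fun {a b} ha hb hab => ?_⟩
  rw [Function.onFun, List.disjoint_left]
  intro i hi hi'
  exact hab ((ho a ha i hi).symm.trans (ho b hb i hi'))

/-! ### Controlled-not circuits -/

/-- The bit flips performed by controlled-not gates whose controls are not targets. -/
def cxFun (l : List (Fin N × Fin N)) (b : Bits N) : Bits N := fun i =>
  xor (b i) (decide ((l.countP fun e => decide (e.2 = i) && b e.1) % 2 = 1))

theorem cxFun_of_notMem {l : List (Fin N × Fin N)} {i : Fin N} (h : ∀ e ∈ l, e.2 ≠ i) (b : Bits N) :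
    cxFun l b i = b i := by
  rw [cxFun, List.countP_eq_zero.2 fun e he => by simp [h e he]]
  simp

theorem cx_prod {l : List (Fin N × Fin N)} (h : ∀ e ∈ l, ∀ e' ∈ l, e.2 ≠ e'.1) :
    (l.map fun e => CX e.1 e.2).prod = classicalOp (cxFun l) := by
  induction l with
  | nil =>
    ext b a
    have : cxFun [] a = a := funext fun i => by simp [cxFun]
    simp [classicalOp, this, Matrix.one_apply]
  | cons e l ih =>
    rw [List.map_cons, List.prod_cons, ih fun a ha a' ha' =>
      h a (List.mem_cons_of_mem _ ha) a' (List.mem_cons_of_mem _ ha'), CX, classicalOp_mul]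
    congr 1
    funext b i
    have h1 : cxFun l b e.1 = b e.1 :=
      cxFun_of_notMem (fun a ha => h a (List.mem_cons_of_mem _ ha) e (by simp)) b
    have h2 : cxFun (e :: l) b i = xor (cxFun l b i) (decide (e.2 = i) && b e.1) := by
      simp only [cxFun, List.countP_cons]
      cases hb : (decide (e.2 = i) && b e.1) <;> simp
      rw [Nat.add_mod]
      rcases Nat.mod_two_eq_zero_or_one (l.countP fun e => decide (e.2 = i) && b e.1) with h | h <;>
        rw [h] <;> simp
    rw [h2, Function.comp_apply, flipIf]
    by_cases hi : i = e.2
    · subst hi; simp [h1]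
    · rw [Function.update_of_ne hi]
      simp [Ne.symm hi]

theorem cxFun_involutive {l : List (Fin N × Fin N)} (h : ∀ e ∈ l, ∀ e' ∈ l, e.2 ≠ e'.1) :
    Function.Involutive (cxFun l) := by
  intro b
  funext i
  have : (l.countP fun e => decide (e.2 = i) && cxFun l b e.1) =
      l.countP fun e => decide (e.2 = i) && b e.1 :=
    List.countP_congr fun e he => by rw [cxFun_of_notMem fun e' he' => h e' he' e he]
  conv_lhs => rw [cxFun, this, cxFun]
  simp

theorem cxFun_perm {l l' : List (Fin N × Fin N)} (h : l.Perm l') : cxFun l = cxFun l' := by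
  funext b i
  rw [cxFun, cxFun, h.countP_eq]

theorem fanout_op {c : Fin N} {ts : List (Fin N)} (h : (c :: ts).Nodup) :
    (Gate.fanout c ts : Gate B N).op = ((ts.map fun t => (c, t)).map fun e => CX e.1 e.2).prod := by
  obtain ⟨hc, hn⟩ := List.nodup_cons.1 h
  rw [cx_prod, Gate.op]
  · congr 1
    funext b i
    rw [cxFun, List.countP_map]
    cases hb : b c with
    | false =>
      have : (ts.countP ((fun e : Fin N × Fin N => decide (e.2 = i) && b e.1) ∘ fun t => (c, t))) = 0 :=
        List.countP_eq_zero.2 fun t _ => by simp [hb]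
      rw [this]; simp
    | true =>
      have : (ts.countP ((fun e : Fin N × Fin N => decide (e.2 = i) && b e.1) ∘ fun t => (c, t))) =
          ts.count i := by
        rw [List.count]
        exact List.countP_congr fun t _ => by simp [hb]
      rw [this]
      by_cases hi : i ∈ ts
      · rw [List.count_eq_one_of_mem hn hi]; simp [hi]
      · rw [List.count_eq_zero_of_not_mem hi]; simp [hi]
  · simp only [List.mem_map, forall_exists_index, and_imp]
    rintro _ t ht rfl _ t' ht' rfl e
    exact hc ((show t = c from e) ▸ ht)

/-- A layer of fan-out gates. -/
def fans {α : Type} (c : α → Fin N) (ts : α → List (Fin N)) (l : List α) : List (Gate B N) :=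
  l.map fun x => .fanout (c x) (ts x)

/-- The controls and targets in a layer of fan-out gates. -/
def fanPairs {α : Type} (c : α → Fin N) (ts : α → List (Fin N)) (l : List α) : List (Fin N × Fin N) :=
  l.flatMap fun x => (ts x).map fun t => (c x, t)

theorem fans_op {α : Type} {c : α → Fin N} {ts : α → List (Fin N)} {l : List α}
    (h : ∀ x ∈ l, (c x :: ts x).Nodup) :
    layerOp (fans c ts l : List (Gate B N)) =
      ((fanPairs c ts l.reverse).map fun e => CX e.1 e.2).prod := by
  induction l with
  | nil => rfl
  | cons x l ih =>
    rw [fans, List.map_cons, layerOp_cons, ← fans, ih fun a ha => h a (List.mem_cons_of_mem _ ha),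
      fanout_op (h x (by simp)), ← List.prod_append, ← List.map_append]
    congr 2
    simp [fanPairs]

theorem fanPairs_reverse {α : Type} (c : α → Fin N) (ts : α → List (Fin N)) (l : List α) :
    (fanPairs c ts l.reverse).Perm (fanPairs c ts l) :=
  List.Perm.flatMap_right _ (List.reverse_perm l)

theorem Hs_conj_cx {W : Finset (Fin N)} (l : List (Fin N × Fin N))
    (h : ∀ e ∈ l, e.1 ∈ W ∧ e.2 ∈ W ∧ e.1 ≠ e.2) :
    Hs W * (l.map fun e => CX e.1 e.2).prod * Hs W = (l.map fun e => CX e.2 e.1).prod := by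
  induction l with
  | nil => simp [Hs_mul_self]
  | cons e l ih =>
    obtain ⟨h1, h2, h3⟩ := h e (by simp)
    rw [List.map_cons, List.prod_cons, List.map_cons, List.prod_cons, ← Hs_CX h1 h2 h3,
      ← ih fun a ha => h a (List.mem_cons_of_mem _ ha)]
    set P := (l.map fun e => CX e.1 e.2).prod
    calc Hs W * (CX e.1 e.2 * P) * Hs W = Hs W * CX e.1 e.2 * 1 * P * Hs W := by
          simp only [mul_assoc, one_mul]
      _ = _ := by rw [← Hs_mul_self W]; simp only [mul_assoc]

/-! ### Layers of single-qubit gates -/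

/-- A layer of Hadamard gates. -/
def hLayer (σ : Std B) (l : List (Fin N)) : List (Gate B N) := l.map (single σ.h)

theorem h_arity (σ : Std B) : (B.get σ.h).arity = 1 := by rw [σ.get_h]; rfl
theorem pos_arity (σ : Std B) : (B.get σ.pos).arity = 1 := by rw [σ.get_pos]; rfl
theorem neg_arity (σ : Std B) : (B.get σ.neg).arity = 1 := by rw [σ.get_neg]; rfl

theorem single_h_op (σ : Std B) (i : Fin N) : (single σ.h i).op = Hop i := single_op σ.get_h i

theorem hLayer_op (σ : Std B) {l : List (Fin N)} (hl : l.Nodup) :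
    layerOp (hLayer σ l) = Hs l.toFinset := by
  induction l with
  | nil => rw [List.toFinset_nil, Hs_empty]; rfl
  | cons i l ih =>
    have hi : i ∉ l.toFinset := by rw [List.mem_toFinset]; exact (List.nodup_cons.1 hl).1
    have hc : Commute (Hs l.toFinset) (Hop i) :=
      Hs_commute fun j hj => Hop_commute fun e => hi (by rw [← e]; exact hj)
    rw [hLayer, List.map_cons, layerOp_cons, ← hLayer, ih (List.nodup_cons.1 hl).2, single_h_op,
      List.toFinset_cons, Hs_insert hi, hc.eq]

theorem flatMap_singleton' {α β : Type} {l : List α} {f : α → List β} {g : α → β}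
    (h : ∀ x ∈ l, f x = [g x]) : l.flatMap f = l.map g := by
  induction l with
  | nil => rfl
  | cons x l ih =>
    rw [List.flatMap_cons, h x (by simp), ih fun y hy => h y (List.mem_cons_of_mem _ hy)]; rfl

theorem hLayer_wires (σ : Std B) (l : List (Fin N)) : (hLayer σ l).flatMap Gate.wires = l := by
  rw [hLayer, List.flatMap_map, flatMap_singleton' (g := id) fun i _ => single_wires (h_arity σ) i,
    List.map_id]

theorem embed_diagonal (i : Fin N) (d : Bits 1 → ℂ) :
    embed (fun _ : Fin 1 => i) (Matrix.diagonal d) = Matrix.diagonal fun b => d fun _ => b i := by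
  classical
  ext b a
  rw [Matrix.diagonal_apply]
  simp only [embed, Matrix.of_apply, Matrix.diagonal_apply]
  by_cases h : b = a
  · subst h; simp [Function.comp_def]
  · rw [if_neg h, ite_eq_right_iff]
    intro h1
    rw [if_neg]
    refine fun h2 => h (funext fun k => ?_)
    by_cases hk : k = i
    · subst hk; exact congrFun h2 0
    · exact h1 k fun _ => Ne.symm hk

/-- The rotation with sign number `s` on qubit `i`. -/
def rot (σ : Std B) (s : ℕ) (i : Fin N) : List (Gate B N) :=
  if s = 1 then [single σ.pos i] else if s = 2 then [single σ.neg i] else []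

theorem rot_op (σ : Std B) (s : ℕ) (i : Fin N) : layerOp (rot σ s i) =
    Matrix.diagonal fun b => cis (tau * (signVal s * ((b i).toNat : ℤ) : ℤ)) := by
  have hd : ∀ {j : Fin B.length} {α : ℝ}, B.get j = rotation α →
      layerOp [single j i] = Matrix.diagonal fun b : Bits N => if b i then Complex.exp (α * Complex.I) else 1 := by
    intro j α h
    refine List.prod_singleton.trans ((single_op h i).trans ?_)
    exact embed_diagonal i fun a => if a 0 then Complex.exp (α * Complex.I) else 1
  by_cases h1 : s = 1
  · subst h1
    rw [rot, if_pos rfl, hd σ.get_pos]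
    congr 1
    funext b
    cases b i <;> simp [signVal, cis]
  · by_cases h2 : s = 2
    · subst h2
      rw [rot, if_neg h1, if_pos rfl, hd σ.get_neg]
      congr 1
      funext b
      cases b i <;> simp [signVal, cis]
    · rw [rot, if_neg h1, if_neg h2, layerOp_nil, ← Matrix.diagonal_one]
      congr 1
      funext b
      simp [signVal, h1, h2, cis_zero]

theorem rots_op {ι : Type} (σ : Std B) (sign : ι → ℕ) (q : ι → Fin N) (l : List ι) :
    layerOp (l.flatMap fun s => rot σ (sign s) (q s)) = Matrix.diagonal fun b =>
      cis (tau * ((l.map fun s => signVal (sign s) * ((b (q s)).toNat : ℤ)).sum : ℤ)) := by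
  induction l with
  | nil => simp [layerOp_nil, cis_zero]
  | cons s l ih =>
    rw [List.flatMap_cons, layerOp_append, ih, rot_op, diagonal_mul]
    congr 1
    funext b
    rw [← cis_add, List.map_cons, List.sum_cons]
    congr 1
    push_cast
    ring

theorem rot_wires (σ : Std B) (s : ℕ) (i : Fin N) : (rot σ s i).flatMap Gate.wires =
    if s = 1 ∨ s = 2 then [i] else [] := by
  rw [rot]
  split_ifs with h1 h2 h3 h4 h5
  · simp [single_wires (pos_arity σ)]
  · omega
  · simp [single_wires (neg_arity σ)]
  · omega
  · omega
  · rfl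

end QFan

namespace QFan

variable {B : GateBasis} {N : ℕ}

theorem sum_map_range {α : Type} [AddCommMonoid α] (f : ℕ → α) (n : ℕ) :
    ((List.range n).map f).sum = ∑ i ∈ Finset.range n, f i := by
  induction n with
  | zero => rfl
  | succ n ih => rw [List.range_succ, List.map_append, List.sum_append, ih, Finset.sum_range_succ]; simp

theorem countP_range (p : ℕ → Bool) (n : ℕ) :
    (List.range n).countP p = ∑ i ∈ Finset.range n, (p i).toNat := by
  induction n with
  | zero => rfl
  | succ n ih =>
    rw [List.range_succ, List.countP_append, ih, Finset.sum_range_succ, List.countP_singleton]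
    cases p n <;> rfl

theorem countP_fanPairs {α : Type} {c : α → Fin N} {ts : α → List (Fin N)} {l : List α}
    (h : ∀ x ∈ l, (ts x).Nodup) (b : Bits N) (i : Fin N) :
    (fanPairs c ts l).countP (fun e => decide (e.2 = i) && b e.1) =
      (l.map fun x => if i ∈ ts x ∧ b (c x) = true then 1 else 0).sum := by
  rw [fanPairs, List.countP_flatMap]
  congr 1
  refine List.map_congr_left fun x hx => ?_
  rw [Function.comp_apply, List.countP_map]
  cases hb : b (c x) with
  | false => simp [Function.comp_def, hb]
  | true =>
    have : ((ts x).countP ((fun e : Fin N × Fin N => decide (e.2 = i) && b e.1) ∘ fun t => (c x, t))) =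
        (ts x).count i := by
      rw [List.count]
      exact List.countP_congr fun t _ => by simp [hb]
    rw [this]
    by_cases hi : i ∈ ts x
    · rw [List.count_eq_one_of_mem (h x hx) hi]; simp [hi]
    · rw [List.count_eq_zero_of_not_mem hi]; simp [hi]

/-- The operator of a sequence of layers. -/
noncomputable def layersOp (Ls : List (List (Gate B N))) : Op N := (Ls.map layerOp).reverse.prod

theorem layersOp_append (L L' : List (List (Gate B N))) :
    layersOp (L ++ L') = layersOp L' * layersOp L := by
  simp [layersOp]

theorem layersOp_cons (L : List (Gate B N)) (Ls : List (List (Gate B N))) :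
    layersOp (L :: Ls) = layersOp Ls * layerOp L := by
  simp [layersOp]

theorem layersOp_nil : layersOp ([] : List (List (Gate B N))) = 1 := rfl

theorem layersOp_flatten (Ls : List (List (Gate B N))) :
    layersOp Ls = (Ls.flatten.map Gate.op).reverse.prod := by
  induction Ls with
  | nil => rfl
  | cons L Ls ih => rw [layersOp_cons, ih]; simp [layerOp]

section
variable [NeZero N]

/-- A range of qubits. -/
def block (N : ℕ) [NeZero N] (M c : ℕ) : List (Fin N) := (List.range c).map fun q => wire N (M + q)

theorem nodup_block {M c : ℕ} (h : M + c ≤ N) : (block N M c).Nodup := by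
  refine List.nodup_range.map_on fun q hq q' hq' e => ?_
  rw [List.mem_range] at hq hq'
  have := (wire_inj (by omega) (by omega)).1 e
  omega

theorem mem_block {M c : ℕ} (h : M + c ≤ N) (i : Fin N) : i ∈ block N M c ↔ M ≤ i ∧ (i : ℕ) < M + c := by
  simp only [block, List.mem_map, List.mem_range]
  constructor
  · rintro ⟨q, hq, rfl⟩
    rw [wire_val (by omega)]
    omega
  · rintro ⟨h1, h2⟩
    exact ⟨i - M, by omega, Fin.ext (by rw [wire_val] <;> omega)⟩

end

/-- The layout of a phase layer: `T` terms with `A` slots, whose ancilla qubits start at `M`. -/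
structure Phase where
  M : ℕ
  T : ℕ
  A : ℕ
  sign : ℕ → ℕ
  slot : ℕ → ℕ → ℕ

theorem Phase.lt_of_mem {P : Phase} {s p : ℕ} (hs : s < P.T) (hp : p < P.A) :
    P.M + s * P.A + p < P.M + P.T * P.A := by
  have : (s + 1) * P.A ≤ P.T * P.A := Nat.mul_le_mul_right _ hs
  rw [Nat.succ_mul] at this
  omega

variable [NeZero N]

namespace Phase

variable (P : Phase)

/-- The ancilla qubits into which qubit `v` is copied. -/
def copies (N : ℕ) [NeZero N] (v : ℕ) : List (Fin N) :=
  ((List.range (P.T * P.A)).filter fun q => decide (P.slot (q / P.A) (q % P.A) = v + 1)).map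
    fun q => wire N (P.M + q)

def layF (B : GateBasis) (N : ℕ) [NeZero N] : List (Gate B N) :=
  fans (wire N) (P.copies N) (List.range P.M)

def layG (B : GateBasis) (N : ℕ) [NeZero N] : List (Gate B N) :=
  fans (fun s => wire N (P.M + s * P.A)) (fun s => block N (P.M + s * P.A + 1) (P.A - 1)) (List.range P.T)

def layH (σ : Std B) (N : ℕ) [NeZero N] : List (Gate B N) := hLayer σ (block N P.M (P.T * P.A))

def layR (σ : Std B) (N : ℕ) [NeZero N] : List (Gate B N) :=
  (List.range P.T).flatMap fun s => rot σ (P.sign s) (wire N (P.M + s * P.A))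

def layers (σ : Std B) (N : ℕ) [NeZero N] : List (List (Gate B N)) :=
  [P.layF B N, P.layH σ N, P.layG B N, P.layH σ N, P.layR σ N, P.layH σ N, P.layG B N, P.layH σ N,
    P.layF B N]

/-- The classical part of the phase layer. -/
def mapF (N : ℕ) [NeZero N] : Bits N → Bits N := cxFun (fanPairs (wire N) (P.copies N) (List.range P.M))

def mapG (N : ℕ) [NeZero N] : Bits N → Bits N :=
  cxFun ((fanPairs (fun s => wire N (P.M + s * P.A)) (fun s => block N (P.M + s * P.A + 1) (P.A - 1))
    (List.range P.T)).map Prod.swap)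

/-- The phase. -/
noncomputable def fn (N : ℕ) [NeZero N] (b : Bits N) : ℂ :=
  cis (tau * (∑ s ∈ Finset.range P.T, signVal (P.sign s) *
    ((P.mapG N (P.mapF N b) (wire N (P.M + s * P.A))).toNat : ℤ) : ℤ))

theorem norm_fn (b : Bits N) : ‖P.fn N b‖ = 1 := norm_cis _

/-- The inverse phase layer. -/
def inv : Phase := { P with sign := fun s => if P.sign s = 0 then 0 else 3 - P.sign s }

theorem inv_fn : P.inv.fn N = star (P.fn N) := by
  funext b
  rw [Pi.star_apply, fn, fn, star_cis, ← mul_neg, ← Int.cast_neg, ← Finset.sum_neg_distrib]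
  congr 3
  refine Finset.sum_congr rfl fun s _ => ?_
  have h : signVal (P.inv.sign s) = -signVal (P.sign s) := by
    show signVal (if P.sign s = 0 then 0 else 3 - P.sign s) = _
    simp only [signVal]
    split_ifs <;> first | rfl | (exfalso; omega)
  rw [h, neg_mul]
  rfl

variable {P}

theorem mem_copies (hN : P.M + P.T * P.A ≤ N) {v : ℕ} {i : Fin N} : i ∈ P.copies N v ↔
    P.M ≤ i ∧ (i : ℕ) < P.M + P.T * P.A ∧ P.slot ((i - P.M) / P.A) ((i - P.M) % P.A) = v + 1 := by
  simp only [copies, List.mem_map, List.mem_filter, List.mem_range, decide_eq_true_eq]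
  constructor
  · rintro ⟨q, ⟨h1, h2⟩, rfl⟩
    rw [wire_val (by omega), Nat.add_sub_cancel_left]
    exact ⟨by omega, by omega, h2⟩
  · rintro ⟨h1, h2, h3⟩
    exact ⟨i - P.M, ⟨by omega, h3⟩, Fin.ext (by rw [wire_val] <;> omega)⟩

theorem nodup_copies (hN : P.M + P.T * P.A ≤ N) (v : ℕ) : (P.copies N v).Nodup := by
  refine (List.nodup_range.filter _).map_on fun q hq q' hq' e => ?_
  simp only [List.mem_filter, List.mem_range] at hq hq'
  have := (wire_inj (by omega) (by omega)).1 e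
  omega

theorem nodup_F (hN : P.M + P.T * P.A ≤ N) {v : ℕ} (hv : v < P.M) : (wire N v :: P.copies N v).Nodup := by
  refine List.nodup_cons.2 ⟨fun h => ?_, nodup_copies hN v⟩
  have := ((mem_copies hN).1 h).1
  rw [wire_val (by omega)] at this
  omega

theorem nodup_G (hA : 0 < P.A) (hN : P.M + P.T * P.A ≤ N) {s : ℕ} (hs : s < P.T) :
    (wire N (P.M + s * P.A) :: block N (P.M + s * P.A + 1) (P.A - 1)).Nodup := by
  have h1 := lt_of_mem hs (show P.A - 1 < P.A by omega)
  have h2 : P.M + s * P.A + 1 + (P.A - 1) ≤ N := by omega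
  refine List.nodup_cons.2 ⟨fun h => ?_, nodup_block h2⟩
  have := ((mem_block h2 _).1 h).1
  rw [wire_val (by omega)] at this
  omega

theorem layF_wires (hN : P.M + P.T * P.A ≤ N) : ((P.layF B N).flatMap Gate.wires).Nodup := by
  rw [layF, fans, List.flatMap_map]
  refine nodup_flatMap_of (fun i => if (i : ℕ) < P.M then i else
    P.slot ((i - P.M) / P.A) ((i - P.M) % P.A) - 1) List.nodup_range
    (fun v hv => nodup_F hN (List.mem_range.1 hv)) fun v hv i hi => ?_
  have hv := List.mem_range.1 hv
  rcases List.mem_cons.1 hi with rfl | hi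
  · simp only [wire_val (show v < N by omega), if_pos hv]
  · obtain ⟨h1, h2, h3⟩ := (mem_copies hN).1 hi
    simp only [if_neg (show ¬ (i : ℕ) < P.M by omega), h3, Nat.add_sub_cancel]

theorem layG_wires (hA : 0 < P.A) (hN : P.M + P.T * P.A ≤ N) :
    ((P.layG B N).flatMap Gate.wires).Nodup := by
  rw [layG, fans, List.flatMap_map]
  refine nodup_flatMap_of (fun i => (i - P.M) / P.A) List.nodup_range
    (fun s hs => nodup_G hA hN (List.mem_range.1 hs)) fun s hs i hi => ?_
  have h1 := lt_of_mem (List.mem_range.1 hs) (show P.A - 1 < P.A by omega)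
  have : P.M + s * P.A ≤ i ∧ (i : ℕ) < P.M + s * P.A + P.A := by
    rcases List.mem_cons.1 hi with rfl | hi
    · rw [wire_val] <;> omega
    · have := (mem_block (by omega) i).1 hi
      omega
  rw [show (i : ℕ) - P.M = P.A * s + (i - P.M - s * P.A) by rw [mul_comm]; omega, Nat.mul_add_div hA,
    Nat.div_eq_of_lt (by omega), add_zero]

theorem layR_wires (σ : Std B) (hA : 0 < P.A) (hN : P.M + P.T * P.A ≤ N) :
    ((P.layR σ N).flatMap Gate.wires).Nodup := by
  rw [layR, List.flatMap_assoc]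
  refine nodup_flatMap_of (fun i => (i - P.M) / P.A) List.nodup_range (fun s _ => ?_) fun s hs i hi => ?_
  · rw [rot_wires]; split_ifs <;> simp
  · have h1 := lt_of_mem (List.mem_range.1 hs) hA
    rw [rot_wires] at hi
    have hi : i = wire N (P.M + s * P.A) := by
      split_ifs at hi <;> simp_all
    rw [hi, wire_val (by omega), Nat.add_sub_cancel_left, Nat.mul_div_cancel _ hA]

theorem layers_wires (σ : Std B) (hA : 0 < P.A) (hN : P.M + P.T * P.A ≤ N) :
    ∀ L ∈ P.layers σ N, (L.flatMap Gate.wires).Nodup := by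
  have h1 := layF_wires (B := B) hN
  have h2 := layG_wires (B := B) hA hN
  have h3 := layR_wires σ hA hN
  have h4 : ((P.layH σ N).flatMap Gate.wires).Nodup := by
    rw [layH, hLayer_wires]; exact nodup_block hN
  simp only [layers, List.mem_cons, List.not_mem_nil, or_false]
  rintro L (rfl | rfl | rfl | rfl | rfl | rfl | rfl | rfl | rfl) <;> assumption

theorem pairsF (hN : P.M + P.T * P.A ≤ N) :
    ∀ e ∈ fanPairs (wire N) (P.copies N) (List.range P.M), (e.1 : ℕ) < P.M ∧ P.M ≤ e.2 := by
  intro e he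
  simp only [fanPairs, List.mem_flatMap, List.mem_map, List.mem_range] at he
  obtain ⟨v, hv, t, ht, rfl⟩ := he
  exact ⟨by simp only; rw [wire_val] <;> omega, ((mem_copies hN).1 ht).1⟩

theorem pairsG (hA : 0 < P.A) (hN : P.M + P.T * P.A ≤ N) :
    ∀ e ∈ fanPairs (fun s => wire N (P.M + s * P.A)) (fun s => block N (P.M + s * P.A + 1) (P.A - 1))
      (List.range P.T), (P.M ≤ e.1 ∧ (e.1 : ℕ) < P.M + P.T * P.A ∧ (e.1 - P.M) % P.A = 0) ∧
        (P.M ≤ e.2 ∧ (e.2 : ℕ) < P.M + P.T * P.A ∧ (e.2 - P.M) % P.A ≠ 0) := by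
  intro e he
  simp only [fanPairs, List.mem_flatMap, List.mem_map, List.mem_range] at he
  obtain ⟨s, hs, t, ht, rfl⟩ := he
  have h1 := lt_of_mem hs (show P.A - 1 < P.A by omega)
  have h2 := (mem_block (by omega) t).1 ht
  refine ⟨?_, show P.M ≤ (t : ℕ) by omega, show (t : ℕ) < P.M + P.T * P.A by omega, ?_⟩
  · have h3 := wire_val (N := N) (i := P.M + s * P.A) (by omega)
    refine ⟨show P.M ≤ (wire N (P.M + s * P.A) : ℕ) by omega,
      show (wire N (P.M + s * P.A) : ℕ) < P.M + P.T * P.A by omega,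
      show ((wire N (P.M + s * P.A) : ℕ) - P.M) % P.A = 0 from ?_⟩
    rw [h3, Nat.add_sub_cancel_left, Nat.mul_mod_left]
  · show ((t : ℕ) - P.M) % P.A ≠ 0
    rw [show (t : ℕ) - P.M = P.A * s + (t - P.M - s * P.A) by rw [mul_comm]; omega, Nat.mul_add_mod,
      Nat.mod_eq_of_lt (by omega)]
    omega

theorem layF_op (hN : P.M + P.T * P.A ≤ N) :
    layerOp (P.layF B N) = classicalOp (P.mapF N) ∧ Function.Involutive (P.mapF N) := by
  have h : ∀ e ∈ fanPairs (wire N) (P.copies N) (List.range P.M),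
      ∀ e' ∈ fanPairs (wire N) (P.copies N) (List.range P.M), e.2 ≠ e'.1 := fun e he e' he' h => by
    have h1 := (pairsF hN e he).2
    have h2 := (pairsF hN e' he').1
    rw [h] at h1
    omega
  refine ⟨?_, cxFun_involutive h⟩
  rw [layF, fans_op fun v hv => nodup_F hN (List.mem_range.1 hv), cx_prod, mapF,
    cxFun_perm (fanPairs_reverse _ _ _)]
  intro e he e' he'
  exact h e ((fanPairs_reverse _ _ _).mem_iff.1 he) e' ((fanPairs_reverse _ _ _).mem_iff.1 he')

theorem layG_op (σ : Std B) (hA : 0 < P.A) (hN : P.M + P.T * P.A ≤ N) :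
    layerOp (P.layH σ N) * layerOp (P.layG B N) * layerOp (P.layH σ N) = classicalOp (P.mapG N) ∧
      Function.Involutive (P.mapG N) := by
  set l := fanPairs (fun s => wire N (P.M + s * P.A)) (fun s => block N (P.M + s * P.A + 1) (P.A - 1))
    (List.range P.T) with hl
  have h : ∀ e ∈ l.map Prod.swap, ∀ e' ∈ l.map Prod.swap, e.2 ≠ e'.1 := by
    simp only [List.mem_map, forall_exists_index, and_imp]
    rintro _ e he rfl _ e' he' rfl h
    have h1 := (pairsG hA hN e he).1.2.2
    have h2 := (pairsG hA hN e' he').2.2.2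
    exact h2 (by rw [← show e.1 = e'.2 from h]; exact h1)
  refine ⟨?_, cxFun_involutive h⟩
  have hp := fanPairs_reverse (fun s => wire N (P.M + s * P.A))
    (fun s => block N (P.M + s * P.A + 1) (P.A - 1)) (List.range P.T)
  rw [layG, fans_op fun s hs => nodup_G hA hN (List.mem_range.1 hs), layH, hLayer_op σ (nodup_block hN),
    Hs_conj_cx, mapG, ← cxFun_perm (hp.map Prod.swap), ← cx_prod, List.map_map]
  · rfl
  · intro e he e' he'
    exact h e ((hp.map _).mem_iff.1 he) e' ((hp.map _).mem_iff.1 he')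
  · intro e he
    obtain ⟨⟨h1, h2, h3⟩, h4, h5, h6⟩ := pairsG hA hN e (hp.mem_iff.1 he)
    rw [List.mem_toFinset, List.mem_toFinset, mem_block hN, mem_block hN]
    exact ⟨⟨h1, h2⟩, ⟨h4, h5⟩, fun h => h6 (by rw [← h]; exact h3)⟩

theorem layers_op (σ : Std B) (hA : 0 < P.A) (hN : P.M + P.T * P.A ≤ N) :
    layersOp (P.layers σ N) = Matrix.diagonal (P.fn N) := by
  obtain ⟨f1, f2⟩ := layF_op (B := B) hN
  obtain ⟨g1, g2⟩ := layG_op σ hA hN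
  have e : layersOp (P.layers σ N) = layerOp (P.layF B N) *
      (layerOp (P.layH σ N) * layerOp (P.layG B N) * layerOp (P.layH σ N)) * layerOp (P.layR σ N) *
      (layerOp (P.layH σ N) * layerOp (P.layG B N) * layerOp (P.layH σ N)) * layerOp (P.layF B N) := by
    simp only [layers, layersOp_cons, layersOp_nil, one_mul, mul_assoc]
  rw [e, f1, g1, layR, rots_op]
  simp only [sum_map_range]
  refine op_ext fun ψ => ?_
  simp only [← Matrix.mulVec_mulVec, classicalOp_mulVec f2, classicalOp_mulVec g2]
  funext b
  rw [Matrix.mulVec_diagonal, Matrix.mulVec_diagonal, g2, f2]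
  rfl

theorem mapF_apply (hA : 0 < P.A) (hN : P.M + P.T * P.A ≤ N) {b : Bits N} (hb : Clean P.M b) {s p : ℕ}
    (hs : s < P.T) (hp : p < P.A) (hslot : P.slot s p ≤ P.M) :
    (P.mapF N b (wire N (P.M + s * P.A + p))).toNat = slotVal (bit b) (P.slot s p) := by
  have h1 := lt_of_mem hs hp
  have h2 := wire_val (N := N) (i := P.M + s * P.A + p) (by omega)
  have h3 : P.M + s * P.A + p - P.M = P.A * s + p := by rw [mul_comm]; omega
  have h4 : ∀ v, wire N (P.M + s * P.A + p) ∈ P.copies N v ↔ P.slot s p = v + 1 := fun v => by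
    rw [mem_copies hN, h2, h3, Nat.mul_add_div hA, Nat.div_eq_of_lt hp, add_zero, Nat.mul_add_mod,
      Nat.mod_eq_of_lt hp]
    exact ⟨fun h => h.2.2, fun h => ⟨by omega, by omega, h⟩⟩
  have h5 : (fanPairs (wire N) (P.copies N) (List.range P.M)).countP
      (fun e => decide (e.2 = wire N (P.M + s * P.A + p)) && b e.1) = slotVal (bit b) (P.slot s p) := by
    rw [countP_fanPairs fun v _ => nodup_copies hN v, sum_map_range]
    simp only [h4]
    rcases Nat.eq_zero_or_pos (P.slot s p) with h0 | h0
    · rw [h0, slotVal, if_pos rfl]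
      exact Finset.sum_eq_zero fun v _ => by simp
    · rw [slotVal, if_neg (by omega), Finset.sum_eq_single (P.slot s p - 1)]
      · have : P.slot s p = P.slot s p - 1 + 1 := by omega
        cases hbb : bit b (P.slot s p - 1) <;> rw [bit] at hbb <;> simp [hbb, ← this]
      · intro v _ hv
        rw [if_neg]; omega
      · intro h
        rw [Finset.mem_range] at h
        omega
  rw [mapF, cxFun, h5, hb _ (by rw [h2]; omega), slotVal]
  split_ifs
  · rfl
  · cases bit b (P.slot s p - 1) <;> rfl

theorem fn_eq (hA : 0 < P.A) (hN : P.M + P.T * P.A ≤ N)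
    (hslot : ∀ s < P.T, signVal (P.sign s) ≠ 0 → ∀ p < P.A, P.slot s p ≤ P.M) {b : Bits N}
    (hb : Clean P.M b) : P.fn N b = cis (tau * phaseSum P.T P.A P.sign P.slot (bit b)) := by
  rw [fn, phaseSum]
  congr 3
  refine Finset.sum_congr rfl fun s hs => ?_
  have hs := Finset.mem_range.1 hs
  by_cases h0 : signVal (P.sign s) = 0
  · rw [h0, zero_mul, zero_mul]
  have hF := fun p hp => mapF_apply hA hN hb hs hp (hslot s hs h0 p hp)
  congr 2
  set b' := P.mapF N b
  have h1 := lt_of_mem hs (show P.A - 1 < P.A by omega)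
  have h2 : ((fanPairs (fun s => wire N (P.M + s * P.A)) (fun s => block N (P.M + s * P.A + 1) (P.A - 1))
      (List.range P.T)).map Prod.swap).countP (fun e => decide (e.2 = wire N (P.M + s * P.A)) && b' e.1) =
      ∑ p ∈ Finset.range (P.A - 1), slotVal (bit b) (P.slot s (p + 1)) := by
    rw [List.countP_map, fanPairs, List.countP_flatMap, sum_map_range, Finset.sum_eq_single s]
    · rw [Function.comp_apply, List.countP_map, block, List.countP_map, countP_range]
      refine Finset.sum_congr rfl fun p hp => ?_
      have hp := Finset.mem_range.1 hp
      rw [← hF (p + 1) (by omega), show P.M + s * P.A + (p + 1) = P.M + s * P.A + 1 + p by omega]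
      simp
    · intro s' hs' hne
      have hs' := Finset.mem_range.1 hs'
      have h4 := lt_of_mem hs' hA
      have h5 : wire N (P.M + s' * P.A) ≠ wire N (P.M + s * P.A) := fun h => by
        have := (wire_inj (by omega) (by omega)).1 h
        exact hne (Nat.eq_of_mul_eq_mul_right hA (by omega))
      rw [Function.comp_apply, List.countP_map]
      exact List.countP_eq_zero.2 fun t _ => by simp [h5]
    · intro h; exact absurd (Finset.mem_range.2 hs) h
  have h3 : (b' (wire N (P.M + s * P.A))).toNat = slotVal (bit b) (P.slot s 0) := hF 0 hA
  have h4 := Finset.sum_range_succ' (fun p => slotVal (bit b) (P.slot s p)) (P.A - 1)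
  rw [Nat.sub_add_cancel hA] at h4
  rw [mapG, cxFun, h2, par, h4, ← h3]
  generalize ∑ p ∈ Finset.range (P.A - 1), slotVal (bit b) (P.slot s (p + 1)) = u
  rcases Nat.mod_two_eq_zero_or_one u with hu | hu <;> cases b' (wire N (P.M + s * P.A)) <;>
    simp [hu, Nat.add_mod]

end Phase
end QFan

namespace QFan

variable {B : GateBasis} {N : ℕ}

def Sym.P (S : Sym) : Phase := ⟨S.M + S.ctls, S.pT, S.k + 2, S.pSign, S.pSlot⟩

def Sym.Q (S : Sym) : Phase := ⟨S.M + S.ctls, S.qT, S.k + 2, S.qSign, S.qSlot⟩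

/-- The number of ancilla qubits used. -/
def Sym.space (S : Sym) : ℕ := S.ctls + (S.pT + S.qT) * (S.k + 2)

theorem Sym.space_le {S : Sym} (hN : S.M + S.space ≤ N) : S.M + S.ctls ≤ N ∧ S.P.M + S.P.T * S.P.A ≤ N ∧
    S.Q.M + S.Q.T * S.Q.A ≤ N := by
  rw [Sym.space, add_mul] at hN
  simp only [Sym.P, Sym.Q]
  omega

variable [NeZero N]

namespace Sym

variable (S : Sym)

def hY (σ : Std B) (N : ℕ) [NeZero N] : List (Gate B N) := hLayer σ (S.gates.map fun g => wire N (S.y g))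

def hC (σ : Std B) (N : ℕ) [NeZero N] : List (Gate B N) := hLayer σ (block N S.M S.ctls)

/-- A circuit for symmetric functions. -/
def layers (σ : Std B) (N : ℕ) [NeZero N] : List (List (Gate B N)) :=
  [S.hY σ N, S.hC σ N] ++ (S.P.layers σ N ++ ([S.hC σ N] ++ (S.Q.layers σ N ++
    ([S.hC σ N] ++ (S.P.inv.layers σ N ++ [S.hC σ N, S.hY σ N])))))

variable {S}

theorem nodup_Y (hS : S.Valid) (hN : S.M ≤ N) : (S.gates.map fun g => wire N (S.y g)).Nodup := by
  refine (List.nodup_range.filter _).map_on fun g hg g' hg' e => ?_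
  have hg := (mem_gates hS).1 hg
  have hg' := (mem_gates hS).1 hg'
  have h1 := hS.y_lt g hg
  have h2 := hS.y_lt g' hg'
  exact hS.y_inj g hg g' hg' ((wire_inj (by omega) (by omega)).1 e)

theorem layers_wires (σ : Std B) (hS : S.Valid) (hN : S.M + S.space ≤ N) :
    ∀ L ∈ S.layers σ N, (L.flatMap Gate.wires).Nodup := by
  obtain ⟨h1, h2, h3⟩ := space_le hN
  have hy : ((S.hY σ N).flatMap Gate.wires).Nodup := by
    rw [hY, hLayer_wires]; exact nodup_Y hS (by omega)
  have hc : ((S.hC σ N).flatMap Gate.wires).Nodup := by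
    rw [hC, hLayer_wires]; exact nodup_block h1
  have hP := Phase.layers_wires (P := S.P) σ (Nat.succ_pos _) h2
  have hQ := Phase.layers_wires (P := S.Q) σ (Nat.succ_pos _) h3
  have hP' := Phase.layers_wires (P := S.P.inv) σ (Nat.succ_pos _) h2
  intro L hL
  simp only [layers, List.mem_append, List.mem_cons, List.not_mem_nil, or_false] at hL
  rcases hL with (rfl | rfl) | h | rfl | h | rfl | h | rfl | rfl
  all_goals first | assumption | exact hP _ h | exact hQ _ h | exact hP' _ h

theorem layers_op (σ : Std B) (hS : S.Valid) (hN : S.M + S.space ≤ N) :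
    layersOp (S.layers σ N) = gadget (S.Y N) (S.C N) (S.P.fn N) (S.Q.fn N) := by
  obtain ⟨h1, h2, h3⟩ := space_le hN
  have hy : layerOp (S.hY σ N) = Hs (S.Y N) := hLayer_op σ (nodup_Y hS (by omega))
  have hc : layerOp (S.hC σ N) = Hs (S.C N) := by
    rw [hC, hLayer_op σ (nodup_block h1)]
    congr 1
    ext i
    rw [List.mem_toFinset, mem_block h1, mem_C_iff]
  have hP := Phase.layers_op (P := S.P) σ (Nat.succ_pos _) h2
  have hQ := Phase.layers_op (P := S.Q) σ (Nat.succ_pos _) h3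
  have hP' := Phase.layers_op (P := S.P.inv) σ (Nat.succ_pos _) h2
  rw [Phase.inv_fn] at hP'
  rw [layers, gadget]
  simp only [layersOp_append, layersOp_cons, layersOp_nil, hP, hQ, hP', hy, hc, one_mul, mul_assoc]

theorem P_fn (hS : S.Valid) (hN : S.M + S.space ≤ N) {b : Bits N} (hb : Clean (S.M + S.ctls) b) :
    S.P.fn N b = cis (tau * phaseSum S.pT (S.k + 2) S.pSign S.pSlot (bit b)) := by
  refine Phase.fn_eq (P := S.P) (Nat.succ_pos _) (space_le hN).2.1 (fun s hs h p _ => ?_) hb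
  change s < S.pT at hs
  change S.pSlot s p ≤ S.M + S.ctls
  replace h : signVal (S.pSign s) ≠ 0 := h
  have hc : s / (S.E * S.E) / 5 / (S.Λ + 2) < S.ctls := by
    refine Nat.div_lt_of_lt_mul (Nat.div_lt_of_lt_mul (Nat.div_lt_of_lt_mul (hs.trans_eq ?_)))
    rw [pT]; ring
  rw [pSign, pSign'] at h
  obtain ⟨h1, -⟩ := ite_ne_right_iff.1 fun e => h (by rw [e]; rfl)
  have hact := on_act h1.1
  rw [pSlot, pSlot']
  have h3 := h1.2.2
  split_ifs at h3 ⊢ <;> first | omega | (have := hS.inp_lt _ hact _ h3; omega)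

theorem Q_fn (hS : S.Valid) (hN : S.M + S.space ≤ N) {b : Bits N} (hb : Clean (S.M + S.ctls) b) :
    S.Q.fn N b = cis (tau * phaseSum S.qT (S.k + 2) S.qSign S.qSlot (bit b)) := by
  refine Phase.fn_eq (P := S.Q) (Nat.succ_pos _) (space_le hN).2.2 (fun s hs h p _ => ?_) hb
  change s < S.qT at hs
  change S.qSlot s p ≤ S.M + S.ctls
  replace h : signVal (S.qSign s) ≠ 0 := h
  have hc : s / S.E / 3 / 2 ^ S.k < S.pairs := by
    refine Nat.div_lt_of_lt_mul (Nat.div_lt_of_lt_mul (Nat.div_lt_of_lt_mul (hs.trans_eq ?_)))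
    rw [qT]; ring
  have hon : S.on (s / S.E / 3 / 2 ^ S.k) = true := by
    by_contra h'
    rw [qSign, qSign', if_neg h'] at h
    exact h rfl
  have hy := hS.y_lt _ (on_act hon)
  have hm : (s / S.E / 3 / 2 ^ S.k + 1) * S.k ≤ S.ctls := Nat.mul_le_mul_right _ hc
  rw [Nat.succ_mul] at hm
  rw [qSlot, qSlot']
  split_ifs <;> omega

theorem layers_near (σ : Std B) (hS : S.Valid) (hN : S.M + S.space ≤ N) {j : ℕ} (hj : S.k + 1 = 2 ^ j)
    (hΛ : S.Λ + 2 ≤ 2 ^ S.k) : Near (Clean S.M) (32 * (S.pairs * (S.Λ + 2)) / (S.E : ℝ) ^ 2)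
      (layersOp (S.layers σ N)) (S.op N) := by
  rw [layers_op σ hS hN]
  exact near hS (space_le hN).1 hj hΛ (Phase.norm_fn _) (Phase.norm_fn _) (fun b => P_fn hS hN)
    fun b => Q_fn hS hN

theorem layers_exact (σ : Std B) (hS : S.Valid) (hN : S.M + S.space ≤ N) {ψ : Bits N → ℂ}
    (hψ : Supp (fun b => Clean S.M b ∧ S.Trivial b) ψ) : (layersOp (S.layers σ N)).mulVec ψ = ψ := by
  rw [layers_op σ hS hN]
  exact exact hS (space_le hN).1 (fun b => P_fn hS hN) (fun b => Q_fn hS hN) hψ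

end Sym
end QFan

namespace QFan

theorem filter_flatMap' {α β : Type} (p : α → Bool) (f : α → List β) (l : List α) :
    (l.filter p).flatMap f = l.flatMap fun a => if p a = true then f a else [] := by
  induction l with
  | nil => rfl
  | cons a l ih => cases h : p a <;> simp [h, ih]

variable {Γ : Type} [Ctx Γ]

section
variable {a m B : Γ → ℕ}

theorem lf_two_pow_min (hm : LF m) (hB : LF B) : LF fun x => min (2 ^ m x) (B x) := by
  have key : ∀ b t : ℕ, (fun y => min (2 * y) b)^[t] (min 1 b) = min (2 ^ t) b := by
    intro b t
    induction t with
    | zero => simp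
    | succ t ih => rw [Function.iterate_succ_apply', ih, pow_succ]; omega
  have := LF.iterate (a := fun x => min 1 (B x)) (h := fun x y => min (2 * y) (B x)) (m := m) (B := B)
    (by fun_prop) (by fun_prop) hm hB.bdd fun x t _ i => by
      rw [key]; exact min_le_right _ _
  simpa only [key] using this

/-- There are arbitrarily large scales. -/
theorem exists_scale {D : Γ → ℕ} (hD : LF D) : ∃ k : Γ → ℕ, LF k ∧ (LF fun x => 2 ^ k x) ∧
    ∀ x, 0 < k x ∧ (∃ j, k x + 1 = 2 ^ j) ∧ D x ≤ 2 ^ k x := by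
  set h : ℕ → ℕ × ℕ → ℕ × ℕ := fun d y => if y.2 ≤ 2 * d then (2 * y.1, y.2 * y.2) else y with hh
  have key : ∀ d t, ∃ j, 0 < j ∧ (h d)^[t] (2, 4) = (2 ^ j, 2 ^ 2 ^ j) ∧
      2 ^ j ≤ 4 * d * d + 4 ∧ 2 ^ 2 ^ j ≤ 4 * d * d + 4 ∧ (t ≤ 2 ^ 2 ^ j ∨ 2 * d ≤ 2 ^ 2 ^ j) := by
    intro d t
    induction t with
    | zero => exact ⟨1, by omega, rfl, by omega, by omega, by omega⟩
    | succ t ih =>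
      obtain ⟨j, h0, h1, h2, h3, h4⟩ := ih
      rw [Function.iterate_succ_apply', h1]
      have e1 : 2 * 2 ^ j = 2 ^ (j + 1) := (pow_succ' 2 j).symm
      have e2 : 2 ^ 2 ^ j * 2 ^ 2 ^ j = 2 ^ 2 ^ (j + 1) := by rw [← pow_add, ← two_mul, e1]
      by_cases hc : 2 ^ 2 ^ j ≤ 2 * d
      · have hs : 2 ^ 2 ^ (j + 1) ≤ 4 * d * d + 4 := by
          rw [← e2]
          have := Nat.mul_le_mul hc hc
          calc _ ≤ _ := this
            _ = 4 * d * d := by ring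
            _ ≤ _ := by omega
        refine ⟨j + 1, by omega, ?_, ((Nat.lt_two_pow_self).le).trans hs, hs, ?_⟩
        · simp only [hh, if_pos hc, e1, e2]
        · have h5 : 2 ^ 2 ^ j < 2 ^ 2 ^ (j + 1) :=
            Nat.pow_lt_pow_right (by omega) (Nat.pow_lt_pow_right (by omega) (by omega))
          omega
      · refine ⟨j, h0, ?_, h2, h3, by omega⟩
        simp only [hh, if_neg hc]
  have hlf : LF fun x => (h (D x))^[2 * D x] (2, 4) := by
    refine LF.iterate (B := fun x => 4 * D x * D x + 4) (LF.const _) ?_ (by fun_prop)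
      (LF.bdd (by fun_prop)) fun x t _ i => ?_
    · simp only [hh]; fun_prop
    · obtain ⟨j, -, h1, h2, h3, -⟩ := key (D x) t
      rw [h1]
      rcases i with i | i
      · exact h2
      · exact h3
  have hspec : ∀ x, ∃ j, 0 < j ∧ (h (D x))^[2 * D x] (2, 4) = (2 ^ j, 2 ^ 2 ^ j) ∧ 2 * D x ≤ 2 ^ 2 ^ j := by
    intro x
    obtain ⟨j, h0, h1, -, -, h4⟩ := key (D x) (2 * D x)
    exact ⟨j, h0, h1, by omega⟩
  have hhalf : ∀ j, 2 ^ 2 ^ j / 2 = 2 ^ (2 ^ j - 1) := fun j => by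
    have := Nat.one_le_two_pow (n := j)
    conv_lhs => rw [show 2 ^ j = 2 ^ j - 1 + 1 by omega, pow_succ]
    omega
  refine ⟨fun x => ((h (D x))^[2 * D x] (2, 4)).1 - 1, by fun_prop, ?_, fun x => ?_⟩
  · convert (by fun_prop : LF fun x => ((h (D x))^[2 * D x] (2, 4)).2 / 2) using 2 with x
    obtain ⟨j, -, h1, -⟩ := hspec x
    simp only [h1, hhalf]
  · obtain ⟨j, h0, h1, h2⟩ := hspec x
    have h3 : 2 ^ 1 ≤ 2 ^ j := Nat.pow_le_pow_right (by omega) h0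
    simp only [h1, ← hhalf]
    exact ⟨by omega, ⟨j, by omega⟩, by omega⟩

end

/-! ### Descriptions of layers -/

/-- The description of a layer. -/
def encs {B : GateBasis} {N : ℕ} (L : List (Gate B N)) : List Tok := L.flatMap Gate.encode

variable {B : GateBasis} {N : Γ → ℕ} [∀ x, NeZero (N x)]

theorem lfl_wire (hN : LF N) {i : Γ → ℕ} (hi : LF i) : LFL fun x => encodeNat (wire (N x) (i x) : ℕ) :=
  LFL.encodeNat (v := fun x => i x % N x) (by fun_prop)

theorem encs_hLayer {N : ℕ} {α : Type} (σ : Std B) (f : α → Fin N) (l : List α) :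
    encs (hLayer σ (l.map f)) = l.flatMap fun x => (Tok.basic :: encodeNat σ.h) ++ encodeNat (f x) := by
  simp only [encs, hLayer, List.flatMap_map, single_encode (h_arity σ)]

theorem encs_fans {N : ℕ} {α : Type} (c : α → Fin N) (ts : α → List (Fin N)) (l : List α) :
    encs (fans c ts l : List (Gate B N)) = l.flatMap fun x =>
      Tok.fanout :: (encodeNat (c x) ++ (ts x).flatMap fun t : Fin N => encodeNat (t : ℕ)) := by
  simp [encs, fans, List.flatMap_map, Gate.encode, Gate.wires, List.flatMap_assoc]

theorem lfl_hBlock (σ : Std B) (hN : LF N) {M c : Γ → ℕ} (hM : LF M) (hc : LF c) :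
    LFL fun x => encs (hLayer σ (block (N x) (M x) (c x))) := by
  simp only [block, encs_hLayer]
  exact LFL.flatMap (f := fun x q => (Tok.basic :: QFan.encodeNat σ.h) ++ QFan.encodeNat (wire (N x) (M x + q) : ℕ))
    (LFL.append (LFL.cons _ (LFL.encodeNat (LF.const _)))
      (lfl_wire (N := fun p : Γ × ℕ => N p.1) (by fun_prop) (by fun_prop))) hc

theorem Phase.lfl {M T A : Γ → ℕ} {sign : Γ × ℕ → ℕ} {slot : (Γ × ℕ) × ℕ → ℕ} (hM : LF M) (hT : LF T)
    (hA : LF A) (hs : LF sign) (hl : LF slot) (σ : Std B) (hN : LF N) :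
    LFL fun x => ((Phase.mk (M x) (T x) (A x) (fun s => sign (x, s)) fun s p => slot ((x, s), p)).layers
      σ (N x)).flatMap fun L => Tok.layer :: encs L := by
  set P : Γ → Phase := fun x => Phase.mk (M x) (T x) (A x) (fun s => sign (x, s)) fun s p => slot ((x, s), p)
  have hF : LFL fun x => encs ((P x).layF B (N x)) := by
    simp only [layF, encs_fans, copies, List.flatMap_map, filter_flatMap', decide_eq_true_eq]
    refine LFL.flatMap (f := fun x v => Tok.fanout :: (encodeNat (wire (N x) v : ℕ) ++
      (List.range (T x * A x)).flatMap fun q => if slot ((x, q / A x), q % A x) = v + 1 then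
        encodeNat (wire (N x) (M x + q) : ℕ) else [])) (LFL.cons _ (LFL.append
        (lfl_wire (N := fun p : Γ × ℕ => N p.1) (by fun_prop) (by fun_prop))
        (LFL.flatMap (f := fun (p : Γ × ℕ) q => if slot ((p.1, q / A p.1), q % A p.1) = p.2 + 1 then
          encodeNat (wire (N p.1) (M p.1 + q) : ℕ) else []) ?_ (by fun_prop)))) hM
    refine LFL.ite ?_ (lfl_wire (N := fun p : (Γ × ℕ) × ℕ => N p.1.1) (by fun_prop) (by fun_prop)) LFL.nil
    fun_prop
  have hG : LFL fun x => encs ((P x).layG B (N x)) := by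
    simp only [layG, encs_fans, block, List.flatMap_map]
    exact LFL.flatMap (f := fun x s => Tok.fanout :: (encodeNat (wire (N x) (M x + s * A x) : ℕ) ++
      (List.range (A x - 1)).flatMap fun q => encodeNat (wire (N x) (M x + s * A x + 1 + q) : ℕ)))
      (LFL.cons _ (LFL.append (lfl_wire (N := fun p : Γ × ℕ => N p.1) (by fun_prop) (by fun_prop))
        (LFL.flatMap (f := fun (p : Γ × ℕ) q =>
          encodeNat (wire (N p.1) (M p.1 + p.2 * A p.1 + 1 + q) : ℕ))
          (lfl_wire (N := fun p : (Γ × ℕ) × ℕ => N p.1.1) (by fun_prop) (by fun_prop)) (by fun_prop)))) hT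
  have hH : LFL fun x => encs ((P x).layH σ (N x)) := lfl_hBlock σ hN hM (hT.mul hA)
  have hR : LFL fun x => encs ((P x).layR σ (N x)) := by
    have e : ∀ {N : ℕ} (s : ℕ) (i : Fin N), encs (rot σ s i) = if s = 1 then
        (Tok.basic :: encodeNat σ.pos) ++ encodeNat i else if s = 2 then
        (Tok.basic :: encodeNat σ.neg) ++ encodeNat i else [] := by
      intro N s i
      rw [rot]
      split_ifs <;> simp [encs, single_encode (pos_arity σ), single_encode (neg_arity σ)]
    have e' : ∀ x, encs ((P x).layR σ (N x)) = (List.range (T x)).flatMap fun s =>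
        encs (rot σ (sign (x, s)) (wire (N x) (M x + s * A x))) := fun x => by
      rw [encs, layR, List.flatMap_assoc]; rfl
    simp only [e', e]
    have hw := lfl_wire (N := fun p : Γ × ℕ => N p.1) (i := fun p => M p.1 + p.2 * A p.1)
      (by fun_prop) (by fun_prop)
    exact LFL.flatMap (f := fun x s => if sign (x, s) = 1 then
        (Tok.basic :: encodeNat σ.pos) ++ encodeNat (wire (N x) (M x + s * A x)) else
        if sign (x, s) = 2 then
        (Tok.basic :: encodeNat σ.neg) ++ encodeNat (wire (N x) (M x + s * A x)) else [])
      (LFL.ite (LF.decide_eq hs (LF.const _)) (LFL.append (LFL.cons _ (LFL.encodeNat (LF.const _))) hw)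
        (LFL.ite (LF.decide_eq hs (LF.const _)) (LFL.append (LFL.cons _ (LFL.encodeNat (LF.const _))) hw)
          LFL.nil)) hT
  simp only [layers, List.flatMap_cons, List.flatMap_nil]
  exact .append (.cons _ hF) (.append (.cons _ hH) (.append (.cons _ hG) (.append (.cons _ hH)
    (.append (.cons _ hR) (.append (.cons _ hH) (.append (.cons _ hG) (.append (.cons _ hH)
    (.append (.cons _ hF) .nil))))))))

namespace Sym

/-- The data of the gates are computable with polynomially bounded registers. -/
structure IsLF (S : Γ → Sym) : Prop where
  M : LF fun x => (S x).M
  Λ : LF fun x => (S x).Λ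
  act : LF fun p : Γ × ℕ => (S p.1).act p.2
  cnt : LF fun p : Γ × ℕ => (S p.1).cnt p.2
  y : LF fun p : Γ × ℕ => (S p.1).y p.2
  inp : LF fun p : (Γ × ℕ) × ℕ => (S p.1.1).inp p.1.2 p.2
  J : LF fun p : (Γ × ℕ) × ℕ => (S p.1.1).J p.1.2 p.2

theorem lfl {S : Γ → Sym} (hS : IsLF S) (hk : LF fun x => (S x).k) (hk2 : LF fun x => 2 ^ (S x).k)
    (hk0 : ∀ x, 0 < (S x).k) (σ : Std B) (hN : LF N) :
    (LFL fun x => ((S x).layers σ (N x)).flatMap fun L => Tok.layer :: encs L) ∧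
      LF fun x => (S x).space := by
  obtain ⟨hM, hΛ, hact, hcnt, hy, hinp, hJ⟩ := hS
  obtain ⟨M, eM⟩ : ∃ M : Γ → ℕ, ∀ x, (S x).M = M x := ⟨_, fun _ => rfl⟩
  obtain ⟨Λ, eΛ⟩ : ∃ M : Γ → ℕ, ∀ x, (S x).Λ = M x := ⟨_, fun _ => rfl⟩
  obtain ⟨k, ek⟩ : ∃ M : Γ → ℕ, ∀ x, (S x).k = M x := ⟨_, fun _ => rfl⟩
  obtain ⟨act, eact⟩ : ∃ M : Γ × ℕ → Bool, ∀ x g, (S x).act g = M (x, g) := ⟨fun p => (S p.1).act p.2, fun _ _ => rfl⟩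
  obtain ⟨cnt, ecnt⟩ : ∃ M : Γ × ℕ → ℕ, ∀ x g, (S x).cnt g = M (x, g) := ⟨fun p => (S p.1).cnt p.2, fun _ _ => rfl⟩
  obtain ⟨y, ey⟩ : ∃ M : Γ × ℕ → ℕ, ∀ x g, (S x).y g = M (x, g) := ⟨fun p => (S p.1).y p.2, fun _ _ => rfl⟩
  obtain ⟨inp, einp⟩ : ∃ M : (Γ × ℕ) × ℕ → ℕ, ∀ x g i, (S x).inp g i = M ((x, g), i) :=
    ⟨fun p => (S p.1.1).inp p.1.2 p.2, fun _ _ _ => rfl⟩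
  obtain ⟨J, eJ⟩ : ∃ M : (Γ × ℕ) × ℕ → Bool, ∀ x g i, (S x).J g i = M ((x, g), i) :=
    ⟨fun p => (S p.1.1).J p.1.2 p.2, fun _ _ _ => rfl⟩
  simp only [ek] at hk0
  simp only [eM, eΛ, ek, eact, ecnt, ey, einp, eJ] at hM hΛ hk hk2 hact hcnt hy hinp hJ
  have hact : LF act := hact
  have hcnt : LF cnt := hcnt
  have hy : LF y := hy
  have hinp : LF inp := hinp
  have hJ : LF J := hJ
  obtain ⟨K, eK⟩ : ∃ K : Γ → ℕ, ∀ x, 2 ^ k x = K x := ⟨_, fun _ => rfl⟩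
  simp only [eK] at hk2
  have eE : ∀ x, (S x).E = 2 * K x := fun x => by rw [E, ek, pow_succ', eK]
  have epow : ∀ x r, r < k x → 2 ^ r = min (2 ^ r) (K x) := fun x r hr => by
    rw [← eK, min_eq_left (Nat.pow_le_pow_right (by omega) hr.le)]
  have hpow : LF fun p : Γ × ℕ => min (2 ^ p.2) (K p.1) := lf_two_pow_min (by fun_prop) (by fun_prop)
  obtain ⟨W, eW⟩ : ∃ W : Γ × ℕ → ℕ, ∀ x r, min (2 ^ r) (K x) = W (x, r) :=
    ⟨fun p => min (2 ^ p.2) (K p.1), fun _ _ => rfl⟩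
  have hW : LF W := by simpa only [eW] using hpow
  have eW' : ∀ x r, r < k x → 2 ^ r = W (x, r) := fun x r hr => (epow x r hr).trans (eW x r)
  have econ : ∀ x c, (S x).on c = (bif act (x, c / (Λ x + 2)) then J ((x, c / (Λ x + 2)), c % (Λ x + 2)) else false) :=
    fun x c => by
      rw [on, gOf, jOf, eΛ, eact, eJ]; cases act (x, c / (Λ x + 2)) <;> rfl
  obtain ⟨on, eon⟩ : ∃ M : Γ × ℕ → Bool, ∀ x g, (S x).on g = M (x, g) := ⟨fun p => (S p.1).on p.2, fun _ _ => rfl⟩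
  have hon : LF on := by
    have : LF fun p : Γ × ℕ => (S p.1).on p.2 := by simp only [econ]; fun_prop
    simpa only [eon] using this
  have ectls : ∀ x, (S x).ctls = Λ x * (Λ x + 2) * k x := fun x => by rw [ctls, pairs, eΛ, ek]
  have hctls : LF fun x => (S x).ctls := by simp only [ectls]; fun_prop
  have hpT : LF fun x => (S x).pT := by simp only [pT, ectls, eΛ, eE]; fun_prop
  have hqT : LF fun x => (S x).qT := by simp only [qT, pairs, eΛ, ek, eK, eE]; fun_prop
  have hps : LF fun p : Γ × ℕ => (S p.1).pSign p.2 := by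
    have eif : ∀ (c : Prop) [Decidable c] (i a b : ℕ), (if c then i < a else i < b) ↔ i < if c then a else b :=
      fun c _ i a b => by split_ifs <;> rfl
    simp only [pSign, pSign', eif, eE, eΛ, ek, eon, ecnt, gOf, jOf, eW' _ _ (Nat.mod_lt _ (hk0 _))]
    fun_prop
  have hpl : LF fun p : (Γ × ℕ) × ℕ => (S p.1.1).pSlot p.1.2 p.2 := by
    simp only [pSlot, pSlot', eE, eΛ, ek, einp, gOf, eM]
    fun_prop
  have hqs : LF fun p : Γ × ℕ => (S p.1).qSign p.2 := by
    simp only [qSign, qSign', eE, ek, eon, eK]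
    fun_prop
  have hql : LF fun p : (Γ × ℕ) × ℕ => (S p.1.1).qSlot p.1.2 p.2 := by
    have : ∀ x s p, (S x).qSlot s p = if p < k x then
        (if ¬ s / (2 * K x) % 3 = 0 ∧ s / (2 * K x) / 3 % K x / W (x, p) % 2 = 1 then
          M x + (s / (2 * K x) / 3 / K x * k x + p) + 1 else 0)
        else if p = k x ∧ ¬ s / (2 * K x) % 3 = 1 then y (x, s / (2 * K x) / 3 / K x / (Λ x + 2)) + 1 else 0 := by
      intro x s p
      simp only [qSlot, qSlot', eE, eΛ, ek, ey, eM, gOf, eK]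
      by_cases hp : p < k x
      · rw [if_pos hp, if_pos hp, eW' _ _ hp]
      · rw [if_neg hp, if_neg hp]
    simp only [this]
    fun_prop
  have hY : LFL fun x => encs ((S x).hY σ (N x)) := by
    simp only [Sym.hY, gates, encs_hLayer, filter_flatMap', eact, ey, eΛ]
    exact LFL.flatMap (f := fun x g => if act (x, g) = true then
      (Tok.basic :: encodeNat σ.h) ++ encodeNat (wire (N x) (y (x, g)) : ℕ) else [])
      (LFL.ite (by fun_prop) (LFL.append (LFL.cons _ (LFL.encodeNat (LF.const _)))
        (lfl_wire (N := fun p : Γ × ℕ => N p.1) (by fun_prop) (by fun_prop))) LFL.nil) hΛ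
  have hC : LFL fun x => encs ((S x).hC σ (N x)) := by
    simp only [Sym.hC, eM]
    exact lfl_hBlock σ hN hM hctls
  have hMc : LF fun x => (S x).M + (S x).ctls := by simp only [eM]; exact hM.add hctls
  have hA : LF fun x => (S x).k + 2 := by simp only [ek]; fun_prop
  have hP : LFL fun x => ((S x).P.layers σ (N x)).flatMap fun L => Tok.layer :: encs L :=
    Phase.lfl hMc hpT hA hps hpl σ hN
  have hQ : LFL fun x => ((S x).Q.layers σ (N x)).flatMap fun L => Tok.layer :: encs L :=
    Phase.lfl hMc hqT hA hqs hql σ hN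
  have hP' : LFL fun x => ((S x).P.inv.layers σ (N x)).flatMap fun L => Tok.layer :: encs L :=
    Phase.lfl hMc hpT hA (LF.ite (LF.decide_eq hps (LF.const 0)) (LF.const 0) ((LF.const 3).sub hps)) hpl σ hN
  constructor
  · simp only [layers, List.flatMap_append, List.flatMap_cons, List.flatMap_nil]
    have hC1 := (LFL.cons .layer hC).append LFL.nil
    exact .append (.append (.cons _ hY) hC1) (.append hP (.append hC1 (.append hQ (.append hC1
      (.append hP' (.append (.cons _ hC) (.append (.cons _ hY) .nil)))))))
  · simp only [space]
    exact hctls.add ((hpT.add hqT).mul hA)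

end Sym
end QFan

namespace QFan

variable {B : GateBasis} {M N : ℕ}

/-- Rename the qubits of a gate. -/
def Gate.map (f : Fin M → Fin N) : Gate B M → Gate B N
  | basic j w => basic j (f ∘ w)
  | fanout c ts => fanout (f c) (ts.map f)
  | and xs y => and (xs.map f) (f y)
  | or xs y => or (xs.map f) (f y)
  | threshold t xs y => threshold t (xs.map f) (f y)

theorem Gate.map_wires (f : Fin M → Fin N) (g : Gate B M) : (g.map f).wires = g.wires.map f := by
  cases g <;> simp [Gate.map, Gate.wires, List.map_ofFn]

/-- The first token in the description of a gate. -/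
def Gate.tok : Gate B N → Tok
  | basic _ _ => .basic
  | fanout _ _ => .fanout
  | and _ _ => .and
  | or _ _ => .or
  | threshold _ _ _ => .threshold

/-- The index or the threshold of a gate, if applicable. -/
def Gate.index : Gate B N → List ℕ
  | basic j _ => [(j : ℕ)]
  | threshold t _ _ => [t]
  | _ => []

/-- The numbers in the description of a gate. -/
def Gate.nums (g : Gate B N) : List ℕ := g.index ++ g.wires.map Fin.val

theorem Gate.encode_eq (g : Gate B N) : g.encode = g.tok :: g.nums.flatMap encodeNat := by
  cases g <;> simp [Gate.encode, Gate.nums, Gate.index, Gate.tok, List.flatMap_map, List.flatMap_assoc]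

theorem Gate.map_encode {f : Fin M → Fin N} (hf : ∀ i, (f i : ℕ) = i) (g : Gate B M) :
    (g.map f).encode = g.encode := by
  have h : (g.map f).wires.map Fin.val = g.wires.map Fin.val := by
    rw [Gate.map_wires, List.map_map]
    exact List.map_congr_left fun i _ => hf i
  rw [Gate.encode_eq, Gate.encode_eq, Gate.nums, Gate.nums, h]
  cases g <;> rfl

theorem Gate.length_le_encode (g : Gate B N) : g.wires.length ≤ g.encode.length := by
  have h : ∀ l : List ℕ, l.length ≤ (l.flatMap encodeNat).length := by
    intro l
    induction l with
    | nil => simp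
    | cons a l ih =>
      rw [List.flatMap_cons, List.length_append, List.length_cons, encodeNat, List.length_append,
        List.length_singleton]
      omega
  rw [Gate.encode_eq, List.length_cons]
  refine le_trans ?_ ((h g.nums).trans (Nat.le_succ _))
  simp [Gate.nums]

theorem Circuit.size_le_encode {m : ℕ} (C : Circuit B m) : C.size ≤ C.encode.length := by
  have h1 : ∀ L : List (Gate B (m + C.anc)), (L.map fun g => g.wires.length).sum ≤
      (L.flatMap Gate.encode).length := fun L => by
    rw [List.length_flatMap]
    exact List.sum_le_sum fun g _ => g.length_le_encode
  rw [Circuit.size, Circuit.encode, List.length_append]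
  refine le_trans ?_ (Nat.le_add_left _ _)
  rw [List.length_flatMap]
  exact List.sum_le_sum fun L _ => (h1 L).trans (by simp)

theorem hLayer_allowed (σ : Std B) (l : List (Fin N)) : ∀ g ∈ hLayer σ l, g.Allowed .nc := by
  intro g hg
  obtain ⟨i, -, rfl⟩ := List.mem_map.1 hg
  trivial

theorem Phase.layers_allowed [NeZero N] (P : Phase) (σ : Std B) :
    ∀ L ∈ P.layers σ N, ∀ g ∈ L, g.Allowed .nc := by
  have hfan : ∀ {α : Type} (c : α → Fin N) ts l, ∀ g ∈ (fans c ts l : List (Gate B N)), g.Allowed .nc := by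
    intro α c ts l g hg
    obtain ⟨i, -, rfl⟩ := List.mem_map.1 hg
    trivial
  have hR : ∀ g ∈ P.layR σ N, g.Allowed .nc := by
    intro g hg
    obtain ⟨s, -, hg⟩ := List.mem_flatMap.1 hg
    rw [rot] at hg
    split_ifs at hg <;> simp at hg <;> rw [hg] <;> trivial
  have hH := hLayer_allowed σ (block N P.M (P.T * P.A))
  simp only [layers, List.mem_cons, List.not_mem_nil, or_false]
  rintro L (rfl | rfl | rfl | rfl | rfl | rfl | rfl | rfl | rfl)
  all_goals first | exact hfan _ _ _ | exact hH | exact hR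

theorem Sym.layers_allowed [NeZero N] (S : Sym) (σ : Std B) : ∀ L ∈ S.layers σ N, ∀ g ∈ L, g.Allowed .nc := by
  intro L hL
  simp only [layers, List.mem_append, List.mem_cons, List.not_mem_nil, or_false] at hL
  rcases hL with (rfl | rfl) | h | rfl | h | rfl | h | rfl | rfl
  all_goals first | exact hLayer_allowed σ _ | exact Phase.layers_allowed _ σ _ h

theorem layersOp_unitary {Ls : List (List (Gate B N))} (h : ∀ L ∈ Ls, (L.flatMap Gate.wires).Nodup) :
    layersOp Ls ∈ Matrix.unitaryGroup (Bits N) ℂ := by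
  induction Ls with
  | nil => exact one_mem _
  | cons L Ls ih =>
    rw [layersOp_cons]
    exact mul_mem (ih fun L' h' => h L' (List.mem_cons_of_mem _ h')) (layerOp_unitary (h L (by simp)))

/-- Circuits that alternate given layers and layers of gates for symmetric functions. -/
theorem exists_circuits (σ : Std B) {m M : ℕ → ℕ} (hm : LF m) (hM : LF M) (hle : ∀ n, m n ≤ M n) (d : ℕ)
    {raw : ∀ n, ℕ → List (Gate B (M n))} (hraw : ∀ n ℓ, ((raw n ℓ).flatMap Gate.wires).Nodup)
    (hallowed : ∀ n ℓ, ∀ g ∈ raw n ℓ, g.Allowed .nc) (hlfl : LFL fun p : ℕ × ℕ => encs (raw p.1 p.2))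
    {S : ℕ × ℕ → Sym} (hS : Sym.IsLF S) (hSM : ∀ x, (S x).M = M x.1) (hV : ∀ x, (S x).Valid) (c : ℕ) :
    ∃ C : ∀ n, Circuit B (m n), UniformShallow .nc C ∧ ∀ n, ∃ (h : M n ≤ m n + (C n).anc)
      (_ : NeZero (m n + (C n).anc)) (G : ℕ → Op (m n + (C n).anc)),
      (∀ ℓ < d, G ℓ ∈ Matrix.unitaryGroup _ ℂ ∧
        Near (Clean (M n)) (32 / ((n : ℝ) + 1) ^ c) (G ℓ) ((S (n, ℓ)).op _) ∧
        ∀ ψ, Supp (fun b => Clean (M n) b ∧ (S (n, ℓ)).Trivial b) ψ → (G ℓ).mulVec ψ = ψ) ∧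
      (C n).op = ((List.range d).map fun ℓ =>
        G ℓ * layerOp ((raw n ℓ).map (Gate.map (Fin.castLE h)))).reverse.prod := by
  obtain ⟨k, hk, hk2, hks⟩ := exists_scale (Γ := ℕ × ℕ) (D := fun x => ((S x).Λ + 2) ^ 2 * (x.1 + 1) ^ c)
    ((LF.pow (hS.Λ.add (LF.const 2)) 2).mul (LF.pow (by fun_prop) c))
  set S' : ℕ × ℕ → Sym := fun x => { S x with k := k x } with hS'
  have hV' : ∀ x, (S' x).Valid := fun x =>
    ⟨(hV x).lt, (hV x).cnt_le, (hV x).inp_lt, (hV x).y_lt, (hV x).inp_ne, (hV x).y_inj⟩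
  have hI : Sym.IsLF S' := ⟨hS.M, hS.Λ, hS.act, hS.cnt, hS.y, hS.inp, hS.J⟩
  have hspace : LF fun p : ℕ × ℕ => (S' p).space :=
    (Sym.lfl (B := B) (N := fun _ => 1) hI hk hk2 (fun x => (hks x).1) σ (LF.const 1)).2
  set anc : ℕ → ℕ := fun n => (M n - m n) + 1 + ∑ ℓ ∈ Finset.range d, (S' (n, ℓ)).space with hanc
  have hanc_lf : LF anc := by
    have : LF fun n => ∑ ℓ ∈ Finset.range d, (S' (n, ℓ)).space := LF.sum hspace (LF.const d)
    fun_prop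
  have hN : LF fun x : ℕ × ℕ => m x.1 + anc x.1 := by fun_prop
  have hne : ∀ n, NeZero (m n + anc n) := fun n => ⟨by simp only [hanc]; omega⟩
  have : ∀ x : ℕ × ℕ, NeZero (m x.1 + anc x.1) := fun x => hne x.1
  have hMN : ∀ n, M n ≤ m n + anc n := fun n => by
    have := hle n; simp only [hanc]; omega
  have hfit : ∀ n, ∀ ℓ < d, (S' (n, ℓ)).M + (S' (n, ℓ)).space ≤ m n + anc n := fun n ℓ hℓ => by
    have h1 := Finset.single_le_sum (f := fun ℓ => (S' (n, ℓ)).space) (fun _ _ => Nat.zero_le _)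
      (Finset.mem_range.2 hℓ)
    have h2 : (S' (n, ℓ)).M = M n := hSM (n, ℓ)
    have := hle n
    simp only [hanc] at h1 ⊢
    omega
  set sub : ∀ n, ℕ → List (List (Gate B (m n + anc n))) := fun n ℓ =>
    (raw n ℓ).map (Gate.map (Fin.castLE (hMN n))) :: (S' (n, ℓ)).layers σ (m n + anc n) with hsub
  have hsubw : ∀ n, ∀ ℓ < d, ∀ L ∈ sub n ℓ, (L.flatMap Gate.wires).Nodup := by
    intro n ℓ hℓ L hL
    rcases List.mem_cons.1 hL with rfl | hL
    · rw [List.flatMap_map]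
      simp only [Gate.map_wires]
      rw [← List.map_flatMap]
      exact (hraw n ℓ).map (Fin.castLE_injective _)
    · exact Sym.layers_wires σ (hV' _) (hfit n ℓ hℓ) L hL
  set C : ∀ n, Circuit B (m n) := fun n => ⟨anc n, (List.range d).flatMap (sub n), fun L hL => by
    obtain ⟨ℓ, hℓ, hL⟩ := List.mem_flatMap.1 hL
    exact hsubw n ℓ (List.mem_range.1 hℓ) L hL⟩ with hC
  have hlf : LFL fun n => (C n).encode := by
    have e : ∀ n, (C n).encode = encodeNat (m n) ++ encodeNat (anc n) ++ (List.range d).flatMap fun ℓ =>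
        (Tok.layer :: encs (raw n ℓ)) ++ ((S' (n, ℓ)).layers σ (m n + anc n)).flatMap fun L =>
          Tok.layer :: encs L := by
      intro n
      have e1 : ∀ ℓ, encs ((raw n ℓ).map (Gate.map (Fin.castLE (hMN n)))) = encs (raw n ℓ) := fun ℓ => by
        rw [encs, encs, List.flatMap_map]
        exact List.flatMap_congr fun g _ => Gate.map_encode (f := Fin.castLE (hMN n)) (fun i => rfl) g
      rw [Circuit.encode]
      congr 1
      refine List.flatMap_assoc.trans (List.flatMap_congr fun ℓ _ => ?_)
      rw [← e1]
      exact List.flatMap_cons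
    simp only [e]
    exact .append (.append (.encodeNat hm) (.encodeNat hanc_lf)) (LFL.flatMap (.append (.cons _ hlfl)
      (Sym.lfl hI hk hk2 (fun x => (hks x).1) σ hN).1) (LF.const d))
  refine ⟨C, ⟨?_, hlf.logSpace, ⟨d * (1 + 33), fun n => ?_⟩, ?_⟩, fun n => ⟨hMN n, hne n,
    fun ℓ => layersOp ((S' (n, ℓ)).layers σ (m n + anc n)), fun ℓ hℓ => ⟨?_, ?_, ?_⟩, ?_⟩⟩
  · intro n L hL g hg
    obtain ⟨ℓ, -, hL⟩ := List.mem_flatMap.1 hL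
    rcases List.mem_cons.1 hL with rfl | hL
    · obtain ⟨g', hg', rfl⟩ := List.mem_map.1 hg
      have := hallowed n ℓ g' hg'
      cases g' <;> trivial
    · exact Sym.layers_allowed _ σ L hL g hg
  · refine le_of_eq ?_
    rw [Circuit.depth, hC, List.length_flatMap]
    simp [hsub, Sym.layers, Phase.layers]
  · obtain ⟨p, hp⟩ := hlf.length.bdd.polynomial
    exact ⟨p, fun n => (C n).size_le_encode.trans (hp n)⟩
  · exact layersOp_unitary (Sym.layers_wires σ (hV' _) (hfit n ℓ hℓ))
  · obtain ⟨h0, ⟨j, hj⟩, hD⟩ := hks (n, ℓ)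
    have h1 : 1 ≤ (n + 1) ^ c := Nat.one_le_pow _ _ (by omega)
    have hΛ : (S (n, ℓ)).Λ + 2 ≤ 2 ^ k (n, ℓ) := by
      refine le_trans ?_ hD
      nlinarith [Nat.zero_le (S (n, ℓ)).Λ]
    have key := Sym.layers_near σ (hV' (n, ℓ)) (hfit n ℓ hℓ) hj hΛ
    have e : (S' (n, ℓ)).M = M n := hSM (n, ℓ)
    rw [e] at key
    refine key.mono ?_
    have hn : (0 : ℝ) < ((n : ℝ) + 1) ^ c := by positivity
    rw [div_le_div_iff₀ (by rw [Sym.E]; positivity) hn]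
    have h2 : (S' (n, ℓ)).pairs * ((S (n, ℓ)).Λ + 2) * (n + 1) ^ c ≤ (S' (n, ℓ)).E ^ 2 := by
      have h3 : (S' (n, ℓ)).pairs = (S (n, ℓ)).Λ * ((S (n, ℓ)).Λ + 2) := rfl
      have h4 : (S' (n, ℓ)).E = 2 ^ (k (n, ℓ) + 1) := rfl
      rw [h3, h4]
      set L := (S (n, ℓ)).Λ + 2 with hL
      set w := (n + 1) ^ c
      have hw : L ^ 2 * w ≤ 2 ^ (k (n, ℓ) + 1) := hD.trans (Nat.pow_le_pow_right (by omega) (by omega))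
      calc (S (n, ℓ)).Λ * L * L * w ≤ L * L * L * w := by gcongr; omega
        _ ≤ (L * L * L * w) * (L * w) := Nat.le_mul_of_pos_right _ (by positivity)
        _ = (L ^ 2 * w) ^ 2 := by ring
        _ ≤ _ := Nat.pow_le_pow_left hw 2
    have h3 : ((S' (n, ℓ)).pairs : ℝ) * ((S (n, ℓ)).Λ + 2) * (n + 1) ^ c ≤ ((S' (n, ℓ)).E : ℝ) ^ 2 := by
      exact_mod_cast h2
    rw [mul_assoc]
    exact mul_le_mul_of_nonneg_left h3 (by norm_num)
  · intro ψ hψ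
    refine Sym.layers_exact σ (hV' _) (hfit n ℓ hℓ) (hψ.mono fun b hb => ⟨?_, hb.2⟩)
    rw [show (S' (n, ℓ)).M = M n from hSM (n, ℓ)]
    exact hb.1
  · have e : (C n).op = layersOp ((List.range d).flatMap (sub n)) := (layersOp_flatten _).symm
    rw [e]
    induction List.range d with
    | nil => rfl
    | cons ℓ l ih =>
      rw [List.flatMap_cons, layersOp_append, ih, hsub, layersOp_cons]
      simp

end QFan

namespace QFan

variable {B : GateBasis} {M N K : ℕ}

/-- Add qubits in the state `|0⟩` to a basis state. -/
def pad (N : ℕ) (a : Bits M) : Bits N := fun i => if h : i < M then a ⟨i, h⟩ else false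

open scoped Classical in
/-- Add qubits in the state `|0⟩` to a state. -/
noncomputable def ext (h : M ≤ N) (ψ : Bits M → ℂ) (b : Bits N) : ℂ :=
  if Clean M b then ψ (b ∘ Fin.castLE h) else 0

theorem pad_clean (a : Bits M) : Clean M (pad N a) := fun i hi => by rw [pad, dif_neg (by omega)]

theorem pad_castLE (h : M ≤ N) (a : Bits M) (i : Fin M) : pad N a (Fin.castLE h i) = a i := by
  rw [pad, dif_pos (by simp)]; rfl

theorem pad_comp (h : M ≤ N) (a : Bits M) : pad N a ∘ Fin.castLE h = a := funext (pad_castLE h a)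

theorem Clean.pad_comp {b : Bits N} (hb : Clean M b) (h : M ≤ N) : pad N (b ∘ Fin.castLE h) = b := by
  funext i
  by_cases hi : (i : ℕ) < M
  · rw [pad, dif_pos hi]; rfl
  · rw [pad, dif_neg hi, hb i (by omega)]

theorem clean_castLE (h : M ≤ N) (hK : N ≤ K) {b : Bits K} :
    Clean M b ↔ Clean N b ∧ Clean M (b ∘ Fin.castLE hK) := by
  constructor
  · exact fun hb => ⟨fun i hi => hb i (by omega), fun i hi => hb _ hi⟩
  · rintro ⟨h1, h2⟩ i hi
    by_cases hN : N ≤ i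
    · exact h1 i hN
    · exact h2 ⟨i, by omega⟩ hi

theorem ext_ext (h : M ≤ N) (hK : N ≤ K) (ψ : Bits M → ℂ) : ext hK (ext h ψ) = ext (h.trans hK) ψ := by
  funext b
  have e := clean_castLE h hK (b := b)
  by_cases hb : Clean M b
  · rw [ext, if_pos (e.1 hb).1, ext, if_pos (e.1 hb).2, ext, if_pos hb]; rfl
  · rw [ext, ext, ext, if_neg hb]
    split_ifs with h1 h2
    · exact absurd (e.2 ⟨h1, h2⟩) hb
    · rfl
    · rfl

theorem withZeros_eq {m a : ℕ} (ψ : Bits m → ℂ) : withZeros a ψ = ext (Nat.le_add_right m a) ψ := by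
  funext b
  have : (∀ j : Fin a, b (Fin.natAdd m j) = false) ↔ Clean m b := by
    constructor
    · intro h i hi
      obtain ⟨j, rfl⟩ : ∃ j : Fin a, i = Fin.natAdd m j := ⟨⟨i - m, by omega⟩, Fin.ext (by simp; omega)⟩
      exact h j
    · exact fun h j => h _ (by simp)
  by_cases hb : Clean m b
  · exact (if_pos (this.2 hb)).trans (if_pos hb).symm
  · exact (if_neg (mt this.1 hb)).trans (if_neg hb).symm

theorem supp_ext (h : M ≤ N) (ψ : Bits M → ℂ) : Supp (Clean M) (ext h ψ) := fun b hb => by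
  by_contra hc
  exact hb (by rw [ext, if_neg hc])

theorem sum_ext {R : Type} [AddCommMonoid R] (h : M ≤ N) (ψ : Bits M → ℂ) (F : Bits N → ℂ → R) (hF : ∀ b, F b 0 = 0) :
    ∑ b, F b (ext h ψ b) = ∑ a, F (pad N a) (ψ a) := by
  classical
  have h1 : ∀ a, ext h ψ (pad N a) = ψ a := fun a => by rw [ext, if_pos (pad_clean a), pad_comp]
  simp only [← h1]
  rw [← Finset.sum_subset (Finset.subset_univ (Finset.univ.image (pad N))), Finset.sum_image]
  · intro a _ a' _ e
    rw [← pad_comp h a, e, pad_comp h]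
  · intro b _ hb
    rw [ext, if_neg fun hc => hb (Finset.mem_image.2 ⟨_, Finset.mem_univ _, hc.pad_comp h⟩), hF]

theorem nrm_ext (h : M ≤ N) (ψ : Bits M → ℂ) : nrm (ext h ψ) = nrm ψ := by
  rw [nrm, nrm, EuclideanSpace.norm_eq, EuclideanSpace.norm_eq]
  congr 1
  exact sum_ext h ψ (fun _ z => ‖z‖ ^ 2) fun _ => by simp

theorem ext_single (h : M ≤ N) (a : Bits M) : ext h (Pi.single a 1) = Pi.single (pad N a) 1 := by
  classical
  funext b
  rw [ext, Pi.single_apply, Pi.single_apply]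
  by_cases hb : b = pad N a
  · rw [if_pos hb, hb, if_pos (pad_clean a), if_pos (pad_comp h a)]
  · rw [if_neg hb]
    split_ifs with h1 h2
    · exact absurd (by rw [← h2, h1.pad_comp]) hb
    · rfl
    · rfl

/-- `X` acts as `Y` on the first qubits. -/
def Lifts (h : M ≤ N) (X : Op N) (Y : Op M) : Prop := ∀ ψ, X.mulVec (ext h ψ) = ext h (Y.mulVec ψ)

theorem Lifts.one (h : M ≤ N) : Lifts h 1 1 := fun ψ => by simp only [Matrix.one_mulVec]

theorem Lifts.mul {h : M ≤ N} {X X' : Op N} {Y Y' : Op M} (h' : Lifts h X' Y') (h1 : Lifts h X Y) :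
    Lifts h (X' * X) (Y' * Y) := fun ψ => by
  rw [← Matrix.mulVec_mulVec, h1, h', Matrix.mulVec_mulVec]

theorem Lifts.prod {ι : Type} {h : M ≤ N} {X : ι → Op N} {Y : ι → Op M} {l : List ι}
    (hl : ∀ i ∈ l, Lifts h (X i) (Y i)) : Lifts h (l.map X).reverse.prod (l.map Y).reverse.prod := by
  induction l with
  | nil => exact .one h
  | cons i l ih =>
    simp only [List.map_cons, List.reverse_cons, List.prod_append, List.prod_singleton]
    exact (ih fun j hj => hl j (List.mem_cons_of_mem _ hj)).mul (hl i (by simp))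

theorem lifts_of {h : M ≤ N} {X : Op N} {Y : Op M} (hXY : ∀ b a, X b (pad N a) = ext h (fun b' => Y b' a) b) :
    Lifts h X Y := by
  intro ψ
  funext b
  have := sum_ext h ψ (fun a z => X b a * z) fun _ => mul_zero _
  rw [Matrix.mulVec, dotProduct, this]
  simp only [hXY, ext, Matrix.mulVec, dotProduct]
  split_ifs <;> simp

theorem lifts_classicalOp {h : M ≤ N} {f : Bits M → Bits M} {f' : Bits N → Bits N}
    (hf : ∀ a, f' (pad N a) = pad N (f a)) : Lifts h (classicalOp f') (classicalOp f) := by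
  refine lifts_of fun b a => ?_
  simp only [classicalOp, Matrix.of_apply, hf, ext]
  by_cases hb : b = pad N (f a)
  · rw [if_pos hb, hb, if_pos (pad_clean _), pad_comp, if_pos rfl]
  · rw [if_neg hb]
    split_ifs with h1 h2
    · exact absurd (by rw [← h2, h1.pad_comp]) hb
    · rfl
    · rfl

theorem pad_flipIf (h : M ≤ N) {y : Fin M} {g : Bits M → Bool} {g' : Bits N → Bool}
    (hg : ∀ a, g' (pad N a) = g a) (a : Bits M) :
    flipIf (Fin.castLE h y) g' (pad N a) = pad N (flipIf y g a) := by
  funext i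
  rw [flipIf, hg, pad_castLE]
  by_cases hi : i = Fin.castLE h y
  · subst hi
    rw [Function.update_self, pad_castLE, flipIf, Function.update_self]
  · rw [Function.update_of_ne hi, pad, pad]
    split_ifs with h1
    · rw [flipIf, Function.update_of_ne fun e => hi (by rw [← e]; rfl)]
    · rfl

theorem Gate.lifts_map (h : M ≤ N) (g : Gate B M) : Lifts h (g.map (Fin.castLE h)).op g.op := by
  have hcount : ∀ (xs : List (Fin M)) (a : Bits M), (xs.map (Fin.castLE h)).countP (pad N a) = xs.countP a :=
    fun xs a => by
      rw [List.countP_map]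
      exact List.countP_congr fun i _ => by rw [Function.comp_apply, pad_castLE]
  cases g with
  | basic j w =>
    classical
    refine lifts_of fun b a => ?_
    simp only [Gate.map, Gate.op, Matrix.of_apply, ext, ← Function.comp_assoc, pad_comp]
    by_cases hb : Clean M b
    · rw [if_pos hb]
      refine if_congr ⟨fun H i hi => ?_, fun H i hi => ?_⟩ rfl rfl
      · have := H (Fin.castLE h i) fun k e => hi k (Fin.castLE_injective h e)
        rwa [pad_castLE] at this
      · by_cases hiM : (i : ℕ) < M
        · have := H ⟨i, hiM⟩ fun k e => hi k (by rw [Function.comp_apply, e]; rfl)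
          rw [pad, dif_pos hiM, ← this]; rfl
        · rw [hb i (by omega), pad_clean a i (by omega)]
    · rw [if_neg hb, if_neg]
      refine fun H => hb fun i hi => ?_
      rw [H i fun k e => ?_, pad_clean a i hi]
      have := congrArg Fin.val e
      simp only [Function.comp_apply, Fin.val_castLE] at this
      omega
  | fanout c ts =>
    refine lifts_classicalOp fun a => ?_
    funext i
    by_cases hi : (i : ℕ) < M
    · obtain ⟨i, rfl⟩ : ∃ i', i = Fin.castLE h i' := ⟨⟨i, hi⟩, rfl⟩
      simp only [pad_castLE, List.mem_map, Fin.castLE_inj, exists_eq_right]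
    · rw [if_neg, pad, pad, dif_neg hi, dif_neg hi]
      intro h'
      obtain ⟨j, -, rfl⟩ := List.mem_map.1 h'
      exact hi j.2
  | and xs y => exact lifts_classicalOp (pad_flipIf h fun a => by rw [hcount, List.length_map])
  | or xs y => exact lifts_classicalOp (pad_flipIf h fun a => by rw [hcount])
  | threshold t xs y => exact lifts_classicalOp (pad_flipIf h fun a => by rw [hcount])

theorem layerOp_lifts (h : M ≤ N) (L : List (Gate B M)) :
    Lifts h (layerOp (L.map (Gate.map (Fin.castLE h)))) (layerOp L) := by
  rw [layerOp, List.map_map]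
  exact Lifts.prod fun g _ => g.lifts_map h

/-- A product of approximations. -/
theorem near_prod {ι : Type} {h : M ≤ N} {G S R : ι → Op N} {X : ι → Op M} {ε : ℝ} {l : List ι}
    (hG : ∀ i ∈ l, G i ∈ Matrix.unitaryGroup (Bits N) ℂ) (hR : ∀ i ∈ l, R i ∈ Matrix.unitaryGroup (Bits N) ℂ)
    (hX : ∀ i ∈ l, X i ∈ Matrix.unitaryGroup (Bits M) ℂ) {R' : ι → Op M} (hRR : ∀ i ∈ l, Lifts h (R i) (R' i))
    (hn : ∀ i ∈ l, Near (Clean M) ε (G i) (S i)) (hSR : ∀ i ∈ l, Lifts h (S i * R i) (X i)) (ψ : Bits M → ℂ) :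
    nrm ((l.map fun i => G i * R i).reverse.prod.mulVec (ext h ψ) -
      ext h ((l.map X).reverse.prod.mulVec ψ)) ≤ l.length * ε * nrm ψ := by
  induction l generalizing ψ with
  | nil => simp [nrm]
  | cons i l ih =>
    have ih := ih (fun j hj => hG j (List.mem_cons_of_mem _ hj)) (fun j hj => hR j (List.mem_cons_of_mem _ hj))
      (fun j hj => hX j (List.mem_cons_of_mem _ hj)) (fun j hj => hRR j (List.mem_cons_of_mem _ hj))
      (fun j hj => hn j (List.mem_cons_of_mem _ hj)) (fun j hj => hSR j (List.mem_cons_of_mem _ hj))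
      ((X i).mulVec ψ)
    simp only [List.map_cons, List.reverse_cons, List.prod_append, List.prod_singleton, List.length_cons,
      ← Matrix.mulVec_mulVec]
    set A := (l.map fun i => G i * R i).reverse.prod
    have hA : A ∈ Matrix.unitaryGroup (Bits N) ℂ := by
      refine Submonoid.list_prod_mem _ fun Y hY => ?_
      obtain ⟨j, hj, rfl⟩ := List.mem_map.1 (List.mem_reverse.1 hY)
      exact mul_mem (hG j (List.mem_cons_of_mem _ hj)) (hR j (List.mem_cons_of_mem _ hj))
    refine (nrm_sub_le _ (A.mulVec (ext h ((X i).mulVec ψ))) _).trans ?_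
    rw [← Matrix.mulVec_sub, nrm_mulVec hA, hRR i (by simp), ← hSR i (by simp), ← Matrix.mulVec_mulVec,
      hRR i (by simp)]
    rw [← hSR i (by simp), ← Matrix.mulVec_mulVec, hRR i (by simp)] at ih
    have h1 := hn i (by simp) _ (supp_ext h ((R' i).mulVec ψ))
    have h2 : nrm (ext h ((R' i).mulVec ψ)) = nrm ψ := by
      rw [← hRR i (by simp), nrm_mulVec (hR i (by simp)), nrm_ext]
    rw [h2] at h1
    rw [nrm_mulVec (hX i (by simp))] at ih
    push_cast
    linarith

end QFan

namespace QFan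

/-! ### Reading descriptions of circuits -/

/-- The numbers of layers, of gates in the layer and of numbers in the gate after a token. -/
def stepTok (s : ℕ × ℕ × ℕ) (t : ℕ) : ℕ × ℕ × ℕ :=
  if t = 2 then (s.1 + 1, 0, 0) else if 3 ≤ t then (s.1, s.2.1 + 1, 0) else
    if t = 1 then (s.1, s.2.1, s.2.2 + 1) else s

def runToks (s : ℕ × ℕ × ℕ) (w : List Tok) : ℕ × ℕ × ℕ := (w.map Tok.code).foldl stepTok s

/-- The total weight of the tokens. -/
def total (W : ℕ × ℕ × ℕ → ℕ → ℕ) (s : ℕ × ℕ × ℕ) : List ℕ → ℕ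
  | [] => 0
  | t :: w => W s t + total W (stepTok s t) w

theorem total_append' (W : ℕ × ℕ × ℕ → ℕ → ℕ) (s : ℕ × ℕ × ℕ) (w w' : List ℕ) :
    total W s (w ++ w') = total W s w + total W (w.foldl stepTok s) w' := by
  induction w generalizing s with
  | nil => simp [total]
  | cons t w ih => rw [List.cons_append, total, total, ih, List.foldl_cons, add_assoc]

theorem LFL.total {Γ : Type} [Ctx Γ] {f : Γ → List Tok} (hf : LFL f) {W : Γ → ℕ × ℕ × ℕ → ℕ → ℕ}
    (hW : LF fun p : (Γ × ℕ × ℕ × ℕ) × ℕ => W p.1.1 p.1.2 p.2) (hle : ∀ x s t, W x s t ≤ 7) :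
    LF fun x => QFan.total (W x) (0, 0, 0) ((f x).map Tok.code) := by
  obtain ⟨l, y, hl, hy, h⟩ := hf
  set F : Γ → ℕ × (ℕ × ℕ × ℕ) × ℕ → ℕ × (ℕ × ℕ × ℕ) × ℕ := fun x p =>
    (p.1 + 1, stepTok p.2.1 (y x p.1), p.2.2 + W x p.2.1 (y x p.1)) with hF
  have key : ∀ x m, ∃ a b c, (F x)^[m] (0, (0, 0, 0), 0) = (m, (a, b, c),
      QFan.total (W x) (0, 0, 0) ((List.range m).map (y x))) ∧ a ≤ m ∧ b ≤ m ∧ c ≤ m ∧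
      ((List.range m).map (y x)).foldl stepTok (0, 0, 0) = (a, b, c) ∧
      QFan.total (W x) (0, 0, 0) ((List.range m).map (y x)) ≤ 7 * m := by
    intro x m
    induction m with
    | zero => exact ⟨0, 0, 0, rfl, by omega, by omega, by omega, rfl, le_rfl⟩
    | succ m ih =>
      obtain ⟨a, b, c, h1, ha, hb, hc, h2, h3⟩ := ih
      have h4 := hle x (a, b, c) (y x m)
      have h5 : QFan.total (W x) (0, 0, 0) ((List.range (m + 1)).map (y x)) =
          QFan.total (W x) (0, 0, 0) ((List.range m).map (y x)) + W x (a, b, c) (y x m) := by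
        rw [List.range_succ, List.map_append, total_append', h2]
        simp [QFan.total]
      rw [Function.iterate_succ_apply', h1, h5, List.range_succ, List.map_append, List.foldl_append, h2]
      refine ⟨(stepTok (a, b, c) (y x m)).1, (stepTok (a, b, c) (y x m)).2.1, (stepTok (a, b, c) (y x m)).2.2,
        rfl, ?_, ?_, ?_, rfl, by omega⟩
      all_goals
        simp only [stepTok]
        split_ifs <;> simp only <;> omega
  have := LF.iterate (a := fun _ : Γ => ((0, (0, 0, 0), 0) : ℕ × (ℕ × ℕ × ℕ) × ℕ)) (h := F) (m := l)
    (B := fun x => 7 * l x) (LF.const _) ?_ hl (LF.bdd (by fun_prop)) fun x t ht i => ?_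
  · convert (by fun_prop : LF fun x => ((F x)^[l x] (0, (0, 0, 0), 0)).2.2) using 2 with x
    obtain ⟨a, b, c, h1, -⟩ := key x (l x)
    rw [h1, h]
  · have h6 : LF fun p : Γ × ℕ × (ℕ × ℕ × ℕ) × ℕ => y p.1 p.2.1 :=
      LF.comp hy (f := fun p : Γ × ℕ × (ℕ × ℕ × ℕ) × ℕ => (p.1, p.2.1)) (by fun_prop)
    have h7 : LF fun p : Γ × ℕ × (ℕ × ℕ × ℕ) × ℕ => W p.1 p.2.2.1 (y p.1 p.2.1) :=
      LF.comp hW (f := fun p : Γ × ℕ × (ℕ × ℕ × ℕ) × ℕ => ((p.1, p.2.2.1), y p.1 p.2.1)) (by fun_prop)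
    obtain ⟨Y, eY⟩ : ∃ Y : Γ × ℕ × (ℕ × ℕ × ℕ) × ℕ → ℕ, ∀ p, y p.1 p.2.1 = Y p := ⟨_, fun _ => rfl⟩
    obtain ⟨V, eV⟩ : ∃ V : Γ × ℕ × (ℕ × ℕ × ℕ) × ℕ → ℕ, ∀ p, W p.1 p.2.2.1 (Y p) = V p := ⟨_, fun _ => rfl⟩
    simp only [eY, eV] at h6 h7
    simp only [hF, stepTok, eY, eV]
    have h6 : LF Y := h6
    have h7 : LF V := h7
    fun_prop
  · obtain ⟨a, b, c, h1, ha, hb, hc, h2, h3⟩ := key x t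
    rw [h1]
    rcases i with i | (i | i | i) | i
    · show t ≤ _; omega
    · show a ≤ _; omega
    · show b ≤ _; omega
    · show c ≤ _; omega
    · show _ ≤ _; exact h3.trans (by omega)

theorem LogSpace.lfl {f : ℕ → List Tok} (hf : LogSpace f) : LFL f := by
  have h := LogSpace.lf hf Tok.code (W := 7) (by rintro (_ | _) <;> simp [Tok.code])
  refine ⟨fun n => (f n).length, fun n i => ((f n)[i]?).elim 0 Tok.code, ?_, ?_, fun n => ?_⟩
  · exact LF.comp (g := fun p : ℕ × ℕ => p.1) LF.fst (LF.comp h (f := fun n : ℕ => (n, 0)) (by fun_prop))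
  · exact LF.comp (g := fun p : ℕ × ℕ => p.2) LF.snd h
  · refine List.ext_getElem (by simp) fun i h1 h2 => ?_
    simp at h1 h2
    simp [h2]

section
variable {W : ℕ × ℕ × ℕ → ℕ → ℕ}

/-- The total weight of a list of tokens. -/
def weightOf (W : ℕ × ℕ × ℕ → ℕ → ℕ) (s : ℕ × ℕ × ℕ) (w : List Tok) : ℕ := total W s (w.map Tok.code)

theorem weightOf_append (s : ℕ × ℕ × ℕ) (w w' : List Tok) :
    weightOf W s (w ++ w') = weightOf W s w + weightOf W (runToks s w) w' := by
  rw [weightOf, List.map_append, total_append']; rfl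

theorem runToks_append (s : ℕ × ℕ × ℕ) (w w' : List Tok) : runToks s (w ++ w') = runToks (runToks s w) w' := by
  rw [runToks, List.map_append, List.foldl_append]; rfl

theorem encodeNat_toks (l g j v : ℕ) : runToks (l, g, j) (encodeNat v) = (l, g, j + 1) ∧
    weightOf W (l, g, j) (encodeNat v) = v * W (l, g, j) 0 + W (l, g, j) 1 := by
  induction v with
  | zero => simp [encodeNat, runToks, Tok.code, stepTok, weightOf, total]
  | succ v ih =>
    have h0 : stepTok (l, g, j) 0 = (l, g, j) := rfl
    have e : encodeNat (v + 1) = .mark :: encodeNat v := by rw [encodeNat, List.replicate_succ]; rfl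
    obtain ⟨h1, h2⟩ := ih
    rw [e]
    refine ⟨h1, ?_⟩
    have : weightOf W (l, g, j) (.mark :: encodeNat v) = W (l, g, j) 0 + weightOf W (l, g, j) (encodeNat v) := rfl
    rw [this, h2]
    ring

theorem nums_toks (l g j : ℕ) (v : List ℕ) : runToks (l, g, j) (v.flatMap encodeNat) = (l, g, j + v.length) ∧
    weightOf W (l, g, j) (v.flatMap encodeNat) =
      ∑ i ∈ Finset.range v.length, (v.getD i 0 * W (l, g, j + i) 0 + W (l, g, j + i) 1) := by
  induction v generalizing j with
  | nil => exact ⟨rfl, rfl⟩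
  | cons a v ih =>
    obtain ⟨h1, h2⟩ := encodeNat_toks (W := W) l g j a
    obtain ⟨h3, h4⟩ := ih (j + 1)
    rw [List.flatMap_cons, runToks_append, h1, h3, weightOf_append, h1, h2, h4, List.length_cons,
      Finset.sum_range_succ']
    refine ⟨by rw [show j + 1 + v.length = j + (v.length + 1) by omega], ?_⟩
    rw [add_comm (a * _ + _)]
    simp [add_assoc, add_comm 1]

variable {B : GateBasis} {N : ℕ}

theorem gate_toks (l g j : ℕ) (x : Gate B N) :
    runToks (l, g, j) x.encode = (l, g + 1, x.nums.length) ∧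
    weightOf W (l, g, j) x.encode = W (l, g, j) x.tok.code + ∑ i ∈ Finset.range x.nums.length,
      (x.nums.getD i 0 * W (l, g + 1, i) 0 + W (l, g + 1, i) 1) := by
  have h3 : stepTok (l, g, j) x.tok.code = (l, g + 1, 0) := by cases x <;> rfl
  obtain ⟨h1, h2⟩ := nums_toks (W := W) l (g + 1) 0 x.nums
  simp only [zero_add] at h1 h2
  rw [x.encode_eq, ← h2]
  constructor
  · show runToks (stepTok (l, g, j) x.tok.code) _ = _
    rw [h3, h1]
  · show W (l, g, j) x.tok.code + weightOf W (stepTok (l, g, j) x.tok.code) _ = _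
    rw [h3]

variable {ly gt : ℕ} {val : Gate B N → ℕ}

theorem layer_toks (hval : ∀ l g j x, weightOf W (l, g, j) x.encode = if l = ly ∧ g + 1 = gt then val x else 0)
    (l g j : ℕ) (L : List (Gate B N)) : (∃ j', runToks (l, g, j) (encs L) = (l, g + L.length, j')) ∧
    weightOf W (l, g, j) (encs L) = if l = ly ∧ g < gt then (L[gt - 1 - g]?).elim 0 val else 0 := by
  induction L generalizing g j with
  | nil => exact ⟨⟨j, rfl⟩, by simp [encs, weightOf, total]⟩
  | cons x L ih =>
    obtain ⟨h1, -⟩ := gate_toks (W := W) l g j x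
    obtain ⟨⟨j', h2⟩, h3⟩ := ih (g + 1) x.nums.length
    have e : encs (x :: L) = x.encode ++ encs L := rfl
    rw [e, runToks_append, weightOf_append, h1, h2, hval, h3, List.length_cons]
    refine ⟨⟨j', by rw [show g + 1 + L.length = g + (L.length + 1) by omega]⟩, ?_⟩
    by_cases hl : l = ly
    · by_cases hg : g + 1 = gt
      · rw [if_pos ⟨hl, hg⟩, if_neg (by omega), if_pos ⟨hl, by omega⟩, show gt - 1 - g = 0 by omega]; simp
      · by_cases hg' : g + 1 < gt
        · rw [if_neg (by omega), if_pos ⟨hl, hg'⟩, if_pos ⟨hl, by omega⟩,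
            show gt - 1 - g = gt - 1 - (g + 1) + 1 by omega]
          simp
        · rw [if_neg (by omega), if_neg (by omega), if_neg (by omega)]
    · rw [if_neg (by omega), if_neg (by omega), if_neg (by omega)]

theorem layers_toks (hval : ∀ l g j x, weightOf W (l, g, j) x.encode = if l = ly ∧ g + 1 = gt then val x else 0)
    (hW : ∀ s, W s 2 = 0) (l : ℕ) (s : ℕ × ℕ) (Ls : List (List (Gate B N))) :
    weightOf W (l, s) (Ls.flatMap fun L => .layer :: L.flatMap Gate.encode) =
      if l < ly ∧ 0 < gt then (((Ls[ly - 1 - l]?).getD [])[gt - 1]?).elim 0 val else 0 := by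
  induction Ls generalizing l s with
  | nil => simp [weightOf, total]
  | cons L Ls ih =>
    obtain ⟨⟨j', h2⟩, h3⟩ := layer_toks hval (l + 1) 0 0 L
    have e1 : runToks (l, s) (.layer :: encs L) = runToks (l + 1, 0, 0) (encs L) := rfl
    have e2 : weightOf W (l, s) (.layer :: encs L) = W (l, s) 2 + weightOf W (l + 1, 0, 0) (encs L) := rfl
    have e : (L :: Ls).flatMap (fun L => Tok.layer :: L.flatMap Gate.encode) =
      (.layer :: encs L) ++ Ls.flatMap fun L => .layer :: L.flatMap Gate.encode := rfl
    rw [e, weightOf_append, e1, h2, e2, hW, h3, ih]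
    by_cases hg : 0 < gt
    · by_cases hl : l + 1 = ly
      · rw [if_pos ⟨hl, hg⟩, if_neg (by omega), if_pos ⟨by omega, hg⟩, show ly - 1 - l = 0 by omega]; simp
      · by_cases hl' : l + 1 < ly
        · rw [if_neg (by omega), if_pos ⟨hl', hg⟩, if_pos ⟨by omega, hg⟩,
            show ly - 1 - l = ly - 1 - (l + 1) + 1 by omega]
          simp
        · rw [if_neg (by omega), if_neg (by omega), if_neg (by omega)]
    · rw [if_neg (by omega), if_neg (by omega), if_neg (by omega)]

/-- A layer of a circuit. -/
def Circuit.layer {m : ℕ} (C : Circuit B m) (ℓ : ℕ) : List (Gate B (m + C.anc)) := (C.layers[ℓ]?).getD []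

theorem circuit_toks {m : ℕ} (C : Circuit B m) {val : Gate B (m + C.anc) → ℕ}
    (hval : ∀ l g j x, weightOf W (l, g, j) x.encode = if l = ly ∧ g + 1 = gt then val x else 0)
    (hW : ∀ s, W s 2 = 0) : weightOf W (0, 0, 0) C.encode =
      (m * W (0, 0, 0) 0 + W (0, 0, 0) 1) + (C.anc * W (0, 0, 1) 0 + W (0, 0, 1) 1) +
      if 0 < ly ∧ 0 < gt then ((C.layer (ly - 1))[gt - 1]?).elim 0 val else 0 := by
  obtain ⟨h1, h2⟩ := encodeNat_toks (W := W) 0 0 0 m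
  obtain ⟨h3, h4⟩ := encodeNat_toks (W := W) 0 0 1 C.anc
  have h5 := layers_toks hval hW 0 (0, 2) C.layers
  rw [Circuit.encode, weightOf_append, weightOf_append, runToks_append, h1, h2, h3, h4, h5]
  rfl

end

variable {B : GateBasis}

/-- The parts of a uniform family of circuits are computable with polynomially bounded registers. -/
theorem parse {m : ℕ → ℕ} {C : ∀ n, Circuit B (m n)} (hC : LogSpace fun n => (C n).encode) :
    LF m ∧ (LF fun n => (C n).anc) ∧ (LF fun n => (C n).encode.length) ∧
    (LF fun p : (ℕ × ℕ) × ℕ => (((C p.1.1).layer p.1.2)[p.2]?).elim 0 fun x => x.tok.code) ∧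
    (LF fun p : (ℕ × ℕ) × ℕ => (((C p.1.1).layer p.1.2)[p.2]?).elim 0 fun x => x.nums.length) ∧
    (LF fun p : ((ℕ × ℕ) × ℕ) × ℕ => (((C p.1.1.1).layer p.1.1.2)[p.1.2]?).elim 0 fun x => x.nums.getD p.2 0) := by
  have hL := hC.lfl
  set Wn : ℕ → ℕ → ℕ → ℕ × ℕ × ℕ → ℕ → ℕ := fun l g i s t =>
    if t = 0 ∧ s.1 = l ∧ s.2.1 = g ∧ s.2.2 = i then 1 else 0 with hWn
  set Wc : ℕ → ℕ → ℕ × ℕ × ℕ → ℕ → ℕ := fun l g s t => if t = 1 ∧ s.1 = l ∧ s.2.1 = g then 1 else 0 with hWc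
  set Wk : ℕ → ℕ → ℕ × ℕ × ℕ → ℕ → ℕ := fun l g s t =>
    if (3 ≤ t ∧ t < 8) ∧ s.1 = l ∧ s.2.1 + 1 = g then t else 0 with hWk
  have htok : ∀ {N} (x : Gate B N), 3 ≤ x.tok.code ∧ x.tok.code < 8 := by
    intro N x; cases x <;> simp [Gate.tok, Tok.code]
  have vn : ∀ {N} l g i l' g' j (x : Gate B N), weightOf (Wn l g i) (l', g', j) x.encode =
      if l' = l ∧ g' + 1 = g then x.nums.getD i 0 else 0 := by
    intro N l g i l' g' j x
    have := htok x
    rw [(gate_toks l' g' j x).2]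
    simp only [hWn, show x.tok.code ≠ 0 by omega, false_and, if_false, zero_add, true_and, one_ne_zero, add_zero]
    by_cases h : l' = l ∧ g' + 1 = g
    · simp only [h, true_and, if_true, mul_ite, mul_one, mul_zero, Finset.sum_ite_eq', Finset.mem_range]
      split_ifs with hi
      · rfl
      · rw [List.getD_eq_default _ _ (by omega)]
    · rw [if_neg h]
      exact Finset.sum_eq_zero fun i' _ => by rw [if_neg fun h' => h ⟨h'.1, h'.2.1⟩, mul_zero]
  have vc : ∀ {N} l g l' g' j (x : Gate B N), weightOf (Wc l g) (l', g', j) x.encode =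
      if l' = l ∧ g' + 1 = g then x.nums.length else 0 := by
    intro N l g l' g' j x
    have := htok x
    rw [(gate_toks l' g' j x).2]
    simp only [hWc, show x.tok.code ≠ 1 by omega, false_and, if_false, zero_add, true_and, zero_ne_one, mul_zero]
    split_ifs <;> simp
  have vk : ∀ {N} l g l' g' j (x : Gate B N), weightOf (Wk l g) (l', g', j) x.encode =
      if l' = l ∧ g' + 1 = g then x.tok.code else 0 := by
    intro N l g l' g' j x
    have := htok x
    rw [(gate_toks l' g' j x).2]
    simp [hWk, this.1, this.2]
  have tn := fun n l g i => circuit_toks (C n) (vn l g i) (by simp [hWn])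
  have tc := fun n l g => circuit_toks (C n) (vc l g) (by simp [hWc])
  have tk := fun n l g => circuit_toks (C n) (vk l g) (by simp [hWk])
  have ln : LF fun p : ((ℕ × ℕ) × ℕ) × ℕ => weightOf (Wn p.1.1.2 p.1.2 p.2) (0, 0, 0) (C p.1.1.1).encode := by
    refine LFL.total (LFL.comp hL (g := fun p : ((ℕ × ℕ) × ℕ) × ℕ => p.1.1.1) (by fun_prop))
      (W := fun p => Wn p.1.1.2 p.1.2 p.2) ?_ fun x s t => ?_
    · simp only [hWn]; fun_prop
    · simp only [hWn]; split_ifs <;> omega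
  have lc : LF fun p : (ℕ × ℕ) × ℕ => weightOf (Wc p.1.2 p.2) (0, 0, 0) (C p.1.1).encode := by
    refine LFL.total (LFL.comp hL (g := fun p : (ℕ × ℕ) × ℕ => p.1.1) (by fun_prop))
      (W := fun p => Wc p.1.2 p.2) ?_ fun x s t => ?_
    · simp only [hWc]; fun_prop
    · simp only [hWc]; split_ifs <;> omega
  have lk : LF fun p : (ℕ × ℕ) × ℕ => weightOf (Wk p.1.2 p.2) (0, 0, 0) (C p.1.1).encode := by
    refine LFL.total (LFL.comp hL (g := fun p : (ℕ × ℕ) × ℕ => p.1.1) (by fun_prop))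
      (W := fun p => Wk p.1.2 p.2) ?_ fun x s t => ?_
    · simp only [hWk]; fun_prop
    · simp only [hWk]; split_ifs <;> omega
  refine ⟨?_, ?_, hL.length, ?_, ?_, ?_⟩
  · have := LF.comp ln (f := fun n : ℕ => (((n, 0), 0), 0)) (by fun_prop)
    simp only [tn] at this
    simpa [hWn] using this
  · have := LF.comp ln (f := fun n : ℕ => (((n, 0), 0), 1)) (by fun_prop)
    simp only [tn] at this
    simpa [hWn] using this
  · have := LF.comp lk (f := fun p : (ℕ × ℕ) × ℕ => ((p.1.1, p.1.2 + 1), p.2 + 1)) (by fun_prop)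
    simp only [tk] at this
    simpa [hWk] using this
  · have := LF.comp lc (f := fun p : (ℕ × ℕ) × ℕ => ((p.1.1, p.1.2 + 1), p.2 + 1)) (by fun_prop)
    simp only [tc] at this
    simpa [hWc] using this
  · have := LF.comp ln (f := fun p : ((ℕ × ℕ) × ℕ) × ℕ => (((p.1.1.1, p.1.1.2 + 1), p.1.2 + 1), p.2)) (by fun_prop)
    simp only [tn] at this
    simpa [hWn] using this

end QFan

namespace QFan

/-! ### Symmetric gates in a layer -/

/-- Extend a set of weights so that it has an even number of elements. -/
def padJ (Λ : ℕ) (J : ℕ → Bool) (j : ℕ) : Bool :=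
  if j ≤ Λ then J j else decide ((∑ i ∈ Finset.range (Λ + 1), (J i).toNat) % 2 = 1)

theorem flips_padJ {S : Sym} {g w : ℕ} {J : ℕ → Bool} (h : S.J g = padJ S.Λ J) (hw : w ≤ S.Λ) :
    S.flips g w = J w := by
  have h1 : (∑ j ∈ Finset.range (S.Λ + 2), if S.J g j = true ∧ w ≠ j then 1 else 0) + (J w).toNat =
      ∑ j ∈ Finset.range (S.Λ + 2), (S.J g j).toNat := by
    have hw' : w ∈ Finset.range (S.Λ + 2) := Finset.mem_range.2 (by omega)
    rw [← Finset.sum_erase_add _ _ hw', ← Finset.sum_erase_add _ _ hw']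
    rw [if_neg (by simp), add_zero, h, padJ, if_pos hw]
    congr 1
    refine Finset.sum_congr rfl fun j hj => ?_
    have := (Finset.mem_erase.1 hj).1
    cases padJ S.Λ J j <;> simp [this.symm]
  have h2 : (∑ j ∈ Finset.range (S.Λ + 2), (S.J g j).toNat) % 2 = 0 := by
    have e : ∑ j ∈ Finset.range (S.Λ + 1), (S.J g j).toNat = ∑ j ∈ Finset.range (S.Λ + 1), (J j).toNat :=
      Finset.sum_congr rfl fun j hj => by rw [h, padJ, if_pos (by have := Finset.mem_range.1 hj; omega)]
    rw [Finset.sum_range_succ, e, h, padJ, if_neg (by omega)]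
    rcases Nat.mod_two_eq_zero_or_one (∑ j ∈ Finset.range (S.Λ + 1), (J j).toNat) with h | h <;> simp [h, Nat.add_mod]
  rw [Sym.flips]
  rw [← h1] at h2
  generalize (∑ j ∈ Finset.range (S.Λ + 2), if S.J g j = true ∧ w ≠ j then 1 else 0) = u at h2 ⊢
  cases hJ : J w <;> rw [hJ] at h2
  · exact decide_eq_false (by rw [Bool.toNat_false] at h2; omega)
  · exact decide_eq_true (by rw [Bool.toNat_true] at h2; omega)

theorem lf_padJ {Γ : Type} [Ctx Γ] {Λ j : Γ → ℕ} {J : Γ × ℕ → Bool} (hΛ : LF Λ) (hj : LF j) (hJ : LF J) :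
    LF fun x => padJ (Λ x) (fun w => J (x, w)) (j x) := by
  simp only [padJ]
  have : LF fun x => J (x, j x) := by fun_prop
  exact LF.ite (by fun_prop) this (by fun_prop)

/-- The symmetric gates in a layer of gates with the given tokens and numbers. -/
def numSym (M Λ : ℕ) (kd cn : ℕ → ℕ) (nm : ℕ → ℕ → ℕ) : Sym where
  M := M
  Λ := Λ
  k := 0
  act g := decide (5 ≤ kd g)
  cnt g := cn g - 1 - if kd g = 7 then 1 else 0
  inp g i := nm g (i + if kd g = 7 then 1 else 0)
  y g := nm g (cn g - 1)
  J g := padJ Λ fun w => if kd g = 5 then decide (w = cn g - 1) else if kd g = 6 then decide (0 < w) else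
    decide (nm g 0 ≤ w)

theorem numSym_lf {Γ : Type} [Ctx Γ] {M Λ : Γ → ℕ} {kd cn : Γ × ℕ → ℕ} {nm : (Γ × ℕ) × ℕ → ℕ} (hM : LF M)
    (hΛ : LF Λ) (hkd : LF kd) (hcn : LF cn) (hnm : LF nm) : Sym.IsLF fun x => numSym (M x) (Λ x)
      (fun g => kd (x, g)) (fun g => cn (x, g)) fun g i => nm ((x, g), i) where
  M := hM
  Λ := hΛ
  act := by simp only [numSym]; fun_prop
  cnt := by simp only [numSym]; fun_prop
  y := by simp only [numSym]; fun_prop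
  inp := by simp only [numSym]; fun_prop
  J := by
    simp only [numSym]
    have h : LF fun p : ((Γ × ℕ) × ℕ) × ℕ => if kd p.1.1 = 5 then decide (p.2 = cn p.1.1 - 1) else
        if kd p.1.1 = 6 then decide (0 < p.2) else decide (nm (p.1.1, 0) ≤ p.2) := by fun_prop
    exact lf_padJ (Λ := fun p : (Γ × ℕ) × ℕ => Λ p.1.1) (j := fun p => p.2) (by fun_prop) (by fun_prop) h

variable {B : GateBasis} {M N : ℕ}

theorem Gate.exists_symmetric (x : Gate B M) (h : 5 ≤ x.tok.code) : ∃ (xs : List (Fin M)) (y : Fin M) (f : ℕ → Bool), x.wires = xs ++ [y] ∧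
    (x.nums.length - 1 - if x.tok.code = 7 then 1 else 0) = xs.length ∧
    (∀ i < xs.length, x.nums.getD (i + if x.tok.code = 7 then 1 else 0) 0 = (xs.map Fin.val).getD i 0) ∧
    x.nums.getD (x.nums.length - 1) 0 = y ∧
    ((fun w => if x.tok.code = 5 then decide (w = x.nums.length - 1) else if x.tok.code = 6 then decide (0 < w) else
      decide (x.nums.getD 0 0 ≤ w)) = f) ∧
    ∀ (N : ℕ) (e : Fin M → Fin N), (x.map e).op = classicalOp (flipIf (e y) fun b => f ((xs.map e).countP b)) := by
  cases x with
  | basic j w => simp [Gate.tok, Tok.code] at h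
  | fanout c ts => simp [Gate.tok, Tok.code] at h
  | and xs y =>
    refine ⟨xs, y, _, rfl, by simp [nums, index, wires, tok, Tok.code], fun i hi => ?_, ?_, rfl, fun N e => ?_⟩
    · simp [nums, index, wires, tok, Tok.code, List.getElem?_append, hi]
    · simp [nums, index, wires]
    · simp [nums, index, wires, tok, Tok.code, Gate.map, op]
  | or xs y =>
    refine ⟨xs, y, _, rfl, by simp [nums, index, wires, tok, Tok.code], fun i hi => ?_, ?_, rfl, fun N e => ?_⟩
    · simp [nums, index, wires, tok, Tok.code, List.getElem?_append, hi]
    · simp [nums, index, wires]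
    · simp [tok, Tok.code, Gate.map, op]
  | threshold t xs y =>
    refine ⟨xs, y, _, rfl, by simp [nums, index, wires, tok, Tok.code], fun i hi => ?_, ?_, rfl, fun N e => ?_⟩
    · simp [nums, index, wires, tok, Tok.code, List.getElem?_append, hi]
    · simp [nums, index, wires]
    · simp [nums, index, wires, tok, Tok.code, Gate.map, op]

/-- The symmetric gates in a layer. -/
def layerSym (Λ : ℕ) (L : List (Gate B M)) : Sym :=
  numSym M Λ (fun g => (L[g]?).elim 0 fun x => x.tok.code) (fun g => (L[g]?).elim 0 fun x => x.nums.length)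
    fun g i => (L[g]?).elim 0 fun x => x.nums.getD i 0

theorem eq_of_mem_wires {L : List (Gate B M)} (hL : (L.flatMap Gate.wires).Nodup) {g g' : ℕ} {x x' : Gate B M}
    (h : L[g]? = some x) (h' : L[g']? = some x') {i : Fin M} (hi : i ∈ x.wires) (hi' : i ∈ x'.wires) : g = g' := by
  obtain ⟨hg, rfl⟩ := List.getElem?_eq_some_iff.1 h
  obtain ⟨hg', rfl⟩ := List.getElem?_eq_some_iff.1 h'
  have := List.pairwise_iff_getElem.1 (List.nodup_flatMap.1 hL).2
  rcases lt_trichotomy g g' with hlt | he | hlt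
  · exact absurd hi' (this g g' hg hg' hlt hi)
  · exact he
  · exact absurd hi (this g' g hg' hg hlt hi')

/-- What a symmetric gate in a layer looks like. -/
theorem layerSym_act {L : List (Gate B M)} (Λ : ℕ) {g : ℕ} (h : (layerSym Λ L).act g = true) :
    ∃ (x : Gate B M) (xs : List (Fin M)) (y : Fin M) (f : ℕ → Bool), L[g]? = some x ∧ 5 ≤ x.tok.code ∧ x.wires = xs ++ [y] ∧ (layerSym Λ L).cnt g = xs.length ∧
    (∀ i < xs.length, (layerSym Λ L).inp g i = (xs.map Fin.val).getD i 0) ∧ (layerSym Λ L).y g = y ∧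
    (layerSym Λ L).J g = padJ Λ f ∧
    ∀ (N : ℕ) (e : Fin M → Fin N), (x.map e).op = classicalOp (flipIf (e y) fun b => f ((xs.map e).countP b)) := by
  simp only [layerSym, numSym, decide_eq_true_eq] at h ⊢
  obtain hx | ⟨x, hx⟩ := Option.eq_none_or_eq_some L[g]?
  · rw [hx] at h; simp at h
  · rw [hx] at h
    obtain ⟨xs, y, f, h1, h2, h3, h4, h5, h6⟩ := x.exists_symmetric h
    simp only [hx, Option.elim]
    exact ⟨x, xs, y, f, rfl, h, h1, h2, h3, h4, congrArg _ h5, h6⟩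

theorem layerSym_valid {L : List (Gate B M)} (hL : (L.flatMap Gate.wires).Nodup) {Λ : ℕ} (hΛ : L.length ≤ Λ)
    (hM : M ≤ Λ) : (layerSym Λ L).Valid := by
  have hmem : ∀ {xs : List (Fin M)} {i : ℕ}, i < xs.length → ∃ z ∈ xs, (xs.map Fin.val).getD i 0 = z := fun {xs i} hi =>
    ⟨xs[i], List.getElem_mem hi, by simp [hi]⟩
  refine ⟨fun g hg => ?_, fun g hg => ?_, fun g hg i hi => ?_, fun g hg => ?_, fun g hg g' hg' i hi e => ?_,
    fun g hg g' hg' e => ?_⟩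
  all_goals obtain ⟨x, xs, y, f, h1, h2, h3, h4, h5, h6, -⟩ := layerSym_act Λ hg
  · exact (List.getElem?_eq_some_iff.1 h1).1.trans_le hΛ
  · have hn := (List.nodup_flatMap.1 hL).1 x (List.mem_of_getElem? h1)
    have := hn.length_le_card
    rw [h3, Fintype.card_fin, List.length_append] at this
    exact le_trans (by rw [h4]; omega) hM
  · obtain ⟨z, -, hz⟩ := hmem (h4 ▸ hi)
    rw [h5 i (h4 ▸ hi), hz]
    exact z.2
  · rw [h6]; exact y.2
  · obtain ⟨x', xs', y', f', h1', h2', h3', h4', h5', h6', -⟩ := layerSym_act Λ hg'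
    obtain ⟨z, hz1, hz2⟩ := hmem (h4 ▸ hi)
    rw [h5 i (h4 ▸ hi), hz2, h6'] at e
    obtain rfl : z = y' := Fin.ext e
    have hgg : g = g' := eq_of_mem_wires hL h1 h1' (i := z) (by simp [h3, hz1]) (by simp [h3'])
    subst hgg
    obtain rfl : x = x' := Option.some.inj (h1.symm.trans h1')
    obtain ⟨rfl, hy⟩ := List.append_inj' (h3.symm.trans h3') rfl
    have hn := (List.nodup_flatMap.1 hL).1 x (List.mem_of_getElem? h1)
    rw [h3'] at hn
    exact (List.nodup_append.1 hn).2.2 z hz1 z (by simp) rfl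
  · obtain ⟨x', xs', y', f', h1', h2', h3', h4', h5', h6', -⟩ := layerSym_act Λ hg'
    rw [h6, h6'] at e
    obtain rfl : y = y' := Fin.ext e
    exact eq_of_mem_wires hL h1 h1' (i := y) (by simp [h3]) (by simp [h3'])

theorem ones_eq_countP [NeZero N] (h : M ≤ N) {S : Sym} {g : ℕ} {xs : List (Fin M)} (hc : S.cnt g = xs.length)
    (hi : ∀ i < xs.length, S.inp g i = (xs.map Fin.val).getD i 0) (b : Bits N) :
    S.ones (bit b) g = (xs.map (Fin.castLE h)).countP b := by
  have e : xs.map (Fin.castLE h) = (List.range xs.length).map fun i => wire N (S.inp g i) := by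
    refine List.ext_getElem (by simp) fun i h1 h2 => Fin.ext ?_
    rw [List.length_map] at h1
    have := (xs[i]).2
    simp only [List.getElem_map, List.getElem_range, hi i h1, Fin.val_castLE]
    rw [wire_val] <;> simp [h1]
    omega
  rw [e, List.countP_map, countP_range, Sym.ones, hc]
  rfl

theorem flatMap_getElem? {α β : Type} (f : α → List β) (L : List α) {Λ : ℕ} (h : L.length ≤ Λ) :
    ((List.range Λ).flatMap fun g => (L[g]?).elim [] f) = L.flatMap f := by
  induction L generalizing Λ with
  | nil => simp
  | cons a L ih =>
    obtain ⟨Λ, rfl⟩ : ∃ n, Λ = n + 1 := ⟨Λ - 1, by simp at h; omega⟩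
    rw [List.range_succ_eq_map, List.flatMap_cons, List.flatMap_map, List.flatMap_cons, ← ih (Λ := Λ) (by simpa using h)]
    rfl

theorem filter_map_eq {α β : Type} (p : α → Bool) (f : α → β) (l : List α) :
    (l.filter p).map f = l.flatMap fun a => if p a = true then [f a] else [] := by
  rw [← filter_flatMap', flatMap_singleton' fun _ _ => rfl]

/-- The gates in a layer that are not symmetric gates. -/
def rawLayer (L : List (Gate B M)) : List (Gate B M) := L.filter fun x => decide (x.tok.code < 5)

theorem layer_split [NeZero N] {L : List (Gate B M)} (hL : (L.flatMap Gate.wires).Nodup) {Λ : ℕ}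
    (hΛ : L.length ≤ Λ) (hM : M ≤ Λ) (h : M ≤ N) : layerOp (L.map (Gate.map (Fin.castLE h))) =
      (layerSym Λ L).op N * layerOp ((rawLayer L).map (Gate.map (Fin.castLE h))) := by
  set F : Gate B M → Op N := fun x => (x.map (Fin.castLE h)).op
  have hS : (layerSym Λ L).op N = ((L.filter fun x => !decide (x.tok.code < 5)).map F).prod := by
    rw [Sym.op, Sym.gates, filter_map_eq, filter_map_eq, ← flatMap_getElem? _ L hΛ]
    congr 1
    refine List.flatMap_congr fun g _ => ?_
    by_cases hg : (layerSym Λ L).act g = true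
    · obtain ⟨x, xs, y, f, h1, h2, h3, h4, h5, h6, h7, h8⟩ := layerSym_act Λ hg
      rw [if_pos hg, h1, Option.elim, if_pos (by simpa using h2)]
      simp only [F, h8, Sym.flipOp]
      have hy : wire N ((layerSym Λ L).y g) = Fin.castLE h y := by
        refine Fin.ext ?_
        rw [h6, wire_val (y.2.trans_le h)]; rfl
      rw [hy]
      congr 3
      funext b
      rw [← ones_eq_countP h h4 h5]
      exact flips_padJ h7 (Sym.ones_le (layerSym_valid hL hΛ hM) hg)
    · rw [if_neg hg]
      simp only [layerSym, numSym, decide_eq_true_eq] at hg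
      cases hx : L[g]? with
      | none => rfl
      | some x =>
        rw [hx] at hg
        exact (if_neg (by simpa using hg)).symm
  have hc : ∀ x ∈ L, ∀ x' ∈ L, Commute (F x) (F x') := by
    intro x hx x' hx'
    obtain ⟨g, hg, rfl⟩ := List.mem_iff_getElem.1 hx
    obtain ⟨g', hg', rfl⟩ := List.mem_iff_getElem.1 hx'
    by_cases he : g = g'
    · subst he; exact Commute.refl _
    · refine (Gate.op_local _).commute (Gate.op_local _) (Set.disjoint_left.2 fun i hi hi' => he ?_)
      simp only [Gate.map_wires, List.mem_map, Set.mem_ofPred_eq] at hi hi'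
      obtain ⟨j, hj, rfl⟩ := hi
      obtain ⟨j', hj', e⟩ := hi'
      obtain rfl := Fin.castLE_injective h e
      exact eq_of_mem_wires hL (List.getElem?_eq_getElem hg) (List.getElem?_eq_getElem hg') hj hj'
  have hperm : (((rawLayer L).map F).reverse ++ ((L.filter fun x => !decide (x.tok.code < 5)).map F)).Perm
      (L.map F).reverse := by
    refine ((List.reverse_perm _).append_right _).trans (List.Perm.trans ?_ (List.reverse_perm _).symm)
    rw [← List.map_append]
    exact (List.filter_append_perm _ L).map F
  have hcomm : ∀ X ∈ L.map F, ∀ Y ∈ L.map F, Commute X Y := by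
    simp only [List.mem_map]
    rintro _ ⟨x, hx, rfl⟩ _ ⟨x', hx', rfl⟩
    exact hc x hx x' hx'
  have key := (List.perm_append_comm.trans hperm).symm.prod_eq' (List.pairwise_of_forall_mem_list fun X hX Y hY =>
    hcomm X (List.mem_reverse.1 hX) Y (List.mem_reverse.1 hY))
  rw [List.prod_append, ← hS] at key
  rw [layerOp, layerOp, List.map_map, List.map_map]
  exact key

end QFan

namespace QFan

variable {B : GateBasis}

theorem ext_sub {M N : ℕ} (h : M ≤ N) (ψ φ : Bits M → ℂ) : ext h (ψ - φ) = ext h ψ - ext h φ := by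
  funext b
  simp only [ext, Pi.sub_apply]
  split_ifs <;> simp

theorem tc_subset_nc (σ : Std B) : BQTCf0 B ⊆ BQNCf0 B := by
  intro F hF c
  obtain ⟨C, hU, K, hK⟩ := hF c
  obtain ⟨d, hd⟩ := hU.depth
  obtain ⟨hm, hanc, hlen, hkd, hcn, hnm⟩ := parse hU.uniform
  have hnod : ∀ n ℓ, (((C n).layer ℓ).flatMap Gate.wires).Nodup := fun n ℓ => by
    rw [Circuit.layer]
    cases hL : (C n).layers[ℓ]? with
    | none => exact List.nodup_nil
    | some L => exact (C n).disjoint L (List.mem_of_getElem? hL)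
  have hlength : ∀ n ℓ, ((C n).layer ℓ).length ≤ (C n).encode.length := fun n ℓ => by
    rw [Circuit.layer]
    cases hL : (C n).layers[ℓ]? with
    | none => exact Nat.zero_le _
    | some L =>
      obtain ⟨s, t, e⟩ := List.append_of_mem (List.mem_of_getElem? hL)
      have h1 : L.length ≤ (L.flatMap Gate.encode).length := by
        rw [List.length_flatMap]
        have := List.card_nsmul_le_sum (L.map fun g => g.encode.length) 1 (by
          intro x hx
          obtain ⟨g, -, rfl⟩ := List.mem_map.1 hx
          rw [g.encode_eq, List.length_cons]; omega)
        simpa using this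
      simp only [Circuit.encode, e, List.flatMap_append, List.flatMap_cons, List.length_append,
        List.length_cons, Option.getD_some]
      omega
  set Λ : ℕ → ℕ := fun n => (F.qubits n + (C n).anc) + (C n).encode.length with hΛ
  have hΛlf : LF Λ := by fun_prop
  have hlfl : LFL fun p : ℕ × ℕ => encs (rawLayer ((C p.1).layer p.2)) := by
    have hg : ∀ {M : ℕ} (o : Option (Gate B M)), (o.elim [] fun x => if decide (x.tok.code < 5) = true then x.encode else []) =
        if (o.elim 0 fun x => x.tok.code) = 3 then Tok.basic :: (List.range (o.elim 0 fun x => x.nums.length)).flatMap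
          fun i => encodeNat (o.elim 0 fun x => x.nums.getD i 0)
        else if (o.elim 0 fun x => x.tok.code) = 4 then Tok.fanout :: (List.range (o.elim 0 fun x => x.nums.length)).flatMap
          fun i => encodeNat (o.elim 0 fun x => x.nums.getD i 0) else [] := by
      intro M o
      have hr : ∀ l : List ℕ, ((List.range l.length).flatMap fun i => encodeNat (l.getD i 0)) = l.flatMap encodeNat := fun l => by
        conv_rhs => rw [← flatMap_getElem? encodeNat l le_rfl]
        exact List.flatMap_congr fun i hi => by
          rw [List.getElem?_eq_getElem (List.mem_range.1 hi), List.getD_eq_getElem _ _ (List.mem_range.1 hi)]; rfl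
      cases o with
      | none => rfl
      | some x => simp only [Option.elim, hr, x.encode_eq]; cases x <;> rfl
    have he : ∀ n ℓ, encs (rawLayer ((C n).layer ℓ)) = (List.range (Λ n)).flatMap fun g =>
        ((C n).layer ℓ)[g]?.elim [] fun x => if decide (x.tok.code < 5) = true then x.encode else [] := fun n ℓ => by
      rw [flatMap_getElem? _ _ ((hlength n ℓ).trans (Nat.le_add_left _ _)), encs, rawLayer, filter_flatMap']
    simp only [he, hg]
    have hnums := LFL.flatMap (f := fun (p : (ℕ × ℕ) × ℕ) i => encodeNat ((((C p.1.1).layer p.1.2)[p.2]?).elim 0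
      fun x => x.nums.getD i 0)) (LFL.encodeNat hnm) hcn
    exact LFL.flatMap (LFL.ite (LF.decide_eq hkd (LF.const 3)) (LFL.cons _ hnums)
      (LFL.ite (LF.decide_eq hkd (LF.const 4)) (LFL.cons _ hnums) .nil)) (LF.comp hΛlf LF.fst)
  obtain ⟨C', hU', h⟩ := exists_circuits σ hm (hm.add hanc) (fun n => Nat.le_add_right _ _) d
    (raw := fun n ℓ => rawLayer ((C n).layer ℓ)) (fun n ℓ => by
      refine List.Sublist.nodup ?_ (hnod n ℓ)
      exact List.Sublist.flatMap List.filter_sublist _) (fun n ℓ g hg => by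
      have := (List.mem_filter.1 hg).2
      cases g <;> trivial) hlfl
    (S := fun x => layerSym (Λ x.1) ((C x.1).layer x.2))
    (numSym_lf (LF.comp (hm.add hanc) LF.fst) (LF.comp hΛlf LF.fst) hkd hcn hnm) (fun x => rfl)
    (fun x => layerSym_valid (hnod _ _) ((hlength _ _).trans (Nat.le_add_left _ _)) (Nat.le_add_right _ _)) c
  refine ⟨C', hU', d * 32 + K, fun n ψ => ?_⟩
  obtain ⟨hle, hne, G, hG, hop⟩ := h n
  have hCop : ((List.range d).map fun ℓ => layerOp ((C n).layer ℓ)).reverse.prod = (C n).op := by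
    have e : (C n).op = layersOp (C n).layers := (layersOp_flatten _).symm
    have e' : ∀ (Ls : List (List (Gate B (F.qubits n + (C n).anc)))) d, Ls.length ≤ d →
        layersOp ((List.range d).map fun ℓ => (Ls[ℓ]?).getD []) = layersOp Ls := by
      intro Ls
      induction Ls with
      | nil =>
        intro d _
        rw [layersOp_flatten]
        simp [layersOp_nil]
      | cons L Ls ih =>
        intro d hd
        obtain ⟨d, rfl⟩ : ∃ k, d = k + 1 := ⟨d - 1, by simp at hd; omega⟩
        rw [List.range_succ_eq_map, List.map_cons, List.map_map, layersOp_cons, layersOp_cons,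
          ← ih d (by simpa using hd)]
        rfl
    rw [e, ← e' _ d (hd n), layersOp, List.map_map]
    rfl
  have key := near_prod (h := hle) (l := List.range d) (fun ℓ hℓ => (hG ℓ (List.mem_range.1 hℓ)).1)
    (R := fun ℓ => layerOp ((rawLayer ((C n).layer ℓ)).map (Gate.map (Fin.castLE hle))))
    (fun ℓ _ => layerOp_unitary (by
      rw [List.flatMap_map]
      simp only [Gate.map_wires]
      rw [← List.map_flatMap]
      exact (List.Sublist.nodup (List.Sublist.flatMap List.filter_sublist _) (hnod n ℓ)).map (Fin.castLE_injective _)))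
    (X := fun ℓ => layerOp ((C n).layer ℓ)) (fun ℓ _ => layerOp_unitary (hnod n ℓ))
    (fun ℓ _ => layerOp_lifts hle _) (fun ℓ hℓ => (hG ℓ (List.mem_range.1 hℓ)).2.1) (fun ℓ _ => by
      rw [← layer_split (hnod n ℓ) ((hlength n ℓ).trans (Nat.le_add_left _ _)) (Nat.le_add_right _ _) hle]
      exact layerOp_lifts hle _) (withZeros (C n).anc ψ)
  rw [← hop, hCop, List.length_range] at key
  have hK := hK n ψ
  change nrm _ ≤ _ * nrm _ at hK
  show nrm _ ≤ _ * nrm ψ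
  have e1 : withZeros (C' n).anc ψ = ext hle (withZeros (C n).anc ψ) := by
    rw [withZeros_eq, withZeros_eq, ext_ext]
  have e2 : withZeros (C' n).anc ((F.op n).mulVec ψ) = ext hle (withZeros (C n).anc ((F.op n).mulVec ψ)) := by
    rw [withZeros_eq, withZeros_eq, ext_ext]
  rw [e1, e2]
  refine (nrm_sub_le _ (ext hle ((C n).op.mulVec (withZeros (C n).anc ψ))) _).trans ?_
  rw [← ext_sub, nrm_ext]
  rw [withZeros_eq (ψ := ψ), nrm_ext, ← withZeros_eq] at key
  refine (add_le_add key hK).trans_eq ?_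
  ring

/-! ### Symmetric functions of the input -/

/-- A gate on `n` inputs and target `n`. -/
def weightSym (M n : ℕ) (act : Bool) (J : ℕ → Bool) : Sym :=
  ⟨M, n + 1, 0, fun g => act && decide (g = 0), fun _ => n, fun _ i => i, fun _ => n, fun _ => J⟩

theorem weightSym_valid {M n : ℕ} (h : n < M) (act : Bool) (J : ℕ → Bool) : (weightSym M n act J).Valid := by
  have hact : ∀ g, (weightSym M n act J).act g = true → g = 0 := fun g hg => by
    simp only [weightSym, Bool.and_eq_true, decide_eq_true_eq] at hg
    exact hg.2
  refine ⟨fun g hg => ?_, fun g _ => Nat.le_succ n, fun g _ i hi => lt_trans hi h, fun g _ => h,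
    fun g _ g' _ i hi => ne_of_lt hi, fun g hg g' hg' _ => ?_⟩
  · rw [hact g hg]; exact Nat.succ_pos n
  · rw [hact g hg, hact g' hg']

theorem weightSym_lf {Γ : Type} [Ctx Γ] {M n : Γ → ℕ} {act : Γ → Bool} {J : Γ × ℕ → Bool} (hM : LF M) (hn : LF n)
    (hact : LF act) (hJ : LF J) : Sym.IsLF fun x => weightSym (M x) (n x) (act x) fun j => J (x, j) where
  M := hM
  Λ := hn.add (LF.const 1)
  act := by
    have : LF fun p : Γ × ℕ => bif act p.1 then decide (p.2 = 0) else false := by fun_prop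
    convert this using 2 with p
    simp only [weightSym]
    cases act p.1 <;> rfl
  cnt := LF.comp hn LF.fst
  y := LF.comp hn LF.fst
  inp := LF.snd
  J := LF.comp hJ (f := fun p : (Γ × ℕ) × ℕ => (p.1.1, p.2)) (by fun_prop)

/-- Flip qubit `n` if `f` holds for the weight of the first `n` qubits. -/
def weightOp {n K : ℕ} (h : n < K) (f : ℕ → Bool) : Op K :=
  classicalOp (flipIf ⟨n, h⟩ fun a => f (weight fun i : Fin n => a (Fin.castLE h.le i)))

theorem weightOp_unitary {n K : ℕ} (h : n < K) (f : ℕ → Bool) : weightOp h f ∈ Matrix.unitaryGroup (Bits K) ℂ :=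
  classicalOp_unitary _ (flipIf_involutive fun b v => by
    have : ∀ i : Fin n, Function.update b ⟨n, h⟩ v (Fin.castLE h.le i) = b (Fin.castLE h.le i) := fun i =>
      Function.update_of_ne (fun h => (ne_of_lt i.2) (congrArg Fin.val h)) _ _
    simp only [this])

theorem weightOp_lifts {n K K' : ℕ} (h : n < K) (h' : K ≤ K') (f : ℕ → Bool) :
    Lifts h' (weightOp (h.trans_le h') f) (weightOp h f) := by
  refine lifts_classicalOp (pad_flipIf h' (y := ⟨n, h⟩) fun a => ?_)
  have : ∀ i : Fin n, pad K' a (Fin.castLE (h.trans_le h').le i) = a (Fin.castLE h.le i) := fun i =>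
    pad_castLE h' a (Fin.castLE h.le i)
  simp only [this]

theorem gate_op {g : BoolFamily} {f : ℕ → Bool} {n : ℕ} (hg : ∀ x, g n x = f (weight x)) :
    g.gate.op n = weightOp (Nat.lt_succ_self n) f :=
  congrArg (fun f => classicalOp (flipIf (Fin.last n) f)) (funext fun b => hg fun i => b i.castSucc)

variable {N n : ℕ} [NeZero N]

theorem weightSym_ones {M : ℕ} (hM : n < M) (hN : M ≤ N) (act : Bool) (J : ℕ → Bool) (g : ℕ) (a : Bits M) :
    (weightSym M n act J).ones (bit (pad N a)) g = weight fun i : Fin n => a (Fin.castLE hM.le i) := by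
  have h : ∀ i : Fin n, bit (pad N a) i = a (Fin.castLE hM.le i) := fun i => by
    have hi := i.2
    rw [bit, pad, dif_pos (by rw [wire_val] <;> omega)]
    congr 1
    refine Fin.ext ?_
    simp only [Fin.val_castLE]
    exact wire_val (by omega)
  have e : (weightSym M n act J).ones (bit (pad N a)) g = ∑ i ∈ Finset.range n, (bit (pad N a) i).toNat := rfl
  rw [e, ← Fin.sum_univ_eq_sum_range fun i => (bit (pad N a) i).toNat, weight, Finset.card_filter]
  refine Finset.sum_congr rfl fun i _ => ?_
  rw [h]
  cases a (Fin.castLE hM.le i) <;> rfl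

theorem weight_le (x : Bits n) : weight x ≤ n := (Finset.card_le_univ _).trans_eq (Fintype.card_fin n)

theorem weightSym_lifts {M : ℕ} (hM : n < M) (hN : M ≤ N) {J : ℕ → Bool} {f : ℕ → Bool}
    (hf : ∀ w ≤ n, (weightSym M n true J).flips 0 w = f w) : Lifts hN ((weightSym M n true J).op N)
      (weightOp hM f) := by
  have hg : (weightSym M n true J).gates = [0] := by
    have h0 : List.filter (fun x => decide (x = 0)) (List.map Nat.succ (List.range n)) = [] :=
      List.filter_eq_nil_iff.2 fun a ha => by
        obtain ⟨b, -, rfl⟩ := List.mem_map.1 ha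
        simp
    have : (weightSym M n true J).gates = (List.range (n + 1)).filter fun g => decide (g = 0) := rfl
    rw [this, List.range_succ_eq_map, List.filter_cons_of_pos (by simp), h0]
  have hy : wire N n = Fin.castLE hN ⟨n, hM⟩ := Fin.ext (wire_val (by omega))
  have e : (weightSym M n true J).op N = classicalOp (flipIf (Fin.castLE hN ⟨n, hM⟩) fun b =>
      (weightSym M n true J).flips 0 ((weightSym M n true J).ones (bit b) 0)) := by
    rw [Sym.op, hg, ← hy]
    exact List.prod_singleton
  rw [e]
  refine lifts_classicalOp (pad_flipIf hN fun a => ?_)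
  rw [weightSym_ones hM hN, hf _ (weight_le _)]

theorem weightSym_inactive {M : ℕ} (J : ℕ → Bool) : (weightSym M n false J).op N = 1 := by
  have : (weightSym M n false J).gates = [] := List.filter_eq_nil_iff.2 fun g _ => by simp [weightSym]
  rw [Sym.op, this]
  rfl

/-- Families of gates for symmetric functions. -/
theorem symmetric_mem (σ : Std B) {J : ℕ × ℕ → Bool} (hJ : LF J) {g : BoolFamily}
    (hg : ∀ n x, g n x = J (n, weight x)) : g.gate ∈ BQNCf0 B := by
  intro c
  have hJ' : LF fun p : (ℕ × ℕ) × ℕ => padJ (p.1.1 + 1) (fun w => J (p.1.1, w)) p.2 := by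
    have : LF fun p : ((ℕ × ℕ) × ℕ) × ℕ => J (p.1.1.1, p.2) := by fun_prop
    exact lf_padJ (by fun_prop) (by fun_prop) this
  obtain ⟨C, hU, h⟩ := exists_circuits σ (m := fun n => n + 1) (M := fun n => n + 1) (by fun_prop) (by fun_prop)
    (fun n => le_rfl) 1 (raw := fun n ℓ => ([] : List (Gate B (n + 1)))) (fun _ _ => List.nodup_nil)
    (fun _ _ g hg => absurd hg List.not_mem_nil) LFL.nil (S := fun x => weightSym (x.1 + 1) x.1 true fun j =>
      padJ (x.1 + 1) (fun w => J (x.1, w)) j) (weightSym_lf (by fun_prop) (by fun_prop) (LF.const true) hJ')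
    (fun _ => rfl) (fun x => weightSym_valid (Nat.lt_succ_self _) _ _) c
  refine ⟨C, hU, 32, fun n ψ => ?_⟩
  obtain ⟨hle, hne, G, hG, hop⟩ := h n
  change Bits (n + 1) → ℂ at ψ
  obtain ⟨U, hU1, hU2⟩ : ∃ U : Op (n + 1), g.gate.op n = U ∧ U ∈ Matrix.unitaryGroup _ ℂ :=
    ⟨_, rfl, g.gate.unitary n⟩
  have he : g.gate.op n = weightOp (Nat.lt_succ_self n) fun w => J (n, w) := gate_op (hg n)
  have hl := weightSym_lifts (N := n + 1 + (C n).anc) (Nat.lt_succ_self n) hle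
    (J := fun j => padJ (n + 1) (fun w => J (n, w)) j) (f := fun w => J (n, w)) fun w hw =>
      flips_padJ (S := weightSym (n + 1) n true fun j => padJ (n + 1) (fun w => J (n, w)) j) (g := 0) rfl
        (hw.trans (Nat.le_succ n))
  have key := near_prod (h := hle) (l := List.range 1) (fun ℓ hℓ => (hG ℓ (List.mem_range.1 hℓ)).1)
    (R := fun _ => 1) (fun _ _ => one_mem _) (R' := fun _ => 1)
    (X := fun _ => U) (fun _ _ => hU2) (fun _ _ => .one hle)
    (fun ℓ hℓ => (hG ℓ (List.mem_range.1 hℓ)).2.1) (fun _ _ => by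
      rw [mul_one, ← hU1, he]
      exact hl) ψ
  simp only [List.map_nil, layerOp_nil] at hop
  rw [← hop, List.length_range, Nat.cast_one, one_mul, show ((List.range 1).map fun _ => U).reverse.prod = U
    from List.prod_singleton] at key
  have e : ∀ φ : Bits (n + 1) → ℂ, withZeros (C n).anc φ = ext (Nat.le_add_right _ _) φ := withZeros_eq
  rw [hU1]
  change nrm ((C n).op.mulVec (withZeros (m := n + 1) (C n).anc ψ) - withZeros (m := n + 1) (C n).anc (U.mulVec ψ)) ≤
    32 / ((n : ℝ) + 1) ^ c * nrm ψ
  rw [e, e]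
  exact key

end QFan

namespace QFan

variable {B : GateBasis} {N : ℕ}

/-! ### Exact gates -/

/-- Layers of fan-out and Hadamard gates that negate qubit `y`, with qubit `e` as an ancilla; the first
layer is empty. -/
noncomputable def notLayer (σ : Std B) (y e : Fin N) (ℓ : ℕ) : List (Gate B N) :=
  if ℓ % 2 = 1 then [single σ.h y] else if ℓ % 4 = 2 then [.fanout y [e]] else if ℓ = 4 then [.fanout e [y]] else []

theorem notLayer_nodup (σ : Std B) {y e : Fin N} (h : y ≠ e) (ℓ : ℕ) :
    ((notLayer σ y e ℓ).flatMap Gate.wires).Nodup := by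
  rw [notLayer]
  split_ifs
  · rw [List.flatMap_singleton, single_wires (h_arity σ)]
    exact List.nodup_singleton y
  all_goals simp [Gate.wires, h, h.symm]

theorem hadamard_cx_hadamard {y e : Fin N} (h : y ≠ e) (ψ : Bits N → ℂ) (b : Bits N) :
    (Hop y).mulVec ((CX y e).mulVec ((Hop y).mulVec ψ)) b = (ψ b + ψ (Function.update b y !b y) +
      (ψ (Function.update b e !b e) - ψ (Function.update (Function.update b y !b y) e !b e))) / 2 := by
  have hs := sqrt_two_mul
  have hs0 : (Real.sqrt 2 : ℂ) ≠ 0 := fun h0 => by rw [h0, mul_zero] at hs; exact two_ne_zero hs.symm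
  have hx : ∀ φ : Bits N → ℂ, (CX y e).mulVec φ = fun b => φ (flipIf e (fun b => b y) b) :=
    classicalOp_mulVec (flipIf_involutive fun b v => Function.update_of_ne h _ _)
  have h2 : ∀ z w : ℂ, z / (Real.sqrt 2 : ℂ) = w * (Real.sqrt 2 : ℂ) / 2 ↔ z = w := fun z w => by
    rw [← hs]
    field_simp
  simp only [Hop_mulVec, hx, flipIf, Function.update_idem, Function.update_self, Function.update_of_ne h,
    Function.update_of_ne h.symm, Bool.xor_false, Bool.xor_true, Function.update_comm h.symm]
  have e1 : Function.update b y (b y) = b := Function.update_eq_self _ _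
  have e2 : ∀ v, Function.update (Function.update b y v) e (b e) = Function.update b y v := fun v => by
    rw [Function.update_comm h, Function.update_eq_self]
  rw [div_eq_div_iff hs0 two_ne_zero, ← hs]
  field_simp
  cases hb : b y <;> rw [hb] at e1 <;> simp only [e1, e2, sgn, Bool.not_false, Bool.not_true] <;> simp <;> ring

theorem notLayer_op (σ : Std B) {y e : Fin N} (h : y ≠ e) {ψ : Bits N → ℂ} (hψ : ∀ b, b e = true → ψ b = 0) :
    ((List.range 7).map fun ℓ => layerOp (notLayer σ y e (ℓ + 1))).reverse.prod.mulVec ψ =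
      (classicalOp (flipIf y fun _ => true)).mulVec ψ := by
  have hf : ∀ {c t : Fin N}, c ≠ t → layerOp [(Gate.fanout c [t] : Gate B N)] = CX c t := fun {c t} hc => by
    rw [layerOp_cons, layerOp_nil, one_mul, fanout_op (by simpa using hc)]
    exact List.prod_singleton
  have hh : layerOp [single σ.h y] = Hop y := by rw [layerOp_cons, layerOp_nil, one_mul, single_h_op]
  have hx : ∀ φ : Bits N → ℂ, (CX e y).mulVec φ = fun b => φ (flipIf y (fun b => b e) b) :=
    classicalOp_mulVec (flipIf_involutive fun b v => Function.update_of_ne h.symm _ _)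
  have e1 : ((List.range 7).map fun ℓ => layerOp (notLayer σ y e (ℓ + 1))).reverse.prod =
      Hop y * (CX y e * (Hop y * (CX e y * (Hop y * (CX y e * Hop y))))) := by
    simp only [List.range_succ, List.range_zero, List.nil_append, List.map_append, List.map_cons, List.map_nil,
      List.reverse_append, List.reverse_cons, List.reverse_nil, List.prod_append, List.prod_cons, List.prod_nil, mul_one]
    simp [notLayer, hf h, hf h.symm, hh]
  rw [e1, classicalOp_mulVec (flipIf_involutive fun _ _ => rfl)]
  simp only [← Matrix.mulVec_mulVec]
  funext b
  rw [hadamard_cx_hadamard h, hx]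
  simp only [hadamard_cx_hadamard h, flipIf, Function.update_idem, Function.update_self, Function.update_of_ne h,
    Function.update_of_ne h.symm, Function.update_comm h.symm, Bool.not_not, Bool.xor_true]
  have e3 : Function.update b y (b y) = b := Function.update_eq_self _ _
  have e4 : ∀ v, Function.update (Function.update b y v) e (b e) = Function.update b y v := fun v => by
    rw [Function.update_comm h, Function.update_eq_self]
  have e5 : Function.update b e (b e) = b := Function.update_eq_self _ _
  cases hb : b e <;> cases hy : b y <;> rw [hb] at e4 e5 <;> rw [hy] at e3 <;>
    simp [e3, e4, e5, hψ, hb, Function.update_of_ne h.symm] <;> ring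

theorem classicalOp_single (f : Bits N → Bits N) (a : Bits N) :
    (classicalOp f).mulVec (Pi.single a 1) = Pi.single (f a) 1 := by
  rw [Matrix.mulVec_single_one]
  funext b
  simp [classicalOp, Pi.single_apply]

theorem weightSym_flips {M n w t : ℕ} (ht : t ≤ n + 1) :
    (weightSym M n true fun j => decide (j = t)).flips 0 w = !decide (w = t) := by
  have h : (∑ j ∈ Finset.range (n + 1 + 2), if decide (j = t) = true ∧ w ≠ j then 1 else 0) =
      if w = t then 0 else 1 := by
    rw [Finset.sum_eq_single t (fun j _ hj => if_neg fun h => hj (of_decide_eq_true h.1))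
      fun h => absurd (Finset.mem_range.2 (show t < n + 1 + 2 by omega)) h]
    simp
  have e : (weightSym M n true fun j => decide (j = t)).flips 0 w =
    decide ((∑ j ∈ Finset.range (n + 1 + 2), if decide (j = t) = true ∧ w ≠ j then 1 else 0) % 2 = 1) := rfl
  rw [e, h]
  split_ifs with h <;> simp [h]

theorem weightOp_not {n K : ℕ} (h : n < K) {f f' : ℕ → Bool} (hf : ∀ w ≤ n, f w = !f' w) :
    weightOp h (fun _ => true) * weightOp h f = weightOp h f' := by
  rw [weightOp, weightOp, classicalOp_mul]
  refine congrArg classicalOp (funext fun b => ?_)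
  rw [Function.comp_apply, flipIf, flipIf, flipIf, hf _ (weight_le _)]
  simp

theorem notLayers_lifts (σ : Std B) (n : ℕ) : Lifts (Nat.le_succ (n + 1)) ((List.range 7).map fun ℓ =>
    layerOp (notLayer σ (⟨n, by omega⟩ : Fin (n + 2)) ⟨n + 1, by omega⟩ (ℓ + 1))).reverse.prod
    (weightOp (Nat.lt_succ_self n) fun _ => true) := fun φ => by
  rw [← weightOp_lifts]
  refine notLayer_op σ (fun h => absurd (congrArg Fin.val h) (Nat.succ_ne_self n).symm) fun b hb => ?_
  by_contra h0
  rw [supp_ext _ φ b h0 ⟨n + 1, by omega⟩ le_rfl] at hb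
  exact Bool.false_ne_true hb

theorem prod_range_succ {R : Type} [Monoid R] (d : ℕ) (Y : ℕ → R) : ((List.range (d + 1)).map Y).reverse.prod =
    ((List.range d).map fun ℓ => Y (ℓ + 1)).reverse.prod * Y 0 := by
  rw [List.range_succ_eq_map, List.map_cons, List.map_map, List.reverse_cons, List.prod_append, List.prod_singleton]
  rfl

theorem exact_mem (σ : Std B) {t : ℕ → ℕ} (ht : LF t) : exactFn t ∈ RQNCf0 B true := by
  intro c
  have hy : ∀ n, (⟨n, by omega⟩ : Fin (n + 2)) ≠ ⟨n + 1, by omega⟩ := fun n h => by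
    have := congrArg Fin.val h
    simp at this
  have hJ : LF fun p : (ℕ × ℕ) × ℕ => decide (p.2 = min (t p.1.1) (p.1.1 + 1)) := by fun_prop
  obtain ⟨C, hU, h⟩ := exists_circuits σ (m := fun n => n + 1) (M := fun n => n + 2) (by fun_prop) (by fun_prop)
    (fun n => Nat.le_succ _) 8 (raw := fun n ℓ => notLayer σ (⟨n, by omega⟩ : Fin (n + 2)) ⟨n + 1, by omega⟩ ℓ)
    (fun n ℓ => notLayer_nodup σ (hy n) ℓ) (fun n ℓ g hg => by
      simp only [notLayer] at hg
      split_ifs at hg <;> simp only [List.mem_singleton, List.not_mem_nil] at hg <;> subst hg <;> trivial)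
    (by
      have e : ∀ n ℓ, encs (notLayer σ (⟨n, by omega⟩ : Fin (n + 2)) ⟨n + 1, by omega⟩ ℓ) =
          if ℓ % 2 = 1 then (Tok.basic :: encodeNat σ.h) ++ encodeNat n else if ℓ % 4 = 2 then
            Tok.fanout :: (encodeNat n ++ encodeNat (n + 1)) else if ℓ = 4 then
            Tok.fanout :: (encodeNat (n + 1) ++ encodeNat n) else [] := fun n ℓ => by
        rw [notLayer]
        split_ifs
        · rw [encs, List.flatMap_singleton, single_encode (h_arity σ)]
        all_goals simp [encs, Gate.encode, Gate.wires]
      simp only [e]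
      have h1 : LFL fun p : ℕ × ℕ => encodeNat p.1 := LFL.encodeNat (by fun_prop)
      have h2 : LFL fun p : ℕ × ℕ => encodeNat (p.1 + 1) := LFL.encodeNat (v := fun p : ℕ × ℕ => p.1 + 1) (by fun_prop)
      exact LFL.ite (by fun_prop) (LFL.append (LFL.cons _ (LFL.encodeNat (LF.const _))) h1)
        (LFL.ite (by fun_prop) (LFL.cons _ (h1.append h2)) (LFL.ite (by fun_prop) (LFL.cons _ (h2.append h1)) LFL.nil)))
    (S := fun x => weightSym (x.1 + 2) x.1 (decide (x.2 = 0)) fun j => decide (j = min (t x.1) (x.1 + 1)))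
    (weightSym_lf (by fun_prop) (by fun_prop) (by fun_prop) hJ)
    (fun _ => rfl) (fun x => weightSym_valid (by omega) _ _) c
  refine ⟨C, hU, ?_⟩
  suffices H : ∀ n, (C n).Approximates ((exactFn t).gate.op n) (8 * 32 / ((n : ℝ) + 1) ^ c) ∧
      ∀ b : Bits (n + 1), exactFn t n (fun i => b i.castSucc) = true →
      (C n).op.mulVec (withZeros (C n).anc (Pi.single b 1)) =
        withZeros (C n).anc (((exactFn t).gate.op n).mulVec (Pi.single b 1)) from
    ⟨⟨8 * 32, fun n => (H n).1⟩, fun n => (H n).2⟩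
  intro n
  obtain ⟨hle, hne, G, hG, hop⟩ := h n
  set y : Fin (n + 2) := ⟨n, by omega⟩
  set e : Fin (n + 2) := ⟨n + 1, by omega⟩
  set t' := min (t n) (n + 1)
  set R : ℕ → Op (n + 2) := fun ℓ => layerOp (notLayer σ y e ℓ)
  have hn : n < n + 2 := by omega
  have hle' : n + 1 ≤ n + 2 := Nat.le_succ _
  set F : Op (n + 2) := weightOp hn fun w => !decide (w = t') 
  have hFl : Lifts hle ((weightSym (n + 2) n true fun j => decide (j = t')).op _) F :=
    weightSym_lifts (f := fun w => !decide (w = t')) hn hle fun w _ => weightSym_flips (min_le_right _ _)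
  set X : ℕ → Op (n + 2) := fun ℓ => if ℓ = 0 then F else R ℓ
  have hl : ∀ ℓ, Lifts hle ((weightSym (n + 2) n (decide (ℓ = 0)) fun j => decide (j = t')).op _ *
      layerOp ((notLayer σ y e ℓ).map (Gate.map (Fin.castLE hle)))) (X ℓ) := fun ℓ => by
    rcases Nat.eq_zero_or_pos ℓ with rfl | h0
    · have := hFl.mul (.one hle)
      rwa [mul_one F] at this
    · have := layerOp_lifts hle (notLayer σ y e ℓ)
      rw [decide_eq_false h0.ne', weightSym_inactive, one_mul]
      simp only [X, if_neg h0.ne']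
      exact this
  set Z : Op (n + 2) := ((List.range 7).map fun ℓ => R (ℓ + 1)).reverse.prod with hZdef
  have hZ : Lifts hle' Z (weightOp (Nat.lt_succ_self n) fun _ => true) := notLayers_lifts σ n
  obtain ⟨U, hU⟩ : ∃ U : Op (n + 1), (exactFn t).gate.op n = U := ⟨_, rfl⟩
  rw [hU]
  rw [gate_op (f := fun w => decide (w = t n)) fun _ => rfl] at hU
  have hX : Lifts hle' ((List.range 8).map X).reverse.prod U := by
    have e0 : (List.range 7).map (fun ℓ => X (ℓ + 1)) = (List.range 7).map fun ℓ => R (ℓ + 1) :=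
      List.map_congr_left fun ℓ _ => if_neg (Nat.succ_ne_zero ℓ)
    have hX0 : X 0 = F := if_pos rfl
    rw [prod_range_succ, e0, ← hZdef, hX0, ← hU, ← weightOp_not (f := fun w => !decide (w = t'))]
    · exact hZ.mul (weightOp_lifts (Nat.lt_succ_self n) hle' _)
    · intro w hw
      exact congrArg Bool.not (decide_eq_decide.2 (by omega))
  have hw : ∀ φ : Bits (n + 1) → ℂ, withZeros (C n).anc φ = ext hle (ext hle' φ) := fun φ => by
    rw [ext_ext, withZeros_eq]
  constructor
  · intro ψ
    change Bits (n + 1) → ℂ at ψ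
    have key := near_prod (h := hle) (l := List.range 8) (fun ℓ hℓ => (hG ℓ (List.mem_range.1 hℓ)).1)
      (R := fun ℓ => layerOp ((notLayer σ y e ℓ).map (Gate.map (Fin.castLE hle)))) (fun ℓ _ => layerOp_unitary (by
        rw [List.flatMap_map]
        simp only [Gate.map_wires]
        rw [← List.map_flatMap]
        exact (notLayer_nodup σ (hy n) ℓ).map (Fin.castLE_injective _)))
      (R' := R) (X := X) (fun ℓ _ => by
        simp only [X]
        split_ifs
        exacts [weightOp_unitary _ _, layerOp_unitary (notLayer_nodup σ (hy n) ℓ)])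
      (fun ℓ _ => layerOp_lifts hle _) (fun ℓ hℓ => (hG ℓ (List.mem_range.1 hℓ)).2.1) (fun ℓ _ => hl ℓ) (ext hle' ψ)
    rw [← hop, hX, List.length_range, nrm_ext] at key
    change nrm ((C n).op.mulVec (withZeros (m := n + 1) (C n).anc ψ) - withZeros (m := n + 1) (C n).anc (U.mulVec ψ)) ≤
      8 * 32 / ((n : ℝ) + 1) ^ c * nrm ψ
    rw [hw, hw]
    refine key.trans_eq ?_
    push_cast
    ring
  · intro b hb
    have hwt : weight (fun i : Fin n => b i.castSucc) = t n := of_decide_eq_true hb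
    have hUb : U.mulVec (Pi.single b 1) = (weightOp (Nat.lt_succ_self n) fun _ => true).mulVec (Pi.single b 1) := by
      rw [← hU, weightOp, weightOp, classicalOp_single, classicalOp_single, flipIf, flipIf]
      congr 3
    have h0 : (G 0).mulVec (ext hle (ext hle' (Pi.single b 1))) = ext hle (ext hle' (Pi.single b 1)) := by
      refine (hG 0 (by norm_num)).2.2 _ ?_
      rw [ext_single, ext_single]
      intro b' hb'
      obtain rfl : b' = pad _ (pad _ b) := by
        by_contra hne
        exact hb' (Pi.single_eq_of_ne hne 1)
      refine ⟨pad_clean _, fun k hk => ?_⟩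
      simp only [Sym.on, weightSym, Bool.and_eq_true, decide_eq_true_eq] at hk
      refine (weightSym_ones (by omega) hle _ _ _ _).trans (Eq.trans ?_ hk.2.symm)
      have : ∀ i : Fin n, pad (n + 2) b (Fin.castLE (by omega) i) = b i.castSucc := fun i =>
        pad_castLE hle' b i.castSucc
      simp only [this]
      have := weight_le fun i : Fin n => b i.castSucc
      omega
    have h1 : Lifts hle ((List.range 7).map fun ℓ => G (ℓ + 1) *
        layerOp ((notLayer σ y e (ℓ + 1)).map (Gate.map (Fin.castLE hle)))).reverse.prod Z :=
      Lifts.prod fun ℓ hℓ ψ => by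
        rw [← Matrix.mulVec_mulVec, layerOp_lifts hle]
        exact (hG (ℓ + 1) (by have := List.mem_range.1 hℓ; omega)).2.2 _
          ((supp_ext _ _).mono fun b' hb' => ⟨hb', fun k hk => by simp [Sym.on, weightSym] at hk⟩)
    have h2 : layerOp ((notLayer σ y e 0).map (Gate.map (Fin.castLE hle))) = 1 := layerOp_nil
    change (C n).op.mulVec (withZeros (m := n + 1) (C n).anc (Pi.single b 1)) =
      withZeros (m := n + 1) (C n).anc (U.mulVec (Pi.single b 1))
    rw [hUb, hw, hw, hop, prod_range_succ, ← Matrix.mulVec_mulVec, h2, mul_one, h0, h1, hZ]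

end QFan

namespace QFan

theorem BClass_mono {B : GateBasis} {G G' : GateSet} (h : ∀ {N : ℕ} (g : Gate B N), g.Allowed G → g.Allowed G') :
    BClass B G ⊆ BClass B G' := fun _ hF c => by
  obtain ⟨C, hU, hC⟩ := hF c
  exact ⟨C, ⟨fun n L hL g hg => h g (hU.allowed n L hL g hg), hU.uniform, hU.depth, hU.size⟩, hC⟩

end QFan

theorem mainTheorem1 :
    ∃ θ : ℝ, Irrational (θ / Real.pi) ∧
      ∀ B : QFan.GateBasis, QFan.stdBasis θ ⊆ B →
        (∀ t : ℕ → ℕ, QFan.LogSpaceNat t → QFan.exactFn t ∈ QFan.RQNCf0 B true) ∧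
        (∀ t : ℕ → ℕ, QFan.LogSpaceNat t → (QFan.thresholdFn t).gate ∈ QFan.BQNCf0 B) ∧
        QFan.majorityFn.gate ∈ QFan.BQNCf0 B ∧
        QFan.andFn.gate ∈ QFan.BQNCf0 B ∧
        (∀ q : ℕ → ℕ, QFan.LogSpaceNat q → (∀ n, 0 < q n) →
          (QFan.modFn q).gate ∈ QFan.BQNCf0 B) ∧
        QFan.BQNCf0 B = QFan.BQACf0 B ∧
        QFan.BQACf0 B = QFan.BQTCf0 B := by
  refine ⟨2 * Real.pi * QFan.tau, ?_, fun B hB => ?_⟩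
  · rw [show 2 * Real.pi * QFan.tau / Real.pi = 2 * QFan.tau by field_simp]
    exact QFan.irrational_two_mul_tau
  obtain ⟨σ⟩ := QFan.exists_std hB
  have h1 : QFan.BQNCf0 B ⊆ QFan.BQACf0 B := QFan.BClass_mono fun g hg => by cases g <;> trivial
  have h2 : QFan.BQACf0 B ⊆ QFan.BQTCf0 B := QFan.BClass_mono fun g hg => by cases g <;> trivial
  have h3 := QFan.tc_subset_nc σ
  refine ⟨fun t ht => QFan.exact_mem σ ht.lf, fun t ht => ?_, ?_, ?_, fun q hq _ => ?_,
    h1.antisymm (h2.trans h3), h2.antisymm (h3.trans h1)⟩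
  · have := ht.lf
    exact QFan.symmetric_mem σ (J := fun p => decide (t p.1 ≤ p.2)) (by fun_prop) fun _ _ => rfl
  · exact QFan.symmetric_mem σ (J := fun p => decide (p.1 ≤ 2 * p.2)) (by fun_prop) fun _ _ => rfl
  · exact QFan.symmetric_mem σ (J := fun p => decide (p.2 = p.1)) (by fun_prop) fun _ _ => rfl
  · have := hq.lf
    exact QFan.symmetric_mem σ (J := fun p => decide (p.2 % q p.1 = 0)) (by fun_prop) fun _ _ => rfl
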